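/- **Conventions.** Let $\Bbbk$ be a commutative ring. Maps and differentials act on the right, so $(x_1\otimes\dots\otimes x_k)\partial=\sum_a(-1)^{|x_{a+1}|+\dots+|x_k|}x_1\otimes\dots\otimes x_a\partial\otimes\dots\otimes x_k$, and the Koszul sign rule is in force. A *collection* is a sequence $P=(P(n))_{n\ge 0}$ of complexes of $\Bbbk$-modules with differential $\partial$ of degree $1$. Put $$(P\odot Q)(n)=\bigoplus_{k\ge 0,\;n_1+\dots+n_k=n}P(n_1)\otimes\dots\otimes P(n_k)\otimes Q(k).$$ A (non-symmetric) dg-operad is a monoid for $\odot$. For a dg-operad $\mathcal O$, an $\mathcal O$-bimodule $F$ has commuting associative unital actions $\lambda:\mathcal O\odot F\to F$ and $\rho:F\odot\mathcal O\to F$; $\rho_\emptyset:\mathcal O(0)\to F(0)$ denotes the right action for $k=0$. The tensor product $P\odot_{\mathcal O}Q$ is the coequalizer of the two actions $P\odot\mathcal O\odot Q\rightrightarrows P\odot Q$. **The objects.** Let $A=A_\infty^{\mathsf{su}}\langle i,j\rangle$ be the dg-operad generated by $m_n$ ($n\ge 2$, arity $n$, degree $2-n$) and nullary $1^{\mathsf{su}},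 i$ (degree $0$), $j$ (degree $-1$), with the relations $$m_n\partial=-\sum_{a+b+c=n,\;1<b<n}(-1)^{ab+c}(1^{\otimes a}\otimes m_b\otimes 1^{\otimes c})m_{a+1+c},\qquad 1^{\mathsf{su}}\partial=0=i\partial,\qquad j\partial=1^{\mathsf{su}}-i,$$ $$(1^{\mathsf{su}}\otimes 1)m_2=1=(1\otimes 1^{\mathsf{su}})m_2,\qquad (1^{\otimes a}\otimes 1^{\mathsf{su}}\otimes 1^{\otimes b})m_{a+1+b}=0\quad(a+b>1).$$ For a decomposition $n=i_1+\dots+i_l$ into positive integers put $\sigma=(i_2-1)+2(i_3-1)+\dots+(l-1)(i_l-1)$. Let $F=F_1^{\mathsf{su}}\langle i,j\rangle$ be the dg-bimodule over $A$ generated by $f_n$ ($n\ge 1$, arity $n$, degree $1-n$) with the relations $$f_n\partial=\sum_{a+b+c=n,\;b>1}(-1)^{c+ab}(1^{\otimes a}\otimes m_b\otimes 1^{\otimes c})f_{a+1+c}-\sum_{i_1+\dots+i_l=n,\;l>1}(-1)^{\sigma}(f_{i_1}\otimes\dots\otimes f_{i_l})m_l,$$ $$1^{\mathsf{su}}\rho_\emptyset=1^{\mathsf{su}}f_1,\qquad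 (1^{\otimes a}\otimes 1^{\mathsf{su}}\otimes 1^{\otimes b})f_{a+1+b}=0\quad(a+b>0).$$ For $k\ge 1$, $n_1,\dots,n_k\ge 0$ and $n=n_1+\dots+n_k$ put $$m_{n_1;\dots;n_k}=(1^{\otimes n_1}\otimes j\otimes 1^{\otimes n_2}\otimes j\otimes\dots\otimes j\otimes 1^{\otimes n_k})m_{n+k-1},$$ and define $f_{n_1;\dots;n_k}$ likewise with $f_{n+k-1}$ in place of $m_{n+k-1}$. Let $A^{hu}=A_\infty^{hu}\subset A$ be the dg-suboperad generated by $i$ and all $m_{n_1;\dots;n_k}$ with $n+k\ge 3$. Let $F^{hu}=F_1^{hu}\subset F$ be the $A^{hu}$-subbimodule (closed under $\partial$) generated by $v=jf_1-j\rho_\emptyset$ and all $f_{n_1;\dots;n_k}$ with $n+k\ge 2$ except $f_{0;0}=jf_1$. Let $\alpha:F^{hu}\odot_{A^{hu}}F^{hu}\to F\odot_A F$ be the morphism induced by the inclusions. **Theorem.** 1. There are a unique morphism of $A$-bimodules $\Delta:F\to F\odot_A F$ and a unique morphism of $A$-bimodules $\varepsilon:F\to A$ such that for all $n\ge 1$ $$f_n\Delta=\sum_{i_1+\dots+i_k=n}(-1)^{\sigma}(f_{i_1}\otimes\dots\otimes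 f_{i_k})\otimes f_k,\qquad f_1\varepsilon=1,\qquad f_n\varepsilon=0\ \ (n>1),$$ and $(F,\Delta,\varepsilon)$ is a coassociative counital coalgebra in the monoidal category of $A$-bimodules. 2. The map $\alpha$ is injective in every arity and degree. 3. There are a unique morphism of $A^{hu}$-bimodules $\Delta^{hu}:F^{hu}\to F^{hu}\odot_{A^{hu}}F^{hu}$ and a unique morphism of $A^{hu}$-bimodules $\varepsilon^{hu}:F^{hu}\to A^{hu}$ such that $\Delta^{hu}\alpha$ and the composite of $\varepsilon^{hu}$ with $A^{hu}\subset A$ are the restrictions of $\Delta$ and $\varepsilon$ to $F^{hu}$. They make $F^{hu}$ into a coassociative counital coalgebra in $A^{hu}$-bimodules. 4. $v\Delta^{hu}=v\otimes f_1+v$, where the second summand $v$ is the image of $v\in F^{hu}(0)$ under the $k=0$ inclusion $F^{hu}(0)\to(F^{hu}\odot_{A^{hu}}F^{hu})(0)$. 5. Homotopy unital $A_\infty$-morphisms, that is, the $A^{hu}$-bimodule morphisms $g:F^{hu}\to\mathcal{HOM}(B,C)$ for $A^{hu}$-algebras $B,C$, where $\mathcal{HOM}(B,C)(n)$ is the complex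 of $\Bbbk$-linear maps $B^{\otimes n}\to C$, compose by the convolution $$g\cdot h=\bigl[F^{hu}\xrightarrow{\ \Delta^{hu}\ }F^{hu}\odot_{A^{hu}}F^{hu}\xrightarrow{\ g\odot h\ }\mathcal{HOM}(B,C)\odot_{\mathcal{END}\,C}\mathcal{HOM}(C,D)\to\mathcal{HOM}(B,D)\bigr].$$ This composite is again such a morphism, the composition is associative, and the morphisms $F^{hu}\xrightarrow{\varepsilon^{hu}}A^{hu}\to\mathcal{END}\,B$ are identities for it. -/

import Mathlib

universe u

open scoped BigOperators

namespace HUnital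

/-! Collections of complexes. -/

/-- A collection of complexes of `R`-modules: `X n p` is the degree `p` component of the complex in
arity `n`, and `d h : X n p → X n q` is its differential, of degree `+1` (`h : p + 1 = q`). -/
structure DGColl (R : Type u) [CommRing R] where
  X : ℕ → ℤ → Type u
  [grp : ∀ n p, AddCommGroup (X n p)]
  [mod : ∀ n p, Module R (X n p)]
  d : ∀ {n : ℕ} {p q : ℤ}, p + 1 = q → X n p →ₗ[R] X n q
  d_d : ∀ {n : ℕ} {p q r : ℤ} (h : p + 1 = q) (h' : q + 1 = r) (x : X n p), d h' (d h x) = 0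

attribute [instance] DGColl.grp DGColl.mod

variable {R : Type u} [CommRing R]

/-- Transport along equalities of arities and degrees. -/
def DGColl.cast (P : DGColl R) {n m : ℕ} {p q : ℤ} (hn : n = m) (hp : p = q) :
    P.X n p →ₗ[R] P.X m q :=
  hn ▸ hp ▸ LinearMap.id

/-- The degrees of `x₁ ⊗ ⋯ ⊗ d xᵢ ⊗ ⋯ ⊗ xₖ` if the `xⱼ` have degrees `pⱼ`. -/
def dDeg {k : ℕ} (p : Fin k → ℤ) (i j : Fin k) : ℤ := if j = i then p j + 1 else p j

theorem sum_dDeg {k : ℕ} (p : Fin k → ℤ) (i : Fin k) : ∑ j, dDeg p i j = ∑ j, p j + 1 := by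
  have : ∀ j, dDeg p i j = p j + (if j = i then 1 else 0) := fun j => by
    unfold dDeg; split <;> simp
  simp [this, Finset.sum_add_distrib]

/-- The family `x₁, …, d xᵢ, …, xₖ`. -/
def DGColl.dAt (P : DGColl R) {k : ℕ} {n : Fin k → ℕ} {p : Fin k → ℤ} (i : Fin k)
    (x : ∀ j, P.X (n j) (p j)) (j : Fin k) : P.X (n j) (dDeg p i j) :=
  if h : j = i then P.d (by simp [dDeg, h]) (x j) else P.cast rfl (by simp [dDeg, h]) (x j)

/-- The sign `(-1)^e`. -/
def sgn (e : ℤ) : ℤ := (e.negOnePow : ℤ)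

/-- A morphism `P ⊙ Q → S` in the category of collections of complexes, where
`(P ⊙ Q)(N) = ⨁ P(n₁) ⊗ ⋯ ⊗ P(nₖ) ⊗ Q(k)` over `k ≥ 0` and `n₁ + ⋯ + nₖ = N`.
It is given by multilinear maps of degree zero that commute with the differential. Differentials
act on the right, thus
`d (x₁ ⊗ ⋯ ⊗ xₖ ⊗ y) = x₁ ⊗ ⋯ ⊗ xₖ ⊗ d y
  + ∑ᵢ (-1)^(|y| + |xₖ| + ⋯ + |xᵢ₊₁|) x₁ ⊗ ⋯ ⊗ d xᵢ ⊗ ⋯ ⊗ xₖ ⊗ y`. -/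
structure OdotMap (P Q S : DGColl R) where
  app : ∀ {k N : ℕ} {q r : ℤ} (n : Fin k → ℕ) (p : Fin k → ℤ),
    ∑ i, n i = N → ∑ i, p i + q = r →
      MultilinearMap R (fun i => P.X (n i) (p i)) (Q.X k q →ₗ[R] S.X N r)
  leibniz : ∀ {k N : ℕ} {q r r' : ℤ} (n : Fin k → ℕ) (p : Fin k → ℤ)
    (hN : ∑ i, n i = N) (hr : ∑ i, p i + q = r) (hr' : r + 1 = r')
    (x : ∀ i, P.X (n i) (p i)) (y : Q.X k q),
    S.d hr' (app n p hN hr x y) =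
      app n p hN (by rw [← hr', ← hr, add_assoc]) x (Q.d rfl y) +
      ∑ i, sgn (q + ∑ j, if i < j then p j else 0) •
        app n (dDeg p i) hN (by rw [sum_dDeg, ← hr', ← hr]; ring) (P.dAt i x) y

/-- The family `x₁₁, …, x₁ₙ₁, x₂₁, …, xₖₙₖ` made of the families `xᵢ₁, …, xᵢₙᵢ`. -/
abbrev flat {k : ℕ} {n : Fin k → ℕ} {C : ∀ i, Fin (n i) → Sort*} (x : ∀ i j, C i j)
    (a : Fin (∑ i, n i)) : C (finSigmaFinEquiv.symm a).1 (finSigmaFinEquiv.symm a).2 :=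
  x (finSigmaFinEquiv.symm a).1 (finSigmaFinEquiv.symm a).2

theorem sum_flat {M : Type*} [AddCommMonoid M] {k : ℕ} {n : Fin k → ℕ}
    (f : ∀ i, Fin (n i) → M) : ∑ a, flat f a = ∑ i, ∑ j, f i j := by
  rw [← Fintype.sum_sigma']
  exact Equiv.sum_comp finSigmaFinEquiv.symm (fun s : (i : Fin k) × Fin (n i) => f s.1 s.2)

/-- The exponent of the Koszul sign of the permutation
`x₁₁ ⋯ x₁ₙ₁ y₁ x₂₁ ⋯ x₂ₙ₂ y₂ ⋯ xₖ₁ ⋯ xₖₙₖ yₖ ↦ x₁₁ ⋯ xₖₙₖ y₁ ⋯ yₖ`,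
for `|xᵢⱼ| = s i j` and `|yᵢ| = p i`. -/
def koszul {k : ℕ} {n : Fin k → ℕ} (s : ∀ i, Fin (n i) → ℤ) (p : Fin k → ℤ) : ℤ :=
  ∑ i, ∑ i', if i < i' then p i * ∑ j, s i' j else 0

/-- The square
`(P ⊙ Q) ⊙ U → S ⊙ U → V` equals `(P ⊙ Q) ⊙ U ≅ P ⊙ (Q ⊙ U) → P ⊙ W → V`. -/
def OdotMap.Assoc {P Q S U V W : DGColl R} (a : OdotMap P Q S) (b : OdotMap S U V)
    (c : OdotMap Q U W) (e : OdotMap P W V) : Prop :=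
  ∀ {k N : ℕ} {q r : ℤ} (n : Fin k → ℕ) (p : Fin k → ℤ)
    (m : ∀ i, Fin (n i) → ℕ) (s : ∀ i, Fin (n i) → ℤ)
    (hN : ∑ i, ∑ j, m i j = N) (hr : ∑ i, (∑ j, s i j + p i) + q = r)
    (x : ∀ i j, P.X (m i j) (s i j)) (y : ∀ i, Q.X (n i) (p i)) (z : U.X k q),
    b.app (fun i => ∑ j, m i j) (fun i => ∑ j, s i j + p i) hN hr
        (fun i => a.app (m i) (s i) rfl rfl (x i) (y i)) z =
      sgn (koszul s p) •
        e.app (flat m) (flat s) (by rw [sum_flat, hN])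
          (by rw [sum_flat, ← hr, Finset.sum_add_distrib, add_assoc]) (flat x)
          (c.app n p rfl rfl y z)

/-- A chain map of collections of complexes (of degree zero). -/
structure DGColl.Hom (P Q : DGColl R) where
  f : ∀ {n : ℕ} {p : ℤ}, P.X n p →ₗ[R] Q.X n p
  map_d : ∀ {n : ℕ} {p q : ℤ} (h : p + 1 = q) (x : P.X n p), f (P.d h x) = Q.d h (f x)

theorem DGColl.Hom.map_cast {P Q : DGColl R} (f : P.Hom Q) {n m : ℕ} {p q : ℤ} (hn : n = m)
    (hp : p = q) (x : P.X n p) : f.f (P.cast hn hp x) = Q.cast hn hp (f.f x) := by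
  subst hn hp; rfl

theorem DGColl.Hom.map_dAt {P Q : DGColl R} (f : P.Hom Q) {k : ℕ} {n : Fin k → ℕ}
    {p : Fin k → ℤ} (i : Fin k) (x : ∀ j, P.X (n j) (p j)) (j : Fin k) :
    f.f (P.dAt i x j) = Q.dAt i (fun j => f.f (x j)) j := by
  unfold DGColl.dAt
  split
  · exact f.map_d _ _
  · exact f.map_cast _ _ _

/-- The identity chain map. -/
def DGColl.Hom.id (P : DGColl R) : P.Hom P where
  f := LinearMap.id
  map_d _ _ := rfl

/-- The composite `P' ⊙ Q' → P ⊙ Q → S`. -/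
def OdotMap.pre {P Q S P' Q' : DGColl R} (a : OdotMap P Q S) (f : P'.Hom P) (g : Q'.Hom Q) :
    OdotMap P' Q' S where
  app n p hN hr :=
    (LinearMap.lcomp R _ g.f).compMultilinearMap ((a.app n p hN hr).compLinearMap fun _ => f.f)
  leibniz n p hN hr hr' x y := by
    have h : ∀ i, (fun j => f.f (P'.dAt i x j)) = P.dAt i (fun j => f.f (x j)) :=
      fun i => funext fun j => f.map_dAt i x j
    simp [a.leibniz n p hN hr hr', g.map_d, h]

/-! Operads and bimodules. -/

/-- A (non-symmetric) dg-operad: a monoid in the category of collections of complexes. -/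
structure DGOperad (R : Type u) [CommRing R] extends DGColl R where
  one : X 1 0
  mul : OdotMap toDGColl toDGColl toDGColl
  d_one : d (zero_add 1) one = 0
  one_mul : ∀ {k : ℕ} {q : ℤ} (y : X k q),
    mul.app (fun _ => 1) (fun _ => 0) (by simp) (by simp) (fun _ => one) y = y
  mul_one : ∀ {n : ℕ} {p : ℤ} (x : X n p),
    mul.app (fun _ : Fin 1 => n) (fun _ => p) (by simp) (by simp) (fun _ => x) one = x
  assoc : OdotMap.Assoc mul mul mul mul

/-- An `A`-`B`-bimodule in the monoidal category of collections of complexes. -/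
structure DGBimod (A B : DGOperad R) extends DGColl R where
  lact : OdotMap A.toDGColl toDGColl toDGColl
  ract : OdotMap toDGColl B.toDGColl toDGColl
  one_lact : ∀ {k : ℕ} {q : ℤ} (y : X k q),
    lact.app (fun _ => 1) (fun _ => 0) (by simp) (by simp) (fun _ => A.one) y = y
  ract_one : ∀ {n : ℕ} {p : ℤ} (x : X n p),
    ract.app (fun _ : Fin 1 => n) (fun _ => p) (by simp) (by simp) (fun _ => x) B.one = x
  lact_assoc : OdotMap.Assoc A.mul lact lact lact
  ract_assoc : OdotMap.Assoc ract ract B.mul ract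
  comm : OdotMap.Assoc lact ract ract lact

/-- The regular bimodule. -/
def DGOperad.regular (O : DGOperad R) : DGBimod O O where
  toDGColl := O.toDGColl
  lact := O.mul
  ract := O.mul
  one_lact := O.one_mul
  ract_one := O.mul_one
  lact_assoc := O.assoc
  ract_assoc := O.assoc
  comm := O.assoc

/-- A morphism of `A`-`B`-bimodules in the category of collections of complexes. -/
structure DGBimod.Hom {A B : DGOperad R} (P Q : DGBimod A B) extends
    DGColl.Hom P.toDGColl Q.toDGColl where
  map_lact : ∀ {k N : ℕ} {q r : ℤ} (n : Fin k → ℕ) (p : Fin k → ℤ)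
    (hN : ∑ i, n i = N) (hr : ∑ i, p i + q = r) (a : ∀ i, A.X (n i) (p i)) (y : P.X k q),
    f (P.lact.app n p hN hr a y) = Q.lact.app n p hN hr a (f y)
  map_ract : ∀ {k N : ℕ} {q r : ℤ} (n : Fin k → ℕ) (p : Fin k → ℤ)
    (hN : ∑ i, n i = N) (hr : ∑ i, p i + q = r) (x : ∀ i, P.X (n i) (p i)) (b : B.X k q),
    f (P.ract.app n p hN hr x b) = Q.ract.app n p hN hr (fun i => f (x i)) b

/-- The identity morphism of a bimodule. -/
def DGBimod.Hom.id {A B : DGOperad R} (P : DGBimod A B) : P.Hom P where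
  toHom := DGColl.Hom.id P.toDGColl
  map_lact _ _ _ _ _ _ := rfl
  map_ract _ _ _ _ _ _ := rfl

/-- The composite "first `f`, then `g`". -/
def DGBimod.Hom.comp {A B : DGOperad R} {P Q S : DGBimod A B} (f : P.Hom Q) (g : Q.Hom S) :
    P.Hom S where
  f := g.f.comp f.f
  map_d h x := by simp [f.map_d, g.map_d]
  map_lact n p hN hr a y := by simp [f.map_lact, g.map_lact]
  map_ract n p hN hr x b := by simp [f.map_ract, g.map_ract]

/-! Subobjects. -/

/-- A subcollection of complexes. -/
structure DGColl.Sub (P : DGColl R) where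
  carrier : ∀ n p, Submodule R (P.X n p)
  d_mem : ∀ {n : ℕ} {p q : ℤ} (h : p + 1 = q) (x : P.X n p),
    x ∈ carrier n p → P.d h x ∈ carrier n q

/-- A subcollection as a collection. -/
def DGColl.Sub.coll {P : DGColl R} (S : P.Sub) : DGColl R where
  X n p := S.carrier n p
  d h := (P.d h).restrict (S.d_mem h)
  d_d h h' x := Subtype.ext (P.d_d h h' x.1)

/-- The inclusion of a subcollection. -/
def DGColl.Sub.incl {P : DGColl R} (S : P.Sub) : S.coll.Hom P where
  f := Submodule.subtype _
  map_d _ _ := rfl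

/-- Restriction of `P ⊙ Q → S` to a subcollection of the target. -/
def OdotMap.codRestrict {P Q S : DGColl R} (a : OdotMap P Q S) (S' : S.Sub)
    (h : ∀ {k N : ℕ} {q r : ℤ} (n : Fin k → ℕ) (p : Fin k → ℤ)
      (hN : ∑ i, n i = N) (hr : ∑ i, p i + q = r) (x : ∀ i, P.X (n i) (p i)) (y : Q.X k q),
      a.app n p hN hr x y ∈ S'.carrier N r) : OdotMap P Q S'.coll where
  app n p hN hr :=
    { toFun := fun x => (a.app n p hN hr x).codRestrict _ (h n p hN hr x)
      map_update_add' := fun x i u v => LinearMap.ext fun y => Subtype.ext <| by simp; rfl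
      map_update_smul' := fun x i c v => LinearMap.ext fun y => Subtype.ext <| by simp; rfl }
  leibniz {k N q r r'} n p hN hr hr' x y := by
    refine Subtype.ext ((a.leibniz n p hN hr hr' x y).trans ?_)
    refine Eq.trans ?_ (map_add (S'.incl.f (n := N) (p := r')) _ _).symm
    rw [map_sum]
    simp only [map_zsmul]
    rfl

/-- A dg-suboperad. -/
structure DGOperad.Sub (O : DGOperad R) extends DGColl.Sub O.toDGColl where
  one_mem : O.one ∈ carrier 1 0
  mul_mem : ∀ {k N : ℕ} {q r : ℤ} (n : Fin k → ℕ) (p : Fin k → ℤ)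
    (hN : ∑ i, n i = N) (hr : ∑ i, p i + q = r) (x : ∀ i, O.X (n i) (p i)) (y : O.X k q),
    (∀ i, x i ∈ carrier (n i) (p i)) → y ∈ carrier k q → O.mul.app n p hN hr x y ∈ carrier N r

/-- A dg-suboperad as a dg-operad. -/
def DGOperad.Sub.operad {O : DGOperad R} (S : O.Sub) : DGOperad R where
  toDGColl := S.coll
  one := ⟨O.one, S.one_mem⟩
  mul := (O.mul.pre S.incl S.incl).codRestrict S.toSub fun n p hN hr x y =>
    S.mul_mem n p hN hr _ _ (fun i => (x i).2) y.2
  d_one := Subtype.ext O.d_one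
  one_mul y := Subtype.ext (O.one_mul y.1)
  mul_one x := Subtype.ext (O.mul_one x.1)
  assoc n p m s hN hr x y z := Subtype.ext
    (O.assoc n p m s hN hr (fun i j => (x i j).1) (fun i => (y i).1) z.1)

/-- The dg-suboperad generated by a set of elements. -/
def DGOperad.adjoin (O : DGOperad R) (G : ∀ n p, O.X n p → Prop) : O.Sub where
  carrier n p := ⨅ (S : O.Sub) (_ : ∀ n p x, G n p x → x ∈ S.carrier n p), S.carrier n p
  d_mem h x hx := by
    simp only [Submodule.mem_iInf] at hx ⊢
    exact fun S hS => S.d_mem h x (hx S hS)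
  one_mem := by
    simp only [Submodule.mem_iInf]
    exact fun S _ => S.one_mem
  mul_mem n p hN hr x y hx hy := by
    simp only [Submodule.mem_iInf] at hx hy ⊢
    exact fun S hS => S.mul_mem n p hN hr x y (fun i => hx i S hS) (hy S hS)

theorem DGOperad.mem_adjoin {O : DGOperad R} {G : ∀ n p, O.X n p → Prop} {n : ℕ} {p : ℤ}
    {x : O.X n p} (hx : G n p x) : x ∈ (O.adjoin G).carrier n p := by
  simp only [DGOperad.adjoin, Submodule.mem_iInf]
  exact fun S hS => hS _ _ _ hx

/-- A bimodule over dg-suboperads, obtained by restriction. -/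
def DGBimod.restrict {A B : DGOperad R} (P : DGBimod A B) (A' : A.Sub) (B' : B.Sub) :
    DGBimod A'.operad B'.operad where
  toDGColl := P.toDGColl
  lact := P.lact.pre A'.incl (DGColl.Hom.id _)
  ract := P.ract.pre (DGColl.Hom.id _) B'.incl
  one_lact y := P.one_lact y
  ract_one x := P.ract_one x
  lact_assoc n p m s hN hr x y z :=
    P.lact_assoc n p m s hN hr (fun i j => (x i j).1) (fun i => (y i).1) z
  ract_assoc n p m s hN hr x y z :=
    P.ract_assoc n p m s hN hr x (fun i => (y i).1) z.1
  comm n p m s hN hr x y z :=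
    P.comm n p m s hN hr (fun i j => (x i j).1) y z.1

/-- A dg-subbimodule over dg-suboperads. -/
structure DGBimod.Sub {A B : DGOperad R} (P : DGBimod A B) (A' : A.Sub) (B' : B.Sub) extends
    DGColl.Sub P.toDGColl where
  lact_mem : ∀ {k N : ℕ} {q r : ℤ} (n : Fin k → ℕ) (p : Fin k → ℤ)
    (hN : ∑ i, n i = N) (hr : ∑ i, p i + q = r) (a : ∀ i, A.X (n i) (p i)) (y : P.X k q),
    (∀ i, a i ∈ A'.carrier (n i) (p i)) → y ∈ carrier k q →
      P.lact.app n p hN hr a y ∈ carrier N r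
  ract_mem : ∀ {k N : ℕ} {q r : ℤ} (n : Fin k → ℕ) (p : Fin k → ℤ)
    (hN : ∑ i, n i = N) (hr : ∑ i, p i + q = r) (x : ∀ i, P.X (n i) (p i)) (b : B.X k q),
    (∀ i, x i ∈ carrier (n i) (p i)) → b ∈ B'.carrier k q →
      P.ract.app n p hN hr x b ∈ carrier N r

/-- A dg-subbimodule as a dg-bimodule. -/
def DGBimod.Sub.bimod {A B : DGOperad R} {P : DGBimod A B} {A' : A.Sub} {B' : B.Sub}
    (S : P.Sub A' B') : DGBimod A'.operad B'.operad where
  toDGColl := S.coll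
  lact := (P.lact.pre A'.incl S.incl).codRestrict S.toSub fun n p hN hr x y =>
    S.lact_mem n p hN hr _ _ (fun i => (x i).2) y.2
  ract := (P.ract.pre S.incl B'.incl).codRestrict S.toSub fun n p hN hr x y =>
    S.ract_mem n p hN hr _ _ (fun i => (x i).2) y.2
  one_lact y := Subtype.ext (P.one_lact y.1)
  ract_one x := Subtype.ext (P.ract_one x.1)
  lact_assoc n p m s hN hr x y z := Subtype.ext
    (P.lact_assoc n p m s hN hr (fun i j => (x i j).1) (fun i => (y i).1) z.1)
  ract_assoc n p m s hN hr x y z := Subtype.ext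
    (P.ract_assoc n p m s hN hr (fun i j => (x i j).1) (fun i => (y i).1) z.1)
  comm n p m s hN hr x y z := Subtype.ext
    (P.comm n p m s hN hr (fun i j => (x i j).1) (fun i => (y i).1) z.1)

/-- The dg-subbimodule over given dg-suboperads generated by a set of elements. -/
def DGBimod.adjoin {A B : DGOperad R} (P : DGBimod A B) (A' : A.Sub) (B' : B.Sub)
    (G : ∀ n p, P.X n p → Prop) : P.Sub A' B' where
  carrier n p := ⨅ (S : P.Sub A' B') (_ : ∀ n p x, G n p x → x ∈ S.carrier n p), S.carrier n p
  d_mem h x hx := by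
    simp only [Submodule.mem_iInf] at hx ⊢
    exact fun S hS => S.d_mem h x (hx S hS)
  lact_mem n p hN hr a y ha hy := by
    simp only [Submodule.mem_iInf] at hy ⊢
    exact fun S hS => S.lact_mem n p hN hr a y ha (hy S hS)
  ract_mem n p hN hr x b hx hb := by
    simp only [Submodule.mem_iInf] at hx ⊢
    exact fun S hS => S.ract_mem n p hN hr x b (fun i => hx i S hS) hb

theorem DGBimod.mem_adjoin {A B : DGOperad R} {P : DGBimod A B} {A' : A.Sub} {B' : B.Sub}
    {G : ∀ n p, P.X n p → Prop} {n : ℕ} {p : ℤ} {x : P.X n p} (hx : G n p x) :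
    x ∈ (P.adjoin A' B' G).carrier n p := by
  simp only [DGBimod.adjoin, Submodule.mem_iInf]
  exact fun S hS => hS _ _ _ hx

/-! Operads and bimodules given by generators and relations. -/

/-- Chain maps `f`, `g`, `h` that intertwine two morphisms `P ⊙ Q → S` and `P' ⊙ Q' → S'`. -/
def OdotMap.Compat {P Q S P' Q' S' : DGColl R} (a : OdotMap P Q S) (a' : OdotMap P' Q' S')
    (f : P.Hom P') (g : Q.Hom Q') (h : S.Hom S') : Prop :=
  ∀ {k N : ℕ} {q r : ℤ} (n : Fin k → ℕ) (p : Fin k → ℤ) (hN : ∑ i, n i = N)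
    (hr : ∑ i, p i + q = r) (x : ∀ i, P.X (n i) (p i)) (y : Q.X k q),
    h.f (a.app n p hN hr x y) = a'.app n p hN hr (fun i => f.f (x i)) (g.f y)

/-- A family of functions is a morphism `P ⊙ Q → S` if it becomes one after a jointly injective
family of chain maps. -/
def OdotMap.ofSep {P Q S : DGColl R} {ι : Type*} {P' Q' S' : ι → DGColl R}
    (f : ∀ i, P.Hom (P' i)) (g : ∀ i, Q.Hom (Q' i)) (h : ∀ i, S.Hom (S' i))
    (sep : ∀ {n : ℕ} {p : ℤ} {x y : S.X n p}, (∀ i, (h i).f x = (h i).f y) → x = y)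
    (a' : ∀ i, OdotMap (P' i) (Q' i) (S' i))
    (F : ∀ {k N : ℕ} {q r : ℤ} (n : Fin k → ℕ) (p : Fin k → ℤ), ∑ i, n i = N →
      ∑ i, p i + q = r → (∀ i, P.X (n i) (p i)) → Q.X k q → S.X N r)
    (hF : ∀ (c : ι) {k N : ℕ} {q r : ℤ} (n : Fin k → ℕ) (p : Fin k → ℤ) (hN : ∑ i, n i = N)
      (hr : ∑ i, p i + q = r) (x : ∀ i, P.X (n i) (p i)) (y : Q.X k q),
      (h c).f (F n p hN hr x y) = (a' c).app n p hN hr (fun i => (f c).f (x i)) ((g c).f y)) :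
    OdotMap P Q S where
  app n p hN hr :=
    { toFun := fun x =>
        { toFun := F n p hN hr x
          map_add' := fun y z => sep fun c => by simp [hF]
          map_smul' := fun y z => sep fun c => by simp [hF] }
      map_update_add' := fun x i u v => LinearMap.ext fun y => sep fun c => by
        have e : ∀ w, (fun j => (f c).f (Function.update x i w j)) =
            Function.update (fun j => (f c).f (x j)) i ((f c).f w) := fun w =>
          funext fun j => Function.apply_update (fun j => ⇑((f c).f (n := n j) (p := p j))) x i w j
        simp [hF, e]
      map_update_smul' := fun x i u v => LinearMap.ext fun y => sep fun c => by
        have e : ∀ w, (fun j => (f c).f (Function.update x i w j)) =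
            Function.update (fun j => (f c).f (x j)) i ((f c).f w) := fun w =>
          funext fun j => Function.apply_update (fun j => ⇑((f c).f (n := n j) (p := p j))) x i w j
        simp [hF, e] }
  leibniz n p hN hr hr' x y := sep fun c => by
    have e : ∀ i, (fun j => (f c).f (P.dAt i x j)) = (P' c).dAt i (fun j => (f c).f (x j)) :=
      fun i => funext fun j => (f c).map_dAt i x j
    rw [(h c).map_d]
    simp [hF, (a' c).leibniz n p hN hr hr', (g c).map_d, e]

theorem OdotMap.Assoc.ofSep {P Q S U V W : DGColl R} {a : OdotMap P Q S} {b : OdotMap S U V}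
    {c : OdotMap Q U W} {e : OdotMap P W V} {ι : Type*} {P' Q' S' U' V' W' : ι → DGColl R}
    {fP : ∀ i, P.Hom (P' i)} {fQ : ∀ i, Q.Hom (Q' i)} {fS : ∀ i, S.Hom (S' i)}
    {fU : ∀ i, U.Hom (U' i)} {fV : ∀ i, V.Hom (V' i)} {fW : ∀ i, W.Hom (W' i)}
    {a' : ∀ i, OdotMap (P' i) (Q' i) (S' i)} {b' : ∀ i, OdotMap (S' i) (U' i) (V' i)}
    {c' : ∀ i, OdotMap (Q' i) (U' i) (W' i)} {e' : ∀ i, OdotMap (P' i) (W' i) (V' i)}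
    (sep : ∀ {n : ℕ} {p : ℤ} {x y : V.X n p}, (∀ i, (fV i).f x = (fV i).f y) → x = y)
    (ha : ∀ i, a.Compat (a' i) (fP i) (fQ i) (fS i))
    (hb : ∀ i, b.Compat (b' i) (fS i) (fU i) (fV i))
    (hc : ∀ i, c.Compat (c' i) (fQ i) (fU i) (fW i))
    (he : ∀ i, e.Compat (e' i) (fP i) (fW i) (fV i))
    (h : ∀ i, OdotMap.Assoc (a' i) (b' i) (c' i) (e' i)) : OdotMap.Assoc a b c e := by
  intro k N q r n p m s hN hr x y z
  refine sep fun i => ?_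
  rw [hb i, map_zsmul, he i, hc i]
  simp only [ha i _]
  exact h i n p m s hN hr _ _ _

/-- Formal expressions in generators `G` and the operations of a dg-operad. -/
inductive OpTerm (R : Type u) (G : ℕ → ℤ → Type) : ℕ → ℤ → Type u
  | gen {n : ℕ} {p : ℤ} (g : G n p) : OpTerm R G n p
  | one : OpTerm R G 1 0
  | mul {k N : ℕ} {q r : ℤ} (n : Fin k → ℕ) (p : Fin k → ℤ) (hN : ∑ i, n i = N)
      (hr : ∑ i, p i + q = r) (x : ∀ i, OpTerm R G (n i) (p i)) (y : OpTerm R G k q) :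
      OpTerm R G N r
  | d {n : ℕ} {p q : ℤ} (h : p + 1 = q) (x : OpTerm R G n p) : OpTerm R G n q
  | zero {n : ℕ} {p : ℤ} : OpTerm R G n p
  | add {n : ℕ} {p : ℤ} (x y : OpTerm R G n p) : OpTerm R G n p
  | smul {n : ℕ} {p : ℤ} (c : R) (x : OpTerm R G n p) : OpTerm R G n p

/-- The value of an expression in a dg-operad with chosen elements. -/
def OpTerm.eval {G : ℕ → ℤ → Type} (O : DGOperad R) (φ : ∀ n p, G n p → O.X n p) :
    ∀ {n : ℕ} {p : ℤ}, OpTerm R G n p → O.X n p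
  | _, _, .gen g => φ _ _ g
  | _, _, .one => O.one
  | _, _, .mul n p hN hr x y => O.mul.app n p hN hr (fun i => (x i).eval O φ) (y.eval O φ)
  | _, _, .d h x => O.d h (x.eval O φ)
  | _, _, .zero => 0
  | _, _, .add x y => x.eval O φ + y.eval O φ
  | _, _, .smul c x => c • x.eval O φ

section OperadPresentation

variable {G : ℕ → ℤ → Type} (M : ∀ O : DGOperad R, (∀ n p, G n p → O.X n p) → Prop)

/-- A dg-operad with chosen elements that satisfy the relations `M`. -/
structure OpModel where
  O : DGOperad R
  φ : ∀ n p, G n p → O.X n p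
  rel : M O φ

/-- Two expressions are identified if they have the same value in every model of the relations. -/
def opSetoid (n : ℕ) (p : ℤ) : Setoid (OpTerm R G n p) where
  r s t := ∀ m : OpModel M, s.eval m.1 m.2 = t.eval m.1 m.2
  iseqv :=
    { refl := fun _ _ => rfl
      symm := fun h m => (h m).symm
      trans := fun (h : ∀ _, _) (h' : ∀ _, _) m => (h m).trans (h' m) }

/-- The components of the presented operad. -/
def OpQuot (n : ℕ) (p : ℤ) : Type u := Quotient (opSetoid M n p)

namespace OpQuot

variable {M}

/-- The class of an expression. -/
def mk {n : ℕ} {p : ℤ} (t : OpTerm R G n p) : OpQuot M n p := Quotient.mk (opSetoid M n p) t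

/-- An expression that represents a given class. -/
noncomputable def rep {n : ℕ} {p : ℤ} (x : OpQuot M n p) : OpTerm R G n p :=
  Quotient.out (s := opSetoid M n p) x

/-- The value of an element of the presented operad in a model of the relations. -/
def val (m : OpModel M) {n : ℕ} {p : ℤ} (x : OpQuot M n p) : m.1.X n p :=
  Quotient.lift (fun t : OpTerm R G n p => t.eval m.1 m.2) (fun s t (h : ∀ m : OpModel M, s.eval m.1 m.2 = t.eval m.1 m.2) => h m) x

theorem ext {n : ℕ} {p : ℤ} {x y : OpQuot M n p} (h : ∀ m : OpModel M, x.val m = y.val m) :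
    x = y := by
  induction x using Quotient.inductionOn
  induction y using Quotient.inductionOn
  exact Quotient.sound h

theorem val_mk (m : OpModel M) {n : ℕ} {p : ℤ} (t : OpTerm R G n p) :
    (mk (M := M) t).val m = t.eval m.1 m.2 := rfl

theorem eval_rep (m : OpModel M) {n : ℕ} {p : ℤ} (x : OpQuot M n p) :
    x.rep.eval m.1 m.2 = x.val m := by
  conv_rhs => rw [← Quotient.out_eq (s := opSetoid M n p) x]
  rfl

variable {n : ℕ} {p : ℤ}

instance : Zero (OpQuot M n p) := ⟨mk .zero⟩
noncomputable instance : Add (OpQuot M n p) := ⟨fun x y => mk (.add x.rep y.rep)⟩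
noncomputable instance : SMul R (OpQuot M n p) := ⟨fun c x => mk (.smul c x.rep)⟩
noncomputable instance : Neg (OpQuot M n p) := ⟨fun x => (-1 : R) • x⟩
noncomputable instance : Sub (OpQuot M n p) := ⟨fun x y => x + -y⟩
noncomputable instance : SMul ℕ (OpQuot M n p) := ⟨fun c x => (c : R) • x⟩
noncomputable instance : SMul ℤ (OpQuot M n p) := ⟨fun c x => (c : R) • x⟩

theorem val_zero (m : OpModel M) : (0 : OpQuot M n p).val m = 0 := rfl

theorem val_add (m : OpModel M) (x y : OpQuot M n p) : (x + y).val m = x.val m + y.val m := by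
  rw [← eval_rep m x, ← eval_rep m y]; rfl

theorem val_smul (m : OpModel M) (c : R) (x : OpQuot M n p) : (c • x).val m = c • x.val m := by
  rw [← eval_rep m x]; rfl

theorem val_neg (m : OpModel M) (x : OpQuot M n p) : (-x).val m = -x.val m :=
  (val_smul m (-1) x).trans (neg_one_smul R _)

noncomputable instance : AddCommGroup (OpQuot M n p) :=
  Function.Injective.addCommGroup (fun x (m : OpModel M) => x.val m)
    (fun _ _ h => ext fun m => congrFun h m) rfl (fun x y => funext fun m => val_add m x y)
    (fun x => funext fun m => val_neg m x)
    (fun x y => funext fun m => by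
      rw [Pi.sub_apply, sub_eq_add_neg, ← val_neg m y]; exact val_add m x (-y))
    (fun x c => funext fun m => (val_smul m (c : R) x).trans (Nat.cast_smul_eq_nsmul R c _))
    (fun x c => funext fun m => (val_smul m (c : R) x).trans (Int.cast_smul_eq_zsmul R c _))

noncomputable instance : Module R (OpQuot M n p) :=
  Function.Injective.module R
    (f := ({ toFun := fun x m => x.val m
             map_zero' := rfl
             map_add' := fun x y => funext fun m => val_add m x y } :
      OpQuot M n p →+ ∀ m : OpModel M, m.1.X n p))
    (fun _ _ h => ext fun m => congrFun h m) (fun c x => funext fun m => val_smul m c x)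

/-- Evaluation in a model as a linear map. -/
def ev (m : OpModel M) : OpQuot M n p →ₗ[R] m.1.X n p where
  toFun := val m
  map_add' := val_add m
  map_smul' := val_smul m

theorem ext_ev {x y : OpQuot M n p} (h : ∀ m : OpModel M, ev m x = ev m y) : x = y := ext h

theorem ev_mk (m : OpModel M) (t : OpTerm R G n p) : ev m (mk (M := M) t) = t.eval m.1 m.2 := rfl

theorem ev_rep (m : OpModel M) (x : OpQuot M n p) : x.rep.eval m.1 m.2 = ev m x := eval_rep m x

variable (M) in
/-- The underlying collection of complexes. -/
noncomputable def coll : DGColl R where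
  X := OpQuot M
  d h :=
    { toFun := fun x => mk (.d h x.rep)
      map_add' := fun x y => ext_ev fun m => by simp [ev_mk, OpTerm.eval, ev_rep]
      map_smul' := fun c x => ext_ev fun m => by simp [ev_mk, OpTerm.eval, ev_rep] }
  d_d h h' x := ext_ev fun m => by
    simp only [LinearMap.coe_mk, AddHom.coe_mk, ev_mk, OpTerm.eval, ev_rep, map_zero]
    exact m.1.d_d h h' _

/-- Evaluation in a model as a chain map. -/
noncomputable def evHom (m : OpModel M) : (coll M).Hom m.1.toDGColl where
  f := ev m
  map_d h x := by
    exact congrArg (m.1.d h) (ev_rep m x)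

theorem ev_d (m : OpModel M) {q : ℤ} (h : p + 1 = q) (x : OpQuot M n p) :
    ev m ((coll M).d h x) = m.1.d h (ev m x) := (evHom m).map_d h x

variable (M) in
/-- The composition in the presented operad. -/
noncomputable def mul : OdotMap (coll M) (coll M) (coll M) :=
  OdotMap.ofSep (fun m : OpModel M => evHom m) (fun m => evHom m) (fun m => evHom m) ext_ev
    (fun m => m.1.mul)
    (fun n p hN hr x y => mk (.mul n p hN hr (fun i => (x i).rep) y.rep))
    (fun m _ _ _ _ n p hN hr x y =>
      congrArg₂ (fun x y => m.1.mul.app n p hN hr x y) (funext fun i => ev_rep m (x i)) (ev_rep m y))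

theorem mul_compat (m : OpModel M) :
    (mul M).Compat m.1.mul (evHom m) (evHom m) (evHom m) :=
  fun n p hN hr x y =>
    congrArg₂ (fun x y => m.1.mul.app n p hN hr x y) (funext fun i => ev_rep m (x i)) (ev_rep m y)

end OpQuot

/-- The dg-operad with generators `G` and relations `M`, `M` being a system of equations between
expressions in the generators: the initial dg-operad with elements that satisfy `M`. -/
noncomputable def presentedOperad : DGOperad R where
  toDGColl := OpQuot.coll M
  one := .mk .one
  mul := OpQuot.mul M
  d_one := OpQuot.ext_ev fun m =>
    (OpQuot.ev_d m _ _).trans (m.1.d_one.trans (map_zero _).symm)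
  one_mul _ := OpQuot.ext_ev fun m =>
    (OpQuot.mul_compat m _ _ _ _ _ _).trans (m.1.one_mul _)
  mul_one _ := OpQuot.ext_ev fun m =>
    (OpQuot.mul_compat m _ _ _ _ _ _).trans (m.1.mul_one _)
  assoc := OdotMap.Assoc.ofSep OpQuot.ext_ev OpQuot.mul_compat OpQuot.mul_compat
    OpQuot.mul_compat OpQuot.mul_compat fun m : OpModel M => m.1.assoc

/-- The generators of the presented operad. -/
noncomputable def presentedOperad.gen (n : ℕ) (p : ℤ) (g : G n p) :
    (presentedOperad M).X n p := .mk (.gen g)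

end OperadPresentation

/-- Formal expressions in generators `G` and the operations of an `A`-`B`-bimodule. -/
inductive BiTerm (A B : DGOperad R) (G : ℕ → ℤ → Type u) : ℕ → ℤ → Type u
  | gen {n : ℕ} {p : ℤ} (g : G n p) : BiTerm A B G n p
  | lact {k N : ℕ} {q r : ℤ} (n : Fin k → ℕ) (p : Fin k → ℤ) (hN : ∑ i, n i = N)
      (hr : ∑ i, p i + q = r) (a : ∀ i, A.X (n i) (p i)) (y : BiTerm A B G k q) :
      BiTerm A B G N r
  | ract {k N : ℕ} {q r : ℤ} (n : Fin k → ℕ) (p : Fin k → ℤ) (hN : ∑ i, n i = N)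
      (hr : ∑ i, p i + q = r) (x : ∀ i, BiTerm A B G (n i) (p i)) (b : B.X k q) :
      BiTerm A B G N r
  | d {n : ℕ} {p q : ℤ} (h : p + 1 = q) (x : BiTerm A B G n p) : BiTerm A B G n q
  | zero {n : ℕ} {p : ℤ} : BiTerm A B G n p
  | add {n : ℕ} {p : ℤ} (x y : BiTerm A B G n p) : BiTerm A B G n p
  | smul {n : ℕ} {p : ℤ} (c : R) (x : BiTerm A B G n p) : BiTerm A B G n p

/-- The value of an expression in a bimodule with chosen elements. -/
def BiTerm.eval {A B : DGOperad R} {G : ℕ → ℤ → Type u} (P : DGBimod A B)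
    (φ : ∀ n p, G n p → P.X n p) : ∀ {n : ℕ} {p : ℤ}, BiTerm A B G n p → P.X n p
  | _, _, .gen g => φ _ _ g
  | _, _, .lact n p hN hr a y => P.lact.app n p hN hr a (y.eval P φ)
  | _, _, .ract n p hN hr x b => P.ract.app n p hN hr (fun i => (x i).eval P φ) b
  | _, _, .d h x => P.d h (x.eval P φ)
  | _, _, .zero => 0
  | _, _, .add x y => x.eval P φ + y.eval P φ
  | _, _, .smul c x => c • x.eval P φ

section BimodulePresentation

variable {A B : DGOperad R} {G : ℕ → ℤ → Type u}
  (M : ∀ P : DGBimod A B, (∀ n p, G n p → P.X n p) → Prop)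

/-- A bimodule with chosen elements that satisfy the relations `M`. -/
structure BiModel where
  P : DGBimod A B
  φ : ∀ n p, G n p → P.X n p
  rel : M P φ

/-- Two expressions are identified if they have the same value in every model of the relations. -/
def biSetoid (n : ℕ) (p : ℤ) : Setoid (BiTerm A B G n p) where
  r s t := ∀ m : BiModel M, s.eval m.1 m.2 = t.eval m.1 m.2
  iseqv :=
    { refl := fun _ _ => rfl
      symm := fun h m => (h m).symm
      trans := fun (h : ∀ _, _) (h' : ∀ _, _) m => (h m).trans (h' m) }

/-- The components of the presented bimodule. -/
def BiQuot (n : ℕ) (p : ℤ) : Type u := Quotient (biSetoid M n p)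

namespace BiQuot

variable {M}

/-- The class of an expression. -/
def mk {n : ℕ} {p : ℤ} (t : BiTerm A B G n p) : BiQuot M n p := Quotient.mk (biSetoid M n p) t

/-- An expression that represents a given class. -/
noncomputable def rep {n : ℕ} {p : ℤ} (x : BiQuot M n p) : BiTerm A B G n p :=
  Quotient.out (s := biSetoid M n p) x

/-- The value of an element of the presented bimodule in a model of the relations. -/
def val (m : BiModel M) {n : ℕ} {p : ℤ} (x : BiQuot M n p) : m.1.X n p :=
  Quotient.lift (fun t : BiTerm A B G n p => t.eval m.1 m.2) (fun s t (h : ∀ m : BiModel M, s.eval m.1 m.2 = t.eval m.1 m.2) => h m) x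

theorem ext {n : ℕ} {p : ℤ} {x y : BiQuot M n p} (h : ∀ m : BiModel M, x.val m = y.val m) :
    x = y := by
  induction x using Quotient.inductionOn
  induction y using Quotient.inductionOn
  exact Quotient.sound h

theorem val_mk (m : BiModel M) {n : ℕ} {p : ℤ} (t : BiTerm A B G n p) :
    (mk (M := M) t).val m = t.eval m.1 m.2 := rfl

theorem eval_rep (m : BiModel M) {n : ℕ} {p : ℤ} (x : BiQuot M n p) :
    x.rep.eval m.1 m.2 = x.val m := by
  conv_rhs => rw [← Quotient.out_eq (s := biSetoid M n p) x]
  rfl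

variable {n : ℕ} {p : ℤ}

instance : Zero (BiQuot M n p) := ⟨mk .zero⟩
noncomputable instance : Add (BiQuot M n p) := ⟨fun x y => mk (.add x.rep y.rep)⟩
noncomputable instance : SMul R (BiQuot M n p) := ⟨fun c x => mk (.smul c x.rep)⟩
noncomputable instance : Neg (BiQuot M n p) := ⟨fun x => (-1 : R) • x⟩
noncomputable instance : Sub (BiQuot M n p) := ⟨fun x y => x + -y⟩
noncomputable instance : SMul ℕ (BiQuot M n p) := ⟨fun c x => (c : R) • x⟩
noncomputable instance : SMul ℤ (BiQuot M n p) := ⟨fun c x => (c : R) • x⟩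

theorem val_zero (m : BiModel M) : (0 : BiQuot M n p).val m = 0 := rfl

theorem val_add (m : BiModel M) (x y : BiQuot M n p) : (x + y).val m = x.val m + y.val m := by
  rw [← eval_rep m x, ← eval_rep m y]; rfl

theorem val_smul (m : BiModel M) (c : R) (x : BiQuot M n p) : (c • x).val m = c • x.val m := by
  rw [← eval_rep m x]; rfl

theorem val_neg (m : BiModel M) (x : BiQuot M n p) : (-x).val m = -x.val m :=
  (val_smul m (-1) x).trans (neg_one_smul R _)

noncomputable instance : AddCommGroup (BiQuot M n p) :=
  Function.Injective.addCommGroup (fun x (m : BiModel M) => x.val m)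
    (fun _ _ h => ext fun m => congrFun h m) rfl (fun x y => funext fun m => val_add m x y)
    (fun x => funext fun m => val_neg m x)
    (fun x y => funext fun m => by
      rw [Pi.sub_apply, sub_eq_add_neg, ← val_neg m y]; exact val_add m x (-y))
    (fun x c => funext fun m => (val_smul m (c : R) x).trans (Nat.cast_smul_eq_nsmul R c _))
    (fun x c => funext fun m => (val_smul m (c : R) x).trans (Int.cast_smul_eq_zsmul R c _))

noncomputable instance : Module R (BiQuot M n p) :=
  Function.Injective.module R
    (f := ({ toFun := fun x m => x.val m
             map_zero' := rfl
             map_add' := fun x y => funext fun m => val_add m x y } :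
      BiQuot M n p →+ ∀ m : BiModel M, m.1.X n p))
    (fun _ _ h => ext fun m => congrFun h m) (fun c x => funext fun m => val_smul m c x)

/-- Evaluation in a model as a linear map. -/
def ev (m : BiModel M) : BiQuot M n p →ₗ[R] m.1.X n p where
  toFun := val m
  map_add' := val_add m
  map_smul' := val_smul m

theorem ext_ev {x y : BiQuot M n p} (h : ∀ m : BiModel M, ev m x = ev m y) : x = y := ext h

theorem ev_mk (m : BiModel M) (t : BiTerm A B G n p) : ev m (mk (M := M) t) = t.eval m.1 m.2 := rfl

theorem ev_rep (m : BiModel M) (x : BiQuot M n p) : x.rep.eval m.1 m.2 = ev m x := eval_rep m x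

variable (M) in
/-- The underlying collection of complexes. -/
noncomputable def coll : DGColl R where
  X := BiQuot M
  d h :=
    { toFun := fun x => mk (.d h x.rep)
      map_add' := fun x y => ext_ev fun m => by simp [ev_mk, BiTerm.eval, ev_rep]
      map_smul' := fun c x => ext_ev fun m => by simp [ev_mk, BiTerm.eval, ev_rep] }
  d_d h h' x := ext_ev fun m => by
    simp only [LinearMap.coe_mk, AddHom.coe_mk, ev_mk, BiTerm.eval, ev_rep, map_zero]
    exact m.1.d_d h h' _

/-- Evaluation in a model as a chain map. -/
noncomputable def evHom (m : BiModel M) : (coll M).Hom m.1.toDGColl where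
  f := ev m
  map_d h x := by
    exact congrArg (m.1.d h) (ev_rep m x)

theorem ev_d (m : BiModel M) {q : ℤ} (h : p + 1 = q) (x : BiQuot M n p) :
    ev m ((coll M).d h x) = m.1.d h (ev m x) := (evHom m).map_d h x

variable (M) in
/-- The left action on the presented bimodule. -/
noncomputable def lact : OdotMap A.toDGColl (coll M) (coll M) :=
  OdotMap.ofSep (fun _ : BiModel M => DGColl.Hom.id _) (fun m => evHom m) (fun m => evHom m)
    ext_ev (fun m => m.1.lact)
    (fun n p hN hr a y => mk (.lact n p hN hr a y.rep))
    (fun m _ _ _ _ n p hN hr a y =>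
      congrArg (fun y => m.1.lact.app n p hN hr a y) (ev_rep m y))

theorem lact_compat (m : BiModel M) :
    (lact M).Compat m.1.lact (DGColl.Hom.id _) (evHom m) (evHom m) :=
  fun n p hN hr a y =>
    congrArg (fun y => m.1.lact.app n p hN hr a y) (ev_rep m y)

variable (M) in
/-- The right action on the presented bimodule. -/
noncomputable def ract : OdotMap (coll M) B.toDGColl (coll M) :=
  OdotMap.ofSep (fun m : BiModel M => evHom m) (fun _ => DGColl.Hom.id _) (fun m => evHom m)
    ext_ev (fun m => m.1.ract)
    (fun n p hN hr x b => mk (.ract n p hN hr (fun i => (x i).rep) b))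
    (fun m _ _ _ _ n p hN hr x b =>
      congrArg (fun x => m.1.ract.app n p hN hr x b) (funext fun i => ev_rep m (x i)))

theorem ract_compat (m : BiModel M) :
    (ract M).Compat m.1.ract (evHom m) (DGColl.Hom.id _) (evHom m) :=
  fun n p hN hr x b =>
    congrArg (fun x => m.1.ract.app n p hN hr x b) (funext fun i => ev_rep m (x i))

end BiQuot

/-- The bimodule with generators `G` and relations `M`, `M` being a system of equations between
expressions in the generators: the initial bimodule with elements that satisfy `M`. -/
noncomputable def presentedBimod : DGBimod A B where
  toDGColl := BiQuot.coll M
  lact := BiQuot.lact M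
  ract := BiQuot.ract M
  one_lact _ := BiQuot.ext_ev fun m =>
    (BiQuot.lact_compat m _ _ _ _ _ _).trans (m.1.one_lact _)
  ract_one _ := BiQuot.ext_ev fun m =>
    (BiQuot.ract_compat m _ _ _ _ _ _).trans (m.1.ract_one _)
  lact_assoc := OdotMap.Assoc.ofSep (fP := fun _ => DGColl.Hom.id _)
    (fQ := fun _ => DGColl.Hom.id _) BiQuot.ext_ev (fun _ _ _ _ _ _ _ _ _ _ _ => rfl)
    BiQuot.lact_compat BiQuot.lact_compat BiQuot.lact_compat
    fun m : BiModel M => m.1.lact_assoc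
  ract_assoc := OdotMap.Assoc.ofSep (fW := fun _ => DGColl.Hom.id _)
    (fU := fun _ => DGColl.Hom.id _) BiQuot.ext_ev BiQuot.ract_compat
    BiQuot.ract_compat (fun _ _ _ _ _ _ _ _ _ _ _ => rfl) BiQuot.ract_compat
    fun m : BiModel M => m.1.ract_assoc
  comm := OdotMap.Assoc.ofSep BiQuot.ext_ev BiQuot.lact_compat
    BiQuot.ract_compat BiQuot.ract_compat BiQuot.lact_compat fun m : BiModel M => m.1.comm

/-- The generators of the presented bimodule. -/
noncomputable def presentedBimod.gen (n : ℕ) (p : ℤ) (g : G n p) :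
    (presentedBimod M).X n p := .mk (.gen g)

variable {M} in
/-- The morphism from the presented bimodule to a model of the relations. -/
noncomputable def presentedBimod.ev (m : BiModel M) : (presentedBimod M).Hom m.1 where
  toHom := BiQuot.evHom m
  map_lact n p hN hr a y := BiQuot.lact_compat m n p hN hr a y
  map_ract n p hN hr x b := BiQuot.ract_compat m n p hN hr x b

end BimodulePresentation

/-! The tensor product of bimodules over an operad. -/

/-- A generator `x₁ ⊗ ⋯ ⊗ xₖ ⊗ y` of `P ⊙ Q`. -/
structure OdotSym (P Q : DGColl R) (N : ℕ) (r : ℤ) : Type u where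
  k : ℕ
  q : ℤ
  n : Fin k → ℕ
  p : Fin k → ℤ
  hN : ∑ i, n i = N
  hr : ∑ i, p i + q = r
  x : ∀ i, P.X (n i) (p i)
  y : Q.X k q

section RelTensor

variable {A O B : DGOperad R}

/-- A morphism `t : P ⊙ Q → T` to an `A`-`B`-bimodule `T` that is `O`-balanced, i.e. coequalizes the
two arrows `P ⊙ O ⊙ Q → P ⊙ Q`, and commutes with the actions of `A` and `B`. -/
structure IsBalanced (P : DGBimod A O) (Q : DGBimod O B) (T : DGBimod A B)
    (t : OdotMap P.toDGColl Q.toDGColl T.toDGColl) : Prop where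
  balanced : OdotMap.Assoc P.ract t Q.lact t
  left : OdotMap.Assoc P.lact t t T.lact
  right : OdotMap.Assoc t T.ract Q.ract t

/-- The relations of `P ⊙_O Q`. -/
def IsTensorModel (P : DGBimod A O) (Q : DGBimod O B) (T : DGBimod A B)
    (φ : ∀ N r, OdotSym P.toDGColl Q.toDGColl N r → T.X N r) : Prop :=
  ∃ t : OdotMap P.toDGColl Q.toDGColl T.toDGColl, IsBalanced P Q T t ∧
    ∀ N r (s : OdotSym P.toDGColl Q.toDGColl N r),
      φ N r s = t.app s.n s.p s.hN s.hr s.x s.y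

/-- The tensor product `P ⊙_O Q` of an `A`-`O`-bimodule and an `O`-`B`-bimodule: the universal
`A`-`B`-bimodule with a balanced morphism from `P ⊙ Q`. -/
noncomputable def relTensor (P : DGBimod A O) (Q : DGBimod O B) : DGBimod A B :=
  presentedBimod (IsTensorModel P Q)

namespace relTensor

theorem ev_gen {P : DGBimod A O} {Q : DGBimod O B} (m : BiModel (IsTensorModel P Q)) {N : ℕ} {r : ℤ}
    (s : OdotSym P.toDGColl Q.toDGColl N r) :
    (BiQuot.evHom m).f (presentedBimod.gen (IsTensorModel P Q) N r s) =
      m.rel.choose.app s.n s.p s.hN s.hr s.x s.y :=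
  m.rel.choose_spec.2 N r s

/-- The canonical morphism `P ⊙ Q → P ⊙_O Q`. -/
noncomputable def mk (P : DGBimod A O) (Q : DGBimod O B) :
    OdotMap P.toDGColl Q.toDGColl (relTensor P Q).toDGColl :=
  OdotMap.ofSep (fun _ : BiModel (IsTensorModel P Q) => DGColl.Hom.id _)
    (fun _ => DGColl.Hom.id _) (fun m => BiQuot.evHom m) BiQuot.ext_ev (fun m => m.rel.choose)
    (fun n p hN hr x y => presentedBimod.gen (IsTensorModel P Q) _ _ ⟨_, _, n, p, hN, hr, x, y⟩)
    (fun m _ _ _ _ _ _ _ _ _ _ => ev_gen m _)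

theorem mk_compat {P : DGBimod A O} {Q : DGBimod O B} (m : BiModel (IsTensorModel P Q)) :
    (mk P Q).Compat m.rel.choose (DGColl.Hom.id _) (DGColl.Hom.id _) (BiQuot.evHom m) :=
  fun _ _ _ _ _ _ => ev_gen m _

theorem isBalanced (P : DGBimod A O) (Q : DGBimod O B) :
    IsBalanced P Q (relTensor P Q) (mk P Q) where
  balanced := OdotMap.Assoc.ofSep (fP := fun _ => DGColl.Hom.id _)
    (fQ := fun _ => DGColl.Hom.id _) (fS := fun _ => DGColl.Hom.id _)
    (fU := fun _ => DGColl.Hom.id _) (fW := fun _ => DGColl.Hom.id _) BiQuot.ext_ev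
    (fun _ _ _ _ _ _ _ _ _ _ _ => rfl) mk_compat
    (fun _ _ _ _ _ _ _ _ _ _ _ => rfl) mk_compat
    fun m : BiModel (IsTensorModel P Q) => m.rel.choose_spec.1.balanced
  left := OdotMap.Assoc.ofSep (fP := fun _ => DGColl.Hom.id _)
    (fQ := fun _ => DGColl.Hom.id _) (fS := fun _ => DGColl.Hom.id _)
    (fU := fun _ => DGColl.Hom.id _) BiQuot.ext_ev
    (fun _ _ _ _ _ _ _ _ _ _ _ => rfl) mk_compat mk_compat BiQuot.lact_compat
    fun m : BiModel (IsTensorModel P Q) => m.rel.choose_spec.1.left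
  right := OdotMap.Assoc.ofSep (fP := fun _ => DGColl.Hom.id _)
    (fQ := fun _ => DGColl.Hom.id _)
    (fU := fun _ => DGColl.Hom.id _) (fW := fun _ => DGColl.Hom.id _) BiQuot.ext_ev
    mk_compat BiQuot.ract_compat (fun _ _ _ _ _ _ _ _ _ _ _ => rfl) mk_compat
    fun m : BiModel (IsTensorModel P Q) => m.rel.choose_spec.1.right

/-- The morphism `P ⊙_O Q → T` induced by a balanced morphism `P ⊙ Q → T`. -/
noncomputable def lift {P : DGBimod A O} {Q : DGBimod O B} {T : DGBimod A B}
    (t : OdotMap P.toDGColl Q.toDGColl T.toDGColl) (h : IsBalanced P Q T t) :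
    (relTensor P Q).Hom T :=
  presentedBimod.ev (M := IsTensorModel P Q)
    ⟨T, fun _ _ s => t.app s.n s.p s.hN s.hr s.x s.y, t, h, fun _ _ _ => rfl⟩

theorem lift_mk {P : DGBimod A O} {Q : DGBimod O B} {T : DGBimod A B}
    (t : OdotMap P.toDGColl Q.toDGColl T.toDGColl) (h : IsBalanced P Q T t)
    {k N : ℕ} {q r : ℤ} (n : Fin k → ℕ) (p : Fin k → ℤ) (hN : ∑ i, n i = N)
    (hr : ∑ i, p i + q = r) (x : ∀ i, P.X (n i) (p i)) (y : Q.X k q) :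
    (lift t h).f ((mk P Q).app n p hN hr x y) = t.app n p hN hr x y := rfl

end relTensor

end RelTensor

namespace relTensor

variable {A O B : DGOperad R}

/-- The morphism `f ⊙ g : P ⊙_O Q → P' ⊙_O Q'`. -/
noncomputable def map {P P' : DGBimod A O} {Q Q' : DGBimod O B} (f : P.Hom P') (g : Q.Hom Q') :
    (relTensor P Q).Hom (relTensor P' Q') :=
  lift ((mk P' Q').pre f.toHom g.toHom)
    { balanced := fun n p m s hN hr x y z => by
        change (mk P' Q').app _ _ hN hr (fun i => f.f (P.ract.app _ _ rfl rfl (x i) (y i)))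
          (g.f z) = _ • (mk P' Q').app _ _ _ _ (fun a => f.f (flat x a))
            (g.f (Q.lact.app n p rfl rfl y z))
        simp only [f.map_ract, g.map_lact]
        exact (isBalanced P' Q').balanced n p m s hN hr (fun i j => f.f (x i j)) y (g.f z)
      left := fun n p m s hN hr x y z => by
        change (mk P' Q').app _ _ hN hr (fun i => f.f (P.lact.app _ _ rfl rfl (x i) (y i)))
          (g.f z) = _
        simp only [f.map_lact]
        exact (isBalanced P' Q').left n p m s hN hr x (fun i => f.f (y i)) (g.f z)
      right := fun n p m s hN hr x y z => by
        refine ((isBalanced P' Q').right n p m s hN hr (fun i j => f.f (x i j))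
          (fun i => g.f (y i)) z).trans ?_
        rw [← g.map_ract]
        rfl }

/-- The isomorphism `O ⊙_O P → P`. -/
noncomputable def leftUnitor (P : DGBimod O B) : (relTensor O.regular P).Hom P :=
  lift P.lact ⟨P.lact_assoc, P.lact_assoc, P.comm⟩

/-- The isomorphism `P ⊙_O O → P`. -/
noncomputable def rightUnitor (P : DGBimod A O) : (relTensor P O.regular).Hom P :=
  lift P.ract ⟨P.ract_assoc, P.comm, P.ract_assoc⟩

/-- The inclusions of subbimodules `P' ⊂ P` and `Q' ⊂ Q` over suboperads induce a morphism
`P' ⊙_{O'} Q' → P ⊙_O Q`. -/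
noncomputable def subMap {P : DGBimod A O} {Q : DGBimod O B} {A' : A.Sub} {O' : O.Sub} {B' : B.Sub}
    (P' : P.Sub A' O') (Q' : Q.Sub O' B') :
    (relTensor P'.bimod Q'.bimod).Hom ((relTensor P Q).restrict A' B') :=
  lift (T := (relTensor P Q).restrict A' B') ((mk P Q).pre P'.incl Q'.incl)
    { balanced := fun n p m s hN hr x y z =>
        (isBalanced P Q).balanced n p m s hN hr (fun i j => (x i j).1) (fun i => (y i).1) z.1
      left := fun n p m s hN hr x y z =>
        (isBalanced P Q).left n p m s hN hr (fun i j => (x i j).1) (fun i => (y i).1) z.1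
      right := fun n p m s hN hr x y z =>
        (isBalanced P Q).right n p m s hN hr (fun i j => (x i j).1) (fun i => (y i).1) z.1 }

/-- `a` is the associativity isomorphism `(P ⊙ Q) ⊙ S → P ⊙ (Q ⊙ S)`, which sends
`(x₁₁ ⊗ ⋯ ⊗ y₁) ⊗ ⋯ ⊗ (xₖ₁ ⊗ ⋯ ⊗ yₖ) ⊗ z` to `± x₁₁ ⊗ ⋯ ⊗ xₖₙₖ ⊗ (y₁ ⊗ ⋯ ⊗ yₖ ⊗ z)` with the
Koszul sign. These elements generate the source. -/
def IsAssociator {O₀ O₁ O₂ O₃ : DGOperad R} {P : DGBimod O₀ O₁} {Q : DGBimod O₁ O₂}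
    {S : DGBimod O₂ O₃}
    (a : (relTensor (relTensor P Q) S).Hom (relTensor P (relTensor Q S))) : Prop :=
  ∀ {k N : ℕ} {q r : ℤ} (n : Fin k → ℕ) (p : Fin k → ℤ)
    (m : ∀ i, Fin (n i) → ℕ) (s : ∀ i, Fin (n i) → ℤ)
    (hN : ∑ i, ∑ j, m i j = N) (hr : ∑ i, (∑ j, s i j + p i) + q = r)
    (x : ∀ i j, P.X (m i j) (s i j)) (y : ∀ i, Q.X (n i) (p i)) (z : S.X k q),
    a.f ((mk (relTensor P Q) S).app (fun i => ∑ j, m i j) (fun i => ∑ j, s i j + p i) hN hr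
        (fun i => (mk P Q).app (m i) (s i) rfl rfl (x i) (y i)) z) =
      sgn (koszul s p) •
        (mk P (relTensor Q S)).app (flat m) (flat s) (by rw [sum_flat, hN])
          (by rw [sum_flat, ← hr, Finset.sum_add_distrib, add_assoc]) (flat x)
          ((mk Q S).app n p rfl rfl y z)

end relTensor

/-- `(C, Δ, ε)` is a coassociative counital coalgebra in the monoidal category of
`O`-bimodules. -/
structure IsCoalgebra {O : DGOperad R} (C : DGBimod O O) (Δ : C.Hom (relTensor C C))
    (ε : C.Hom O.regular) : Prop where
  coassoc : ∃ a : (relTensor (relTensor C C) C).Hom (relTensor C (relTensor C C)),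
    relTensor.IsAssociator a ∧
      (Δ.comp (relTensor.map Δ (.id C))).comp a = Δ.comp (relTensor.map (.id C) Δ)
  counit_left : (Δ.comp (relTensor.map ε (.id C))).comp (relTensor.leftUnitor C) = .id C
  counit_right : (Δ.comp (relTensor.map (.id C) ε)).comp (relTensor.rightUnitor C) = .id C

/-! The operad `A_∞^su⟨i,j⟩` and the bimodule `F_1^su⟨i,j⟩`. -/

/-- The element `(1 ⊗ ⋯ ⊗ x ⊗ ⋯ ⊗ 1) y`, with `x` in the position `a` among `l` arguments. -/
def insertOp {O : DGOperad R} {Q S : DGColl R} (t : OdotMap O.toDGColl Q S) {l n N : ℕ} {p q r : ℤ}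
    (a : Fin l) (x : O.X n p) (y : Q.X l q) (hN : n + l = N + 1) (hr : p + q = r) : S.X N r :=
  t.app (fun b => if b = a then n else 1) (fun b => if b = a then p else 0)
    (by
      have h : ∀ b : Fin l, (if b = a then (n : ℤ) else 1) =
          1 + (if b = a then (n : ℤ) - 1 else 0) := fun b => by split <;> simp
      zify
      simp only [h, Finset.sum_add_distrib]
      simp
      omega)
    (by simp [hr])
    (fun b => if h : b = a then O.cast (if_pos h).symm (if_pos h).symm x
      else O.cast (if_neg h).symm (if_neg h).symm O.one) y

/-- Triples `(a, b, c)` with `a + b + c = n` and `b > 1`. -/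
abbrev Cut (n : ℕ) : Type :=
  {t : Fin (n + 1) × Fin (n + 1) × Fin (n + 1) // (t.1 + t.2.1 + t.2.2 : ℕ) = n ∧ 1 < (t.2.1 : ℕ)}

/-- The number `a`. -/
abbrev Cut.a {n : ℕ} (t : Cut n) : ℕ := t.1.1
/-- The number `b`. -/
abbrev Cut.b {n : ℕ} (t : Cut n) : ℕ := t.1.2.1
/-- The number `c`. -/
abbrev Cut.c {n : ℕ} (t : Cut n) : ℕ := t.1.2.2

theorem Cut.sum {n : ℕ} (t : Cut n) : t.a + t.b + t.c = n := t.2.1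

/-- Generators: `m_n` of arity `n ≥ 2` and degree `2 - n`, and nullary `1^su`, `i`, `j` of
degrees `0`, `0`, `-1`. -/
inductive AGen : ℕ → ℤ → Type
  | m (n : ℕ) (p : ℤ) (hn : 2 ≤ n) (hp : p = 2 - n) : AGen n p
  | unit : AGen 0 0
  | i : AGen 0 0
  | j : AGen 0 (-1)

/-- The relations of `A_∞^su⟨i,j⟩`. -/
structure ARel (O : DGOperad R) (φ : ∀ n p, AGen n p → O.X n p) : Prop where
  /-- `m_n ∂ = - ∑ (-1)^(ab+c) (1^⊗a ⊗ m_b ⊗ 1^⊗c) m_{a+1+c}`, where `a + b + c = n`,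
  `1 < b < n`. -/
  m_d : ∀ (n : ℕ) (hn : 2 ≤ n),
    O.d rfl (φ n (2 - n) (.m n _ hn rfl)) =
      -∑ t : {t : Cut n // t.b < n}, sgn (t.1.a * t.1.b + t.1.c) •
        insertOp O.mul (⟨t.1.a, by omega⟩ : Fin (t.1.a + 1 + t.1.c))
          (φ t.1.b (2 - t.1.b) (.m _ _ t.1.2.2 rfl))
          (φ (t.1.a + 1 + t.1.c) (2 - (t.1.a + 1 + t.1.c : ℕ))
            (.m _ _ (by have := t.1.sum; have := t.2; omega) rfl))
          (by have := t.1.sum; omega) (by have := t.1.sum; omega)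
  /-- `1^su ∂ = 0`. -/
  unit_d : O.d (zero_add 1) (φ 0 0 .unit) = 0
  /-- `(1^su ⊗ 1) m_2 = 1`. -/
  unit_left : insertOp O.mul (0 : Fin 2) (φ 0 0 .unit) (φ 2 0 (.m 2 0 le_rfl (by simp)))
    rfl rfl = O.one
  /-- `(1 ⊗ 1^su) m_2 = 1`. -/
  unit_right : insertOp O.mul (1 : Fin 2) (φ 0 0 .unit) (φ 2 0 (.m 2 0 le_rfl (by simp)))
    rfl rfl = O.one
  /-- `(1^⊗a ⊗ 1^su ⊗ 1^⊗b) m_{a+1+b} = 0` for `a + b > 1`. -/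
  unit_m : ∀ (l : ℕ) (hl : 3 ≤ l) (a : Fin l),
    insertOp O.mul a (φ 0 0 .unit) (φ l (2 - l) (.m l _ (by omega) rfl))
      (show 0 + l = l - 1 + 1 by omega) (zero_add _) = 0
  /-- `i ∂ = 0`. -/
  i_d : O.d (zero_add 1) (φ 0 0 .i) = 0
  /-- `j ∂ = 1^su - i`. -/
  j_d : O.d (by simp) (φ 0 (-1) .j) = φ 0 0 .unit - φ 0 0 .i

variable (R) in
/-- The dg-operad `A_∞^su⟨i,j⟩`. -/
noncomputable def Asu : DGOperad R := presentedOperad (R := R) ARel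

namespace Asu

/-- The operation `m_n`. -/
noncomputable def m (n : ℕ) (hn : 2 ≤ n) : (Asu R).X n (2 - n) :=
  presentedOperad.gen ARel _ _ (.m n _ hn rfl)

/-- The strict unit `1^su`. -/
noncomputable def unit : (Asu R).X 0 0 := presentedOperad.gen ARel _ _ .unit

/-- The homotopy unit `i`. -/
noncomputable def i : (Asu R).X 0 0 := presentedOperad.gen ARel _ _ .i

/-- The homotopy `j`. -/
noncomputable def j : (Asu R).X 0 (-1) := presentedOperad.gen ARel _ _ .j

end Asu

/-- Generators: `f_n` of arity `n ≥ 1` and degree `1 - n`. -/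
inductive FGen : ℕ → ℤ → Type u
  | f (n : ℕ) (p : ℤ) (hn : 1 ≤ n) (hp : p = 1 - n) : FGen n p

/-- The exponent `σ = (i₂ - 1) + 2 (i₃ - 1) + ⋯ + (l - 1) (i_l - 1)` for a composition
`n = i₁ + ⋯ + i_l`. -/
def sigma {n : ℕ} (c : Composition n) : ℤ := ∑ a : Fin c.length, ((a : ℕ) : ℤ) * (c.blocksFun a - 1)

theorem sum_degree {n : ℕ} (c : Composition n) :
    ∑ a, (1 - (c.blocksFun a : ℤ)) = c.length - n := by
  have h := c.sum_blocksFun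
  zify at h
  simp [Finset.sum_sub_distrib, h]

/-- The relations of `F_1^su⟨i,j⟩`. -/
structure FRel (P : DGBimod (Asu R) (Asu R)) (φ : ∀ n p, FGen n p → P.X n p) : Prop where
  /-- `f_n ∂ = ∑ (-1)^(c+ab) (1^⊗a ⊗ m_b ⊗ 1^⊗c) f_{a+1+c} - ∑ (-1)^σ (f_{i₁} ⊗ ⋯ ⊗ f_{i_l}) m_l`,
  where `a + b + c = n`, `b > 1`, and `i₁ + ⋯ + i_l = n`, `l > 1`. -/
  f_d : ∀ (n : ℕ) (hn : 1 ≤ n),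
    P.d rfl (φ n (1 - n) (.f n _ hn rfl)) =
      ∑ t : Cut n, sgn (t.c + t.a * t.b) •
        insertOp P.lact (⟨t.a, by omega⟩ : Fin (t.a + 1 + t.c)) (Asu.m t.b t.2.2)
          (φ (t.a + 1 + t.c) (1 - (t.a + 1 + t.c : ℕ)) (.f _ _ (by omega) rfl))
          (by have := t.sum; omega) (by have := t.sum; omega) -
      ∑ c : {c : Composition n // 1 < c.length}, sgn (sigma c.1) •
        P.ract.app c.1.blocksFun (fun a => 1 - (c.1.blocksFun a : ℤ)) c.1.sum_blocksFun
          (by rw [sum_degree]; ring)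
          (fun a => φ _ _ (.f _ _ (c.1.one_le_blocksFun a) rfl)) (Asu.m c.1.length c.2)
  /-- `1^su ρ_∅ = 1^su f_1`. -/
  unit_rho : P.ract.app (k := 0) Fin.elim0 Fin.elim0 rfl rfl (fun a => a.elim0) Asu.unit =
    insertOp P.lact (0 : Fin 1) Asu.unit (φ 1 0 (.f 1 0 le_rfl (by simp))) rfl rfl
  /-- `(1^⊗a ⊗ 1^su ⊗ 1^⊗b) f_{a+1+b} = 0` for `a + b > 0`. -/
  unit_f : ∀ (l : ℕ) (hl : 2 ≤ l) (a : Fin l),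
    insertOp P.lact a Asu.unit (φ l (1 - l) (.f l _ (by omega) rfl))
      (show 0 + l = l - 1 + 1 by omega) (zero_add _) = 0

variable (R) in
/-- The dg-bimodule `F_1^su⟨i,j⟩` over `A_∞^su⟨i,j⟩`. -/
noncomputable def Fsu : DGBimod (Asu R) (Asu R) := presentedBimod FRel

namespace Fsu

/-- The element `f_n`. -/
noncomputable def f (n : ℕ) (hn : 1 ≤ n) : (Fsu R).X n (1 - n) :=
  presentedBimod.gen FRel _ _ (.f n _ hn rfl)

/-- The nullary element `x ρ_∅`. -/
noncomputable def rho {p : ℤ} (x : (Asu R).X 0 p) : (Fsu R).X 0 p :=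
  (Fsu R).ract.app (k := 0) Fin.elim0 Fin.elim0 rfl (by simp) (fun a => a.elim0) x

/-- The element `v = j f_1 - j ρ_∅`. -/
noncomputable def v : (Fsu R).X 0 (-1) :=
  insertOp (Fsu R).lact (0 : Fin 1) Asu.j (f 1 le_rfl) rfl (by simp) - rho Asu.j

end Fsu

/-! The operad `A_∞^hu` and the bimodule `F_1^hu`. -/

/-- The arity of a letter of a word in `1` (`false`) and `j` (`true`). -/
def letterArity : Bool → ℕ
  | true => 0
  | false => 1

/-- The degree of a letter. -/
def letterDeg : Bool → ℤ
  | true => -1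
  | false => 0

/-- The letters `1` and `j` as elements of the operad. -/
noncomputable def letter : ∀ b : Bool, (Asu R).X (letterArity b) (letterDeg b)
  | true => Asu.j
  | false => (Asu R).one

/-- The element `(w₁ ⊗ ⋯ ⊗ w_l) y` for a word `w` of length `l` in the letters `1` and `j`. The
words `w = 1^n₁ j 1^n₂ j ⋯ j 1^nₖ` correspond to the sequences `n₁; n₂; …; nₖ`, where
`l = n + k - 1`, `n = n₁ + ⋯ + nₖ`. For `y = m_l` this is `m_{n₁; …; nₖ}`, for `y = f_l` this is
`f_{n₁; …; nₖ}`. -/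
noncomputable def wordAct {Q S : DGColl R} (t : OdotMap (Asu R).toDGColl Q S) {l : ℕ} {q : ℤ}
    (w : Fin l → Bool) (y : Q.X l q) :
    S.X (∑ a, letterArity (w a)) (∑ a, letterDeg (w a) + q) :=
  t.app (fun a => letterArity (w a)) (fun a => letterDeg (w a)) rfl rfl (fun a => letter (w a)) y

/-- The generators `i` and `m_{n₁; …; nₖ}`, `n + k ≥ 3`, of `A_∞^hu`. -/
inductive AhuGen : ∀ n p, (Asu R).X n p → Prop
  | i : AhuGen 0 0 Asu.i
  | m (l : ℕ) (hl : 2 ≤ l) (w : Fin l → Bool) :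
      AhuGen _ _ (wordAct (Asu R).mul w (Asu.m l hl))

/-- The generators `v` and `f_{n₁; …; nₖ}`, `n + k ≥ 2`, of `F_1^hu`, without `f_{0;0} = j f_1`. -/
inductive FhuGen : ∀ n p, (Fsu R).X n p → Prop
  | v : FhuGen 0 (-1) Fsu.v
  | f (l : ℕ) (hl : 1 ≤ l) (w : Fin l → Bool) (hw : ¬(l = 1 ∧ ∀ a, w a = true)) :
      FhuGen _ _ (wordAct (Fsu R).lact w (Fsu.f l hl))

variable (R) in
/-- The dg-suboperad `A_∞^hu` of `A_∞^su⟨i,j⟩`. -/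
noncomputable def AhuSub : (Asu R).Sub := (Asu R).adjoin AhuGen

variable (R) in
/-- The dg-subbimodule `F_1^hu` of `F_1^su⟨i,j⟩`. -/
noncomputable def FhuSub : (Fsu R).Sub (AhuSub R) (AhuSub R) :=
  (Fsu R).adjoin (AhuSub R) (AhuSub R) FhuGen

variable (R) in
/-- The dg-operad `A_∞^hu`. -/
noncomputable def Ahu : DGOperad R := (AhuSub R).operad

variable (R) in
/-- The dg-bimodule `F_1^hu` over `A_∞^hu`. -/
noncomputable def Fhu : DGBimod (Ahu R) (Ahu R) := (FhuSub R).bimod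

namespace Fhu

/-- The element `v` of `F_1^hu`. -/
noncomputable def v : (Fhu R).X 0 (-1) := ⟨Fsu.v, DGBimod.mem_adjoin .v⟩

/-- The element `f_1` of `F_1^hu`. -/
noncomputable def f₁ : (Fhu R).X 1 0 := ⟨Fsu.f 1 le_rfl, by
  have h : wordAct (Fsu R).lact (fun _ : Fin 1 => false) (Fsu.f 1 le_rfl) = Fsu.f 1 le_rfl :=
    (Fsu R).one_lact (Fsu.f 1 le_rfl)
  have h' : (Fsu.f 1 le_rfl : (Fsu R).X 1 0) ∈ (FhuSub R).carrier _ _ := by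
    rw [← h]
    exact DGBimod.mem_adjoin (.f 1 le_rfl (fun _ => false) (by simp))
  exact h'⟩

end Fhu

/-- The comultiplication of `F_1^su⟨i,j⟩`:
`f_n Δ = ∑ (-1)^σ (f_{i₁} ⊗ ⋯ ⊗ f_{iₖ}) ⊗ fₖ` over all `i₁ + ⋯ + iₖ = n`. -/
def IsComult (Δ : (Fsu R).Hom (relTensor (Fsu R) (Fsu R))) : Prop :=
  ∀ (n : ℕ) (hn : 1 ≤ n), Δ.f (Fsu.f n hn) =
    ∑ c : Composition n, sgn (sigma c) •
      (relTensor.mk (Fsu R) (Fsu R)).app c.blocksFun (fun a => 1 - (c.blocksFun a : ℤ))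
        c.sum_blocksFun (by rw [sum_degree]; ring)
        (fun a => Fsu.f _ (c.one_le_blocksFun a)) (Fsu.f c.length (c.length_pos_of_pos hn))

/-- The counit of `F_1^su⟨i,j⟩`: `f_1 ε = 1`, and `f_n ε = 0` for `n > 1`. -/
def IsCounit (ε : (Fsu R).Hom (Asu R).regular) : Prop :=
  ε.f (Fsu.f 1 le_rfl) = (Asu R).one ∧
    ∀ (n : ℕ) (hn : 1 < n), ε.f (Fsu.f n hn.le) = 0

variable (R) in
/-- The morphism `α : F_1^hu ⊙ F_1^hu → F_1^su⟨i,j⟩ ⊙ F_1^su⟨i,j⟩`, where the tensor products are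
over `A_∞^hu` and over `A_∞^su⟨i,j⟩`. -/
noncomputable def alpha : (relTensor (Fhu R) (Fhu R)).Hom
    ((relTensor (Fsu R) (Fsu R)).restrict (AhuSub R) (AhuSub R)) :=
  relTensor.subMap (FhuSub R) (FhuSub R)

/-! Algebras, algebra maps and their composition. -/

/-- A complex of `R`-modules. -/
structure Cplx (R : Type u) [CommRing R] where
  X : ℤ → Type u
  [grp : ∀ p, AddCommGroup (X p)]
  [mod : ∀ p, Module R (X p)]
  d : ∀ {p q : ℤ}, p + 1 = q → X p →ₗ[R] X q
  d_d : ∀ {p q r : ℤ} (h : p + 1 = q) (h' : q + 1 = r) (x : X p), d h' (d h x) = 0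

attribute [instance] Cplx.grp Cplx.mod

/-- Transport along equalities of degrees. -/
def Cplx.cast (A : Cplx R) {p q : ℤ} (h : p = q) : A.X p →ₗ[R] A.X q := h ▸ LinearMap.id

/-- The `j`-th factor of `1 ⊗ ⋯ ⊗ d ⊗ ⋯ ⊗ 1`, with `d` in the position `i`. -/
def Cplx.dAt (A : Cplx R) {k : ℕ} {p : Fin k → ℤ} (i j : Fin k) :
    A.X (p j) →ₗ[R] A.X (dDeg p i j) :=
  if h : j = i then A.d (by simp [dDeg, h]) else A.cast (by simp [dDeg, h])

/-- The module `HOM(A, B)(n)^p` of linear maps `A^⊗n → B` of degree `p`. Such a map is given by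
multilinear maps `A^{s₁} × ⋯ × A^{sₙ} → B^{s₁ + ⋯ + sₙ + p}`. -/
abbrev HOM (A B : Cplx R) (n : ℕ) (p : ℤ) : Type u :=
  ∀ s : Fin n → ℤ, MultilinearMap R (fun a => A.X (s a)) (B.X (∑ a, s a + p))

/-- The component `A^{s₁} × ⋯ × A^{sₙ} → B^r` of `f`, where `r = s₁ + ⋯ + sₙ + p`. -/
def HOM.component {A B : Cplx R} {n : ℕ} {p : ℤ} (f : HOM A B n p) (s : Fin n → ℤ) {r : ℤ}
    (h : ∑ a, s a + p = r) : MultilinearMap R (fun a => A.X (s a)) (B.X r) :=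
  (B.cast h).compMultilinearMap (f s)

/-- The identity of `A` as an element of `HOM(A, A)(1)^0`. -/
def HOM.one (A : Cplx R) : HOM A A 1 0 := fun s =>
  { toFun := fun x => A.cast (by simp) (x 0)
    map_update_add' := fun x a u v => by
      obtain rfl := Subsingleton.elim 0 a
      simp
    map_update_smul' := fun x a c v => by
      obtain rfl := Subsingleton.elim 0 a
      simp }

/-- The differential of `HOM(A, B)(n)`:
`f ∂ = f d - (-1)^|f| ∑ₐ (1 ⊗ ⋯ ⊗ d ⊗ ⋯ ⊗ 1) f`, where differentials act on the right. -/
def HOM.d {A B : Cplx R} {n : ℕ} {p q : ℤ} (h : p + 1 = q) (f : HOM A B n p) : HOM A B n q :=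
  fun s =>
    (B.d (by rw [← h, add_assoc])).compMultilinearMap (f s) -
      sgn p • ∑ a, sgn (∑ b, if a < b then s b else 0) •
        (HOM.component f (dDeg s a) (by rw [sum_dDeg, ← h]; ring)).compLinearMap (A.dAt a)

/-- The place of the `j`-th argument of the `i`-th block among all `N` arguments. -/
def blockEquiv {k N : ℕ} {n : Fin k → ℕ} (hN : ∑ i, n i = N) :
    ((i : Fin k) × Fin (n i)) ≃ Fin N :=
  finSigmaFinEquiv.trans (finCongr hN)

theorem sum_blockEquiv {k N : ℕ} {n : Fin k → ℕ} (hN : ∑ i, n i = N) (s : Fin N → ℤ) :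
    ∑ i, ∑ j, s (blockEquiv hN ⟨i, j⟩) = ∑ a, s a := by
  rw [← Fintype.sum_sigma' fun i j => s (blockEquiv hN ⟨i, j⟩)]
  exact Equiv.sum_comp (blockEquiv hN) s

/-- The substitution composition `(x₁ ⊗ ⋯ ⊗ xₖ) y`. Maps act on the right, thus there is the Koszul
sign of the permutation `a₁₁ ⋯ aₖₙₖ x₁ ⋯ xₖ ↦ a₁₁ ⋯ a₁ₙ₁ x₁ ⋯ aₖ₁ ⋯ aₖₙₖ xₖ`. -/
def HOM.comp {A B C : Cplx R} {k N : ℕ} {q r : ℤ} (n : Fin k → ℕ) (p : Fin k → ℤ)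
    (hN : ∑ i, n i = N) (hr : ∑ i, p i + q = r) (x : ∀ i, HOM A B (n i) (p i))
    (y : HOM B C k q) : HOM A C N r := fun s =>
  let e := blockEquiv hN
  let g : MultilinearMap R (fun a : (i : Fin k) × Fin (n i) => A.X (s (e a)))
      (C.X (∑ a, s a + r)) :=
    (HOM.component y (fun i => ∑ j, s (e ⟨i, j⟩) + p i) (by
      rw [Finset.sum_add_distrib, sum_blockEquiv, ← hr]; ring)).compMultilinearMap
      fun i => x i fun j => s (e ⟨i, j⟩)
  sgn (koszul (fun i j => s (e ⟨i, j⟩)) p) •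
    { toFun := fun a => g fun b => a (e b)
      map_update_add' := fun a b u v => by
        obtain ⟨b, rfl⟩ := e.surjective b
        simp [Function.update_comp_eq_of_injective' _ e.injective]
      map_update_smul' := fun a b c v => by
        obtain ⟨b, rfl⟩ := e.surjective b
        simp [Function.update_comp_eq_of_injective' _ e.injective] }

/-- An algebra over a dg-operad: a complex `A` with a morphism of dg-operads `O → END A`. -/
structure OpAlg (O : DGOperad R) extends Cplx R where
  act : ∀ {n : ℕ} {p : ℤ}, O.X n p →ₗ[R] HOM toCplx toCplx n p
  act_one : act O.one = HOM.one toCplx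
  act_mul : ∀ {k N : ℕ} {q r : ℤ} (n : Fin k → ℕ) (p : Fin k → ℤ)
    (hN : ∑ i, n i = N) (hr : ∑ i, p i + q = r) (x : ∀ i, O.X (n i) (p i)) (y : O.X k q),
    act (O.mul.app n p hN hr x y) = HOM.comp n p hN hr (fun i => act (x i)) (act y)
  act_d : ∀ {n : ℕ} {p q : ℤ} (h : p + 1 = q) (x : O.X n p), act (O.d h x) = HOM.d h (act x)

/-- An `(O, F)`-morphism of `O`-algebras `A → B`: a morphism of `O`-bimodules `F → HOM(A, B)`, where
`O` acts on `HOM(A, B)` through `END A` and `END B`. -/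
structure AlgMap {O : DGOperad R} (F : DGBimod O O) (A B : OpAlg O) where
  g : ∀ {n : ℕ} {p : ℤ}, F.X n p →ₗ[R] HOM A.toCplx B.toCplx n p
  map_d : ∀ {n : ℕ} {p q : ℤ} (h : p + 1 = q) (x : F.X n p), g (F.d h x) = HOM.d h (g x)
  map_lact : ∀ {k N : ℕ} {q r : ℤ} (n : Fin k → ℕ) (p : Fin k → ℤ)
    (hN : ∑ i, n i = N) (hr : ∑ i, p i + q = r) (a : ∀ i, O.X (n i) (p i)) (y : F.X k q),
    g (F.lact.app n p hN hr a y) = HOM.comp n p hN hr (fun i => A.act (a i)) (g y)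
  map_ract : ∀ {k N : ℕ} {q r : ℤ} (n : Fin k → ℕ) (p : Fin k → ℤ)
    (hN : ∑ i, n i = N) (hr : ∑ i, p i + q = r) (x : ∀ i, F.X (n i) (p i)) (b : O.X k q),
    g (F.ract.app n p hN hr x b) = HOM.comp n p hN hr (fun i => g (x i)) (B.act b)

/-- `c` is the convolution of `g` and `h`, i.e. the composite
`F → F ⊙_O F → HOM(A, B) ⊙ HOM(B, C) → HOM(A, C)` of `Δ`, `g ⊙ h` and the substitution
composition; `φ` is the composite of the last two arrows. -/
def IsConvolution {O : DGOperad R} {F : DGBimod O O} (Δ : F.Hom (relTensor F F)) {A B C : OpAlg O}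
    (g : AlgMap F A B) (h : AlgMap F B C) (c : AlgMap F A C) : Prop :=
  ∃ φ : ∀ N r, (relTensor F F).X N r →ₗ[R] HOM A.toCplx C.toCplx N r,
    (∀ {k N : ℕ} {q r : ℤ} (n : Fin k → ℕ) (p : Fin k → ℤ) (hN : ∑ i, n i = N)
      (hr : ∑ i, p i + q = r) (x : ∀ i, F.X (n i) (p i)) (y : F.X k q),
      φ N r ((relTensor.mk F F).app n p hN hr x y) =
        HOM.comp n p hN hr (fun i => g.g (x i)) (h.g y)) ∧
    ∀ N r (x : F.X N r), c.g x = φ N r (Δ.f x)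

/-- `O`-algebras and their `(O, F)`-morphisms form a category with respect to convolution, the
identity of `B` being `F → O → END B`. -/
structure ComposeAssociatively {O : DGOperad R} (F : DGBimod O O) (Δ : F.Hom (relTensor F F))
    (ε : F.Hom O.regular) : Prop where
  exists_unique_comp : ∀ (A B C : OpAlg O) (g : AlgMap F A B) (h : AlgMap F B C),
    ∃! c : AlgMap F A C, IsConvolution Δ g h c
  assoc : ∀ (A B C D : OpAlg O) (g : AlgMap F A B) (h : AlgMap F B C) (l : AlgMap F C D)
    (gh : AlgMap F A C) (hl : AlgMap F B D), IsConvolution Δ g h gh → IsConvolution Δ h l hl →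
      ∀ c : AlgMap F A D, IsConvolution Δ gh l c ↔ IsConvolution Δ g hl c
  identity : ∀ B : OpAlg O, ∃ e : AlgMap F B B, (∀ N r (x : F.X N r), e.g x = B.act (ε.f x)) ∧
    (∀ (A : OpAlg O) (g : AlgMap F A B), IsConvolution Δ g e g) ∧
    ∀ (C : OpAlg O) (h : AlgMap F B C), IsConvolution Δ e h h

end HUnital

open HUnital

namespace HUnital

variable {R : Type u} [CommRing R]

/-! Lists of elements of a collection. -/

theorem sgn_add (a b : ℤ) : sgn (a + b) = sgn a * sgn b := by
  simp [sgn, Int.negOnePow_add]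

@[simp] theorem sgn_zero : sgn 0 = 1 := by simp [sgn]

@[simp] theorem sgn_one : sgn 1 = -1 := by simp [sgn]

theorem sgn_mul_self (a : ℤ) : sgn a * sgn a = 1 := by
  rw [← sgn_add, sgn, Int.negOnePow_even _ ⟨a, rfl⟩]; rfl

theorem sgn_eq_of_even {a b : ℤ} (h : Even (a - b)) : sgn a = sgn b := by
  obtain ⟨c, hc⟩ := h
  obtain rfl : a = b + (c + c) := by omega
  rw [sgn_add, sgn_add c c, sgn_mul_self, mul_one]

theorem sgn_smul_smul {M : Type*} [AddCommGroup M] (a b : ℤ) (x : M) :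
    sgn a • sgn b • x = sgn (a + b) • x := by
  rw [sgn_add, mul_smul]

theorem sgn_smul_self {M : Type*} [AddCommGroup M] (a : ℤ) (x : M) :
    sgn a • sgn a • x = x := by
  rw [smul_smul, sgn_mul_self, one_smul]

theorem sgn_smul_inj {M : Type*} [AddCommGroup M] {a : ℤ} {x y : M} (h : sgn a • x = sgn a • y) :
    x = y := by
  rw [← sgn_smul_self a x, h, sgn_smul_self]

/-- A homogeneous element of a collection. -/
structure DGColl.El (P : DGColl R) : Type u where
  ar : ℕ
  deg : ℤ
  val : P.X ar deg

theorem DGColl.El.ext_cast {P : DGColl R} {x y : P.El} (h₁ : x.ar = y.ar) (h₂ : x.deg = y.deg)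
    (h : P.cast h₁ h₂ x.val = y.val) : x = y := by
  obtain ⟨n, p, x⟩ := x
  obtain ⟨m, q, y⟩ := y
  dsimp at h₁ h₂
  subst h₁ h₂
  congr

theorem DGColl.El.mk_cast {P : DGColl R} {n m : ℕ} {p q : ℤ} (hn : n = m) (hp : p = q)
    (x : P.X n p) : (⟨m, q, P.cast hn hp x⟩ : P.El) = ⟨n, p, x⟩ := by
  subst hn hp; rfl

/-- The total arity of a list of elements. -/
def arSum {P : DGColl R} (l : List P.El) : ℕ := (l.map DGColl.El.ar).sum

/-- The total degree of a list of elements. -/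
def degSum {P : DGColl R} (l : List P.El) : ℤ := (l.map DGColl.El.deg).sum

section Sums

variable {P : DGColl R}

@[simp] theorem arSum_nil : arSum ([] : List P.El) = 0 := rfl
@[simp] theorem degSum_nil : degSum ([] : List P.El) = 0 := rfl
@[simp] theorem arSum_cons (x : P.El) (l : List P.El) : arSum (x :: l) = x.ar + arSum l := by
  simp [arSum]
@[simp] theorem degSum_cons (x : P.El) (l : List P.El) : degSum (x :: l) = x.deg + degSum l := by
  simp [degSum]
@[simp] theorem arSum_append (l l' : List P.El) : arSum (l ++ l') = arSum l + arSum l' := by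
  simp [arSum]
@[simp] theorem degSum_append (l l' : List P.El) : degSum (l ++ l') = degSum l + degSum l' := by
  simp [degSum]

theorem arSum_ofFn {k : ℕ} (e : Fin k → P.El) : arSum (List.ofFn e) = ∑ i, (e i).ar := by
  rw [arSum, List.map_ofFn, List.sum_ofFn]; rfl

theorem degSum_ofFn {k : ℕ} (e : Fin k → P.El) : degSum (List.ofFn e) = ∑ i, (e i).deg := by
  rw [degSum, List.map_ofFn, List.sum_ofFn]; rfl

theorem ofFn_get_cast {α : Type*} {k : ℕ} (l : List α) (h : k = l.length) :
    List.ofFn (fun i : Fin k => l.get (i.cast h)) = l := by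
  subst h; exact List.ofFn_get l

end Sums

variable {P Q S : DGColl R}

/-- A family of multilinear maps `P ⊙ Q → S` without a condition on differentials. -/
structure OdotFam (P Q S : DGColl R) where
  app : ∀ {k N : ℕ} {q r : ℤ} (n : Fin k → ℕ) (p : Fin k → ℤ),
    ∑ i, n i = N → ∑ i, p i + q = r →
      MultilinearMap R (fun i => P.X (n i) (p i)) (Q.X k q →ₗ[R] S.X N r)

/-- The multilinear maps of a morphism. -/
def OdotMap.fam (t : OdotMap P Q S) : OdotFam P Q S := ⟨t.app⟩

/-- The value of a family of multilinear maps on a family of elements. -/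
def OdotFam.E (t : OdotFam P Q S) {k N : ℕ} {q r : ℤ} (e : Fin k → P.El) (y : Q.X k q)
    (hN : ∑ i, (e i).ar = N) (hr : ∑ i, (e i).deg + q = r) : S.X N r :=
  t.app (fun i => (e i).ar) (fun i => (e i).deg) hN hr (fun i => (e i).val) y

/-- The component of arity `N` and degree `r` of the value of a family of multilinear maps on
`x₁ ⊗ ⋯ ⊗ xₖ ⊗ y`, for a list `x₁, …, xₖ` of elements of `P`. -/
def OdotFam.L (t : OdotFam P Q S) (N : ℕ) (r : ℤ) (xs : List P.El) (y : Q.El) : S.X N r :=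
  if h : y.ar = xs.length ∧ arSum xs = N ∧ degSum xs + y.deg = r then
    t.E (fun i : Fin y.ar => xs.get (i.cast h.1)) y.val
      (by rw [← arSum_ofFn, ofFn_get_cast, h.2.1]) (by rw [← degSum_ofFn, ofFn_get_cast, h.2.2])
  else 0

theorem OdotFam.E_eq_L (t : OdotFam P Q S) {k N : ℕ} {q r : ℤ} (e : Fin k → P.El) (y : Q.X k q)
    (hN : ∑ i, (e i).ar = N) (hr : ∑ i, (e i).deg + q = r) :
    t.E e y hN hr = t.L N r (List.ofFn e) ⟨k, q, y⟩ := by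
  have h : ∀ (e' : Fin k → P.El) (hN' : ∑ i, (e' i).ar = N) (hr' : ∑ i, (e' i).deg + q = r),
      e = e' → t.E e y hN hr = t.E e' y hN' hr' := by
    rintro e' hN' hr' rfl; rfl
  rw [OdotFam.L, dif_pos ⟨by simp, by rw [arSum_ofFn, hN], by rw [degSum_ofFn, hr]⟩]
  exact h _ _ _ (funext fun i => by simp)

theorem OdotFam.app_eq_L (t : OdotFam P Q S) {k N : ℕ} {q r : ℤ} (n : Fin k → ℕ) (p : Fin k → ℤ)
    (hN : ∑ i, n i = N) (hr : ∑ i, p i + q = r) (x : ∀ i, P.X (n i) (p i)) (y : Q.X k q) :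
    t.app n p hN hr x y = t.L N r (List.ofFn fun i => ⟨n i, p i, x i⟩) ⟨k, q, y⟩ :=
  t.E_eq_L (fun i => ⟨n i, p i, x i⟩) y hN hr

/-- The component of arity `N` and degree `r` of the value of a morphism `P ⊙ Q → S` on
`x₁ ⊗ ⋯ ⊗ xₖ ⊗ y`, for a list `x₁, …, xₖ` of elements of `P`. -/
def OdotMap.L (t : OdotMap P Q S) (N : ℕ) (r : ℤ) (xs : List P.El) (y : Q.El) : S.X N r :=
  t.fam.L N r xs y

theorem OdotMap.app_eq_L (t : OdotMap P Q S) {k N : ℕ} {q r : ℤ} (n : Fin k → ℕ) (p : Fin k → ℤ)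
    (hN : ∑ i, n i = N) (hr : ∑ i, p i + q = r) (x : ∀ i, P.X (n i) (p i)) (y : Q.X k q) :
    t.app n p hN hr x y = t.L N r (List.ofFn fun i => ⟨n i, p i, x i⟩) ⟨k, q, y⟩ :=
  t.fam.app_eq_L n p hN hr x y

/-- The value on a list as an element. -/
def OdotMap.el (t : OdotMap P Q S) (xs : List P.El) (y : Q.El) : S.El :=
  ⟨arSum xs, degSum xs + y.deg, t.L _ _ xs y⟩

@[simp] theorem OdotMap.el_ar (t : OdotMap P Q S) (xs : List P.El) (y : Q.El) :
    (t.el xs y).ar = arSum xs := rfl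

@[simp] theorem OdotMap.el_deg (t : OdotMap P Q S) (xs : List P.El) (y : Q.El) :
    (t.el xs y).deg = degSum xs + y.deg := rfl

theorem OdotMap.el_eq (t : OdotMap P Q S) {N : ℕ} {r : ℤ} {xs : List P.El} {y : Q.El}
    (hN : arSum xs = N) (hr : degSum xs + y.deg = r) : t.el xs y = ⟨N, r, t.L N r xs y⟩ := by
  subst hN hr; rfl

/-- Linearity in every place of a list. -/
def SlotLinear {M : Type*} [AddCommGroup M] [Module R M] (φ : List P.El → M) : Prop :=
  ∀ (l₁ l₂ : List P.El) (n : ℕ) (p : ℤ), IsLinearMap R fun x : P.X n p => φ (l₁ ++ ⟨n, p, x⟩ :: l₂)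

/-- Linearity in an element. -/
def ElLinear {M : Type*} [AddCommGroup M] [Module R M] (φ : P.El → M) : Prop :=
  ∀ (n : ℕ) (p : ℤ), IsLinearMap R fun x : P.X n p => φ ⟨n, p, x⟩

theorem exists_ofFn_update {k : ℕ} (n : Fin k → ℕ) (p : Fin k → ℤ) (x : ∀ i, P.X (n i) (p i))
    (i : Fin k) : ∃ l₁ l₂ : List P.El, ∀ u : P.X (n i) (p i),
      (List.ofFn fun j => (⟨n j, p j, Function.update x i u j⟩ : P.El)) =
        l₁ ++ ⟨n i, p i, u⟩ :: l₂ := by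
  induction k with
  | zero => exact i.elim0
  | succ k ih =>
    induction i using Fin.cases with
    | zero =>
      refine ⟨[], List.ofFn fun j => ⟨n j.succ, p j.succ, x j.succ⟩, fun u => ?_⟩
      simp [List.ofFn_succ, Fin.succ_ne_zero]
    | succ i =>
      obtain ⟨l₁, l₂, h⟩ := ih (fun j => n j.succ) (fun j => p j.succ) (fun j => x j.succ) i
      refine ⟨⟨n 0, p 0, x 0⟩ :: l₁, l₂, fun u => ?_⟩
      have h0 : (0 : Fin (k + 1)) ≠ i.succ := (Fin.succ_ne_zero i).symm
      rw [List.ofFn_succ, Function.update_of_ne h0, List.cons_append, ← h u]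
      congr 2
      funext j
      by_cases hj : j = i
      · subst hj; simp
      · rw [Function.update_of_ne hj, Function.update_of_ne (by simpa using hj)]

theorem exists_update_eq {k : ℕ} (l₁ l₂ : List P.El) (n : ℕ) (p : ℤ)
    (hk : k = (l₁ ++ (⟨n, p, 0⟩ : P.El) :: l₂).length) :
    ∃ (m : Fin k → ℕ) (s : Fin k → ℤ) (x : ∀ i, P.X (m i) (s i)) (i : Fin k) (hm : m i = n)
      (hs : s i = p), ∀ u : P.X n p, l₁ ++ ⟨n, p, u⟩ :: l₂ =
        List.ofFn fun j => (⟨m j, s j, Function.update x i (P.cast hm.symm hs.symm u) j⟩ : P.El) := by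
  subst hk
  set l := l₁ ++ (⟨n, p, 0⟩ : P.El) :: l₂ with hl
  have hi : l₁.length < l.length := by simp [hl]
  have hg : l.get ⟨l₁.length, hi⟩ = ⟨n, p, 0⟩ := by simp [hl]
  refine ⟨fun i => (l.get i).ar, fun i => (l.get i).deg, fun i => (l.get i).val,
    ⟨l₁.length, hi⟩, congrArg DGColl.El.ar hg, congrArg DGColl.El.deg hg, fun u => ?_⟩
  refine List.ext_getElem (by simp [hl]; omega) fun j h₁ h₂ => ?_
  rw [List.getElem_ofFn]
  by_cases hj : j = l₁.length
  · subst hj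
    simp only [Function.update_self, DGColl.El.mk_cast]
    rw [List.getElem_append_right le_rfl]
    simp
  · rw [Function.update_of_ne (by simpa [Fin.ext_iff] using hj)]
    simp only [List.get_eq_getElem]
    rcases lt_or_gt_of_ne hj with h | h
    · rw [List.getElem_append_left h, List.getElem_append_left h]
    · rw [List.getElem_append_right h.le, List.getElem_append_right h.le]
      have aux : ∀ (a b : P.El) (c : ℕ) (h : c < (a :: l₂).length) (h' : c < (b :: l₂).length),
          c ≠ 0 → (a :: l₂)[c] = (b :: l₂)[c] := by
        rintro a b (_ | c) h h' hc
        · exact absurd rfl hc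
        · rfl
      have h₃ : j - l₁.length < l₂.length + 1 := by simp at h₁; omega
      exact aux ⟨n, p, u⟩ ⟨n, p, 0⟩ (j - l₁.length) h₃ h₃ (by omega)

theorem isLinearMap_of_eq {M M' : Type*} [AddCommGroup M] [Module R M] [AddCommGroup M']
    [Module R M'] {f g : M → M'} (h : IsLinearMap R f) (e : ∀ x, f x = g x) : IsLinearMap R g := by
  obtain rfl : f = g := funext e
  exact h

theorem isLinearMap_zero {M M' : Type*} [AddCommGroup M] [Module R M] [AddCommGroup M']
    [Module R M'] : IsLinearMap R (fun _ : M => (0 : M')) :=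
  ⟨fun _ _ => by simp, fun _ _ => by simp⟩

theorem OdotFam.L_of_not (t : OdotFam P Q S) {N : ℕ} {r : ℤ} {xs : List P.El} {y : Q.El}
    (h : ¬(y.ar = xs.length ∧ arSum xs = N ∧ degSum xs + y.deg = r)) : t.L N r xs y = 0 :=
  dif_neg h

theorem OdotFam.slotLinear (t : OdotFam P Q S) (N : ℕ) (r : ℤ) (y : Q.El) :
    SlotLinear fun xs => t.L N r xs y := by
  intro l₁ l₂ n p
  by_cases h : y.ar = (l₁ ++ (⟨n, p, 0⟩ : P.El) :: l₂).length ∧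
      arSum (l₁ ++ (⟨n, p, 0⟩ : P.El) :: l₂) = N ∧
      degSum (l₁ ++ (⟨n, p, 0⟩ : P.El) :: l₂) + y.deg = r
  · obtain ⟨m, s, x, i, rfl, rfl, e⟩ := exists_update_eq l₁ l₂ n p h.1
    have hN : ∑ i, m i = N := by
      have := h.2.1; rw [e, arSum_ofFn] at this; simpa using this
    have hr : ∑ i, s i + y.deg = r := by
      have := h.2.2; rw [e, degSum_ofFn] at this; simpa using this
    have e' : ∀ u, t.app m s hN hr (Function.update x i u) y.val =
        t.L N r (l₁ ++ ⟨m i, s i, u⟩ :: l₂) y := fun u => by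
      rw [e, t.app_eq_L]; rfl
    refine isLinearMap_of_eq ?_ e'
    exact ⟨fun u v => by simp, fun c v => by simp⟩
  · refine isLinearMap_of_eq isLinearMap_zero fun u => (t.L_of_not ?_).symm
    simpa using h

theorem OdotFam.elLinear (t : OdotFam P Q S) (N : ℕ) (r : ℤ) (xs : List P.El) :
    ElLinear fun y => t.L N r xs y := by
  intro k q
  by_cases h : k = xs.length ∧ arSum xs = N ∧ degSum xs + q = r
  · obtain ⟨rfl, h₁, h₂⟩ := h
    have e' : ∀ y, t.app (fun i => (xs.get i).ar) (fun i => (xs.get i).deg)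
        (by rw [← arSum_ofFn, List.ofFn_get, h₁]) (by rw [← degSum_ofFn, List.ofFn_get, h₂])
        (fun i => (xs.get i).val) y = t.L N r xs ⟨xs.length, q, y⟩ := fun y => by
      rw [t.app_eq_L]; simp
    exact isLinearMap_of_eq (LinearMap.isLinear _) e'
  · exact isLinearMap_of_eq isLinearMap_zero fun u => (t.L_of_not h).symm

theorem OdotMap.slotLinear (t : OdotMap P Q S) (N : ℕ) (r : ℤ) (y : Q.El) :
    SlotLinear fun xs => t.L N r xs y := t.fam.slotLinear N r y

theorem OdotMap.elLinear (t : OdotMap P Q S) (N : ℕ) (r : ℤ) (xs : List P.El) :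
    ElLinear fun y => t.L N r xs y := t.fam.elLinear N r xs

theorem OdotMap.L_of_not (t : OdotMap P Q S) {N : ℕ} {r : ℤ} {xs : List P.El} {y : Q.El}
    (h : ¬(y.ar = xs.length ∧ arSum xs = N ∧ degSum xs + y.deg = r)) : t.L N r xs y = 0 :=
  t.fam.L_of_not h

/-- The differential of an element. -/
def DGColl.El.d (x : P.El) : P.El := ⟨x.ar, x.deg + 1, P.d rfl x.val⟩

@[simp] theorem DGColl.El.d_ar (x : P.El) : x.d.ar = x.ar := rfl
@[simp] theorem DGColl.El.d_deg (x : P.El) : x.d.deg = x.deg + 1 := rfl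

/-- The sum of the values of `φ` on the terms of the differential of `x₁ ⊗ ⋯ ⊗ xₖ`. -/
def dsum {M : Type*} [AddCommGroup M] : (List P.El → M) → List P.El → M
  | _, [] => 0
  | φ, x :: xs => sgn (degSum xs) • φ (x.d :: xs) + dsum (fun l => φ (x :: l)) xs

theorem dsum_ofFn {M : Type*} [AddCommGroup M] {k : ℕ} (φ : List P.El → M) (e : Fin k → P.El) :
    dsum φ (List.ofFn e) = ∑ i, sgn (∑ j, if i < j then (e j).deg else 0) •
      φ (List.ofFn (Function.update e i (e i).d)) := by
  induction k generalizing φ with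
  | zero => simp [dsum]
  | succ k ih =>
    rw [List.ofFn_succ, dsum, ih, Fin.sum_univ_succ]
    congr 1
    · rw [degSum_ofFn, List.ofFn_succ, Fin.sum_univ_succ]
      simp [Fin.succ_ne_zero]
    · refine Finset.sum_congr rfl fun i _ => ?_
      rw [List.ofFn_succ, Fin.sum_univ_succ]
      have h0 : (0 : Fin (k + 1)) ≠ i.succ := (Fin.succ_ne_zero i).symm
      rw [Function.update_of_ne h0]
      have : (fun j : Fin k => Function.update e i.succ (e i.succ).d j.succ) =
          Function.update (fun j => e j.succ) i (e i.succ).d := by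
        funext j
        by_cases hj : j = i
        · subst hj; simp
        · rw [Function.update_of_ne hj, Function.update_of_ne (by simpa using hj)]
      rw [this]
      simp

theorem mk_dAt {k : ℕ} {n : Fin k → ℕ} {p : Fin k → ℤ} (i : Fin k) (x : ∀ j, P.X (n j) (p j)) :
    (fun j => (⟨n j, dDeg p i j, P.dAt i x j⟩ : P.El)) =
      Function.update (fun j => ⟨n j, p j, x j⟩) i (⟨n i, p i, x i⟩ : P.El).d := by
  funext j
  by_cases hj : j = i
  · subst hj
    rw [Function.update_self]
    have h : dDeg p j j = p j + 1 := by simp [dDeg]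
    refine DGColl.El.ext_cast rfl h ?_
    rw [DGColl.dAt, dif_pos rfl]
    have aux : ∀ (z : ℤ) (h : p j + 1 = z) (h' : z = p j + 1),
        P.cast rfl h' (P.d h (x j)) = P.d rfl (x j) := by
      intro z h h'
      subst h
      rfl
    exact aux _ _ _
  · rw [Function.update_of_ne hj, DGColl.dAt, dif_neg hj, DGColl.El.mk_cast]

theorem OdotFam.leibniz_L (t : OdotFam P Q S) {k : ℕ} {q : ℤ} {y : Q.X k q} {y' : Q.X k (q + 1)}
    (H : ∀ {N : ℕ} {r r' : ℤ} (n : Fin k → ℕ) (p : Fin k → ℤ) (hN : ∑ i, n i = N)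
      (hr : ∑ i, p i + q = r) (hr' : r + 1 = r') (x : ∀ i, P.X (n i) (p i)),
      S.d hr' (t.app n p hN hr x y) =
        t.app n p hN (by rw [← hr', ← hr, add_assoc]) x y' +
        ∑ i, sgn (q + ∑ j, if i < j then p j else 0) •
          t.app n (dDeg p i) hN (by rw [sum_dDeg, ← hr', ← hr]; ring) (P.dAt i x) y)
    {N : ℕ} {r r' : ℤ} (h : r + 1 = r') {xs : List P.El} (hy : k = xs.length) (hN : arSum xs = N)
    (hr : degSum xs + q = r) :
    S.d h (t.L N r xs ⟨k, q, y⟩) =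
      t.L N r' xs ⟨k, q + 1, y'⟩ + sgn q • dsum (fun l => t.L N r' l ⟨k, q, y⟩) xs := by
  obtain ⟨e, rfl⟩ : ∃ e : Fin k → P.El, xs = List.ofFn e :=
    ⟨fun i => xs.get (i.cast hy), (ofFn_get_cast _ _).symm⟩
  have key := H (fun i => (e i).ar) (fun i => (e i).deg)
    (by rw [← arSum_ofFn, hN]) (by rw [← degSum_ofFn, hr]) h (fun i => (e i).val)
  rw [t.app_eq_L, t.app_eq_L] at key
  simp only [t.app_eq_L, mk_dAt] at key
  refine key.trans ?_
  congr 1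
  rw [dsum_ofFn, Finset.smul_sum]
  refine Finset.sum_congr rfl fun i _ => ?_
  rw [sgn_smul_smul]

theorem OdotMap.leibniz_L (t : OdotMap P Q S) {N : ℕ} {r r' : ℤ} (h : r + 1 = r')
    {xs : List P.El} {y : Q.El} (hy : y.ar = xs.length) (hN : arSum xs = N)
    (hr : degSum xs + y.deg = r) :
    S.d h (t.L N r xs y) = t.L N r' xs y.d + sgn y.deg • dsum (fun l => t.L N r' l y) xs :=
  t.fam.leibniz_L (fun n p hN hr hr' x => t.leibniz n p hN hr hr' x y.val) h hy hN hr

/-- A family of multilinear maps that satisfies the Leibniz rule. -/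
def OdotFam.toOdotMap (f : OdotFam P Q S)
    (h : ∀ {N : ℕ} {r r' : ℤ} (h : r + 1 = r') {xs : List P.El} {y : Q.El},
      y.ar = xs.length → arSum xs = N → degSum xs + y.deg = r →
        S.d h (f.L N r xs y) = f.L N r' xs y.d + sgn y.deg • dsum (fun l => f.L N r' l y) xs) :
    OdotMap P Q S where
  app := f.app
  leibniz {k N q r r'} n p hN hr hr' x y := by
    rw [f.app_eq_L, h hr' (by simp) (by rw [arSum_ofFn, hN]) (by rw [degSum_ofFn, hr]), dsum_ofFn,
      Finset.smul_sum]
    simp only [f.app_eq_L, mk_dAt, sgn_smul_smul]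
    rfl

/-- A family of multilinear maps given by its values on lists. -/
def OdotFam.ofL (φ : ∀ N r, List P.El → Q.El → S.X N r)
    (h₁ : ∀ N r y, SlotLinear fun xs => φ N r xs y) (h₂ : ∀ N r xs, ElLinear (φ N r xs)) :
    OdotFam P Q S where
  app {k N q r} n p _ _ :=
    { toFun := fun x => (h₂ N r (List.ofFn fun i => ⟨n i, p i, x i⟩) k q).mk'
      map_update_add' := fun {dec} x i u v => LinearMap.ext fun y => by
        obtain rfl := Subsingleton.elim dec (instDecidableEqFin k)
        obtain ⟨l₁, l₂, h⟩ := exists_ofFn_update n p x i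
        simp only [IsLinearMap.mk'_apply, LinearMap.add_apply, h]
        exact (h₁ N r ⟨k, q, y⟩ l₁ l₂ _ _).map_add u v
      map_update_smul' := fun {dec} x i c v => LinearMap.ext fun y => by
        obtain rfl := Subsingleton.elim dec (instDecidableEqFin k)
        obtain ⟨l₁, l₂, h⟩ := exists_ofFn_update n p x i
        simp only [IsLinearMap.mk'_apply, LinearMap.smul_apply, h]
        exact (h₁ N r ⟨k, q, y⟩ l₁ l₂ _ _).map_smul c v }

theorem OdotFam.ofL_L {φ : ∀ N r, List P.El → Q.El → S.X N r}
    {h₁ : ∀ N r y, SlotLinear fun xs => φ N r xs y} {h₂ : ∀ N r xs, ElLinear (φ N r xs)}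
    {N : ℕ} {r : ℤ} {xs : List P.El} {y : Q.El} (hy : y.ar = xs.length) (hN : arSum xs = N)
    (hr : degSum xs + y.deg = r) :
    (OdotFam.ofL φ h₁ h₂).L N r xs y = φ N r xs y := by
  rw [OdotFam.L, dif_pos ⟨hy, hN, hr⟩]
  change φ N r (List.ofFn fun i : Fin y.ar => xs.get (i.cast hy)) y = _
  rw [ofFn_get_cast]

end HUnital

namespace HUnital

variable {R : Type u} [CommRing R]

/-! Associativity in terms of lists. -/

variable {P Q S U V W : DGColl R}

/-- The concatenation of the lists `X₁, …, Xₖ` in `(X₁, y₁), …, (Xₖ, yₖ)`. -/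
abbrev flatL {α β : Type*} (L : List (List α × β)) : List α := L.flatMap Prod.fst

/-- The list `y₁, …, yₖ` in `(X₁, y₁), …, (Xₖ, yₖ)`. -/
abbrev sndL {α β : Type*} (L : List (List α × β)) : List β := L.map Prod.snd

/-- The list `X₁ y₁, …, Xₖ yₖ`. -/
def OdotMap.elL (a : OdotMap P Q S) (L : List (List P.El × Q.El)) : List S.El :=
  L.map fun i => a.el i.1 i.2

/-- The exponent of the Koszul sign of `X₁ y₁ ⋯ Xₖ yₖ ↦ X₁ ⋯ Xₖ y₁ ⋯ yₖ`. -/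
def kos : List (List P.El × Q.El) → ℤ
  | [] => 0
  | i :: L => i.2.deg * degSum (flatL L) + kos L

/-- The arities of the `yᵢ` are the lengths of the `Xᵢ`. -/
def Matched (L : List (List P.El × Q.El)) : Prop := ∀ i ∈ L, i.2.ar = i.1.length

theorem Matched.cons {i : List P.El × Q.El} {L : List (List P.El × Q.El)} :
    Matched (i :: L) ↔ i.2.ar = i.1.length ∧ Matched L := by simp [Matched]

theorem Matched.append {L L' : List (List P.El × Q.El)} :
    Matched (L ++ L') ↔ Matched L ∧ Matched L' := by
  simp [Matched, or_imp, forall_and]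

theorem matched_nil : Matched ([] : List (List P.El × Q.El)) := by simp [Matched]

@[simp] theorem OdotMap.elL_nil (a : OdotMap P Q S) : a.elL [] = [] := rfl

@[simp] theorem OdotMap.elL_cons (a : OdotMap P Q S) (i : List P.El × Q.El)
    (L : List (List P.El × Q.El)) : a.elL (i :: L) = a.el i.1 i.2 :: a.elL L := rfl

@[simp] theorem OdotMap.elL_append (a : OdotMap P Q S) (L L' : List (List P.El × Q.El)) :
    a.elL (L ++ L') = a.elL L ++ a.elL L' := by simp [OdotMap.elL]

@[simp] theorem OdotMap.length_elL (a : OdotMap P Q S) (L : List (List P.El × Q.El)) :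
    (a.elL L).length = L.length := by simp [OdotMap.elL]

@[simp] theorem OdotMap.arSum_elL (a : OdotMap P Q S) (L : List (List P.El × Q.El)) :
    arSum (a.elL L) = arSum (flatL L) := by
  induction L with
  | nil => rfl
  | cons i L ih => simp [ih]

@[simp] theorem OdotMap.degSum_elL (a : OdotMap P Q S) (L : List (List P.El × Q.El)) :
    degSum (a.elL L) = degSum (flatL L) + degSum (sndL L) := by
  induction L with
  | nil => rfl
  | cons i L ih => simp [ih]; ring

theorem Matched.length_flatL {L : List (List P.El × Q.El)} (h : Matched L) :
    (flatL L).length = arSum (sndL L) := by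
  induction L with
  | nil => rfl
  | cons i L ih =>
    rw [Matched.cons] at h
    have := ih h.2
    simp_all

theorem OdotMap.arSum_elL_eq_sum (a : OdotMap P Q S) (L : List (List P.El × Q.El)) :
    arSum (a.elL L) = ∑ i : Fin L.length, arSum (L.get i).1 := by
  rw [OdotMap.elL, arSum, List.map_map, ← List.ofFn_getElem_eq_map, List.sum_ofFn]; rfl

theorem OdotMap.degSum_elL_eq_sum (a : OdotMap P Q S) (L : List (List P.El × Q.El)) :
    degSum (a.elL L) = ∑ i : Fin L.length, (degSum (L.get i).1 + (L.get i).2.deg) := by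
  rw [OdotMap.elL, degSum, List.map_map, ← List.ofFn_getElem_eq_map, List.sum_ofFn]; rfl

/-- The list form of `OdotMap.Assoc`. -/
def LAssoc (a : OdotMap P Q S) (b : OdotMap S U V) (c : OdotMap Q U W) (e : OdotMap P W V) : Prop :=
  ∀ (N : ℕ) (r : ℤ) (L : List (List P.El × Q.El)) (z : U.El), Matched L →
    b.L N r (a.elL L) z = sgn (kos L) • e.L N r (flatL L) (c.el (sndL L) z)

theorem kos_ofFn {k : ℕ} (n : Fin k → ℕ) (x : ∀ i, Fin (n i) → P.El) (y : Fin k → Q.El) :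
    kos (List.ofFn fun i => (List.ofFn (x i), y i)) =
      koszul (fun i j => (x i j).deg) (fun i => (y i).deg) := by
  have hd : ∀ {k : ℕ} (n : Fin k → ℕ) (x : ∀ i, Fin (n i) → P.El) (y : Fin k → Q.El),
      degSum (flatL (List.ofFn fun i => (List.ofFn (x i), y i))) = ∑ i, ∑ j, (x i j).deg := by
    intro k n x y
    induction k with
    | zero => simp
    | succ k ih =>
      rw [List.ofFn_succ, Fin.sum_univ_succ]
      simp only [flatL, List.flatMap_cons, degSum_append, degSum_ofFn]
      exact congrArg _ (ih (fun i => n i.succ) (fun i => x i.succ) fun i => y i.succ)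
  induction k with
  | zero => simp [kos, koszul]
  | succ k ih =>
    rw [List.ofFn_succ, kos, ih (fun i => n i.succ) (fun i => x i.succ) fun i => y i.succ,
      hd (fun i => n i.succ) (fun i => x i.succ) fun i => y i.succ, koszul, koszul,
      Fin.sum_univ_succ]
    congr 1
    · rw [Fin.sum_univ_succ]
      simp [Fin.succ_pos, Finset.mul_sum]
    · refine Finset.sum_congr rfl fun i _ => ?_
      rw [Fin.sum_univ_succ]
      simp

theorem flatten_ofFn_ofFn {α : Type*} {k : ℕ} (n : Fin k → ℕ) (f : ∀ i, Fin (n i) → α) :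
    (List.ofFn fun i => List.ofFn (f i)).flatten =
      List.ofFn fun a : Fin (∑ i, n i) =>
        f (finSigmaFinEquiv.symm a).1 (finSigmaFinEquiv.symm a).2 := by
  induction k with
  | zero => simp
  | succ k ih =>
    rw [List.ofFn_succ, List.flatten_cons, ih]
    have hk : ∑ i, n i = n 0 + ∑ i : Fin k, n i.succ := Fin.sum_univ_succ n
    rw [List.ofFn_congr hk, List.ofFn_add]
    congr 1
    · congr 1
      funext j
      have : finSigmaFinEquiv.symm (Fin.cast hk.symm (Fin.castAdd _ j)) =
          (⟨0, j⟩ : (i : Fin (k + 1)) × Fin (n i)) := by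
        rw [Equiv.symm_apply_eq]
        ext
        simp
      exact (congrArg (fun t : (i : Fin (k + 1)) × Fin (n i) => f t.1 t.2) this).symm
    · congr 1
      funext a
      obtain ⟨⟨i, j⟩, rfl⟩ := finSigmaFinEquiv.surjective a
      have : finSigmaFinEquiv.symm (Fin.cast hk.symm (Fin.natAdd _
          (finSigmaFinEquiv (⟨i, j⟩ : (i : Fin k) × Fin (n i.succ))))) =
          (⟨i.succ, j⟩ : (i : Fin (k + 1)) × Fin (n i)) := by
        rw [Equiv.symm_apply_eq]
        ext
        simp only [Fin.val_cast, Fin.val_natAdd, finSigmaFinEquiv_apply]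
        have h : ∀ (m : ℕ) (h : m + 1 ≤ k + 1), ∑ x : Fin (m + 1), n (Fin.castLE h x) =
            n 0 + ∑ x : Fin m, n (Fin.castLE (Nat.le_of_succ_le_succ h) x).succ := by
          intro m h
          rw [Fin.sum_univ_succ]
          rfl
        have h2 := h (i : ℕ) (by omega)
        change _ = ∑ x : Fin ((i : ℕ) + 1), _ + _
        rw [h2]
        ring
      rw [this, Equiv.symm_apply_apply]

theorem flatL_ofFn {k : ℕ} (n : Fin k → ℕ) (x : ∀ i, Fin (n i) → P.El) (y : Fin k → Q.El) :
    flatL (List.ofFn fun i => (List.ofFn (x i), y i)) =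
      List.ofFn fun a : Fin (∑ i, n i) =>
        x (finSigmaFinEquiv.symm a).1 (finSigmaFinEquiv.symm a).2 := by
  rw [← flatten_ofFn_ofFn, flatL, List.flatMap, List.map_ofFn]
  rfl

theorem OdotMap.el_ofFn (a : OdotMap P Q S) {k N : ℕ} {q r : ℤ} (n : Fin k → ℕ) (p : Fin k → ℤ)
    (hN : ∑ i, n i = N) (hr : ∑ i, p i + q = r) (x : ∀ i, P.X (n i) (p i)) (y : Q.X k q) :
    a.el (List.ofFn fun i => ⟨n i, p i, x i⟩) ⟨k, q, y⟩ = ⟨N, r, a.app n p hN hr x y⟩ := by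
  rw [a.el_eq (N := N) (r := r) (by rw [arSum_ofFn, hN]) (by rw [degSum_ofFn, hr]), a.app_eq_L]

theorem Matched.exists_ofFn {L : List (List P.El × Q.El)} (hL : Matched L) :
    ∃ (y : Fin L.length → Q.El) (x : ∀ i, Fin (y i).ar → P.El),
      L = List.ofFn fun i => (List.ofFn (x i), y i) := by
  have hL' : ∀ i, (L.get i).2.ar = (L.get i).1.length := fun i => hL _ (L.get_mem i)
  refine ⟨fun i => (L.get i).2, fun i j => (L.get i).1.get (j.cast (hL' i)), ?_⟩
  conv_lhs => rw [← List.ofFn_get L]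
  congr 1
  funext i
  exact Prod.ext (ofFn_get_cast _ _).symm rfl

section Conversion

variable {a : OdotMap P Q S} {b : OdotMap S U V} {c : OdotMap Q U W} {e : OdotMap P W V}

theorem assoc_aux {V' : DGColl R} {e : OdotMap P W V'} {k N : ℕ} {q r : ℤ} (n : Fin k → ℕ) (p : Fin k → ℤ)
    (m : ∀ i, Fin (n i) → ℕ) (s : ∀ i, Fin (n i) → ℤ)
    (hN : ∑ i, ∑ j, m i j = N) (hr : ∑ i, (∑ j, s i j + p i) + q = r)
    (x : ∀ i j, P.X (m i j) (s i j)) (y : ∀ i, Q.X (n i) (p i)) (z : U.X k q)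
    (L : List (List P.El × Q.El))
    (hL : L = List.ofFn fun i => (List.ofFn fun j => ⟨m i j, s i j, x i j⟩, ⟨n i, p i, y i⟩)) :
    (b.app (fun i => ∑ j, m i j) (fun i => ∑ j, s i j + p i) hN hr
        (fun i => a.app (m i) (s i) rfl rfl (x i) (y i)) z = b.L N r (a.elL L) ⟨k, q, z⟩) ∧
      (sgn (koszul s p) •
        e.app (flat m) (flat s) (by rw [sum_flat, hN])
          (by rw [sum_flat, ← hr, Finset.sum_add_distrib, add_assoc]) (flat x)
          (c.app n p rfl rfl y z) =
        sgn (kos L) • e.L N r (flatL L) (c.el (sndL L) ⟨k, q, z⟩)) := by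
  subst hL
  constructor
  · rw [b.app_eq_L, OdotMap.elL, List.map_ofFn]
    congr 2
    funext i
    exact (a.el_ofFn (m i) (s i) rfl rfl (x i) (y i)).symm
  · rw [kos_ofFn n (fun i j => ⟨m i j, s i j, x i j⟩) fun i => ⟨n i, p i, y i⟩,
      flatL_ofFn n (fun i j => ⟨m i j, s i j, x i j⟩) fun i => ⟨n i, p i, y i⟩, e.app_eq_L,
      sndL, List.map_ofFn]
    congr 2
    exact (c.el_ofFn n p rfl rfl y z).symm

theorem LAssoc.assoc (h : LAssoc a b c e) : OdotMap.Assoc a b c e := by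
  intro k N q r n p m s hN hr x y z
  obtain ⟨h₁, h₂⟩ := assoc_aux (a := a) (b := b) (c := c) (e := e) n p m s hN hr x y z _ rfl
  rw [h₁, h₂]
  refine h _ _ _ _ fun i hi => ?_
  rw [List.mem_ofFn] at hi
  obtain ⟨j, rfl⟩ := hi
  simp

theorem OdotMap.Assoc.lassoc (h : OdotMap.Assoc a b c e) : LAssoc a b c e := by
  intro N r L z hL
  by_cases hz : z.ar = L.length ∧ arSum (flatL L) = N ∧
      degSum (flatL L) + (degSum (sndL L) + z.deg) = r
  · obtain ⟨k, q, z⟩ := z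
    obtain ⟨h₁, h₂, h₃⟩ := hz
    dsimp at h₁ h₃
    subst h₁
    have hL' : ∀ i, (L.get i).2.ar = (L.get i).1.length := fun i => hL _ (L.get_mem i)
    have e' : L = List.ofFn fun i : Fin L.length =>
        (List.ofFn fun j : Fin (L.get i).2.ar =>
          (⟨((L.get i).1.get (j.cast (hL' i))).ar, ((L.get i).1.get (j.cast (hL' i))).deg,
            ((L.get i).1.get (j.cast (hL' i))).val⟩ : P.El),
          (⟨(L.get i).2.ar, (L.get i).2.deg, (L.get i).2.val⟩ : Q.El)) := by
      conv_lhs => rw [← List.ofFn_get L]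
      congr 1
      funext i
      refine Prod.ext ?_ rfl
      exact (ofFn_get_cast _ _).symm
    have hN : ∑ i : Fin L.length, ∑ j : Fin (L.get i).2.ar,
        ((L.get i).1.get (j.cast (hL' i))).ar = N := by
      rw [← h₂, ← a.arSum_elL, a.arSum_elL_eq_sum]
      exact Finset.sum_congr rfl fun i _ =>
        (arSum_ofFn _).symm.trans (congrArg arSum (ofFn_get_cast _ (hL' i)))
    have hr : ∑ i : Fin L.length, (∑ j : Fin (L.get i).2.ar,
        ((L.get i).1.get (j.cast (hL' i))).deg + (L.get i).2.deg) + q = r := by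
      rw [← h₃, ← add_assoc, ← a.degSum_elL, a.degSum_elL_eq_sum]
      congr 1
      exact Finset.sum_congr rfl fun i _ => congrArg (· + _)
        ((degSum_ofFn _).symm.trans (congrArg degSum (ofFn_get_cast _ (hL' i))))
    obtain ⟨e₁, e₂⟩ := assoc_aux (a := a) (b := b) (c := c) (e := e) _ _ _ _ hN hr _ _ z L e'
    rw [← e₁, ← e₂]
    exact h _ _ _ _ hN hr _ _ z
  · have hb : b.L N r (a.elL L) z = 0 := b.L_of_not (by simpa [add_assoc] using hz)
    by_cases hz' : z.ar = L.length
    · rw [hb, e.L_of_not, smul_zero]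
      rintro ⟨h₁, h₂, h₃⟩
      exact hz ⟨hz', h₂, by rw [← h₃]; rfl⟩
    · have hc : c.L (arSum (sndL L)) (degSum (sndL L) + z.deg) (sndL L) z = 0 :=
        c.L_of_not (by simp [hz'])
      have he : e.L N r (flatL L) ⟨_, _, 0⟩ = 0 := (e.elLinear N r (flatL L) (arSum (sndL L)) (degSum (sndL L) + z.deg)).map_zero
      rw [hb, OdotMap.el, hc, he, smul_zero]

end Conversion

end HUnital

namespace HUnital

variable {R : Type u} [CommRing R]

/-! Coherence of the associativity constraint, and its compatibility with differentials. -/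

section Pentagon

variable {P Q S : DGColl R}

theorem kos_append (L L' : List (List P.El × Q.El)) :
    kos (L ++ L') = kos L + kos L' + degSum (sndL L) * degSum (flatL L') := by
  induction L with
  | nil => simp [kos]
  | cons i L ih =>
    simp only [List.cons_append, kos, ih, flatL, List.flatMap_append, degSum_append, List.map_cons,
      degSum_cons]
    ring

/-- The sum of the exponents of the signs of the inner lists. -/
def kosSum {α : Type*} (LL : List (List (List P.El × Q.El) × α)) : ℤ :=
  (LL.map fun i => kos i.1).sum

theorem OdotMap.L_map_smul {V : DGColl R} (w : OdotMap P Q V) {α : Type*} (f : α → ℤ)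
    (g g' : α → P.El) (N : ℕ) (r : ℤ) (u : Q.El) (l : List α)
    (h : ∀ i ∈ l, ∃ (n : ℕ) (p : ℤ) (x : P.X n p), g i = ⟨n, p, sgn (f i) • x⟩ ∧ g' i = ⟨n, p, x⟩)
    (pre : List P.El) :
    w.L N r (pre ++ l.map g) u = sgn (l.map f).sum • w.L N r (pre ++ l.map g') u := by
  induction l generalizing pre with
  | nil => simp
  | cons i l ih =>
    obtain ⟨n, p, x, h₁, h₂⟩ := h i (by simp)
    have h₃ := (IsLinearMap.mk' _ (w.slotLinear N r u pre (l.map g) n p)).map_smul_of_tower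
      (sgn (f i)) x
    simp only [IsLinearMap.mk'_apply] at h₃
    have ih' := ih (fun i hi => h i (by simp [hi])) (pre ++ [g' i])
    simp only [List.append_assoc, List.singleton_append] at ih'
    rw [List.map_cons, List.map_cons, List.map_cons, h₁, h₃, ← h₂, ih', smul_smul, List.sum_cons,
      sgn_add]

theorem OdotMap.L_sgn_smul {V : DGColl R} (w : OdotMap P Q V) (N : ℕ) (r : ℤ) (xs : List P.El)
    {n : ℕ} {p : ℤ} (e : ℤ) (y : Q.X n p) :
    w.L N r xs ⟨n, p, sgn e • y⟩ = sgn e • w.L N r xs ⟨n, p, y⟩ :=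
  (IsLinearMap.mk' _ (w.elLinear N r xs n p)).map_smul_of_tower (sgn e) y

variable {U PQ QS SU QSU V : DGColl R}

/-- A three level list all of whose lengths fit. -/
def Matched₂ (LL : List (List (List P.El × Q.El) × S.El)) : Prop :=
  ∀ i ∈ LL, Matched i.1 ∧ i.2.ar = i.1.length

theorem Matched₂.flatL {LL : List (List (List P.El × Q.El) × S.El)} (h : Matched₂ LL) :
    Matched (flatL LL) := by
  intro i hi
  obtain ⟨j, hj, hi⟩ := List.mem_flatMap.1 hi
  exact (h j hj).1 i hi

variable (LL : List (List (List P.El × Q.El) × S.El))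

/-- The list of the `(xs, y z)`. -/
def pairA (qs : OdotMap Q S QS) : List (List P.El × QS.El) :=
  LL.map fun i => (flatL i.1, qs.el (sndL i.1) i.2)

/-- The list of the `(y, z)`. -/
def pairB : List (List Q.El × S.El) := LL.map fun i => (sndL i.1, i.2)

/-- The list of the `(xs y, z)`. -/
def pairC (pq : OdotMap P Q PQ) : List (List PQ.El × S.El) := LL.map fun i => (pq.elL i.1, i.2)

theorem flatL_pairA (qs : OdotMap Q S QS) : flatL (pairA LL qs) = flatL (flatL LL) := by
  simp [pairA, flatL, List.flatMap_map, List.flatMap_assoc]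

theorem sndL_pairA (qs : OdotMap Q S QS) : sndL (pairA LL qs) = qs.elL (pairB LL) := by
  simp [pairA, pairB, OdotMap.elL]

theorem flatL_pairB : flatL (pairB LL) = sndL (flatL LL) := by
  simp [pairB, flatL, List.flatMap_map, List.map_flatMap]

theorem sndL_pairB : sndL (pairB LL) = sndL LL := by
  simp [pairB]

theorem flatL_pairC (pq : OdotMap P Q PQ) : flatL (pairC LL pq) = pq.elL (flatL LL) := by
  simp [pairC, flatL, OdotMap.elL, List.flatMap_map, List.map_flatMap]

theorem sndL_pairC (pq : OdotMap P Q PQ) : sndL (pairC LL pq) = sndL LL := by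
  simp [pairC]

variable {LL}

theorem Matched₂.pairA (h : Matched₂ LL) (qs : OdotMap Q S QS) : Matched (pairA LL qs) := by
  intro i hi
  obtain ⟨j, hj, rfl⟩ := List.mem_map.1 hi
  exact (h j hj).1.length_flatL.symm

theorem Matched₂.pairB (h : Matched₂ LL) : Matched (pairB LL) := by
  intro i hi
  obtain ⟨j, hj, rfl⟩ := List.mem_map.1 hi
  simpa using (h j hj).2

theorem Matched₂.pairC (h : Matched₂ LL) (pq : OdotMap P Q PQ) : Matched (pairC LL pq) := by
  intro i hi
  obtain ⟨j, hj, rfl⟩ := List.mem_map.1 hi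
  simpa using (h j hj).2

theorem kos_pentagon (pq : OdotMap P Q PQ) (qs : OdotMap Q S QS)
    (LL : List (List (List P.El × Q.El) × S.El)) :
    kosSum LL + kos (pairA LL qs) + kos (pairB LL) = kos (pairC LL pq) + kos (flatL LL) := by
  induction LL with
  | nil => simp [kosSum, pairA, pairB, pairC, kos]
  | cons i LL ih =>
    have hA : pairA (i :: LL) qs = (flatL i.1, qs.el (sndL i.1) i.2) :: pairA LL qs := rfl
    have hB : pairB (i :: LL) = (sndL i.1, i.2) :: pairB LL := rfl
    have hC : pairC (i :: LL) pq = (pq.elL i.1, i.2) :: pairC LL pq := rfl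
    have hD : flatL (i :: LL) = i.1 ++ flatL LL := rfl
    have hS : kosSum (i :: LL) = kos i.1 + kosSum LL := by simp [kosSum]
    rw [hA, hB, hC, hD, hS, kos, kos, kos, kos_append, flatL_pairA, flatL_pairB, flatL_pairC,
      pq.degSum_elL, qs.el_deg]
    linear_combination ih

variable {pq : OdotMap P Q PQ} {qs : OdotMap Q S QS} {su : OdotMap S U SU}
  {qs_u : OdotMap QS U QSU} {q_su : OdotMap Q SU QSU} {pq_su : OdotMap PQ SU V}
  {p_qsu : OdotMap P QSU V}

theorem pentagon_right (h₂ : LAssoc qs qs_u su q_su) (h : Matched₂ LL) (N : ℕ) (r : ℤ) (u : U.El) :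
    p_qsu.L N r (flatL (pairA LL qs)) (qs_u.el (sndL (pairA LL qs)) u) =
      sgn (kos (pairB LL)) •
        p_qsu.L N r (flatL (flatL LL)) (q_su.el (sndL (flatL LL)) (su.el (sndL LL) u)) := by
  rw [flatL_pairA, sndL_pairA, OdotMap.el_eq (N := arSum (sndL (flatL LL)))
    (r := degSum (sndL (flatL LL)) + (degSum (sndL LL) + u.deg)) _ (by simp [flatL_pairB])
    (by simp [flatL_pairB, sndL_pairB, add_assoc]), h₂ _ _ _ _ h.pairB, OdotMap.L_sgn_smul,
    flatL_pairB, sndL_pairB]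
  rfl

theorem pentagon_core (h₂ : LAssoc qs qs_u su q_su) (h₅ : LAssoc pq pq_su q_su p_qsu)
    (h : Matched₂ LL) (N : ℕ) (r : ℤ) (u : U.El) :
    sgn (kos (pairC LL pq)) • pq_su.L N r (flatL (pairC LL pq)) (su.el (sndL (pairC LL pq)) u) =
      sgn (kosSum LL + kos (pairA LL qs)) •
        p_qsu.L N r (flatL (pairA LL qs)) (qs_u.el (sndL (pairA LL qs)) u) := by
  rw [pentagon_right h₂ h, flatL_pairC, h₅ _ _ _ _ h.flatL, sgn_smul_smul, sgn_smul_smul,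
    kos_pentagon pq qs LL, sndL_pairC]

variable {PQS : DGColl R} {pq_s : OdotMap PQ S PQS} {p_qs : OdotMap P QS PQS}
  {w : OdotMap PQS U V}

theorem pentagon_left (h₁ : LAssoc pq pq_s qs p_qs) (h : Matched₂ LL) (N : ℕ) (r : ℤ) (u : U.El) :
    w.L N r (pq_s.elL (pairC LL pq)) u =
      sgn (kosSum LL) • w.L N r (p_qs.elL (pairA LL qs)) u := by
  have := w.L_map_smul (fun i : List (List P.El × Q.El) × S.El => kos i.1)
    (fun i => pq_s.el (pq.elL i.1) i.2) (fun i => p_qs.el (flatL i.1) (qs.el (sndL i.1) i.2))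
    N r u LL (fun i hi => ⟨arSum (flatL i.1), degSum (flatL i.1) + (degSum (sndL i.1) + i.2.deg),
      p_qs.L _ _ (flatL i.1) (qs.el (sndL i.1) i.2), ?_, rfl⟩) []
  · simpa [pairC, pairA, OdotMap.elL, kosSum, Function.comp_def] using this
  · rw [pq_s.el_eq (N := arSum (flatL i.1))
      (r := degSum (flatL i.1) + (degSum (sndL i.1) + i.2.deg)) (by simp) (by simp [add_assoc]),
      h₁ _ _ _ _ (h i hi).1]

/-- The third side of the pentagon from the other four. -/
theorem pentagon₃ (h₁ : LAssoc pq pq_s qs p_qs) (h₂ : LAssoc qs qs_u su q_su)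
    (h₄ : LAssoc p_qs w qs_u p_qsu) (h₅ : LAssoc pq pq_su q_su p_qsu)
    (h : Matched₂ LL) (N : ℕ) (r : ℤ) (u : U.El) :
    w.L N r (pq_s.elL (pairC LL pq)) u = sgn (kos (pairC LL pq)) •
      pq_su.L N r (flatL (pairC LL pq)) (su.el (sndL (pairC LL pq)) u) := by
  rw [pentagon_core h₂ h₅ h, pentagon_left h₁ h, h₄ _ _ _ _ (h.pairA qs), sgn_smul_smul]

/-- The fourth side of the pentagon from the other four. -/
theorem pentagon₄ (h₁ : LAssoc pq pq_s qs p_qs) (h₂ : LAssoc qs qs_u su q_su)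
    (h₃ : LAssoc pq_s w su pq_su) (h₅ : LAssoc pq pq_su q_su p_qsu)
    (h : Matched₂ LL) (N : ℕ) (r : ℤ) (u : U.El) :
    w.L N r (p_qs.elL (pairA LL qs)) u = sgn (kos (pairA LL qs)) •
      p_qsu.L N r (flatL (pairA LL qs)) (qs_u.el (sndL (pairA LL qs)) u) := by
  apply sgn_smul_inj (a := kosSum LL)
  rw [← pentagon_left h₁ h, h₃ _ _ _ _ (h.pairC pq), pentagon_core h₂ h₅ h, sgn_smul_smul]

/-- The fifth side of the pentagon from the other four. -/
theorem pentagon₅ (h₁ : LAssoc pq pq_s qs p_qs) (h₂ : LAssoc qs qs_u su q_su)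
    (h₃ : LAssoc pq_s w su pq_su) (h₄ : LAssoc p_qs w qs_u p_qsu)
    (h : Matched₂ LL) (N : ℕ) (r : ℤ) (u : U.El) :
    pq_su.L N r (pq.elL (flatL LL)) (su.el (sndL LL) u) = sgn (kos (flatL LL)) •
      p_qsu.L N r (flatL (flatL LL)) (q_su.el (sndL (flatL LL)) (su.el (sndL LL) u)) := by
  have h₆ := h₃ N r _ u (h.pairC pq)
  rw [pentagon_left h₁ h, h₄ _ _ _ _ (h.pairA qs), pentagon_right h₂ h, flatL_pairC, sndL_pairC,
    sgn_smul_smul, sgn_smul_smul, kos_pentagon pq qs LL, sgn_add, mul_smul] at h₆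
  exact (sgn_smul_inj h₆).symm

/-- The second side of the pentagon from the other four, after the last composition. -/
theorem pentagon₂ (h₁ : LAssoc pq pq_s qs p_qs) (h₃ : LAssoc pq_s w su pq_su)
    (h₄ : LAssoc p_qs w qs_u p_qsu) (h₅ : LAssoc pq pq_su q_su p_qsu)
    (h : Matched₂ LL) (N : ℕ) (r : ℤ) (u : U.El) :
    p_qsu.L N r (flatL (flatL LL)) (qs_u.el (qs.elL (pairB LL)) u) = sgn (kos (pairB LL)) •
      p_qsu.L N r (flatL (flatL LL)) (q_su.el (flatL (pairB LL)) (su.el (sndL (pairB LL)) u)) := by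
  have h₆ := h₃ N r _ u (h.pairC pq)
  rw [pentagon_left h₁ h, h₄ _ _ _ _ (h.pairA qs), flatL_pairC, sndL_pairC,
    h₅ _ _ _ _ h.flatL, sgn_smul_smul, sgn_smul_smul, ← kos_pentagon pq qs LL, sgn_add, mul_smul,
    sgn_add _ (kos (pairB LL)), mul_smul] at h₆
  rw [sgn_add, mul_smul] at h₆
  rw [flatL_pairB, sndL_pairB]
  rw [flatL_pairA, sndL_pairA] at h₆
  exact sgn_smul_inj (sgn_smul_inj h₆)

end Pentagon

section Differential

variable {P Q S : DGColl R} {M : Type*} [AddCommGroup M]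

theorem dsum_congr {φ ψ : List P.El → M} {xs : List P.El}
    (h : ∀ l, arSum l = arSum xs → degSum l = degSum xs + 1 → l.length = xs.length → φ l = ψ l) :
    dsum φ xs = dsum ψ xs := by
  induction xs generalizing φ ψ with
  | nil => rfl
  | cons x xs ih =>
    rw [dsum, dsum, h _ (by simp) (by simp; ring) (by simp)]
    congr 1
    exact ih fun l h₁ h₂ h₃ => h _ (by simp [h₁]) (by simp [h₂]; ring) (by simp [h₃])

theorem dsum_map {M' : Type*} [AddCommGroup M'] (f : M →+ M') (φ : List P.El → M)
    (xs : List P.El) : f (dsum φ xs) = dsum (fun l => f (φ l)) xs := by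
  induction xs generalizing φ with
  | nil => simp [dsum]
  | cons x xs ih => simp [dsum, ih]

theorem dsum_smul (c : ℤ) (φ : List P.El → M) (xs : List P.El) :
    dsum (fun l => c • φ l) xs = c • dsum φ xs :=
  (dsum_map (zsmulAddGroupHom c) φ xs).symm

theorem dsum_add (φ ψ : List P.El → M) (xs : List P.El) :
    dsum (fun l => φ l + ψ l) xs = dsum φ xs + dsum ψ xs := by
  induction xs generalizing φ ψ with
  | nil => simp [dsum]
  | cons x xs ih => rw [dsum, dsum, dsum, ih, smul_add]; abel

theorem dsum_append (φ : List P.El → M) (xs ys : List P.El) :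
    dsum φ (xs ++ ys) = sgn (degSum ys) • dsum (fun l => φ (l ++ ys)) xs +
      dsum (fun l => φ (xs ++ l)) ys := by
  induction xs generalizing φ with
  | nil => simp [dsum]
  | cons x xs ih =>
    simp only [List.cons_append, dsum, ih, degSum_append, sgn_add, smul_add, mul_smul]
    rw [smul_comm, add_assoc]

/-- The sum of the values of `Ψ` on the terms of the differential of
`X₁ ⊗ y₁ ⊗ ⋯ ⊗ Xₖ ⊗ yₖ`. -/
def dsum₂ : (List (List P.El × Q.El) → M) → List (List P.El × Q.El) → M
  | _, [] => 0
  | Ψ, i :: L => sgn (degSum (flatL L) + degSum (sndL L)) •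
      (Ψ ((i.1, i.2.d) :: L) + sgn i.2.deg • dsum (fun X => Ψ ((X, i.2) :: L)) i.1) +
      dsum₂ (fun L' => Ψ (i :: L')) L

theorem dsum₂_congr {Ψ Ψ' : List (List P.El × Q.El) → M} {L : List (List P.El × Q.El)}
    (hL : Matched L)
    (h : ∀ L', Matched L' → L'.length = L.length → Ψ L' = Ψ' L') : dsum₂ Ψ L = dsum₂ Ψ' L := by
  induction L generalizing Ψ Ψ' with
  | nil => rfl
  | cons i L ih =>
    rw [Matched.cons] at hL
    rw [dsum₂, dsum₂, h ((i.1, i.2.d) :: L) (Matched.cons.2 ⟨hL.1, hL.2⟩) rfl,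
      dsum_congr (ψ := fun X => Ψ' ((X, i.2) :: L)) fun l _ _ hl =>
        h _ (Matched.cons.2 ⟨by simp [hl, hL.1], hL.2⟩) rfl]
    congr 1
    exact ih hL.2 fun L' h' hl => h _ (Matched.cons.2 ⟨hL.1, h'⟩) (by simp [hl])

theorem dsum₂_kos (χ : List P.El → List Q.El → M) (L : List (List P.El × Q.El)) :
    dsum₂ (fun L => sgn (kos L) • χ (flatL L) (sndL L)) L =
      sgn (kos L) • (dsum (fun ys => χ (flatL L) ys) (sndL L) +
        sgn (degSum (sndL L)) • dsum (fun xs => χ xs (sndL L)) (flatL L)) := by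
  induction L generalizing χ with
  | nil => simp [dsum₂, dsum]
  | cons i L ih =>
    have ih' := ih fun xs ys => sgn (i.2.deg * degSum xs) • χ (i.1 ++ xs) (i.2 :: ys)
    simp only [sgn_smul_smul] at ih'
    rw [dsum₂]
    simp only [kos, flatL, List.flatMap_cons, sndL, List.map_cons, dsum_append]
    simp only [flatL, sndL] at ih'
    rw [show (fun L' : List (List P.El × Q.El) =>
        sgn (i.2.deg * degSum (L'.flatMap Prod.fst) + kos L') •
          χ (i.1 ++ L'.flatMap Prod.fst) (i.2 :: L'.map Prod.snd)) = fun L' =>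
        sgn (kos L' + i.2.deg * degSum (L'.flatMap Prod.fst)) •
          χ (i.1 ++ L'.flatMap Prod.fst) (i.2 :: L'.map Prod.snd) from
        funext fun L' => by rw [add_comm], ih']
    rw [dsum_congr (xs := L.flatMap Prod.fst) (ψ := fun xs =>
      sgn (i.2.deg * (degSum (L.flatMap Prod.fst) + 1)) • χ (i.1 ++ xs) (i.2 :: L.map Prod.snd))
      fun l _ h₂ _ => by rw [h₂]]
    simp only [dsum_smul, dsum, DGColl.El.d_deg, degSum_cons, smul_add, sgn_smul_smul]
    set f := degSum (L.flatMap Prod.fst)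
    set s := degSum (L.map Prod.snd)
    set K := kos L
    rw [sgn_eq_of_even (a := f + s + ((i.2.deg + 1) * f + K)) (b := i.2.deg * f + K + s)
      ⟨f, by ring⟩,
      sgn_eq_of_even (a := f + s + (i.2.deg + (i.2.deg * f + K)))
        (b := i.2.deg * f + K + (i.2.deg + s + f)) ⟨0, by ring⟩,
      sgn_eq_of_even (a := K + i.2.deg * f) (b := i.2.deg * f + K) ⟨0, by ring⟩,
      sgn_eq_of_even (a := K + (s + i.2.deg * (f + 1)))
        (b := i.2.deg * f + K + (i.2.deg + s)) ⟨0, by ring⟩]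
    abel

variable [Module R M]

theorem dsum_elL {a : OdotMap P Q S} {φ : List S.El → M} (hφ : SlotLinear φ)
    {L : List (List P.El × Q.El)} (hL : Matched L) :
    dsum φ (a.elL L) = dsum₂ (fun L' => φ (a.elL L')) L := by
  induction L generalizing φ with
  | nil => rfl
  | cons i L ih =>
    rw [Matched.cons] at hL
    rw [OdotMap.elL_cons, dsum, dsum₂, ih (φ := fun l => φ (a.el i.1 i.2 :: l))
      (fun l₁ l₂ n p => hφ (a.el i.1 i.2 :: l₁) l₂ n p) hL.2, a.degSum_elL]
    simp only [OdotMap.elL_cons]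
    congr 2
    have h := a.leibniz_L rfl hL.1 rfl rfl
    change φ (⟨arSum i.1, degSum i.1 + i.2.deg + 1, S.d rfl (a.L _ _ i.1 i.2)⟩ :: a.elL L) = _
    rw [h]
    set f := IsLinearMap.mk' _ (hφ [] (a.elL L) (arSum i.1) (degSum i.1 + i.2.deg + 1)) with hf
    change f _ = _
    rw [f.map_add, map_zsmul]
    congr 1
    · change φ _ = φ _
      rw [a.el_eq (r := degSum i.1 + i.2.deg + 1) rfl (by simp; ring)]
      rfl
    · congr 1
      rw [show f (dsum (fun l => a.L (arSum i.1) (degSum i.1 + i.2.deg + 1) l i.2) i.1) = _ from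
        dsum_map f.toAddMonoidHom _ _]
      refine dsum_congr fun l h₁ h₂ _ => ?_
      rw [a.el_eq (r := degSum i.1 + i.2.deg + 1) h₁ (by rw [h₂]; ring)]
      rfl

/-- The expression for the differential of `φ (x₁ ⊗ ⋯ ⊗ xₖ ⊗ y)`. -/
def leib (φ : List P.El → Q.El → M) (xs : List P.El) (y : Q.El) : M :=
  φ xs y.d + sgn y.deg • dsum (fun l => φ l y) xs

theorem OdotMap.leib_L (t : OdotMap P Q S) {N : ℕ} {r r' : ℤ} (h : r + 1 = r')
    {xs : List P.El} {y : Q.El} (hy : y.ar = xs.length) (hN : arSum xs = N)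
    (hr : degSum xs + y.deg = r) : leib (t.L N r') xs y = S.d h (t.L N r xs y) :=
  (t.leibniz_L h hy hN hr).symm

variable {U W : DGColl R}

theorem leib_assoc (a : OdotMap P Q S) (φb : List S.El → U.El → M) (φe : List P.El → W.El → M)
    (hb : ∀ z, SlotLinear fun l => φb l z) (he : ∀ xs, ElLinear (φe xs))
    (c : ∀ N r, List Q.El → U.El → W.X N r)
    (h : ∀ L z, Matched L → z.ar = L.length → φb (a.elL L) z = sgn (kos L) • φe (flatL L)
      ⟨arSum (sndL L), degSum (sndL L) + z.deg, c _ _ (sndL L) z⟩)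
    {L : List (List P.El × Q.El)} (hL : Matched L) {z : U.El} (hz : z.ar = L.length) :
    leib φb (a.elL L) z = sgn (kos L) •
      (φe (flatL L) ⟨arSum (sndL L), degSum (sndL L) + z.deg + 1, leib (c _ _) (sndL L) z⟩ +
        sgn (degSum (sndL L) + z.deg) •
          dsum (fun xs => φe xs ⟨arSum (sndL L), degSum (sndL L) + z.deg, c _ _ (sndL L) z⟩)
            (flatL L)) := by
  have hc : ∀ ys {N N' : ℕ} {r r' : ℤ}, N = N' → r = r' →
      (⟨N, r, c N r ys z⟩ : W.El) = ⟨N', r', c N' r' ys z⟩ := by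
    rintro ys N _ r _ rfl rfl; rfl
  have hc' : ∀ ys {N N' : ℕ} {r r' : ℤ}, N = N' → r = r' →
      (⟨N, r, c N r ys z.d⟩ : W.El) = ⟨N', r', c N' r' ys z.d⟩ := by
    rintro ys N _ r _ rfl rfl; rfl
  rw [leib, dsum_elL (hb z) hL, dsum₂_congr hL fun L' hL' hl => h L' z hL' (by rw [hz, hl]),
    dsum₂_kos (fun xs ys => φe xs ⟨arSum ys, degSum ys + z.deg, c _ _ ys z⟩), h L z.d hL hz]
  set f := IsLinearMap.mk' _ (he (flatL L) (arSum (sndL L)) (degSum (sndL L) + z.deg + 1))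
  have hf : φe (flatL L) ⟨arSum (sndL L), degSum (sndL L) + z.deg + 1, leib (c _ _) (sndL L) z⟩ =
      f (leib (c _ _) (sndL L) z) := rfl
  rw [hf, leib, map_add, map_zsmul, show f (dsum _ _) = _ from dsum_map f.toAddMonoidHom _ _]
  have h₁ : φe (flatL L) ⟨arSum (sndL L), degSum (sndL L) + z.d.deg, c _ _ (sndL L) z.d⟩ =
      f (c _ _ (sndL L) z.d) := congrArg (φe (flatL L)) (hc' _ rfl (by simp; ring))
  have h₂ : dsum (fun ys => φe (flatL L) ⟨arSum ys, degSum ys + z.deg, c _ _ ys z⟩) (sndL L) =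
      dsum (fun ys => f.toAddMonoidHom (c _ _ ys z)) (sndL L) :=
    dsum_congr fun l h₁ h₂ _ => congrArg (φe (flatL L)) (hc _ h₁ (by rw [h₂]; ring))
  rw [h₁, h₂]
  simp only [smul_add, sgn_smul_smul]
  rw [add_comm z.deg (kos L), show z.deg + (kos L + degSum (sndL L)) =
    kos L + (degSum (sndL L) + z.deg) by ring]
  exact (add_assoc _ _ _).symm

theorem OdotMap.leib_assoc_L (a : OdotMap P Q S) (c : OdotMap Q U W) (φb : List S.El → U.El → M)
    (φe : List P.El → W.El → M) (hb : ∀ z, SlotLinear fun l => φb l z)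
    (he : ∀ xs, ElLinear (φe xs))
    (h : ∀ L z, Matched L → z.ar = L.length → φb (a.elL L) z = sgn (kos L) • φe (flatL L) (c.el (sndL L) z))
    {L : List (List P.El × Q.El)} (hL : Matched L) {z : U.El} (hz : z.ar = L.length) :
    leib φb (a.elL L) z = sgn (kos L) • leib φe (flatL L) (c.el (sndL L) z) := by
  rw [leib_assoc a φb φe hb he (fun N r => c.L N r) h hL hz,
    c.leib_L rfl (by simp [hz]) rfl rfl]
  rfl

end Differential

end HUnital

namespace HUnital

variable {R : Type u} [CommRing R]

/-! Extension of multilinear maps from generators. -/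

theorem exists_linear_of_span {σ D M : Type*} [AddCommGroup D] [Module R D] [AddCommGroup M]
    [Module R M] (g : σ → D) (hg : Submodule.span R (Set.range g) = ⊤) (h : σ → M)
    (H : ∀ c : σ →₀ R, Finsupp.linearCombination R g c = 0 →
      Finsupp.linearCombination R h c = 0) :
    ∃ f : D →ₗ[R] M, ∀ a, f (g a) = h a := by
  have hs : Function.Surjective (Finsupp.linearCombination R g) := by
    rw [← LinearMap.range_eq_top, Finsupp.range_linearCombination, hg]
  have hk : LinearMap.ker (Finsupp.linearCombination R g) ≤
      LinearMap.ker (Finsupp.linearCombination R h) := fun c hc => H c hc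
  let e := (Finsupp.linearCombination R g).quotKerEquivOfSurjective hs
  refine ⟨((LinearMap.ker (Finsupp.linearCombination R g)).liftQ _ hk).comp e.symm.toLinearMap,
    fun a => ?_⟩
  have : e.symm (g a) = Submodule.Quotient.mk (Finsupp.single a 1) := by
    rw [LinearEquiv.symm_apply_eq]
    simp [e]
  simp [this]

theorem multilinear_ext_of_span {k : ℕ} {σ : Fin k → Type*} {D : Fin k → Type*} {M : Type*}
    [∀ i, AddCommGroup (D i)] [∀ i, Module R (D i)] [AddCommGroup M] [Module R M]
    (g : ∀ i, σ i → D i) (hg : ∀ i, Submodule.span R (Set.range (g i)) = ⊤)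
    {f f' : MultilinearMap R D M}
    (h : ∀ s : ∀ i, σ i, f (fun i => g i (s i)) = f' fun i => g i (s i)) : f = f' := by
  induction k with
  | zero =>
    ext x
    rw [Subsingleton.elim x fun i => i.elim0, Subsingleton.elim (fun i => i.elim0) fun i =>
      g i (i.elim0 : σ i)]
    exact h fun i => i.elim0
  | succ k ih =>
    have h₁ : f.curryLeft = f'.curryLeft := by
      refine LinearMap.ext_on_range (hg 0) fun a => ?_
      refine ih (fun i => g i.succ) (fun i => hg i.succ) fun s => ?_
      have := h (Fin.cons a s)
      have e : (fun i => g i ((Fin.cons a s : ∀ i, σ i) i)) =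
          Fin.cons (g 0 a) fun i => g i.succ (s i) := by
        funext i
        induction i using Fin.cases <;> rfl
      rw [e] at this
      exact this
    rw [← f.uncurry_curryLeft, h₁, f'.uncurry_curryLeft]

theorem exists_multilinear {k : ℕ} {σ : Fin k → Type*} {D : Fin k → Type*} {M : Type*}
    [∀ i, AddCommGroup (D i)] [∀ i, Module R (D i)] [AddCommGroup M] [Module R M]
    (g : ∀ i, σ i → D i) (hg : ∀ i, Submodule.span R (Set.range (g i)) = ⊤)
    (F : (∀ i, σ i) → M)
    (hF : ∀ (i : Fin k) (s : ∀ i, σ i),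
      ∃ f : D i →ₗ[R] M, ∀ a, f (g i a) = F (Function.update s i a)) :
    ∃ f : MultilinearMap R D M, ∀ s : ∀ i, σ i, f (fun i => g i (s i)) = F s := by
  induction k with
  | zero =>
    refine ⟨MultilinearMap.constOfIsEmpty R D (F fun i => i.elim0), fun s => ?_⟩
    rw [Subsingleton.elim s fun i => i.elim0]
    rfl
  | succ k ih =>
    have h₁ : ∀ a : σ 0, ∃ f : MultilinearMap R (fun i : Fin k => D i.succ) M,
        ∀ s : ∀ i : Fin k, σ i.succ, f (fun i => g i.succ (s i)) = F (Fin.cons a s) := by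
      intro a
      refine ih (fun i => g i.succ) (fun i => hg i.succ) (fun s => F (Fin.cons a s)) fun i s => ?_
      obtain ⟨f, hf⟩ := hF i.succ (Fin.cons a s)
      exact ⟨f, fun b => by rw [hf, Fin.cons_update]⟩
    choose G hG using h₁
    obtain ⟨ℓ, hℓ⟩ := exists_linear_of_span (g 0) (hg 0) G (by
      intro c hc
      refine multilinear_ext_of_span (fun i => g i.succ) (fun i => hg i.succ) fun s => ?_
      by_cases h0 : Nonempty (σ 0)
      · obtain ⟨a₀⟩ := h0
        obtain ⟨f, hf⟩ := hF 0 (Fin.cons a₀ s)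
        have h₂ := congrArg f hc
        rw [map_zero, Finsupp.linearCombination_apply, Finsupp.sum, map_sum] at h₂
        rw [Finsupp.linearCombination_apply, Finsupp.sum, sum_apply]
        rw [zero_apply, ← h₂]
        refine Finset.sum_congr rfl fun a _ => ?_
        rw [smul_apply, hG, map_smul, hf, Fin.update_cons_zero]
      · have : c = 0 := by
          ext a
          exact absurd ⟨a⟩ h0
        simp [this])
    refine ⟨ℓ.uncurryLeft, fun s => ?_⟩
    rw [LinearMap.uncurryLeft_apply, hℓ]
    refine (hG _ _).trans ?_
    congr 1
    funext i
    induction i using Fin.cases <;> rfl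

theorem exists_ofFn_update_eq {α : Type*} {k : ℕ} (f : Fin k → α) (i : Fin k) :
    ∃ l₁ l₂ : List α, (∀ a, List.ofFn (Function.update f i a) = l₁ ++ a :: l₂) ∧
      (∀ b ∈ l₁, ∃ j, b = f j) ∧ ∀ b ∈ l₂, ∃ j, b = f j := by
  induction k with
  | zero => exact i.elim0
  | succ k ih =>
    induction i using Fin.cases with
    | zero =>
      refine ⟨[], List.ofFn fun j => f j.succ, fun a => ?_, by simp, fun b hb => ?_⟩
      · simp [List.ofFn_succ, Fin.succ_ne_zero]
      · obtain ⟨j, rfl⟩ := List.mem_ofFn.1 hb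
        exact ⟨_, rfl⟩
    | succ i =>
      obtain ⟨l₁, l₂, h, h₁, h₂⟩ := ih (fun j => f j.succ) i
      refine ⟨f 0 :: l₁, l₂, fun a => ?_, fun b hb => ?_, fun b hb => ?_⟩
      · have h0 : (0 : Fin (k + 1)) ≠ i.succ := (Fin.succ_ne_zero i).symm
        rw [List.ofFn_succ, Function.update_of_ne h0, List.cons_append, ← h a]
        congr 2
        funext j
        by_cases hj : j = i
        · subst hj; simp
        · rw [Function.update_of_ne hj, Function.update_of_ne (by simpa using hj)]
      · rcases List.mem_cons.1 hb with rfl | hb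
        · exact ⟨0, rfl⟩
        · obtain ⟨j, rfl⟩ := h₁ b hb
          exact ⟨_, rfl⟩
      · obtain ⟨j, rfl⟩ := h₂ b hb
        exact ⟨_, rfl⟩

section Slots

variable {P Q S : DGColl R} {M : Type*} [AddCommGroup M] [Module R M]

theorem SlotLinear.cons {φ : List P.El → M} (h : SlotLinear φ) (x : P.El) :
    SlotLinear fun l => φ (x :: l) := fun l₁ l₂ n p => h (x :: l₁) l₂ n p

/-- The element lies in the span of the elements with a property of the same arity and degree. -/
def InSpan (G : P.El → Prop) (x : P.El) : Prop :=
  x.val ∈ Submodule.span R {y : P.X x.ar x.deg | G ⟨x.ar, x.deg, y⟩}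

theorem InSpan.of {G : P.El → Prop} {x : P.El} (h : G x) : InSpan G x :=
  Submodule.subset_span h

/-- The lists have entries of the same arities and degrees. -/
def SameType (l l' : List P.El) : Prop :=
  l.map (fun x => (x.ar, x.deg)) = l'.map fun x => (x.ar, x.deg)

theorem SameType.arSum {l l' : List P.El} (h : SameType l l') : arSum l = arSum l' := by
  have := congrArg (List.map Prod.fst) h
  simp only [List.map_map] at this
  exact congrArg List.sum this

theorem SameType.degSum {l l' : List P.El} (h : SameType l l') : degSum l = degSum l' := by
  have := congrArg (List.map Prod.snd) h
  simp only [List.map_map] at this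
  exact congrArg List.sum this

theorem SameType.length {l l' : List P.El} (h : SameType l l') : l.length = l'.length := by
  simpa using congrArg List.length h

theorem SlotLinear.mem_of_inSpan {φ : List P.El → M} (h : SlotLinear φ) {G : P.El → Prop}
    {N : Submodule R M} {l : List P.El} (hl : ∀ x ∈ l, InSpan G x)
    (hG : ∀ l', SameType l' l → (∀ x ∈ l', G x) → φ l' ∈ N) : φ l ∈ N := by
  induction l generalizing φ with
  | nil => exact hG [] rfl (by simp)
  | cons x l ih =>
    refine ih (φ := fun l => φ (x :: l)) (h.cons x) (fun y hy => hl y (by simp [hy]))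
      fun l' hl' hG' => ?_
    obtain ⟨n, p, x⟩ := x
    have hx : x ∈ Submodule.span R {y : P.X n p | G ⟨n, p, y⟩} := hl ⟨n, p, x⟩ (by simp)
    clear hl
    have hN : Submodule.span R {y : P.X n p | G ⟨n, p, y⟩} ≤
        N.comap (IsLinearMap.mk' _ (h [] l' n p)) := by
      rw [Submodule.span_le]
      intro y hy
      refine hG (⟨n, p, y⟩ :: l') (by simpa [SameType] using hl') fun z hz => ?_
      rcases List.mem_cons.1 hz with rfl | hz
      · exact hy
      · exact hG' z hz
    exact hN hx

theorem SlotLinear.sub {φ ψ : List P.El → M} (h : SlotLinear φ) (h' : SlotLinear ψ) :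
    SlotLinear fun l => φ l - ψ l := fun l₁ l₂ n p =>
  ((h l₁ l₂ n p).mk' - (h' l₁ l₂ n p).mk' : _ →ₗ[R] M).isLinear

theorem SlotLinear.add {φ ψ : List P.El → M} (h : SlotLinear φ) (h' : SlotLinear ψ) :
    SlotLinear fun l => φ l + ψ l := fun l₁ l₂ n p =>
  ((h l₁ l₂ n p).mk' + (h' l₁ l₂ n p).mk' : _ →ₗ[R] M).isLinear

theorem SlotLinear.map {M' : Type*} [AddCommGroup M'] [Module R M'] {φ : List P.El → M}
    (h : SlotLinear φ) (f : M →ₗ[R] M') : SlotLinear fun l => f (φ l) := fun l₁ l₂ n p =>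
  (f.comp (h l₁ l₂ n p).mk' : _ →ₗ[R] M').isLinear

theorem ElLinear.map {M' : Type*} [AddCommGroup M'] [Module R M'] {φ : P.El → M}
    (h : ElLinear φ) (f : M →ₗ[R] M') : ElLinear fun l => f (φ l) := fun n p =>
  (f.comp (h n p).mk' : _ →ₗ[R] M').isLinear

/-- Multiplication by an integer as a linear map. -/
abbrev zsmulLin (R : Type u) [CommRing R] (M : Type*) [AddCommGroup M] [Module R M] (e : ℤ) :
    M →ₗ[R] M := e • LinearMap.id

theorem SlotLinear.ext_of_inSpan {φ ψ : List P.El → M} (h : SlotLinear φ) (h' : SlotLinear ψ)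
    {G : P.El → Prop} {l : List P.El} (hl : ∀ x ∈ l, InSpan G x)
    (hG : ∀ l', SameType l' l → (∀ x ∈ l', G x) → φ l' = ψ l') : φ l = ψ l := by
  have := (h.sub h').mem_of_inSpan (N := ⊥) hl fun l' h₁ h₂ => by
    simp [hG l' h₁ h₂]
  exact sub_eq_zero.1 this

theorem ElLinear.mem_of_inSpan {φ : P.El → M} (h : ElLinear φ) {G : P.El → Prop}
    {N : Submodule R M} {x : P.El} (hx : InSpan G x)
    (hG : ∀ y : P.El, y.ar = x.ar → y.deg = x.deg → G y → φ y ∈ N) : φ x ∈ N := by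
  obtain ⟨n, p, x⟩ := x
  have hN : Submodule.span R {y : P.X n p | G ⟨n, p, y⟩} ≤
      N.comap (IsLinearMap.mk' _ (h n p)) := by
    rw [Submodule.span_le]
    exact fun y hy => hG ⟨n, p, y⟩ rfl rfl hy
  exact hN hx

theorem ElLinear.sub {φ ψ : P.El → M} (h : ElLinear φ) (h' : ElLinear ψ) :
    ElLinear fun l => φ l - ψ l := fun n p =>
  ((h n p).mk' - (h' n p).mk' : _ →ₗ[R] M).isLinear

theorem ElLinear.ext_of_inSpan {φ ψ : P.El → M} (h : ElLinear φ) (h' : ElLinear ψ)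
    {G : P.El → Prop} {x : P.El} (hx : InSpan G x)
    (hG : ∀ y : P.El, y.ar = x.ar → y.deg = x.deg → G y → φ y = ψ y) : φ x = ψ x := by
  have := (h.sub h').mem_of_inSpan (N := ⊥) hx fun y h₁ h₂ h₃ => by simp [hG y h₁ h₂ h₃]
  exact sub_eq_zero.1 this

theorem isLinearMap_of_linear {M₁ M₂ : Type*} [AddCommGroup M₁] [Module R M₁] [AddCommGroup M₂]
    [Module R M₂] {g : M₁ → M₂} (f : M₁ →ₗ[R] M₂) (e : ∀ x, f x = g x) : IsLinearMap R g :=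
  isLinearMap_of_eq f.isLinear e

theorem isLinearMap_dsum {M₁ : Type*} [AddCommGroup M₁] [Module R M₁] (φ : M₁ → List P.El → M)
    (h : ∀ l, IsLinearMap R fun x => φ x l) (xs : List P.El) :
    IsLinearMap R fun x => dsum (φ x) xs := by
  refine ⟨fun x y => ?_, fun c x => ?_⟩
  · rw [← dsum_add]
    exact congrArg (dsum · xs) (funext fun l => (h l).map_add x y)
  · rw [show φ (c • x) = fun l => c • φ x l from funext fun l => (h l).map_smul c x]
    exact (dsum_map (DistribSMul.toAddMonoidHom M c) (φ x) xs).symm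

theorem SlotLinear.dsum {φ : List P.El → M} (h : SlotLinear φ) : SlotLinear (dsum φ) := by
  intro l₁ l₂ n p
  simp only [dsum_append, HUnital.dsum, degSum_cons]
  have h₁ : IsLinearMap R fun x : P.X n p =>
      HUnital.dsum (fun l => φ (l ++ ⟨n, p, x⟩ :: l₂)) l₁ :=
    isLinearMap_dsum (fun x l => φ (l ++ ⟨n, p, x⟩ :: l₂)) (fun l => h l l₂ n p) l₁
  have h₂ : IsLinearMap R fun x : P.X n p =>
      HUnital.dsum (fun l => φ (l₁ ++ ⟨n, p, x⟩ :: l)) l₂ :=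
    isLinearMap_dsum (fun x l => φ (l₁ ++ ⟨n, p, x⟩ :: l)) (fun l => h l₁ l n p) l₂
  have h₃ := h l₁ l₂ n (p + 1)
  exact isLinearMap_of_linear (sgn (p + degSum l₂) • h₁.mk' +
    (sgn (degSum l₂) • (h₃.mk').comp (P.d rfl) + h₂.mk')) fun x => rfl

theorem dsum_slotLinear {φ : List P.El → Q.El → M} (h : ∀ l, ElLinear (φ l)) (xs : List P.El) :
    ElLinear fun y => dsum (fun l => φ l y) xs := fun n p =>
  isLinearMap_dsum (fun (y : Q.X n p) l => φ l ⟨n, p, y⟩) (fun l => h l n p) xs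

theorem leib_slotLinear {φ : List P.El → Q.El → M} (h : ∀ y, SlotLinear fun l => φ l y)
    (y : Q.El) : SlotLinear fun l => leib φ l y :=
  (h y.d).add ((h y).dsum.map (zsmulLin R M (sgn y.deg)))

theorem leib_elLinear {φ : List P.El → Q.El → M} (h : ∀ l, ElLinear (φ l))
    (xs : List P.El) : ElLinear fun y => leib φ xs y := fun n p =>
  isLinearMap_of_linear (((h xs n (p + 1)).mk').comp (Q.d rfl) +
    sgn p • (dsum_slotLinear h xs n p).mk') fun _ => rfl

theorem SlotLinear.zero_slot {φ : List P.El → M} (h : SlotLinear φ) (l₁ l₂ : List P.El) (n : ℕ)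
    (p : ℤ) : φ (l₁ ++ ⟨n, p, 0⟩ :: l₂) = 0 := (h l₁ l₂ n p).map_zero

theorem DGColl.El.d_d (x : P.El) : x.d.d = ⟨x.ar, x.deg + 1 + 1, 0⟩ :=
  congrArg (DGColl.El.mk _ _) (P.d_d _ _ _)

theorem dsum_dsum {φ : List P.El → M} (h : SlotLinear φ) (xs : List P.El) :
    dsum (dsum φ) xs = 0 := by
  induction xs generalizing φ with
  | nil => rfl
  | cons x xs ih =>
    have h₀ : φ (x.d.d :: xs) = 0 := by
      rw [DGColl.El.d_d]; exact h.zero_slot [] xs _ _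
    have h₁ : dsum (fun l => dsum φ (x :: l)) xs =
        dsum (fun l => sgn (degSum xs + 1) • φ (x.d :: l)) xs +
          dsum (dsum fun l => φ (x :: l)) xs := by
      rw [← dsum_add]
      exact dsum_congr fun l _ h₂ _ => by rw [dsum, h₂]
    rw [dsum, h₁, ih (h.cons x), dsum, h₀, dsum_smul, sgn_add, smul_zero]
    simp

theorem leib_leib {φ : List P.El → Q.El → M} (h : ∀ y, SlotLinear fun l => φ l y)
    (h' : ∀ l, ElLinear (φ l)) (xs : List P.El) (y : Q.El) : leib (leib φ) xs y = 0 := by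
  have h₀ : φ xs y.d.d = 0 := by
    rw [DGColl.El.d_d]
    exact (h' xs _ _).map_zero
  rw [leib, leib, h₀]
  simp only [leib]
  rw [dsum_add, dsum_smul, dsum_dsum (h y), DGColl.El.d_deg, sgn_add]
  simp

theorem dsum_mem {φ : List P.El → M} {N : Submodule R M} {xs : List P.El}
    (h : ∀ l, arSum l = arSum xs → degSum l = degSum xs + 1 → l.length = xs.length → φ l ∈ N) :
    dsum φ xs ∈ N := by
  induction xs generalizing φ with
  | nil => exact N.zero_mem
  | cons x xs ih =>
    rw [dsum]
    refine N.add_mem (zsmul_mem (h _ (by simp) (by simp; ring) (by simp)) _) ?_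
    exact ih fun l h₁ h₂ h₃ => h _ (by simp [h₁]) (by simp [h₂]; ring) (by simp [h₃])

end Slots

end HUnital

namespace HUnital

variable {R : Type u} [CommRing R]

/-! Reduction of associativity to generators. -/

section Reduction

variable {P Q S U V W : DGColl R} {a : OdotMap P Q S} {b : OdotMap S U V} {c : OdotMap Q U W}
  {e : OdotMap P W V}

theorem LAssoc.of_matched
    (h : ∀ L z, Matched L → z.ar = L.length → ∀ N r, arSum (flatL L) = N →
      degSum (flatL L) + (degSum (sndL L) + z.deg) = r →
        b.L N r (a.elL L) z = sgn (kos L) • e.L N r (flatL L) (c.el (sndL L) z)) :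
    LAssoc a b c e := by
  intro N r L z hL
  by_cases hz : z.ar = L.length ∧ arSum (flatL L) = N ∧
      degSum (flatL L) + (degSum (sndL L) + z.deg) = r
  · exact h L z hL hz.1 N r hz.2.1 hz.2.2
  · have hb : b.L N r (a.elL L) z = 0 := b.L_of_not (by simpa [add_assoc] using hz)
    by_cases hz' : z.ar = L.length
    · rw [hb, e.L_of_not, smul_zero]
      rintro ⟨h₁, h₂, h₃⟩
      exact hz ⟨hz', h₂, by rw [← h₃]; rfl⟩
    · have hc : c.L (arSum (sndL L)) (degSum (sndL L) + z.deg) (sndL L) z = 0 :=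
        c.L_of_not (by simp [hz'])
      have he : e.L N r (flatL L) ⟨_, _, 0⟩ = 0 := (e.elLinear N r (flatL L)
        (arSum (sndL L)) (degSum (sndL L) + z.deg)).map_zero
      rw [hb, OdotMap.el, hc, he, smul_zero]

theorem isLinearMap_smul {M M' : Type*} [AddCommGroup M] [Module R M] [AddCommGroup M']
    [Module R M'] {f : M → M'} (h : IsLinearMap R f) (e : ℤ) : IsLinearMap R fun x => e • f x :=
  isLinearMap_of_linear (e • h.mk') fun _ => rfl

theorem OdotMap.el_slot_linear (a : OdotMap P Q S) {M : Type*} [AddCommGroup M] [Module R M]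
    {φ : S.El → M} (hφ : ElLinear φ) (y : Q.El) : SlotLinear fun X => φ (a.el X y) := by
  intro l₁ l₂ n p
  have h := a.slotLinear (arSum (l₁ ++ (⟨n, p, 0⟩ : P.El) :: l₂))
    (degSum (l₁ ++ (⟨n, p, 0⟩ : P.El) :: l₂) + y.deg) y l₁ l₂ n p
  refine isLinearMap_of_linear ((hφ _ _).mk'.comp h.mk') fun x => ?_
  exact (congrArg φ (a.el_eq (N := arSum (l₁ ++ (⟨n, p, 0⟩ : P.El) :: l₂))
    (r := degSum (l₁ ++ (⟨n, p, 0⟩ : P.El) :: l₂) + y.deg) (by simp) (by simp))).symm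

theorem OdotMap.el_el_linear (a : OdotMap P Q S) {M : Type*} [AddCommGroup M] [Module R M]
    {φ : S.El → M} (hφ : ElLinear φ) (X : List P.El) : ElLinear fun y => φ (a.el X y) := by
  intro n p
  exact isLinearMap_of_linear ((hφ (arSum X) (degSum X + p)).mk'.comp
    (a.elLinear (arSum X) (degSum X + p) X n p).mk') fun x => rfl

theorem SlotLinear.elLinear {M : Type*} [AddCommGroup M] [Module R M] {φ : List P.El → M}
    (h : SlotLinear φ) (l₁ l₂ : List P.El) : ElLinear fun x => φ (l₁ ++ x :: l₂) :=
  fun n p => h l₁ l₂ n p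

theorem kos_slot (L₁ L₂ : List (List P.El × Q.El)) (l₁ l₂ : List P.El) {n : ℕ} {p : ℤ}
    (x : P.X n p) (y : Q.El) :
    kos (L₁ ++ (l₁ ++ ⟨n, p, x⟩ :: l₂, y) :: L₂) = kos (L₁ ++ (l₁ ++ ⟨n, p, 0⟩ :: l₂, y) :: L₂) := by
  simp [kos_append, kos]

theorem assoc_right_slotLinear (c : OdotMap Q U W) (e : OdotMap P W V) (N : ℕ) (r : ℤ)
    (L₁ L₂ : List (List P.El × Q.El)) (y : Q.El) (z : U.El) :
    SlotLinear fun X => sgn (kos (L₁ ++ (X, y) :: L₂)) •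
      e.L N r (flatL (L₁ ++ (X, y) :: L₂)) (c.el (sndL (L₁ ++ (X, y) :: L₂)) z) := by
  intro l₁ l₂ n p
  simp only [kos_slot]
  refine isLinearMap_smul ?_ _
  have h := e.slotLinear N r (c.el (sndL L₁ ++ y :: sndL L₂) z) (flatL L₁ ++ l₁)
    (l₂ ++ flatL L₂) n p
  refine isLinearMap_of_eq h fun x => ?_
  simp [flatL]

theorem assoc_right_elLinear (c : OdotMap Q U W) (e : OdotMap P W V) (N : ℕ) (r : ℤ)
    (L₁ L₂ : List (List P.El × Q.El)) (X : List P.El) (z : U.El) :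
    ElLinear fun y => sgn (kos (L₁ ++ (X, y) :: L₂)) •
      e.L N r (flatL (L₁ ++ (X, y) :: L₂)) (c.el (sndL (L₁ ++ (X, y) :: L₂)) z) := by
  intro k q
  have hk : ∀ y : Q.X k q, kos (L₁ ++ (X, (⟨k, q, y⟩ : Q.El)) :: L₂) =
      kos (L₁ ++ (X, (⟨k, q, 0⟩ : Q.El)) :: L₂) := fun y => by simp [kos_append, kos]
  simp only [hk]
  refine isLinearMap_smul ?_ _
  have h := (c.el_slot_linear (e.elLinear N r (flatL L₁ ++ (X ++ flatL L₂))) z).elLinear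
    (sndL L₁) (sndL L₂) k q
  refine isLinearMap_of_eq h fun x => ?_
  simp [flatL]

theorem LAssoc.of_span₁ {G : P.El → Prop} (hG : ∀ x, InSpan G x)
    (h : ∀ N r L z, Matched L → (∀ i ∈ L, ∀ x ∈ i.1, G x) →
      b.L N r (a.elL L) z = sgn (kos L) • e.L N r (flatL L) (c.el (sndL L) z)) :
    LAssoc a b c e := by
  suffices h' : ∀ N r L L₀ z, Matched (L₀ ++ L) → (∀ i ∈ L₀, ∀ x ∈ i.1, G x) →
      b.L N r (a.elL (L₀ ++ L)) z =
        sgn (kos (L₀ ++ L)) • e.L N r (flatL (L₀ ++ L)) (c.el (sndL (L₀ ++ L)) z) from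
    fun N r L z hL => h' N r L [] z hL (by simp)
  intro N r L
  induction L with
  | nil =>
    intro L₀ z hL h₀
    rw [List.append_nil] at hL ⊢
    exact h N r L₀ z hL h₀
  | cons i L ih =>
    intro L₀ z hL h₀
    obtain ⟨X, y⟩ := i
    have h₁ : SlotLinear fun X => b.L N r (a.elL (L₀ ++ (X, y) :: L)) z := by
      have := a.el_slot_linear ((b.slotLinear N r z).elLinear (a.elL L₀) (a.elL L)) y
      simpa using this
    refine h₁.ext_of_inSpan (assoc_right_slotLinear c e N r L₀ L y z) (fun x _ => hG x)
      fun X' ht hX => ?_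
    have := ih (L₀ ++ [(X', y)]) z ?_ ?_
    · simpa using this
    · rw [Matched.append, Matched.append, Matched.cons]
      rw [Matched.append, Matched.cons] at hL
      exact ⟨⟨hL.1, by simpa [ht.length] using hL.2.1, matched_nil⟩, hL.2.2⟩
    · intro i hi
      rcases List.mem_append.1 hi with hi | hi
      · exact h₀ i hi
      · rw [List.mem_singleton.1 hi]
        exact hX

theorem LAssoc.of_span₂ {G : Q.El → Prop} (hG : ∀ x, InSpan G x)
    (h : ∀ N r L z, Matched L → (∀ i ∈ L, G i.2) →
      b.L N r (a.elL L) z = sgn (kos L) • e.L N r (flatL L) (c.el (sndL L) z)) :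
    LAssoc a b c e := by
  suffices h' : ∀ N r L L₀ z, Matched (L₀ ++ L) → (∀ i ∈ L₀, G i.2) →
      b.L N r (a.elL (L₀ ++ L)) z =
        sgn (kos (L₀ ++ L)) • e.L N r (flatL (L₀ ++ L)) (c.el (sndL (L₀ ++ L)) z) from
    fun N r L z hL => h' N r L [] z hL (by simp)
  intro N r L
  induction L with
  | nil =>
    intro L₀ z hL h₀
    rw [List.append_nil] at hL ⊢
    exact h N r L₀ z hL h₀
  | cons i L ih =>
    intro L₀ z hL h₀
    obtain ⟨X, y⟩ := i
    have h₁ : ElLinear fun y => b.L N r (a.elL (L₀ ++ (X, y) :: L)) z := by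
      have := a.el_el_linear ((b.slotLinear N r z).elLinear (a.elL L₀) (a.elL L)) X
      simpa using this
    refine h₁.ext_of_inSpan (assoc_right_elLinear c e N r L₀ L X z) (hG y)
      fun y' h₂ h₃ hy => ?_
    have := ih (L₀ ++ [(X, y')]) z ?_ ?_
    · simpa using this
    · rw [Matched.append, Matched.append, Matched.cons]
      rw [Matched.append, Matched.cons] at hL
      exact ⟨⟨hL.1, by simpa [h₂] using hL.2.1, matched_nil⟩, hL.2.2⟩
    · intro i hi
      rcases List.mem_append.1 hi with hi | hi
      · exact h₀ i hi
      · rw [List.mem_singleton.1 hi]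
        exact hy

theorem LAssoc.of_span₃ {G : U.El → Prop} (hG : ∀ x, InSpan G x)
    (h : ∀ N r L z, Matched L → z.ar = L.length → G z →
      b.L N r (a.elL L) z = sgn (kos L) • e.L N r (flatL L) (c.el (sndL L) z)) :
    LAssoc a b c e := by
  refine LAssoc.of_matched fun L z hL hz N r _ _ => ?_
  refine (b.elLinear N r (a.elL L)).ext_of_inSpan
    ((c.el_el_linear (e.elLinear N r (flatL L)) (sndL L)).map (zsmulLin R _ (sgn (kos L)))) (hG z)
    fun y h₁ h₂ h₃ => h N r L y hL (h₁.trans hz) h₃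

end Reduction

/-! Lists cut into blocks. -/

section Blocks

variable {α : Type*} {P : DGColl R}

/-- The list `l` cut into blocks of lengths the arities of `xs`. -/
def blocks : List α → List P.El → List (List α × P.El)
  | _, [] => []
  | l, x :: xs => (l.take x.ar, x) :: blocks (l.drop x.ar) xs

theorem sndL_blocks (l : List α) (xs : List P.El) : sndL (blocks l xs) = xs := by
  induction xs generalizing l with
  | nil => rfl
  | cons x xs ih =>
    simp only [sndL, blocks, List.map_cons]
    exact congrArg (x :: ·) (ih _)

@[simp] theorem length_blocks (l : List α) (xs : List P.El) :
    (blocks l xs).length = xs.length := by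
  conv_rhs => rw [← sndL_blocks l xs]
  simp

theorem flatL_blocks {l : List α} {xs : List P.El} (h : l.length = arSum xs) :
    flatL (blocks l xs) = l := by
  induction xs generalizing l with
  | nil => exact (List.length_eq_zero_iff.1 (by simpa using h)).symm
  | cons x xs ih =>
    have := ih (l := l.drop x.ar) (by simp at h ⊢; omega)
    simp only [flatL, blocks, List.flatMap_cons]
    exact (congrArg (_ ++ ·) this).trans (List.take_append_drop _ _)

theorem matched_blocks {l : List α} {xs : List P.El} (h : l.length = arSum xs) :
    ∀ i ∈ blocks l xs, i.2.ar = i.1.length := by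
  induction xs generalizing l with
  | nil => simp [blocks]
  | cons x xs ih =>
    intro i hi
    simp only [blocks, List.mem_cons] at hi
    simp only [arSum_cons] at h
    rcases hi with rfl | hi
    · simp; omega
    · exact ih (by simp; omega) i hi

theorem blocks_flatL {L : List (List α × P.El)} (h : ∀ i ∈ L, i.2.ar = i.1.length) :
    blocks (flatL L) (sndL L) = L := by
  induction L with
  | nil => rfl
  | cons i L ih =>
    have h₁ := h i (by simp)
    have := ih fun j hj => h j (by simp [hj])
    simp only [flatL, List.flatMap_cons, sndL, List.map_cons, blocks]
    rw [h₁, List.take_left, List.drop_left]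
    exact congrArg (_ :: ·) this

theorem blocks_append (l : List α) (xs ys : List P.El) :
    blocks l (xs ++ ys) = blocks l xs ++ blocks (l.drop (arSum xs)) ys := by
  induction xs generalizing l with
  | nil => simp [blocks]
  | cons x xs ih => simp [blocks, ih, List.drop_drop]

end Blocks

/-! Units in terms of lists. -/

/-- The unit of an operad as an element. -/
def DGOperad.oneEl (O : DGOperad R) : O.toDGColl.El := ⟨1, 0, O.one⟩

section Units

variable {A B : DGOperad R} (P : DGBimod A B)

theorem DGBimod.one_lact_el (x : P.toDGColl.El) :
    P.lact.el (List.replicate x.ar A.oneEl) x = x := by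
  have := P.lact.el_ofFn (k := x.ar) (N := x.ar) (r := x.deg) (fun _ => 1) (fun _ => 0) (by simp) (by simp)
    (fun _ => A.one) x.val
  rw [P.one_lact, List.ofFn_const] at this
  exact this

theorem DGBimod.ract_one_el (x : P.toDGColl.El) : P.ract.el [x] B.oneEl = x := by
  have := P.ract.el_ofFn (k := 1) (N := x.ar) (r := x.deg) (fun _ => x.ar) (fun _ => x.deg) (by simp) (by simp)
    (fun _ => x.val) B.one
  rw [P.ract_one, List.ofFn_const] at this
  exact this

theorem OdotMap.L_eq_of_el {P Q S : DGColl R} {t : OdotMap P Q S} {xs : List P.El} {y : Q.El}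
    {n : ℕ} {p : ℤ} {x : S.X n p} (h : t.el xs y = ⟨n, p, x⟩) : t.L n p xs y = x := by
  have h₁ : arSum xs = n := congrArg DGColl.El.ar h
  have h₂ : degSum xs + y.deg = p := congrArg DGColl.El.deg h
  rw [t.el_eq h₁ h₂] at h
  injection h

end Units

end HUnital

namespace HUnital

variable {R : Type u} [CommRing R]

/-! A linear characterization of tensor products over an operad. -/

section Tensor

variable {A O B : DGOperad R}

/-- A balanced family of multilinear maps from `P ⊙ Q` to a module. -/
structure LinModel (P : DGBimod A O) (Q : DGBimod O B) {M : Type*} [AddCommGroup M] [Module R M]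
    (t : List P.El → Q.El → M) : Prop where
  slot : ∀ y, SlotLinear fun xs => t xs y
  lin : ∀ xs, ElLinear (t xs)
  balanced : ∀ (L : List (List P.El × O.El)) (z : Q.El), Matched L → z.ar = L.length →
    t (P.ract.elL L) z = sgn (kos L) • t (flatL L) (Q.lact.el (sndL L) z)

/-- The lengths, arities and degrees fit to `x₁ ⊗ ⋯ ⊗ xₖ ⊗ y` of arity `N` and degree `r`. -/
def Fits {P Q : DGColl R} (N : ℕ) (r : ℤ) (xs : List P.El) (y : Q.El) : Prop :=
  y.ar = xs.length ∧ arSum xs = N ∧ degSum xs + y.deg = r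

/-- A value of a morphism `P ⊙ Q → S`. -/
def IsGen {P Q S : DGColl R} (t : OdotMap P Q S) (x : S.El) : Prop :=
  ∃ xs y, y.ar = xs.length ∧ x = t.el xs y

/-- The collection `D` is a tensor product `P ⊙_O Q` of the underlying modules. -/
structure IsTensor (P : DGBimod A O) (Q : DGBimod O B) {D : DGColl R}
    (mk : OdotMap P.toDGColl Q.toDGColl D) : Prop where
  balanced : LAssoc P.ract mk Q.lact mk
  span : ∀ x : D.El, InSpan (IsGen mk) x
  lin : ∀ {M : Type u} [AddCommGroup M] [Module R M] (t : List P.El → Q.El → M), LinModel P Q t →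
    ∀ N r, ∃ f : D.X N r →ₗ[R] M, ∀ xs y, Fits N r xs y → f (mk.L N r xs y) = t xs y

theorem dsum_linear {P : DGColl R} {M M' : Type*} [AddCommGroup M] [Module R M] [AddCommGroup M']
    [Module R M'] (f : M →ₗ[R] M') (φ : List P.El → M) (xs : List P.El) :
    f (dsum φ xs) = dsum (fun l => f (φ l)) xs := dsum_map f.toAddMonoidHom φ xs

theorem leib_linear {P Q : DGColl R} {M M' : Type*} [AddCommGroup M] [Module R M]
    [AddCommGroup M'] [Module R M'] (f : M →ₗ[R] M') (φ : List P.El → Q.El → M)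
    (xs : List P.El) (y : Q.El) : f (leib φ xs y) = leib (fun l z => f (φ l z)) xs y := by
  rw [leib, leib, map_add, map_zsmul, dsum_linear]

theorem leib_congr {P Q : DGColl R} {M : Type*} [AddCommGroup M] {φ ψ : List P.El → Q.El → M}
    {xs : List P.El} {y : Q.El} {N : ℕ} {r : ℤ} (h : Fits N r xs y)
    (hφ : ∀ l z, Fits N (r + 1) l z → φ l z = ψ l z) : leib φ xs y = leib ψ xs y := by
  rw [leib, leib, hφ xs y.d ⟨h.1, h.2.1, by rw [← h.2.2, DGColl.El.d_deg, add_assoc]⟩]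
  refine congrArg _ (congrArg _ (dsum_congr fun l h₁ h₂ h₃ => hφ l y ⟨?_, ?_, ?_⟩))
  · rw [h₃, h.1]
  · rw [h₁, h.2.1]
  · rw [h₂, ← h.2.2]; ring

section Construction

variable (P : DGBimod A O) (Q : DGBimod O B)

/-- The relations of the total tensor product. -/
def tensorRel : Submodule R (List P.El × Q.El →₀ R) where
  carrier := {c | ∀ (M : Type u) [AddCommGroup M] [Module R M] (t : List P.El → Q.El → M),
    LinModel P Q t → Finsupp.linearCombination R (fun s : List P.El × Q.El => t s.1 s.2) c = 0}
  add_mem' h h' M _ _ t ht := by rw [map_add, h M t ht, h' M t ht, add_zero]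
  zero_mem' M _ _ t ht := map_zero _
  smul_mem' c x h M _ _ t ht := by rw [map_smul, h M t ht, smul_zero]

/-- The module generated by all `x₁ ⊗ ⋯ ⊗ xₖ ⊗ y`, whether or not the lengths fit. -/
abbrev TensorTot : Type u := (List P.El × Q.El →₀ R) ⧸ tensorRel P Q

namespace TensorTot

/-- The element `x₁ ⊗ ⋯ ⊗ xₖ ⊗ y`. -/
noncomputable def gen (xs : List P.El) (y : Q.El) : TensorTot P Q :=
  Submodule.Quotient.mk (Finsupp.single (xs, y) 1)

variable {P Q}

/-- The linear map given by a balanced family. -/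
noncomputable def lift {M : Type u} [AddCommGroup M] [Module R M] {t : List P.El → Q.El → M}
    (h : LinModel P Q t) : TensorTot P Q →ₗ[R] M :=
  (tensorRel P Q).liftQ (Finsupp.linearCombination R (fun s : List P.El × Q.El => t s.1 s.2))
    fun _ hc => hc M t h

@[simp] theorem lift_gen {M : Type u} [AddCommGroup M] [Module R M] {t : List P.El → Q.El → M}
    (h : LinModel P Q t) (xs : List P.El) (y : Q.El) : lift h (gen P Q xs y) = t xs y :=
  (Finsupp.linearCombination_single R (v := fun s : List P.El × Q.El => t s.1 s.2) 1
    (xs, y)).trans (one_smul R _)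

theorem ext {x y : TensorTot P Q} (h : ∀ (M : Type u) [AddCommGroup M] [Module R M]
    (t : List P.El → Q.El → M) (ht : LinModel P Q t), lift ht x = lift ht y) : x = y := by
  induction x using Submodule.Quotient.induction_on with | _ x => ?_
  induction y using Submodule.Quotient.induction_on with | _ y => ?_
  rw [Submodule.Quotient.eq]
  intro M _ _ t ht
  rw [map_sub, sub_eq_zero]
  exact h M t ht

theorem linModel_gen : LinModel P Q (gen P Q) where
  slot y l₁ l₂ n p :=
    { map_add := fun u v => ext fun M _ _ t ht => by
        simp only [map_add, lift_gen]
        exact (ht.slot y l₁ l₂ n p).map_add u v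
      map_smul := fun c u => ext fun M _ _ t ht => by
        simp only [map_smul, lift_gen]
        exact (ht.slot y l₁ l₂ n p).map_smul c u }
  lin xs n p :=
    { map_add := fun u v => ext fun M _ _ t ht => by
        simp only [map_add, lift_gen]
        exact (ht.lin xs n p).map_add u v
      map_smul := fun c u => ext fun M _ _ t ht => by
        simp only [map_smul, lift_gen]
        exact (ht.lin xs n p).map_smul c u }
  balanced L z hL hz := ext fun M _ _ t ht => by
    rw [map_zsmul, lift_gen, lift_gen, ht.balanced L z hL hz]

variable (P Q) in
/-- The component of arity `N` and degree `r`. -/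
noncomputable def part (N : ℕ) (r : ℤ) : Submodule R (TensorTot P Q) :=
  Submodule.span R {w | ∃ xs y, Fits N r xs y ∧ w = gen P Q xs y}

theorem linModel_leib : LinModel P Q (leib (gen P Q)) where
  slot := leib_slotLinear linModel_gen.slot
  lin := leib_elLinear linModel_gen.lin
  balanced _ _ hL hz := P.ract.leib_assoc_L Q.lact (gen P Q) (gen P Q) linModel_gen.slot
    linModel_gen.lin linModel_gen.balanced hL hz

theorem gen_mem {N : ℕ} {r : ℤ} {xs : List P.El} {y : Q.El} (h : Fits N r xs y) :
    gen P Q xs y ∈ part P Q N r := Submodule.subset_span ⟨xs, y, h, rfl⟩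

theorem leib_gen_mem {N : ℕ} {r r' : ℤ} (hr : r + 1 = r') {xs : List P.El} {y : Q.El}
    (h : Fits N r xs y) : leib (gen P Q) xs y ∈ part P Q N r' := by
  subst hr
  refine add_mem (gen_mem ⟨h.1, h.2.1, ?_⟩) (zsmul_mem (dsum_mem fun l h₁ h₂ h₃ =>
    gen_mem ⟨?_, ?_, ?_⟩) _)
  · rw [← h.2.2, DGColl.El.d_deg, add_assoc]
  · rw [h₃, h.1]
  · rw [h₁, h.2.1]
  · rw [h₂, ← h.2.2]; ring

theorem lift_leib_mem {N : ℕ} {r r' : ℤ} (hr : r + 1 = r') (x : TensorTot P Q)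
    (hx : x ∈ part P Q N r) : lift linModel_leib x ∈ part P Q N r' := by
  have : part P Q N r ≤ (part P Q N r').comap (lift linModel_leib) := by
    rw [part, Submodule.span_le]
    rintro _ ⟨xs, y, h, rfl⟩
    simp only [Submodule.comap_coe, Set.mem_preimage, lift_gen]
    exact leib_gen_mem hr h
  exact this hx

variable (P Q) in
/-- The collection of the components. -/
noncomputable def coll : DGColl R where
  X N r := part P Q N r
  d h := (lift linModel_leib).restrict (lift_leib_mem h)
  d_d h h' x := Subtype.ext <| by
    have : (lift (linModel_leib (P := P) (Q := Q))).comp (lift linModel_leib) = 0 := by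
      refine Submodule.linearMap_qext _ (Finsupp.lhom_ext' fun s => LinearMap.ext_ring ?_)
      change lift linModel_leib (lift linModel_leib (gen P Q s.1 s.2)) = 0
      rw [lift_gen, leib_linear]
      simp only [lift_gen]
      exact leib_leib linModel_gen.slot linModel_gen.lin _ _
    exact LinearMap.congr_fun this x.1

open Classical in
/-- The element `x₁ ⊗ ⋯ ⊗ xₖ ⊗ y` of the component of arity `N` and degree `r`. -/
noncomputable def genIn (N : ℕ) (r : ℤ) (xs : List P.El) (y : Q.El) : (coll P Q).X N r :=
  if h : Fits N r xs y then ⟨gen P Q xs y, gen_mem h⟩ else 0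

theorem genIn_of_fits {N : ℕ} {r : ℤ} {xs : List P.El} {y : Q.El} (h : Fits N r xs y) :
    genIn N r xs y = (⟨gen P Q xs y, gen_mem h⟩ : part P Q N r) := dif_pos h

theorem genIn_of_not {N : ℕ} {r : ℤ} {xs : List P.El} {y : Q.El} (h : ¬Fits N r xs y) :
    genIn N r xs y = 0 := dif_neg h

variable (P Q) in
/-- The inclusion of a component into the total tensor product. -/
noncomputable def incl (N : ℕ) (r : ℤ) : (coll P Q).X N r →ₗ[R] TensorTot P Q :=
  (part P Q N r).subtype

theorem incl_injective {N : ℕ} {r : ℤ} {x y : (coll P Q).X N r}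
    (h : incl P Q N r x = incl P Q N r y) : x = y := Subtype.ext h

theorem genIn_slotLinear (N : ℕ) (r : ℤ) (y : Q.El) :
    SlotLinear fun xs : List P.El => genIn N r xs y := by
  intro l₁ l₂ n p
  by_cases h : Fits N r (l₁ ++ (⟨n, p, 0⟩ : P.El) :: l₂) y
  · have h' : ∀ x : P.X n p, Fits N r (l₁ ++ (⟨n, p, x⟩ : P.El) :: l₂) y := fun x => by
      simpa [Fits] using h
    refine isLinearMap_of_eq (f := fun x => (⟨_, gen_mem (h' x)⟩ : part P Q N r)) ?_
      fun x => (genIn_of_fits (h' x)).symm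
    exact ⟨fun u v => Subtype.ext ((linModel_gen.slot y l₁ l₂ n p).map_add u v),
      fun c u => Subtype.ext ((linModel_gen.slot y l₁ l₂ n p).map_smul c u)⟩
  · refine isLinearMap_of_eq isLinearMap_zero fun x => (genIn_of_not ?_).symm
    simpa [Fits] using h

theorem genIn_elLinear (N : ℕ) (r : ℤ) (xs : List P.El) :
    ElLinear fun y : Q.El => genIn N r xs y := by
  intro n p
  by_cases h : Fits N r xs (⟨n, p, 0⟩ : Q.El)
  · have h' : ∀ x : Q.X n p, Fits N r xs (⟨n, p, x⟩ : Q.El) := fun x => h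
    refine isLinearMap_of_eq (f := fun x => (⟨_, gen_mem (h' x)⟩ : part P Q N r)) ?_
      fun x => (genIn_of_fits (h' x)).symm
    exact ⟨fun u v => Subtype.ext ((linModel_gen.lin xs n p).map_add u v),
      fun c u => Subtype.ext ((linModel_gen.lin xs n p).map_smul c u)⟩
  · exact isLinearMap_of_eq isLinearMap_zero fun x =>
      (genIn_of_not (show ¬Fits N r xs (⟨n, p, x⟩ : Q.El) from h)).symm

variable (P Q) in
/-- The canonical morphism from `P ⊙ Q`. -/
noncomputable def mk : OdotMap P.toDGColl Q.toDGColl (coll P Q) :=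
  (OdotFam.ofL genIn genIn_slotLinear genIn_elLinear).toOdotMap <| by
    intro N r r' h xs y hy hN hr
    subst h
    have hL : ∀ r xs y, Fits N r xs y →
        incl P Q N r ((OdotFam.ofL genIn genIn_slotLinear genIn_elLinear).L N r xs y) =
          gen P Q xs y := fun r xs y h => by
      rw [OdotFam.ofL_L h.1 h.2.1 h.2.2, genIn_of_fits h]; rfl
    have hf : Fits N r xs y := ⟨hy, hN, hr⟩
    refine incl_injective ?_
    change lift linModel_leib (incl P Q N r _) = incl P Q N (r + 1)
      (leib ((OdotFam.ofL genIn genIn_slotLinear genIn_elLinear).L N (r + 1)) xs y)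
    rw [hL r xs y hf, lift_gen, leib_linear]
    exact (leib_congr hf (hL (r + 1))).symm

theorem mk_L {N : ℕ} {r : ℤ} {xs : List P.El} {y : Q.El} (h : Fits N r xs y) :
    (mk P Q).L N r xs y = (⟨gen P Q xs y, gen_mem h⟩ : part P Q N r) := by
  rw [← genIn_of_fits h]
  exact OdotFam.ofL_L (h₁ := genIn_slotLinear) (h₂ := genIn_elLinear) h.1 h.2.1 h.2.2

theorem isTensor : IsTensor P Q (mk P Q) where
  balanced := LAssoc.of_matched fun L z hL hz N r hN hr => by
    have h₁ : Fits N r (P.ract.elL L) z := ⟨by simpa using hz, by simpa using hN,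
      by simpa [add_assoc] using hr⟩
    have h₂ : Fits N r (flatL L) (Q.lact.el (sndL L) z) := ⟨hL.length_flatL.symm, hN, hr⟩
    rw [mk_L h₁, mk_L h₂]
    exact Subtype.ext (linModel_gen.balanced L z hL hz)
  span x := by
    obtain ⟨N, r, x, hx⟩ := x
    change _ ∈ Submodule.span R _
    induction hx using Submodule.span_induction with
    | mem w hw =>
      obtain ⟨xs, y, h, rfl⟩ := hw
      refine Submodule.subset_span ⟨xs, y, h.1, ?_⟩
      rw [(mk P Q).el_eq h.2.1 h.2.2, mk_L h]
    | zero => exact zero_mem _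
    | add u v hu hv h h' => exact add_mem h h'
    | smul c u hu h => exact Submodule.smul_mem _ c h
  lin t ht N r := ⟨(lift ht).comp (part P Q N r).subtype, fun xs y h => by
    rw [mk_L h]
    exact lift_gen ht xs y⟩

end TensorTot

end Construction

end Tensor

end HUnital

namespace HUnital

variable {R : Type u} [CommRing R]

/-! Extension of morphisms to tensor products. -/

section Extension

variable {A O B : DGOperad R} {P : DGBimod A O} {Q : DGBimod O B}

/-- The units are inserted between `xs` and `y`. -/
def unitSplit (i : List P.El × Q.El) : List (List P.El × O.El) × Q.El :=
  (i.1.map fun x => ([x], O.oneEl), i.2)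

theorem flatL_unitSplit (xs : List P.El) :
    flatL (xs.map fun x => (([x], O.oneEl) : List P.El × O.El)) = xs := by
  induction xs with
  | nil => rfl
  | cons x xs ih => simpa [flatL] using ih

theorem sndL_unitSplit (xs : List P.El) :
    sndL (xs.map fun x => (([x], O.oneEl) : List P.El × O.El)) =
      List.replicate xs.length O.oneEl := by
  simp [Function.comp_def, List.map_const']

theorem elL_unitSplit (xs : List P.El) :
    P.ract.elL (xs.map fun x => (([x], O.oneEl) : List P.El × O.El)) = xs := by
  simp [OdotMap.elL, Function.comp_def, P.ract_one_el]

theorem kos_unitSplit (xs : List P.El) :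
    kos (xs.map fun x => (([x], O.oneEl) : List P.El × O.El)) = 0 := by
  induction xs with
  | nil => rfl
  | cons x xs ih =>
    rw [List.map_cons, kos, ih]
    simp [DGOperad.oneEl]

theorem matched₂_unitSplit {L : List (List P.El × Q.El)} (hL : Matched L) :
    Matched₂ (L.map unitSplit) := by
  intro i hi
  obtain ⟨j, hj, rfl⟩ := List.mem_map.1 hi
  refine ⟨fun k hk => ?_, by simpa [unitSplit] using hL j hj⟩
  obtain ⟨x, _, rfl⟩ := List.mem_map.1 hk
  rfl

theorem pairC_unitSplit (L : List (List P.El × Q.El)) :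
    pairC (L.map unitSplit) P.ract = L := by
  rw [pairC, List.map_map]
  conv_rhs => rw [← List.map_id L]
  exact List.map_congr_left fun i _ => Prod.ext (elL_unitSplit i.1) rfl

theorem pairA_unitSplit {L : List (List P.El × Q.El)} (hL : Matched L) :
    pairA (L.map unitSplit) Q.lact = L := by
  rw [pairA, List.map_map]
  conv_rhs => rw [← List.map_id L]
  refine List.map_congr_left fun i hi => Prod.ext (flatL_unitSplit i.1) ?_
  simp only [Function.comp, unitSplit]
  rw [sndL_unitSplit, ← hL i hi, Q.one_lact_el]
  rfl

theorem kosSum_unitSplit (L : List (List P.El × Q.El)) : kosSum (L.map unitSplit) = 0 := by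
  rw [kosSum, List.map_map]
  refine List.sum_eq_zero fun x hx => ?_
  obtain ⟨i, _, rfl⟩ := List.mem_map.1 hx
  exact kos_unitSplit i.1

variable {S V W : DGColl R} {c : OdotMap Q.toDGColl S W} {e : OdotMap P.toDGColl W V}
  {lW : OdotMap O.toDGColl W W}

theorem balanced_in_slot (h₁ : LAssoc P.ract e lW e) (h₂ : LAssoc Q.lact c c lW)
    {l₁ l₂ : List (List P.El × Q.El)} (hl₁ : Matched l₁) (hl₂ : Matched l₂)
    {L : List (List P.El × O.El)} {y : Q.El} (hL : Matched L) (hy : y.ar = L.length)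
    (N : ℕ) (r : ℤ) (z : S.El) :
    sgn (kos (l₁ ++ (P.ract.elL L, y) :: l₂)) • e.L N r (flatL (l₁ ++ (P.ract.elL L, y) :: l₂))
        (c.el (sndL (l₁ ++ (P.ract.elL L, y) :: l₂)) z) =
      sgn (kos L) • sgn (kos (l₁ ++ (flatL L, Q.lact.el (sndL L) y) :: l₂)) •
        e.L N r (flatL (l₁ ++ (flatL L, Q.lact.el (sndL L) y) :: l₂))
          (c.el (sndL (l₁ ++ (flatL L, Q.lact.el (sndL L) y) :: l₂)) z) := by
  have hm : Matched₂ (l₁.map unitSplit ++ (L, y) :: l₂.map unitSplit) := by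
    intro i hi
    rcases List.mem_append.1 hi with hi | hi
    · exact matched₂_unitSplit hl₁ i hi
    · rcases List.mem_cons.1 hi with rfl | hi
      · exact ⟨hL, hy⟩
      · exact matched₂_unitSplit hl₂ i hi
  have key := pentagon_core h₂ h₁ hm N r z
  have hC : pairC (l₁.map unitSplit ++ (L, y) :: l₂.map unitSplit) P.ract =
      l₁ ++ (P.ract.elL L, y) :: l₂ := by
    rw [pairC, List.map_append, List.map_cons]
    exact congrArg₂ (· ++ ·) (pairC_unitSplit l₁) (congrArg _ (pairC_unitSplit l₂))
  have hA : pairA (l₁.map unitSplit ++ (L, y) :: l₂.map unitSplit) Q.lact =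
      l₁ ++ (flatL L, Q.lact.el (sndL L) y) :: l₂ := by
    rw [pairA, List.map_append, List.map_cons]
    exact congrArg₂ (· ++ ·) (pairA_unitSplit hl₁) (congrArg _ (pairA_unitSplit hl₂))
  have hK : kosSum (l₁.map unitSplit ++ (L, y) :: l₂.map unitSplit) = kos L := by
    have h₃ := kosSum_unitSplit l₁
    have h₄ := kosSum_unitSplit l₂
    simp only [kosSum, List.map_append, List.map_cons, List.sum_append, List.sum_cons] at *
    rw [h₃, h₄]
    ring
  rw [hC, hA, hK] at key
  rw [key, sgn_smul_smul]

/-- A tuple of generators of components of a tensor product. -/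
abbrev GenTuple (P : DGBimod A O) (Q : DGBimod O B) {k : ℕ} (n : Fin k → ℕ) (p : Fin k → ℤ) :
    Type u :=
  ∀ i, {s : List P.El × Q.El // Fits (n i) (p i) s.1 s.2}

/-- The list of a tuple of generators. -/
abbrev GenTuple.list {k : ℕ} {n : Fin k → ℕ} {p : Fin k → ℤ} (s : GenTuple P Q n p) :
    List (List P.El × Q.El) := List.ofFn fun i => (s i).1

theorem span_range_gen {D : DGColl R} {mk : OdotMap P.toDGColl Q.toDGColl D}
    (h : ∀ x : D.El, InSpan (IsGen mk) x) (n : ℕ) (p : ℤ) :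
    Submodule.span R (Set.range fun s : {s : List P.El × Q.El // Fits n p s.1 s.2} =>
      mk.L n p s.1.1 s.1.2) = ⊤ := by
  rw [eq_top_iff]
  intro x _
  refine Submodule.span_mono ?_ (h ⟨n, p, x⟩)
  rintro z ⟨xs, y, hy, hz⟩
  have h₁ : arSum xs = n := (congrArg DGColl.El.ar hz).symm
  have h₂ : degSum xs + y.deg = p := (congrArg DGColl.El.deg hz).symm
  exact ⟨⟨(xs, y), hy, h₁, h₂⟩, OdotMap.L_eq_of_el hz.symm⟩

theorem exists_elL_of_isGen {D : DGColl R} {mk : OdotMap P.toDGColl Q.toDGColl D} {l : List D.El}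
    (h : ∀ x ∈ l, IsGen mk x) : ∃ L, Matched L ∧ mk.elL L = l := by
  induction l with
  | nil => exact ⟨[], matched_nil, rfl⟩
  | cons x l ih =>
    obtain ⟨L, h₁, h₂⟩ := ih fun x hx => h x (by simp [hx])
    obtain ⟨xs, y, hy, hx⟩ := h x (by simp)
    exact ⟨(xs, y) :: L, Matched.cons.2 ⟨hy, h₁⟩, by rw [OdotMap.elL_cons, h₂, hx]⟩

theorem IsTensor.exists_ext {D : DGColl R} {mk : OdotMap P.toDGColl Q.toDGColl D}
    (h : IsTensor P Q mk) (h₁ : LAssoc P.ract e lW e) (h₂ : LAssoc Q.lact c c lW) :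
    ∃ b : OdotMap D S V, LAssoc mk b c e := by
  have key : ∀ (k N : ℕ) (q r : ℤ) (n : Fin k → ℕ) (p : Fin k → ℤ),
      ∃ f : MultilinearMap R (fun i => D.X (n i) (p i)) (S.X k q →ₗ[R] V.X N r),
        ∀ s : GenTuple P Q n p, f (fun i => mk.L (n i) (p i) (s i).1.1 (s i).1.2) =
          (sgn (kos s.list) • (c.el_el_linear (e.elLinear N r (flatL s.list)) (sndL s.list)
            k q).mk') := by
    intro k N q r n p
    refine exists_multilinear (fun i (s : {s : List P.El × Q.El // Fits (n i) (p i) s.1 s.2}) =>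
      mk.L (n i) (p i) s.1.1 s.1.2) (fun i => span_range_gen h.span (n i) (p i)) _ fun i s => ?_
    obtain ⟨l₁, l₂, hl, hl₁, hl₂⟩ := exists_ofFn_update_eq (fun j => (s j).1) i
    have hs : ∀ a, GenTuple.list (Function.update s i a : GenTuple P Q n p) =
        l₁ ++ a.1 :: l₂ := fun a => by
      rw [← hl a.1, GenTuple.list]
      congr 1
      funext j
      by_cases hj : j = i
      · subst hj; simp
      · simp [Function.update_of_ne hj]
    have hm₁ : Matched l₁ := fun b hb => by
      obtain ⟨j, rfl⟩ := hl₁ b hb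
      exact (s j).2.1
    have hm₂ : Matched l₂ := fun b hb => by
      obtain ⟨j, rfl⟩ := hl₂ b hb
      exact (s j).2.1
    obtain ⟨f, hf⟩ := h.lin (M := S.X k q →ₗ[R] V.X N r)
      (fun xs y => sgn (kos (l₁ ++ (xs, y) :: l₂)) •
        (c.el_el_linear (e.elLinear N r (flatL (l₁ ++ (xs, y) :: l₂)))
          (sndL (l₁ ++ (xs, y) :: l₂)) k q).mk')
      { slot := fun y m₁ m₂ a b =>
          { map_add := fun u v => LinearMap.ext fun z =>
              (assoc_right_slotLinear c e N r l₁ l₂ y ⟨k, q, z⟩ m₁ m₂ a b).map_add u v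
            map_smul := fun t u => LinearMap.ext fun z =>
              (assoc_right_slotLinear c e N r l₁ l₂ y ⟨k, q, z⟩ m₁ m₂ a b).map_smul t u }
        lin := fun xs a b =>
          { map_add := fun u v => LinearMap.ext fun z =>
              (assoc_right_elLinear c e N r l₁ l₂ xs ⟨k, q, z⟩ a b).map_add u v
            map_smul := fun t u => LinearMap.ext fun z =>
              (assoc_right_elLinear c e N r l₁ l₂ xs ⟨k, q, z⟩ a b).map_smul t u }
        balanced := fun L y hL hy => LinearMap.ext fun z =>
          balanced_in_slot h₁ h₂ hm₁ hm₂ hL hy N r ⟨k, q, z⟩ } (n i) (p i)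
    exact ⟨f, fun a => by rw [hf _ _ a.2, hs a]⟩
  choose f hf using key
  let b : OdotFam D S V := ⟨fun {k N q r} n p _ _ => f k N q r n p⟩
  have hb : ∀ (L : List (List P.El × Q.El)) (z : S.El) (N : ℕ) (r : ℤ), Matched L →
      z.ar = L.length → arSum (flatL L) = N → degSum (flatL L) + (degSum (sndL L) + z.deg) = r →
      b.L N r (mk.elL L) z = sgn (kos L) • e.L N r (flatL L) (c.el (sndL L) z) := by
    intro L z N r hL hz hN hr
    obtain ⟨k, q, z⟩ := z
    dsimp at hz hr
    subst hz
    let s : GenTuple P Q (fun i => arSum (L.get i).1)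
        (fun i => degSum (L.get i).1 + (L.get i).2.deg) :=
      fun i => ⟨L.get i, hL _ (L.get_mem i), rfl, rfl⟩
    have hs : s.list = L := List.ofFn_get L
    have h₃ := congrArg (fun g => g z) (hf L.length N q r _ _ s)
    have h₄ := b.app_eq_L (k := L.length) (N := N) (q := q) (r := r)
      (fun i => arSum (L.get i).1) (fun i => degSum (L.get i).1 + (L.get i).2.deg)
      (by rw [← mk.arSum_elL_eq_sum, mk.arSum_elL, hN])
      (by rw [← mk.degSum_elL_eq_sum, mk.degSum_elL, ← hr, add_assoc])
      (fun i => mk.L _ _ (s i).1.1 (s i).1.2) z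
    have h₅ : (List.ofFn fun i => (⟨arSum (L.get i).1, degSum (L.get i).1 + (L.get i).2.deg,
        mk.L _ _ (s i).1.1 (s i).1.2⟩ : D.El)) = mk.elL L := by
      conv_rhs => rw [← hs, OdotMap.elL, List.map_ofFn]
      rfl
    rw [h₅] at h₄
    rw [← h₄]
    refine h₃.trans ?_
    simp only [hs]
    rfl
  refine ⟨b.toOdotMap ?_, ?_⟩
  · intro N r r' hr' xs y hy hN hr
    have hφ : SlotLinear fun l => (V.d hr') (b.L N r l y) := (b.slotLinear N r y).map (V.d hr')
    have hψ : SlotLinear fun l => leib (b.L N r') l y :=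
      leib_slotLinear (fun y => b.slotLinear N r' y) y
    refine hφ.ext_of_inSpan hψ (fun x _ => h.span x) fun l' ht hl' => ?_
    obtain ⟨L, hL, rfl⟩ := exists_elL_of_isGen hl'
    have hz : y.ar = L.length := by rw [hy, ← ht.length, OdotMap.length_elL]
    have hN' : arSum (flatL L) = N := by rw [← hN, ← ht.arSum, OdotMap.arSum_elL]
    have hr₂ : degSum (flatL L) + (degSum (sndL L) + y.deg) = r := by
      rw [← hr, ← ht.degSum, OdotMap.degSum_elL, add_assoc]
    have hf' : Fits N r (mk.elL L) y := ⟨by simpa using hz, by simpa using hN',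
      by simpa [add_assoc] using hr₂⟩
    have h₃ : leib (b.L N r') (mk.elL L) y =
        sgn (kos L) • leib (e.L N r') (flatL L) (c.el (sndL L) y) := by
      refine mk.leib_assoc_L c _ _ (fun y => b.slotLinear N r' y) (e.elLinear N r')
        (fun L' z hL' hz' => ?_) hL hz
      by_cases hx : arSum (flatL L') = N ∧ degSum (flatL L') + (degSum (sndL L') + z.deg) = r'
      · exact hb L' z N r' hL' hz' hx.1 hx.2
      · rw [b.L_of_not, e.L_of_not, smul_zero]
        · exact fun h => hx h.2
        · exact fun h => hx (by simpa [add_assoc] using h.2)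
    rw [h₃, hb L y N r hL hz hN' hr₂, map_zsmul, e.leib_L hr' hL.length_flatL.symm hN' hr₂]
  · refine LAssoc.of_matched fun L z hL hz N r hN hr => hb L z N r hL hz hN hr

end Extension

end HUnital

namespace HUnital

variable {R : Type u} [CommRing R]

/-! The actions on a tensor product. -/

theorem exists_blocks_slot {α : Type*} {P : DGColl R} (xs : List P.El) (l₁ l₂ : List α)
    (h : l₁.length < arSum xs) : ∃ L₁ L₂ m₁ m₂ y, ∀ a,
      blocks (l₁ ++ a :: l₂) xs = L₁ ++ (m₁ ++ a :: m₂, y) :: L₂ := by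
  induction xs generalizing l₁ with
  | nil => simp at h
  | cons x xs ih =>
    by_cases hx : l₁.length < x.ar
    · obtain ⟨t, ht⟩ : ∃ t, x.ar = l₁.length + (t + 1) := ⟨x.ar - l₁.length - 1, by omega⟩
      refine ⟨[], blocks (l₂.drop t) xs, l₁, l₂.take t, x, fun a => ?_⟩
      simp [blocks, ht, List.take_append, List.drop_append,
        List.drop_eq_nil_of_le (show l₁.length ≤ l₁.length + (t + 1) by omega)]
    · rw [arSum_cons] at h
      obtain ⟨L₁, L₂, m₁, m₂, y, e⟩ := ih (l₁.drop x.ar) (by rw [List.length_drop]; omega)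
      refine ⟨(l₁.take x.ar, x) :: L₁, L₂, m₁, m₂, y, fun a => ?_⟩
      rw [blocks, List.take_append_of_le_length (by omega),
        List.drop_append_of_le_length (by omega), e a, List.cons_append]

section Left

variable {A O B : DGOperad R} {P : DGBimod A O} {Q : DGBimod O B}

theorem left_slotLinear {C S T : DGColl R} (a : OdotMap C S T) {M : Type*} [AddCommGroup M]
    [Module R M] {χ : List T.El → M} (hχ : SlotLinear χ) (L₁ L₂ : List (List C.El × S.El))
    (y : S.El) : SlotLinear fun X => sgn (kos (L₁ ++ (X, y) :: L₂)) •
      χ (a.elL (L₁ ++ (X, y) :: L₂)) := by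
  intro l₁ l₂ n p
  simp only [kos_slot]
  refine isLinearMap_smul ?_ _
  have := a.el_slot_linear (hχ.elLinear (a.elL L₁) (a.elL L₂)) y l₁ l₂ n p
  simpa using this

theorem left_elLinear {C S T : DGColl R} (a : OdotMap C S T) {M : Type*} [AddCommGroup M]
    [Module R M] {χ : List T.El → M} (hχ : SlotLinear χ) (L₁ L₂ : List (List C.El × S.El))
    (X : List C.El) : ElLinear fun y => sgn (kos (L₁ ++ (X, y) :: L₂)) •
      χ (a.elL (L₁ ++ (X, y) :: L₂)) := by
  intro k q
  have hk : ∀ y : S.X k q, kos (L₁ ++ (X, (⟨k, q, y⟩ : S.El)) :: L₂) =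
      kos (L₁ ++ (X, (⟨k, q, 0⟩ : S.El)) :: L₂) := fun y => by simp [kos_append, kos]
  simp only [hk]
  refine isLinearMap_smul ?_ _
  have := a.el_el_linear (hχ.elLinear (a.elL L₁) (a.elL L₂)) X k q
  simpa using this

/-- The blocks of a two level list. -/
def blocks₂ {C S T : DGColl R} : List C.El → List (List S.El × T.El) →
    List (List (List C.El × S.El) × T.El)
  | _, [] => []
  | l, i :: L => (blocks (l.take (arSum i.1)) i.1, i.2) :: blocks₂ (l.drop (arSum i.1)) L

section Blocks₂

variable {C S T : DGColl R}

theorem flatL_blocks₂ (l : List C.El) (L : List (List S.El × T.El)) :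
    flatL (blocks₂ l L) = blocks l (flatL L) := by
  induction L generalizing l with
  | nil => rfl
  | cons i L ih =>
    have h : flatL (i :: L) = i.1 ++ flatL L := rfl
    have h' : ∀ (xs : List S.El) (l l' : List C.El), l.take (arSum xs) = l'.take (arSum xs) →
        blocks l xs = blocks l' xs := by
      intro xs
      induction xs with
      | nil => intro l l' _; rfl
      | cons x xs ih =>
        intro l l' h
        rw [arSum_cons] at h
        have h₁ := congrArg (List.take x.ar) h
        have h₂ := congrArg (List.drop x.ar) h
        rw [List.take_take, List.take_take, min_eq_left (by omega)] at h₁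
        rw [List.drop_take, List.drop_take, Nat.add_sub_cancel_left] at h₂
        rw [blocks, blocks, h₁, ih _ _ h₂]
    rw [h, blocks_append, ← ih]
    rw [h' i.1 l (l.take (arSum i.1)) (by rw [List.take_take, min_self])]
    rfl

theorem pairB_blocks₂ (l : List C.El) (L : List (List S.El × T.El)) :
    pairB (blocks₂ l L) = L := by
  induction L generalizing l with
  | nil => rfl
  | cons i L ih =>
    rw [blocks₂, pairB, List.map_cons, ← pairB, ih]
    exact congrArg (· :: L) (Prod.ext (sndL_blocks _ _) rfl)

theorem matched₂_blocks₂ {l : List C.El} {L : List (List S.El × T.El)} (hL : Matched L)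
    (h : l.length = arSum (flatL L)) : Matched₂ (blocks₂ l L) := by
  induction L generalizing l with
  | nil => intro i hi; simp [blocks₂] at hi
  | cons i L ih =>
    rw [Matched.cons] at hL
    replace h : l.length = arSum i.1 + arSum (flatL L) := h.trans (arSum_append i.1 (flatL L))
    intro j hj
    rw [blocks₂, List.mem_cons] at hj
    rcases hj with rfl | hj
    · exact ⟨matched_blocks (by simp; omega), by simpa using hL.1⟩
    · exact ih hL.2 (by simp; omega) j hj

theorem pairA_blocks₂ {l : List C.El} {L : List (List S.El × T.El)} (qs : OdotMap S T S)
    (h : l.length = arSum (flatL L)) : pairA (blocks₂ l L) qs = blocks l (qs.elL L) := by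
  induction L generalizing l with
  | nil => rfl
  | cons i L ih =>
    replace h : l.length = arSum i.1 + arSum (flatL L) := h.trans (arSum_append i.1 (flatL L))
    rw [blocks₂, pairA, List.map_cons, ← pairA, ih (by simp; omega), OdotMap.elL_cons, blocks]
    refine congrArg (· :: _) (Prod.ext ?_ ?_)
    · exact flatL_blocks (by simp; omega)
    · exact congrArg (qs.el · i.2) (sndL_blocks _ _)

end Blocks₂

variable {D : DGColl R} {mk : OdotMap P.toDGColl Q.toDGColl D}

open Classical in
/-- The family that defines the left action on a tensor product. -/
noncomputable def leftFam (mk : OdotMap P.toDGColl Q.toDGColl D) (N : ℕ) (r : ℤ) (a : List A.El)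
    (xs : List P.El) (y : Q.El) : D.X N r :=
  if a.length = arSum xs then sgn (kos (blocks a xs)) • mk.L N r (P.lact.elL (blocks a xs)) y
  else 0

theorem leftFam_of_eq {N : ℕ} {r : ℤ} {a : List A.El} {xs : List P.El} {y : Q.El}
    (h : a.length = arSum xs) :
    leftFam mk N r a xs y = sgn (kos (blocks a xs)) • mk.L N r (P.lact.elL (blocks a xs)) y :=
  if_pos h

theorem leftFam_of_ne {N : ℕ} {r : ℤ} {a : List A.El} {xs : List P.El} {y : Q.El}
    (h : a.length ≠ arSum xs) : leftFam mk N r a xs y = 0 := if_neg h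

theorem leftFam_linModel (h : LAssoc P.ract mk Q.lact mk) (N : ℕ) (r : ℤ) (a : List A.El) :
    LinModel P Q (leftFam mk N r a) where
  slot y l₁ l₂ n p := by
    by_cases ha : a.length = arSum (l₁ ++ (⟨n, p, 0⟩ : P.El) :: l₂)
    · have h₁ := left_elLinear P.lact (mk.slotLinear N r y) (blocks a l₁)
        (blocks ((a.drop (arSum l₁)).drop n) l₂) ((a.drop (arSum l₁)).take n) n p
      refine isLinearMap_of_eq h₁ fun x => ?_
      change _ = leftFam mk N r a (l₁ ++ ⟨n, p, x⟩ :: l₂) y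
      rw [leftFam_of_eq (by simpa using ha), blocks_append, blocks]
    · exact isLinearMap_of_eq isLinearMap_zero fun x => (leftFam_of_ne (by simpa using ha)).symm
  lin xs n p := by
    by_cases ha : a.length = arSum xs
    · refine isLinearMap_of_eq (isLinearMap_smul (mk.elLinear N r (P.lact.elL (blocks a xs)) n p)
        (sgn (kos (blocks a xs)))) fun x => (leftFam_of_eq ha).symm
    · exact isLinearMap_of_eq isLinearMap_zero fun x => (leftFam_of_ne ha).symm
  balanced L z hL hz := by
    by_cases ha : a.length = arSum (flatL L)
    · have hm := matched₂_blocks₂ hL ha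
      have h₁ := pentagon_left (w := mk) (OdotMap.Assoc.lassoc P.comm) hm N r z
      have h₂ := h N r _ z (hm.pairC P.lact)
      have h₃ := kos_pentagon P.lact P.ract (blocks₂ a L)
      have h₄ : sndL (blocks₂ a L) = sndL L := by
        rw [← sndL_pairB, pairB_blocks₂]
      rw [h₁, flatL_pairC, sndL_pairC, h₄, flatL_blocks₂, pairA_blocks₂ _ ha] at h₂
      rw [pairA_blocks₂ _ ha, pairB_blocks₂, flatL_blocks₂] at h₃
      rw [leftFam_of_eq (by simpa using ha), leftFam_of_eq ha]
      apply sgn_smul_inj (a := kosSum (blocks₂ a L))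
      rw [smul_comm, h₂, sgn_smul_smul, sgn_smul_smul, sgn_smul_smul]
      congr 1
      refine sgn_eq_of_even ⟨kos (blocks a (P.ract.elL L)) - kos (blocks a (flatL L)), ?_⟩
      linear_combination -h₃
    · rw [leftFam_of_ne (by simpa using ha), leftFam_of_ne ha, smul_zero]

theorem leftFam_slotLinear (N : ℕ) (r : ℤ) (xs : List P.El) (y : Q.El) :
    SlotLinear fun a => leftFam mk N r a xs y := by
  intro l₁ l₂ n p
  by_cases ha : (l₁ ++ (⟨n, p, 0⟩ : A.El) :: l₂).length = arSum xs
  · obtain ⟨L₁, L₂, m₁, m₂, w, e⟩ := exists_blocks_slot (α := A.El) xs l₁ l₂ (by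
      simp at ha; omega)
    have h₁ := left_slotLinear P.lact (mk.slotLinear N r y) L₁ L₂ w m₁ m₂ n p
    refine isLinearMap_of_eq h₁ fun x => ?_
    change _ = leftFam mk N r (l₁ ++ ⟨n, p, x⟩ :: l₂) xs y
    rw [leftFam_of_eq (by simpa using ha), e]
  · exact isLinearMap_of_eq isLinearMap_zero fun x => (leftFam_of_ne (by simpa using ha)).symm

theorem IsTensor.exists_lact (h : IsTensor P Q mk) :
    ∃ l : OdotMap A.toDGColl D D, LAssoc P.lact mk mk l := by
  have key : ∀ (N : ℕ) (r : ℤ) (a : List A.El) (k : ℕ) (q : ℤ), ∃ f : D.X k q →ₗ[R] D.X N r,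
      ∀ xs y, Fits k q xs y → f (mk.L k q xs y) = leftFam mk N r a xs y := fun N r a k q =>
    h.lin _ (leftFam_linModel h.balanced N r a) k q
  choose f hf using key
  have h₂ : ∀ N r xs, ElLinear fun y : D.El => f N r xs y.ar y.deg y.val :=
    fun N r xs n p => (f N r xs n p).isLinear
  have h₁ : ∀ N r (y : D.El), SlotLinear fun xs => f N r xs y.ar y.deg y.val := by
    intro N r y l₁ l₂ n p
    have hs := span_range_gen h.span y.ar y.deg
    constructor
    · intro u v
      refine LinearMap.congr_fun (f := f N r _ y.ar y.deg) (g := f N r _ _ _ + f N r _ _ _)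
        (LinearMap.ext_on_range hs fun s => ?_) y.val
      rw [LinearMap.add_apply, hf _ _ _ _ _ _ _ s.2, hf _ _ _ _ _ _ _ s.2, hf _ _ _ _ _ _ _ s.2]
      exact (leftFam_slotLinear N r s.1.1 s.1.2 l₁ l₂ n p).map_add u v
    · intro c u
      refine LinearMap.congr_fun (f := f N r _ y.ar y.deg) (g := c • f N r _ _ _)
        (LinearMap.ext_on_range hs fun s => ?_) y.val
      rw [LinearMap.smul_apply, hf _ _ _ _ _ _ _ s.2, hf _ _ _ _ _ _ _ s.2]
      exact (leftFam_slotLinear N r s.1.1 s.1.2 l₁ l₂ n p).map_smul c u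
  let φ : ∀ N r, List A.El → D.El → D.X N r := fun N r xs y => f N r xs y.ar y.deg y.val
  have hφ : ∀ N r L z, Matched L → z.ar = L.length →
      mk.L N r (P.lact.elL L) z = sgn (kos L) • φ N r (flatL L) (mk.el (sndL L) z) := by
    intro N r L z hL hz
    have h₃ : φ N r (flatL L) (mk.el (sndL L) z) = leftFam mk N r (flatL L) (sndL L) z :=
      hf _ _ _ _ _ _ _ ⟨by simpa using hz, rfl, rfl⟩
    rw [h₃, leftFam_of_eq hL.length_flatL, blocks_flatL hL, sgn_smul_self]
  let b : OdotFam A.toDGColl D D := OdotFam.ofL φ h₁ h₂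
  have hb : ∀ {N r xs y}, Fits N r xs y → b.L N r xs y = φ N r xs y := fun h =>
    OdotFam.ofL_L h.1 h.2.1 h.2.2
  refine ⟨b.toOdotMap ?_, LAssoc.of_matched fun L z hL hz N r hN hr => ?_⟩
  · intro N r r' hr' xs y hy hN hr
    have h₃ : D.d hr' (φ N r xs y) = leib (φ N r') xs y := by
      refine ((h₂ N r xs).map (D.d hr')).ext_of_inSpan (leib_elLinear (h₂ N r') xs) (h.span y)
        fun y' h₃ h₄ h₅ => ?_
      obtain ⟨X, w, hw, rfl⟩ := h₅
      rw [OdotMap.el_ar] at h₃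
      rw [OdotMap.el_deg] at h₄
      have hX : xs.length = arSum X := by rw [← hy, h₃]
      have hL := matched_blocks hX
      have h₆ := sndL_blocks xs X
      have h₇ := flatL_blocks hX
      have h₈ := P.lact.leib_assoc_L mk (mk.L N r') (φ N r') (mk.slotLinear N r') (h₂ N r')
        (hφ N r') hL (z := w) (by simpa using hw)
      have h₉ := hφ N r (blocks xs X) w hL (by simpa using hw)
      rw [h₆, h₇] at h₈ h₉
      rw [mk.leib_L hr' (by simpa using hw) (by simpa [h₇] using hN)
        (by rw [OdotMap.degSum_elL, h₆, h₇, ← hr, ← h₄, add_assoc]), h₉, map_zsmul] at h₈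
      exact sgn_smul_inj h₈
    have hf' : Fits N r xs y := ⟨hy, hN, hr⟩
    change D.d hr' (b.L N r xs y) = leib (b.L N r') xs y
    rw [hb hf', h₃]
    subst hr'
    exact (leib_congr hf' fun l z hz => hb hz).symm
  · rw [hφ N r L z hL hz]
    refine congrArg _ (hb ⟨hL.length_flatL.symm, hN, hr⟩).symm

end Left

end HUnital

namespace HUnital

variable {R : Type u} [CommRing R]

/-! The tensor product of bimodules as a tensor product of modules. -/

theorem presentedBimod.induction {A B : DGOperad R} {G : ℕ → ℤ → Type u}
    {M : ∀ P : DGBimod A B, (∀ n p, G n p → P.X n p) → Prop}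
    (C : ∀ n p, Submodule R ((presentedBimod M).X n p))
    (hgen : ∀ n p (g : G n p), presentedBimod.gen M n p g ∈ C n p)
    (hd : ∀ n p q (h : p + 1 = q) x, x ∈ C n p → (presentedBimod M).d h x ∈ C n q)
    (hlact : ∀ (N : ℕ) (r : ℤ) (a : List A.El) (y : (presentedBimod M).El),
      y.val ∈ C y.ar y.deg → (presentedBimod M).lact.L N r a y ∈ C N r)
    (hract : ∀ (N : ℕ) (r : ℤ) (x : List (presentedBimod M).El) (b : B.El),
      (∀ y ∈ x, y.val ∈ C y.ar y.deg) → (presentedBimod M).ract.L N r x b ∈ C N r)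
    (x : (presentedBimod M).El) : x.val ∈ C x.ar x.deg := by
  obtain ⟨n, p, x⟩ := x
  induction x using Quotient.inductionOn with | _ t => ?_
  have cg : ∀ {n p} {x y : (presentedBimod M).X n p}, x = y → y ∈ C n p → x ∈ C n p := by
    rintro n p x _ rfl h
    exact h
  change BiQuot.mk t ∈ C n p
  induction t with
  | gen g => exact hgen _ _ g
  | @lact k N q r n p hN hr a y ih =>
    refine cg (BiQuot.ext_ev fun m => (BiQuot.lact_compat m n p hN hr a (BiQuot.mk y)).symm) ?_
    have h := hlact N r (List.ofFn fun i => ⟨n i, p i, a i⟩) ⟨k, q, BiQuot.mk y⟩ ih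
    exact cg ((presentedBimod M).lact.app_eq_L n p hN hr a (BiQuot.mk y)) h
  | @ract k N q r n p hN hr x b ih =>
    refine cg (BiQuot.ext_ev fun m =>
      (BiQuot.ract_compat m n p hN hr (fun i => BiQuot.mk (x i)) b).symm) ?_
    have h := hract N r (List.ofFn fun i => ⟨n i, p i, BiQuot.mk (x i)⟩) ⟨k, q, b⟩ fun y hy => by
      obtain ⟨i, rfl⟩ := List.mem_ofFn.1 hy
      exact ih i
    exact cg ((presentedBimod M).ract.app_eq_L n p hN hr (fun i => BiQuot.mk (x i)) b) h
  | @d n p q h x ih =>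
    exact cg (BiQuot.ext_ev fun m => (BiQuot.ev_d m h (BiQuot.mk x)).symm) (hd _ _ _ h _ ih)
  | zero => exact Submodule.zero_mem _
  | @add n p x y ihx ihy =>
    exact cg (BiQuot.ext_ev fun m => (map_add (BiQuot.ev m) (BiQuot.mk x) (BiQuot.mk y)).symm)
      (Submodule.add_mem _ ihx ihy)
  | @smul n p c x ih =>
    exact cg (BiQuot.ext_ev fun m => (map_smul (BiQuot.ev m) c (BiQuot.mk x)).symm)
      (Submodule.smul_mem _ c ih)

section Bimodule

variable {A O B : DGOperad R} {P : DGBimod A O} {Q : DGBimod O B} {D : DGColl R}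
  {mk : OdotMap P.toDGColl Q.toDGColl D}

theorem exists_pairC_of_isGen {S : DGColl R} {L : List (List D.El × S.El)} (hL : Matched L)
    (h : ∀ i ∈ L, ∀ x ∈ i.1, IsGen mk x) :
    ∃ LL : List (List (List P.El × Q.El) × S.El), Matched₂ LL ∧ pairC LL mk = L := by
  induction L with
  | nil => exact ⟨[], by intro i hi; simp at hi, rfl⟩
  | cons i L ih =>
    rw [Matched.cons] at hL
    obtain ⟨LL, h₁, h₂⟩ := ih hL.2 fun i hi => h i (by simp [hi])
    obtain ⟨M, h₃, h₄⟩ := exists_elL_of_isGen (h i (by simp))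
    refine ⟨(M, i.2) :: LL, fun j hj => ?_, ?_⟩
    · rcases List.mem_cons.1 hj with rfl | hj
      · refine ⟨h₃, ?_⟩
        rw [← mk.length_elL, h₄]
        exact hL.1
      · exact h₁ j hj
    · rw [pairC, List.map_cons, ← pairC, h₂, h₄]

theorem exists_pairA_of_isGen {L : List (List A.El × D.El)} (hL : Matched L)
    (h : ∀ i ∈ L, IsGen mk i.2) :
    ∃ LL : List (List (List A.El × P.El) × Q.El), Matched₂ LL ∧ pairA LL mk = L := by
  induction L with
  | nil => exact ⟨[], by intro i hi; simp at hi, rfl⟩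
  | cons i L ih =>
    rw [Matched.cons] at hL
    obtain ⟨LL, h₁, h₂⟩ := ih hL.2 fun i hi => h i (by simp [hi])
    obtain ⟨xs, y, h₃, h₄⟩ := h i (by simp)
    have h₅ : i.1.length = arSum xs := by rw [← hL.1, h₄, OdotMap.el_ar]
    refine ⟨(blocks i.1 xs, y) :: LL, fun j hj => ?_, ?_⟩
    · rcases List.mem_cons.1 hj with rfl | hj
      · exact ⟨matched_blocks h₅, by simpa using h₃⟩
      · exact h₁ j hj
    · rw [pairA, List.map_cons, ← pairA, h₂, flatL_blocks h₅, sndL_blocks, ← h₄]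

theorem linear_eq_of_inSpan {G : D.El → Prop} (h : ∀ x, InSpan G x) {n : ℕ} {p : ℤ} {M : Type*}
    [AddCommGroup M] [Module R M] {f g : D.X n p →ₗ[R] M} (hfg : ∀ x, G ⟨n, p, x⟩ → f x = g x)
    (x : D.X n p) : f x = g x := by
  have : Submodule.span R {y : D.X n p | G ⟨n, p, y⟩} ≤ LinearMap.eqLocus f g :=
    Submodule.span_le.2 hfg
  exact this (h ⟨n, p, x⟩)

theorem flatL_map_units (xs : List P.El) :
    flatL (xs.map fun x => (List.replicate x.ar A.oneEl, x)) =
      List.replicate (arSum xs) A.oneEl := by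
  induction xs with
  | nil => rfl
  | cons x xs ih =>
    rw [List.map_cons, flatL, List.flatMap_cons, arSum_cons, List.replicate_add]
    exact congrArg (_ ++ ·) ih

theorem kos_map_units (xs : List P.El) :
    kos (xs.map fun x => (List.replicate x.ar A.oneEl, x)) = 0 := by
  induction xs with
  | nil => rfl
  | cons x xs ih =>
    rw [List.map_cons, kos, ih, flatL_map_units]
    simp [degSum, DGOperad.oneEl]

theorem elL_map_units (xs : List P.El) :
    P.lact.elL (xs.map fun x => (List.replicate x.ar A.oneEl, x)) = xs := by
  rw [OdotMap.elL, List.map_map]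
  conv_rhs => rw [← List.map_id xs]
  exact List.map_congr_left fun x _ => P.one_lact_el x

theorem IsTensor.exists_bimod (h : IsTensor P Q mk) :
    ∃ (T : DGBimod A B) (t : OdotMap P.toDGColl Q.toDGColl T.toDGColl),
      IsBalanced P Q T t ∧ IsTensor P Q t := by
  obtain ⟨l, hl⟩ := h.exists_lact
  obtain ⟨ρ, hρ⟩ := h.exists_ext h.balanced (OdotMap.Assoc.lassoc Q.comm)
  have one_lact : ∀ (n : ℕ) (p : ℤ) (y : D.X n p),
      l.L n p (List.replicate n A.oneEl) ⟨n, p, y⟩ = y := fun n p => by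
    refine linear_eq_of_inSpan h.span (f := (l.elLinear n p _ n p).mk') (g := LinearMap.id)
      fun y hy => ?_
    obtain ⟨xs, w, hw, e⟩ := hy
    change _ = (⟨arSum xs, degSum xs + w.deg, mk.L _ _ xs w⟩ : D.El) at e
    cases e
    have := hl (arSum xs) (degSum xs + w.deg)
      (xs.map fun x => (List.replicate x.ar A.oneEl, x)) w fun i hi => by
        obtain ⟨x, _, rfl⟩ := List.mem_map.1 hi
        simp
    rw [elL_map_units, flatL_map_units, kos_map_units, sgn_zero, one_smul] at this
    refine Eq.trans ?_ this.symm
    simp only [sndL, List.map_map, Function.comp_def, List.map_id']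
    rfl
  have ract_one : ∀ (n : ℕ) (p : ℤ) (y : D.X n p), ρ.L n p [⟨n, p, y⟩] B.oneEl = y :=
      fun n p => by
    refine linear_eq_of_inSpan h.span (f := (ρ.slotLinear n p B.oneEl [] [] n p).mk')
      (g := LinearMap.id) fun y hy => ?_
    obtain ⟨xs, w, hw, e⟩ := hy
    change _ = (⟨arSum xs, degSum xs + w.deg, mk.L _ _ xs w⟩ : D.El) at e
    cases e
    have := hρ (arSum xs) (degSum xs + w.deg) [(xs, w)] B.oneEl fun i hi => by
      rw [List.mem_singleton.1 hi]
      exact hw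
    simp only [OdotMap.elL_cons, OdotMap.elL_nil, kos, flatL, List.flatMap_cons,
      List.flatMap_nil, List.append_nil, sndL, List.map_cons, List.map_nil, degSum_nil, mul_zero,
      add_zero, sgn_zero, one_smul, Q.ract_one_el] at this
    exact this
  have lassoc₁ : LAssoc A.mul l l l := by
    refine LAssoc.of_span₃ h.span fun N r L z hL hz hG => ?_
    obtain ⟨xs, y, hy, rfl⟩ := hG
    have hx : L.length = arSum xs := hz.symm
    have h₁ := flatL_blocks hx
    have h₂ := sndL_blocks L xs
    have hm : Matched₂ (blocks L xs) := fun i hi =>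
      ⟨fun j hj => hL j (by rw [← h₁]; exact List.mem_flatMap.2 ⟨i, hi, hj⟩),
        matched_blocks hx i hi⟩
    have := pentagon₅ (OdotMap.Assoc.lassoc P.lact_assoc) hl hl hl hm N r y
    rw [h₁, h₂] at this
    exact this
  have lassoc₂ : LAssoc ρ ρ B.mul ρ := by
    refine LAssoc.of_span₁ h.span fun N r L z hL hG => ?_
    obtain ⟨LL, hLL, rfl⟩ := exists_pairC_of_isGen hL hG
    exact pentagon₃ hρ (OdotMap.Assoc.lassoc Q.ract_assoc) hρ hρ hLL N r z
  have lassoc₃ : LAssoc l ρ ρ l := by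
    refine LAssoc.of_span₂ h.span fun N r L z hL hG => ?_
    obtain ⟨LL, hLL, rfl⟩ := exists_pairA_of_isGen hL hG
    exact pentagon₄ hl hρ hρ hl hLL N r z
  let T : DGBimod A B :=
    { toDGColl := D
      lact := l
      ract := ρ
      one_lact := fun {k q} y => by
        rw [l.app_eq_L, List.ofFn_const]
        exact one_lact k q y
      ract_one := fun {n p} x => by
        rw [ρ.app_eq_L, List.ofFn_const]
        exact ract_one n p x
      lact_assoc := lassoc₁.assoc
      ract_assoc := lassoc₂.assoc
      comm := lassoc₃.assoc }
  exact ⟨T, mk, ⟨h.balanced.assoc, hl.assoc, hρ.assoc⟩, h⟩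

/-- The image of an element. -/
def DGColl.Hom.el {P P' : DGColl R} (f : P.Hom P') (x : P.El) : P'.El := ⟨x.ar, x.deg, f.f x.val⟩

@[simp] theorem DGColl.Hom.el_ar {P P' : DGColl R} (f : P.Hom P') (x : P.El) :
    (f.el x).ar = x.ar := rfl

@[simp] theorem DGColl.Hom.el_deg {P P' : DGColl R} (f : P.Hom P') (x : P.El) :
    (f.el x).deg = x.deg := rfl

@[simp] theorem DGColl.Hom.arSum_map {P P' : DGColl R} (f : P.Hom P') (l : List P.El) :
    arSum (l.map f.el) = arSum l := by
  simp [arSum, Function.comp_def]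

@[simp] theorem DGColl.Hom.degSum_map {P P' : DGColl R} (f : P.Hom P') (l : List P.El) :
    degSum (l.map f.el) = degSum l := by
  simp [degSum, Function.comp_def]

theorem DGColl.Hom.map_L {P Q S P' Q' S' : DGColl R} {t : OdotMap P Q S} {t' : OdotMap P' Q' S'}
    {f : P.Hom P'} {g : Q.Hom Q'} {h : S.Hom S'} (H : t.Compat t' f g h) (N : ℕ) (r : ℤ)
    (xs : List P.El) (y : Q.El) : h.f (t.L N r xs y) =
      t'.L N r (xs.map f.el) (g.el y) := by
  by_cases hf : Fits N r xs y
  · obtain ⟨k, q, y⟩ := y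
    obtain ⟨hy, hN, hr⟩ := hf
    dsimp at hy hr
    obtain ⟨e, rfl⟩ : ∃ e : Fin k → P.El, xs = List.ofFn e :=
      ⟨fun i => xs.get (i.cast hy), (ofFn_get_cast _ _).symm⟩
    have h₁ := H (fun i => (e i).ar) (fun i => (e i).deg) (by rw [← arSum_ofFn, hN])
      (by rw [← degSum_ofFn, hr]) (fun i => (e i).val) y
    rw [t.app_eq_L, t'.app_eq_L] at h₁
    rw [List.map_ofFn]
    exact h₁
  · rw [t.L_of_not hf, map_zero, t'.L_of_not]
    simpa [Fits] using hf

theorem relTensor.isTensor (P : DGBimod A O) (Q : DGBimod O B) :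
    IsTensor P Q (relTensor.mk P Q) := by
  obtain ⟨T, t, h, hT⟩ := (TensorTot.isTensor (P := P) (Q := Q)).exists_bimod
  have hl := OdotMap.Assoc.lassoc (relTensor.isBalanced P Q).left
  have hρ := OdotMap.Assoc.lassoc (relTensor.isBalanced P Q).right
  refine ⟨OdotMap.Assoc.lassoc (relTensor.isBalanced P Q).balanced, ?_, ?_⟩
  · have key : ∀ xs y N r, IsGen (relTensor.mk P Q) ⟨N, r, (relTensor.mk P Q).L N r xs y⟩ ∨
        (relTensor.mk P Q).L N r xs y = 0 := by
      intro xs y N r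
      by_cases hf : Fits N r xs y
      · refine Or.inl ⟨xs, y, hf.1, ?_⟩
        rw [(relTensor.mk P Q).el_eq hf.2.1 hf.2.2]
      · exact Or.inr ((relTensor.mk P Q).L_of_not hf)
    let C : ∀ n p, Submodule R ((relTensor P Q).X n p) := fun n p => Submodule.span R
      {y | IsGen (relTensor.mk P Q) ⟨n, p, y⟩}
    have key : ∀ xs y N r, (relTensor.mk P Q).L N r xs y ∈ C N r := fun xs y N r => by
      rcases key xs y N r with h | h
      · exact Submodule.subset_span h
      · rw [h]; exact Submodule.zero_mem _
    refine presentedBimod.induction C ?_ ?_ ?_ ?_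
    · rintro N r ⟨k, q, n, p, hN, hr, x, y⟩
      have := key (List.ofFn fun i => ⟨n i, p i, x i⟩) ⟨k, q, y⟩ N r
      rwa [← OdotMap.app_eq_L (hN := hN) (hr := hr)] at this
    · intro n p q h x hx
      have : C n p ≤ (C n q).comap ((relTensor P Q).d h) := by
        refine Submodule.span_le.2 ?_
        rintro y ⟨xs, w, hw, e⟩
        change _ = (⟨arSum xs, degSum xs + w.deg, (relTensor.mk P Q).L _ _ xs w⟩ :
          (relTensor P Q).El) at e
        cases e
        change (relTensor P Q).d h _ ∈ C _ _
        rw [(relTensor.mk P Q).leibniz_L h hw rfl rfl]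
        exact add_mem (key _ _ _ _) (zsmul_mem (dsum_mem fun l _ _ _ => key _ _ _ _) _)
      exact this hx
    · intro N r a y hy
      refine ((relTensor P Q).lact.elLinear N r a).mem_of_inSpan (x := y)
        (G := IsGen (relTensor.mk P Q)) hy fun z h₁ h₂ h₃ => ?_
      obtain ⟨xs, w, hw, rfl⟩ := h₃
      by_cases ha : a.length = arSum xs
      · have := hl N r (blocks a xs) w (matched_blocks ha)
        rw [flatL_blocks ha, sndL_blocks] at this
        have h₃ := key (P.lact.elL (blocks a xs)) w N r
        rw [this] at h₃
        rw [← sgn_smul_self (kos (blocks a xs)) ((relTensor P Q).lact.L N r a _)]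
        exact zsmul_mem h₃ _
      · rw [OdotMap.L_of_not]
        · exact zero_mem _
        · exact fun h => ha h.1.symm
    · intro N r x b hx
      refine ((relTensor P Q).ract.slotLinear N r b).mem_of_inSpan (l := x)
        (G := IsGen (relTensor.mk P Q)) hx fun l h₁ h₂ => ?_
      obtain ⟨L, hL, rfl⟩ := exists_elL_of_isGen h₂
      rw [hρ N r L b hL]
      exact zsmul_mem (key _ _ _ _) _
  · intro M _ _ f hf N r
    obtain ⟨g, hg⟩ := hT.lin f hf N r
    refine ⟨g.comp (relTensor.lift t h).f, fun xs y hxy => ?_⟩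
    rw [← hg xs y hxy, LinearMap.comp_apply]
    have := DGColl.Hom.map_L (t := relTensor.mk P Q) (t' := t) (f := .id _) (g := .id _)
      (h := (relTensor.lift t h).toHom) (fun n p hN hr x y => rfl) N r xs y
    refine congrArg g (this.trans ?_)
    exact congrArg (t.L N r · y) (List.map_id xs)

end Bimodule

end HUnital

namespace HUnital

variable {R : Type u} [CommRing R]

/-! Extensionality of morphisms and the associativity isomorphism. -/

theorem DGBimod.Hom.ext_f {A B : DGOperad R} {P Q : DGBimod A B} {f g : P.Hom Q}
    (h : ∀ n p (x : P.X n p), f.f x = g.f x) : f = g := by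
  obtain ⟨⟨f, _⟩, _, _⟩ := f
  obtain ⟨⟨g, _⟩, _, _⟩ := g
  have : @f = @g := by
    funext n p
    exact LinearMap.ext (h n p)
  subst this
  rfl

theorem DGBimod.Hom.compat_lact {A B : DGOperad R} {P Q : DGBimod A B} (f : P.Hom Q) :
    P.lact.Compat Q.lact (.id _) f.toHom f.toHom := fun n p hN hr a y => f.map_lact n p hN hr a y

theorem DGBimod.Hom.compat_ract {A B : DGOperad R} {P Q : DGBimod A B} (f : P.Hom Q) :
    P.ract.Compat Q.ract f.toHom (.id _) f.toHom := fun n p hN hr x b => f.map_ract n p hN hr x b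

@[simp] theorem DGColl.Hom.el_id (P : DGColl R) : (DGColl.Hom.id P).el = _root_.id := rfl

theorem DGBimod.Hom.map_lact_L {A B : DGOperad R} {P Q : DGBimod A B} (f : P.Hom Q) (N : ℕ) (r : ℤ)
    (a : List A.El) (y : P.El) : f.f (P.lact.L N r a y) = Q.lact.L N r a (f.el y) := by
  have := DGColl.Hom.map_L f.compat_lact N r a y
  simpa using this

theorem DGBimod.Hom.map_ract_L {A B : DGOperad R} {P Q : DGBimod A B} (f : P.Hom Q) (N : ℕ) (r : ℤ)
    (x : List P.El) (b : B.El) : f.f (P.ract.L N r x b) = Q.ract.L N r (x.map f.el) b := by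
  have := DGColl.Hom.map_L f.compat_ract N r x b
  simpa using this

theorem presentedBimod.hom_ext {A B : DGOperad R} {G : ℕ → ℤ → Type u}
    {M : ∀ P : DGBimod A B, (∀ n p, G n p → P.X n p) → Prop} {T : DGBimod A B}
    {f g : (presentedBimod M).Hom T}
    (h : ∀ n p (s : G n p), f.f (presentedBimod.gen M n p s) = g.f (presentedBimod.gen M n p s)) :
    f = g := by
  refine DGBimod.Hom.ext_f fun n p x => ?_
  refine presentedBimod.induction (fun n p => LinearMap.eqLocus (f.f (n := n) (p := p)) g.f) h
    ?_ ?_ ?_ ⟨n, p, x⟩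
  · intro n p q hq x (hx : f.f x = g.f x)
    change f.f _ = g.f _
    rw [f.map_d, g.map_d, hx]
  · intro N r a y (hy : f.f y.val = g.f y.val)
    change f.f _ = g.f _
    rw [f.map_lact_L, g.map_lact_L]
    exact congrArg (T.lact.L N r a) (congrArg (DGColl.El.mk _ _) hy)
  · intro N r x b hx
    change f.f _ = g.f _
    rw [f.map_ract_L, g.map_ract_L]
    exact congrArg (T.ract.L N r · b) (List.map_congr_left fun y hy =>
      congrArg (DGColl.El.mk _ _) (hx y hy))

namespace relTensor

section

variable {A O B : DGOperad R} {P : DGBimod A O} {Q : DGBimod O B}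

theorem mk_mem {N : ℕ} {r : ℤ} {x : (relTensor P Q).X N r} (h : IsGen (mk P Q) ⟨N, r, x⟩) :
    ∃ xs y, Fits N r xs y ∧ x = (mk P Q).L N r xs y := by
  obtain ⟨xs, y, hy, e⟩ := h
  change _ = (⟨arSum xs, degSum xs + y.deg, (mk P Q).L _ _ xs y⟩ : (relTensor P Q).El) at e
  cases e
  exact ⟨xs, y, ⟨hy, rfl, rfl⟩, rfl⟩

theorem linear_ext {N : ℕ} {r : ℤ} {M : Type*} [AddCommGroup M] [Module R M]
    {f g : (relTensor P Q).X N r →ₗ[R] M}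
    (h : ∀ xs y, Fits N r xs y → f ((mk P Q).L N r xs y) = g ((mk P Q).L N r xs y)) : f = g := by
  refine LinearMap.ext fun x => linear_eq_of_inSpan (isTensor P Q).span (fun x hx => ?_) x
  obtain ⟨xs, y, hf, rfl⟩ := mk_mem hx
  exact h xs y hf

theorem hom_ext {T : DGBimod A B} {f g : (relTensor P Q).Hom T}
    (h : ∀ N r xs y, Fits N r xs y → f.f ((mk P Q).L N r xs y) = g.f ((mk P Q).L N r xs y)) :
    f = g :=
  DGBimod.Hom.ext_f fun N r x => LinearMap.congr_fun (linear_ext (h N r)) x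

theorem lift_L {T : DGBimod A B} (t : OdotMap P.toDGColl Q.toDGColl T.toDGColl)
    (h : IsBalanced P Q T t) (N : ℕ) (r : ℤ) (xs : List P.El) (y : Q.El) :
    (lift t h).f ((mk P Q).L N r xs y) = t.L N r xs y := by
  have := DGColl.Hom.map_L (t := mk P Q) (t' := t) (f := .id _) (g := .id _)
    (h := (lift t h).toHom) (fun n p hN hr x y => rfl) N r xs y
  simpa using this

theorem map_L {P' : DGBimod A O} {Q' : DGBimod O B} (f : P.Hom P') (g : Q.Hom Q') (N : ℕ) (r : ℤ)
    (xs : List P.El) (y : Q.El) :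
    (map f g).f ((mk P Q).L N r xs y) = (mk P' Q').L N r (xs.map f.el) (g.el y) :=
  DGColl.Hom.map_L (t := mk P Q) (t' := mk P' Q') (f := f.toHom) (g := g.toHom)
    (h := (map f g).toHom) (fun _ _ _ _ _ _ => rfl) N r xs y

theorem leftUnitor_L (P : DGBimod O B) (N : ℕ) (r : ℤ) (xs : List O.regular.El) (y : P.El) :
    (leftUnitor P).f ((mk O.regular P).L N r xs y) = P.lact.L N r xs y := lift_L _ _ N r xs y

theorem rightUnitor_L (P : DGBimod A O) (N : ℕ) (r : ℤ) (xs : List P.El) (y : O.regular.El) :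
    (rightUnitor P).f ((mk P O.regular).L N r xs y) = P.ract.L N r xs y := lift_L _ _ N r xs y

end

section Associator

variable {O₀ O₁ O₂ O₃ : DGOperad R} (P : DGBimod O₀ O₁) (Q : DGBimod O₁ O₂) (S : DGBimod O₂ O₃)

theorem exists_associator :
    ∃ a : (relTensor (relTensor P Q) S).Hom (relTensor P (relTensor Q S)),
      ∀ N r (L : List (List P.El × Q.El)) (z : S.El), Matched L →
        a.f ((mk (relTensor P Q) S).L N r ((mk P Q).elL L) z) =
          sgn (kos L) • (mk P (relTensor Q S)).L N r (flatL L) ((mk Q S).el (sndL L) z) := by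
  have bal := fun {A O B : DGOperad R} (P : DGBimod A O) (Q : DGBimod O B) =>
    OdotMap.Assoc.lassoc (isBalanced P Q).balanced
  have left := fun {A O B : DGOperad R} (P : DGBimod A O) (Q : DGBimod O B) =>
    OdotMap.Assoc.lassoc (isBalanced P Q).left
  have right := fun {A O B : DGOperad R} (P : DGBimod A O) (Q : DGBimod O B) =>
    OdotMap.Assoc.lassoc (isBalanced P Q).right
  obtain ⟨b, hb⟩ := (isTensor P Q).exists_ext (bal P (relTensor Q S)) (left Q S)
  have hs := (isTensor P Q).span
  have h : IsBalanced (relTensor P Q) S (relTensor P (relTensor Q S)) b := by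
    refine ⟨LAssoc.assoc ?_, LAssoc.assoc ?_, LAssoc.assoc ?_⟩
    · refine LAssoc.of_span₁ hs fun N r L z hL hG => ?_
      obtain ⟨LL, hLL, rfl⟩ := exists_pairC_of_isGen hL hG
      exact pentagon₃ (right P Q) (bal Q S) hb hb hLL N r z
    · refine LAssoc.of_span₂ hs fun N r L z hL hG => ?_
      obtain ⟨LL, hLL, rfl⟩ := exists_pairA_of_isGen hL hG
      exact pentagon₄ (left P Q) hb hb (left P (relTensor Q S)) hLL N r z
    · refine LAssoc.of_span₁ hs fun N r L z hL hG => ?_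
      obtain ⟨LL, hLL, rfl⟩ := exists_pairC_of_isGen hL hG
      exact pentagon₃ hb (right Q S) (right P (relTensor Q S)) hb hLL N r z
  exact ⟨lift b h, fun N r L z hL => by rw [lift_L, hb N r L z hL]⟩

variable {P Q S}

theorem isAssociator_of_L {a : (relTensor (relTensor P Q) S).Hom (relTensor P (relTensor Q S))}
    (h : ∀ N r (L : List (List P.El × Q.El)) (z : S.El), Matched L →
      a.f ((mk (relTensor P Q) S).L N r ((mk P Q).elL L) z) =
        sgn (kos L) • (mk P (relTensor Q S)).L N r (flatL L) ((mk Q S).el (sndL L) z)) :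
    IsAssociator a := by
  intro k N q r n p m s hN hr x y z
  obtain ⟨h₁, h₂⟩ := assoc_aux (a := mk P Q) (b := mk (relTensor P Q) S) (c := mk Q S)
    (e := mk P (relTensor Q S)) n p m s hN hr x y z _ rfl
  rw [h₁, h₂]
  refine h _ _ _ _ fun i hi => ?_
  rw [List.mem_ofFn] at hi
  obtain ⟨j, rfl⟩ := hi
  simp

end Associator

end relTensor

end HUnital

namespace HUnital

variable {R : Type u} [CommRing R]

/-! The complexes of multilinear maps. -/

/-- A complex as a collection that does not depend on the arity. -/
def Cplx.coll (A : Cplx R) : DGColl R where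
  X _ p := A.X p
  d h := A.d h
  d_d h h' x := A.d_d h h' x

theorem Cplx.cast_cast (A : Cplx R) {p q r : ℤ} (h : p = q) (h' : q = r) (x : A.X p) :
    A.cast h' (A.cast h x) = A.cast (h.trans h') x := by
  subst h h'; rfl

theorem Cplx.cast_rfl (A : Cplx R) {p : ℤ} (h : p = p) (x : A.X p) : A.cast h x = x := rfl

theorem Cplx.cast_d (A : Cplx R) {p q p' q' : ℤ} (h : p + 1 = q) (hp : p = p') (hq : q = q')
    (h' : p' + 1 = q') (x : A.X p) : A.cast hq (A.d h x) = A.d h' (A.cast hp x) := by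
  subst hp hq; rfl

theorem Cplx.coll_cast (A : Cplx R) {n m : ℕ} {p q : ℤ} (hn : n = m) (hp : p = q) (x : A.X p) :
    A.coll.cast hn hp x = A.cast hp x := by
  subst hn hp; rfl

theorem Cplx.coll_dAt (A : Cplx R) {k : ℕ} {n : Fin k → ℕ} {p : Fin k → ℤ} (i : Fin k)
    (x : ∀ j, A.X (p j)) (j : Fin k) :
    DGColl.dAt A.coll (n := n) i x j = A.dAt i j (x j) := by
  unfold DGColl.dAt Cplx.dAt
  split
  · rfl
  · exact A.coll_cast _ _ _

namespace HOM

variable {A B C D : Cplx R}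

theorem component_apply {n : ℕ} {p r : ℤ} (f : HOM A B n p) (s : Fin n → ℤ)
    (h : ∑ a, s a + p = r) (x : ∀ a, A.X (s a)) : component f s h x = B.cast h (f s x) := rfl

theorem ext_component {n : ℕ} {p : ℤ} {f g : HOM A B n p}
    (h : ∀ s r (hr : ∑ a, s a + p = r) x, component f s hr x = component g s hr x) : f = g :=
  funext fun s => MultilinearMap.ext fun x => h s _ rfl x

theorem component_add {n : ℕ} {p r : ℤ} (f g : HOM A B n p) (s : Fin n → ℤ)
    (h : ∑ a, s a + p = r) (x : ∀ a, A.X (s a)) :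
    component (f + g) s h x = component f s h x + component g s h x := map_add (B.cast h) _ _

theorem component_smul {n : ℕ} {p r : ℤ} (c : R) (f : HOM A B n p) (s : Fin n → ℤ)
    (h : ∑ a, s a + p = r) (x : ∀ a, A.X (s a)) :
    component (c • f) s h x = c • component f s h x := map_smul (B.cast h) _ _

/-- The Leibniz rule for the evaluation. -/
theorem component_d {n : ℕ} {p q r r' : ℤ} (f : HOM A B n p) (hq : p + 1 = q) (s : Fin n → ℤ)
    (hr : ∑ a, s a + p = r) (hr' : r + 1 = r') (x : ∀ a, A.X (s a)) :
    B.d hr' (component f s hr x) =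
      component (HOM.d hq f) s (by rw [← hr', ← hr, ← hq, add_assoc]) x +
      ∑ i, sgn (p + ∑ j, if i < j then s j else 0) •
        component f (dDeg s i) (by rw [sum_dDeg, ← hr', ← hr]; ring)
          (fun j => A.dAt i j (x j)) := by
  subst hr hq
  rw [← sub_eq_iff_eq_add, component_apply, component_apply]
  simp only [HOM.d]
  rw [sub_apply, smul_apply, sum_apply]
  simp only [smul_apply, map_sub, map_zsmul, map_sum, Finset.smul_sum, sgn_smul_smul]
  congr 1
  · exact (B.cast_d _ rfl _ hr' _).symm
  · refine Finset.sum_congr rfl fun i _ => ?_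
    congr 1
    exact (B.cast_cast _ _ _).symm

theorem component_d_eq {n : ℕ} {p q r : ℤ} (f : HOM A B n p) (hq : p + 1 = q) (s : Fin n → ℤ)
    (hr : ∑ a, s a + q = r) (x : ∀ a, A.X (s a)) :
    component (HOM.d hq f) s hr x =
      B.d (by rw [← hr, ← hq, add_assoc]) (component f s rfl x) -
      ∑ i, sgn (p + ∑ j, if i < j then s j else 0) •
        component f (dDeg s i) (by rw [sum_dDeg, ← hr, ← hq]; ring) (fun j => A.dAt i j (x j)) :=
  eq_sub_of_add_eq (component_d f hq s rfl _ x).symm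

theorem d_add {n : ℕ} {p q : ℤ} (h : p + 1 = q) (f g : HOM A B n p) :
    HOM.d h (f + g) = HOM.d h f + HOM.d h g := by
  refine ext_component fun s r hr x => ?_
  rw [component_add, component_d_eq, component_d_eq, component_d_eq]
  simp only [component_add, map_add, smul_add, Finset.sum_add_distrib]
  abel

theorem d_smul {n : ℕ} {p q : ℤ} (h : p + 1 = q) (c : R) (f : HOM A B n p) :
    HOM.d h (c • f) = c • HOM.d h f := by
  refine ext_component fun s r hr x => ?_
  rw [component_smul, component_d_eq, component_d_eq, smul_sub, Finset.smul_sum]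
  simp only [component_smul, map_smul]
  refine congrArg _ (Finset.sum_congr rfl fun i _ => smul_comm _ _ _)

/-- The maps as a collection with zero differential. -/
def graded (A B : Cplx R) : DGColl R where
  X n p := HOM A B n p
  d _ := 0
  d_d _ _ _ := rfl

/-- The evaluation. -/
def evApp {k : ℕ} {q r : ℤ} (p : Fin k → ℤ) (hr : ∑ i, p i + q = r) :
    MultilinearMap R (fun i => A.X (p i)) (HOM A B k q →ₗ[R] B.X r) where
  toFun x :=
    { toFun := fun f => component f p hr x
      map_add' := fun f g => component_add f g p hr x
      map_smul' := fun c f => component_smul c f p hr x }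
  map_update_add' x i u v := LinearMap.ext fun f => (component f p hr).map_update_add x i u v
  map_update_smul' x i c v := LinearMap.ext fun f => (component f p hr).map_update_smul x i c v

/-- The evaluation as a family of multilinear maps. -/
def ev₀ (A B : Cplx R) : OdotFam A.coll (graded A B) B.coll where
  app _ p _ hr := evApp p hr

theorem ev₀_leibniz {k : ℕ} {q : ℤ} (f : HOM A B k q) {N : ℕ} {r r' : ℤ} (h : r + 1 = r')
    {xs : List A.coll.El} (hy : k = xs.length) (hN : arSum xs = N) (hr : degSum xs + q = r) :
    B.coll.d h ((ev₀ A B).L N r xs ⟨k, q, f⟩) = (ev₀ A B).L N r' xs ⟨k, q + 1, HOM.d rfl f⟩ +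
      sgn q • dsum (fun l => (ev₀ A B).L N r' l ⟨k, q, f⟩) xs := by
  refine (ev₀ A B).leibniz_L (y := f) (y' := HOM.d rfl f) (fun n p hN hr hr' x => ?_) h hy hN hr
  refine (component_d f rfl p hr hr' x).trans ?_
  refine congrArg _ (Finset.sum_congr rfl fun i _ => congrArg _ ?_)
  exact congrArg (component f (dDeg p i) _) (funext fun j => (A.coll_dAt i x j).symm)

theorem ext_ev₀ {n : ℕ} {p : ℤ} {f g : HOM A B n p}
    (h : ∀ N r xs, n = xs.length → arSum xs = N → degSum xs + p = r →
      (ev₀ A B).L N r xs ⟨n, p, f⟩ = (ev₀ A B).L N r xs ⟨n, p, g⟩) : f = g := by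
  refine ext_component fun s r hr x => ?_
  have := h 0 r (List.ofFn fun i => ⟨0, s i, x i⟩) (by simp) (by simp [arSum_ofFn])
    (by rw [degSum_ofFn, hr])
  rw [← (ev₀ A B).app_eq_L (fun _ => 0) s (by simp) hr x f,
    ← (ev₀ A B).app_eq_L (fun _ => 0) s (by simp) hr x g] at this
  exact this

theorem d_d {n : ℕ} {p q r : ℤ} (h : p + 1 = q) (h' : q + 1 = r) (f : HOM A B n p) :
    HOM.d h' (HOM.d h f) = 0 := by
  subst h h'
  refine ext_ev₀ fun N r xs hn hN hr => ?_
  have hz : (ev₀ A B).L N r xs ⟨n, p + 1 + 1, 0⟩ = 0 := ((ev₀ A B).elLinear N r xs n _).map_zero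
  refine Eq.trans ?_ hz.symm
  have h₁ := ev₀_leibniz (HOM.d rfl f) (r := degSum xs + (p + 1)) (r' := r)
    (by rw [← hr]; ring) hn hN rfl
  have h₂ := ev₀_leibniz f (r := degSum xs + p) (r' := degSum xs + (p + 1)) (by ring) hn hN rfl
  have h₃ := congrArg (B.coll.d (n := N) (q := r) (by rw [← hr]; ring)) h₂
  rw [B.coll.d_d, map_add, h₁, map_zsmul] at h₃
  have h₄ : B.coll.d (q := r) (by rw [← hr]; ring)
      (dsum (fun l => (ev₀ A B).L N (degSum xs + (p + 1)) l ⟨n, p, f⟩) xs) =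
      dsum (fun l => (ev₀ A B).L N r l ⟨n, p + 1, HOM.d rfl f⟩ +
        sgn p • dsum (fun l => (ev₀ A B).L N r l ⟨n, p, f⟩) l) xs := by
    refine (dsum_linear (B.coll.d _) _ xs).trans ?_
    refine dsum_congr fun l e₁ e₂ e₃ => ?_
    exact ev₀_leibniz f _ (hn.trans e₃.symm) (e₁.trans hN) (by rw [e₂]; ring)
  rw [h₄, dsum_add, dsum_smul, dsum_dsum ((ev₀ A B).slotLinear N r ⟨n, p, f⟩), sgn_add] at h₃
  simpa using h₃.symm

/-- The complexes of multilinear maps as a collection. -/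
def coll (A B : Cplx R) : DGColl R where
  X n p := HOM A B n p
  d h := { toFun := HOM.d h, map_add' := d_add h, map_smul' := d_smul h }
  d_d h h' f := d_d h h' f

/-- The evaluation `(a₁, …, aₖ, f) ↦ (a₁ ⊗ ⋯ ⊗ aₖ) f`. -/
def ev (A B : Cplx R) : OdotMap A.coll (coll A B) B.coll where
  app _ p _ hr := evApp p hr
  leibniz n p hN hr hr' x f := by
    refine (component_d f rfl p hr hr' x).trans ?_
    refine congrArg _ (Finset.sum_congr rfl fun i _ => congrArg _ ?_)
    exact congrArg (component f (dDeg p i) _) (funext fun j => (A.coll_dAt i x j).symm)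

theorem ext_ev {n : ℕ} {p : ℤ} {f g : HOM A B n p}
    (h : ∀ N r xs, n = xs.length → arSum xs = N → degSum xs + p = r →
      (ev A B).L N r xs ⟨n, p, f⟩ = (ev A B).L N r xs ⟨n, p, g⟩) : f = g := by
  refine ext_component fun s r hr x => ?_
  have := h 0 r (List.ofFn fun i => ⟨0, s i, x i⟩) (by simp) (by simp [arSum_ofFn])
    (by rw [degSum_ofFn, hr])
  rw [← (ev A B).app_eq_L (fun _ => 0) s (by simp) hr x f,
    ← (ev A B).app_eq_L (fun _ => 0) s (by simp) hr x g] at this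
  exact this

theorem component_comp {k N : ℕ} {q r t : ℤ} (n : Fin k → ℕ) (p : Fin k → ℤ)
    (hN : ∑ i, n i = N) (hr : ∑ i, p i + q = r) (x : ∀ i, HOM A B (n i) (p i))
    (y : HOM B C k q) (s : Fin N → ℤ) (ht : ∑ a, s a + r = t) (a : ∀ b, A.X (s b)) :
    component (HOM.comp n p hN hr x y) s ht a =
      sgn (koszul (fun i j => s (blockEquiv hN ⟨i, j⟩)) p) •
        component y (fun i => ∑ j, s (blockEquiv hN ⟨i, j⟩) + p i)
          (by rw [Finset.sum_add_distrib, sum_blockEquiv, ← ht, ← hr]; ring)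
          (fun i => x i (fun j => s (blockEquiv hN ⟨i, j⟩)) fun j => a (blockEquiv hN ⟨i, j⟩)) := by
  rw [component_apply]
  simp only [HOM.comp]
  rw [smul_apply, map_zsmul]
  refine congrArg _ ?_
  exact C.cast_cast _ _ _

theorem comp_update {k N : ℕ} {n : Fin k → ℕ} {p : Fin k → ℤ} [DecidableEq (Fin k)]
    (hN : ∑ i, n i = N) (x : ∀ i, HOM A B (n i) (p i)) (s : Fin N → ℤ) (a : ∀ b, A.X (s b))
    (i : Fin k) (w : HOM A B (n i) (p i)) : (fun j => Function.update x i w j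
        (fun l => s (blockEquiv hN ⟨j, l⟩)) fun l => a (blockEquiv hN ⟨j, l⟩)) =
      Function.update (fun j => x j (fun l => s (blockEquiv hN ⟨j, l⟩))
        fun l => a (blockEquiv hN ⟨j, l⟩)) i
        (w (fun l => s (blockEquiv hN ⟨i, l⟩)) fun l => a (blockEquiv hN ⟨i, l⟩)) :=
  funext fun j => Function.apply_update (fun j (z : HOM A B (n j) (p j)) =>
    z (fun l => s (blockEquiv hN ⟨j, l⟩)) fun l => a (blockEquiv hN ⟨j, l⟩)) x i w j

/-- The composition as a multilinear map. -/
def compApp {k N : ℕ} {q r : ℤ} (n : Fin k → ℕ) (p : Fin k → ℤ) (hN : ∑ i, n i = N)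
    (hr : ∑ i, p i + q = r) :
    MultilinearMap R (fun i => HOM A B (n i) (p i)) (HOM B C k q →ₗ[R] HOM A C N r) where
  toFun x :=
    { toFun := fun y => HOM.comp n p hN hr x y
      map_add' := fun y z => ext_component fun s t ht a => by
        rw [component_add]
        simp only [component_comp, component_add, smul_add]
      map_smul' := fun c y => ext_component fun s t ht a => by
        rw [RingHom.id_apply, component_smul]
        simp only [component_comp, component_smul]
        exact smul_comm _ _ _ }
  map_update_add' x i u v := LinearMap.ext fun y => ext_component fun s t ht a => by
    change component (HOM.comp n p hN hr (Function.update x i (u + v)) y) s ht a =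
      component (HOM.comp n p hN hr (Function.update x i u) y +
        HOM.comp n p hN hr (Function.update x i v) y) s ht a
    rw [component_add, component_comp, component_comp, component_comp, comp_update, comp_update,
      comp_update, ← smul_add]
    exact congrArg _ ((component y _ _).map_update_add _ i _ _)
  map_update_smul' x i c v := LinearMap.ext fun y => ext_component fun s t ht a => by
    change component (HOM.comp n p hN hr (Function.update x i (c • v)) y) s ht a =
      component (c • HOM.comp n p hN hr (Function.update x i v) y) s ht a
    rw [component_smul, component_comp, component_comp, comp_update, comp_update, smul_comm c]
    exact congrArg _ ((component y _ _).map_update_smul _ i _ _)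

/-- The composition as a family of multilinear maps. -/
def compFam (A B C : Cplx R) : OdotFam (coll A B) (coll B C) (coll A C) where
  app n p hN hr := compApp n p hN hr

theorem ev_L_ofFn {k N : ℕ} {q r : ℤ} (e : Fin k → A.coll.El) (f : HOM A B k q)
    (hN : arSum (List.ofFn e) = N) (hr : ∑ i, (e i).deg + q = r) :
    (ev A B).L N r (List.ofFn e) ⟨k, q, f⟩ =
      component f (fun i => (e i).deg) hr fun i => (e i).val :=
  ((ev A B).fam.E_eq_L e f (by rw [← arSum_ofFn, hN]) hr).symm

theorem ev_comp (N : ℕ) (r : ℤ) {L : List (List A.coll.El × (coll A B).El)}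
    {z : (coll B C).El} (hL : Matched L) (hz : z.ar = L.length) :
    (ev B C).L N r ((ev A B).elL L) z = sgn (kos L) • (ev A C).L N r (flatL L)
      ⟨arSum (sndL L), degSum (sndL L) + z.deg, (compFam A B C).L _ _ (sndL L) z⟩ := by
  obtain ⟨k, q, z⟩ := z
  dsimp only at hz
  subst hz
  by_cases hf : arSum (flatL L) = N ∧ degSum (flatL L) + degSum (sndL L) + q = r
  · obtain ⟨hN, hr⟩ := hf
    obtain ⟨y, x, e⟩ := hL.exists_ofFn
    generalize L.length = k at y x z e
    subst e
    have hk : kos (List.ofFn fun i => (List.ofFn (x i), y i)) = _ := kos_ofFn _ x y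
    have hF := flatL_ofFn _ x y
    have hS : sndL (List.ofFn fun i => (List.ofFn (x i), y i)) = List.ofFn y := by
      simp [List.map_ofFn, Function.comp_def]
    rw [hF, hS] at hr
    rw [hF] at hN
    rw [hk, hF, hS]
    have h₁ : (ev A B).elL (List.ofFn fun i => (List.ofFn (x i), y i)) =
        List.ofFn fun i => ⟨∑ j, (x i j).ar, ∑ j, (x i j).deg + (y i).deg,
          component (y i).val (fun j => (x i j).deg) rfl fun j => (x i j).val⟩ := by
      rw [OdotMap.elL, List.map_ofFn]
      congr 1
      funext i
      exact (ev A B).el_ofFn (fun j => (x i j).ar) (fun j => (x i j).deg) rfl rfl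
        (fun j => (x i j).val) (y i).val
    have h₂ : ∀ N' r' (hN' : ∑ i, (y i).ar = N') (hr' : ∑ i, (y i).deg + q = r'),
        (⟨N', r', (compFam A B C).L N' r' (List.ofFn y) ⟨k, q, z⟩⟩ : (coll A C).El) =
          ⟨∑ i, (y i).ar, ∑ i, (y i).deg + q,
            HOM.comp (fun i => (y i).ar) (fun i => (y i).deg) rfl rfl (fun i => (y i).val) z⟩ := by
      rintro _ _ rfl rfl
      rw [← (compFam A B C).E_eq_L y z rfl rfl]
      rfl
    have hr₁ : ∑ i, (∑ j, (x i j).deg + (y i).deg) + q = r := by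
      rw [← hr, degSum_ofFn, degSum_ofFn, sum_flat fun i j => (x i j).deg,
        Finset.sum_add_distrib]
    let w (i : Fin k) (j : Fin (y i).ar) : A.coll.El :=
      x (finSigmaFinEquiv.symm (blockEquiv (n := fun i => (y i).ar) rfl ⟨i, j⟩)).1
        (finSigmaFinEquiv.symm (blockEquiv (n := fun i => (y i).ar) rfl ⟨i, j⟩)).2
    have hw : w = x := funext fun i => funext fun j => by
      have e : finSigmaFinEquiv.symm (blockEquiv (n := fun i => (y i).ar) rfl ⟨i, j⟩) =
        ⟨i, j⟩ := finSigmaFinEquiv.symm_apply_apply _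
      simp only [w]
      rw [e]
    have hr₂ : ∑ i, (∑ j, (w i j).deg + (y i).deg) + q = r := by
      simp only [w]
      rw [Finset.sum_add_distrib, sum_blockEquiv (n := fun i => (y i).ar) rfl fun a =>
        (x (finSigmaFinEquiv.symm a).1 (finSigmaFinEquiv.symm a).2).deg,
        sum_flat fun i j => (x i j).deg, ← Finset.sum_add_distrib, hr₁]
    rw [h₁, h₂ _ _ (arSum_ofFn y).symm (by rw [degSum_ofFn]),
      ev_L_ofFn _ z (by rw [arSum_ofFn, ← hN, arSum_ofFn, sum_flat fun i j => (x i j).ar]) hr₁,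
      ev_L_ofFn _ _ hN (by
        rw [← hr₁, sum_flat fun i j => (x i j).deg, Finset.sum_add_distrib, add_assoc])]
    have key : ∀ (w : ∀ i, Fin (y i).ar → A.coll.El) (_ : w = x)
        (h : ∑ i, (∑ j, (w i j).deg + (y i).deg) + q = r),
        component z (fun i => ∑ j, (x i j).deg + (y i).deg) hr₁ (fun i =>
          component (y i).val (fun j => (x i j).deg) rfl fun j => (x i j).val) =
        sgn (koszul (fun i j => (x i j).deg) fun i => (y i).deg) •
          sgn (koszul (fun i j => (w i j).deg) fun i => (y i).deg) •
          component z (fun i => ∑ j, (w i j).deg + (y i).deg) h fun i =>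
            (y i).val (fun j => (w i j).deg) fun j => (w i j).val := by
      rintro _ rfl h
      rw [sgn_smul_self]
      rfl
    have h₃ := component_comp (A := A) (B := B) (C := C) (fun i => (y i).ar)
      (fun i => (y i).deg) rfl rfl (fun i => (y i).val) z
      (fun a => (x (finSigmaFinEquiv.symm a).1 (finSigmaFinEquiv.symm a).2).deg) (t := r)
      (by rw [← hr₁, sum_flat fun i j => (x i j).deg, Finset.sum_add_distrib, add_assoc])
      fun a => (x (finSigmaFinEquiv.symm a).1 (finSigmaFinEquiv.symm a).2).val
    refine Eq.trans ?_ (congrArg _ h₃.symm)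
    exact key w hw hr₂
  · rw [(ev B C).L_of_not, (ev A C).L_of_not, smul_zero]
    · rintro ⟨_, h₁, h₂⟩
      exact hf ⟨h₁, by rw [← h₂, add_assoc]⟩
    · rintro ⟨_, h₁, h₂⟩
      exact hf ⟨by rw [← h₁, OdotMap.arSum_elL], by rw [← h₂, OdotMap.degSum_elL]⟩

/-- The composition. -/
def compMap (A B C : Cplx R) : OdotMap (coll A B) (coll B C) (coll A C) :=
  (compFam A B C).toOdotMap <| by
    intro N r r' h ys z hz hN hr
    subst h hN hr
    refine ext_ev fun N r xs hxs hN hr => ?_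
    obtain ⟨L, hL, rfl, rfl⟩ : ∃ L : List (List A.coll.El × (coll A B).El), Matched L ∧
        flatL L = xs ∧ sndL L = ys :=
      ⟨blocks xs ys, matched_blocks hxs.symm, flatL_blocks hxs.symm, sndL_blocks _ _⟩
    have hz' : z.ar = L.length := by rw [hz, List.length_map]
    have h₁ := leib_assoc (ev A B) ((ev B C).L N r) ((ev A C).L N r)
      (fun z => (ev B C).slotLinear N r z) (fun xs => (ev A C).elLinear N r xs)
      (fun N r l z => (compFam A B C).L N r l z) (fun L z hL hz => ev_comp N r hL hz) hL hz'
    have hr' : degSum (flatL L) + (degSum (sndL L) + z.deg) + 1 = r := by rw [← hr]; ring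
    rw [(ev B C).leib_L (r := degSum (flatL L) + (degSum (sndL L) + z.deg)) hr'
      (by rw [hz', OdotMap.length_elL]) (by rw [OdotMap.arSum_elL, hN])
      (by rw [OdotMap.degSum_elL, add_assoc]), ev_comp N _ hL hz', map_zsmul] at h₁
    have h₂ := sgn_smul_inj h₁
    rw [(ev A C).leibniz_L hr' hxs hN rfl] at h₂
    exact add_right_cancel h₂

theorem lassoc_comp (A B C : Cplx R) :
    LAssoc (ev A B) (ev B C) (compMap A B C) (ev A C) :=
  LAssoc.of_matched fun L z hL hz N r _ _ => ev_comp N r hL hz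

theorem assoc_comp (A B C D : Cplx R) :
    LAssoc (compMap A B C) (compMap A C D) (compMap B C D) (compMap A B D) :=
  LAssoc.of_matched (h := by
    intro L z hL _ N r hN hr
    refine ext_ev fun N' r' xs hxs hN' hr' => ?_
    have hxs' : xs.length = arSum (flatL L) := by rw [← hxs, hN]
    have h := pentagon₂ (lassoc_comp A B C) (lassoc_comp B C D) (lassoc_comp A C D)
      (lassoc_comp A B D) (matched₂_blocks₂ hL hxs') N' r' z
    rw [flatL_blocks₂, pairB_blocks₂, flatL_blocks hxs'] at h
    rw [OdotMap.el_eq (N := N) (r := r) _ (by rw [OdotMap.arSum_elL, hN])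
      (by rw [OdotMap.degSum_elL, ← hr, add_assoc]), OdotMap.el_eq (N := N) (r := r) _ hN hr] at h
    refine h.trans ?_
    exact ((ev A D).L_sgn_smul N' r' xs _ _).symm)

end HOM

end HUnital

namespace HUnital

variable {R : Type u} [CommRing R]

/-! Bimodules of multilinear maps and convolution. -/

namespace HOM

variable {A B : Cplx R}

theorem ev_one (x : A.coll.El) : (ev A A).el [x] ⟨1, 0, HOM.one A⟩ = x := by
  obtain ⟨n, p, x⟩ := x
  rw [OdotMap.el_eq (N := n) (r := p) _ (by simp) (by simp)]
  refine congrArg (DGColl.El.mk n p) ?_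
  refine (ev_L_ofFn (fun _ : Fin 1 => (⟨n, p, x⟩ : A.coll.El)) (HOM.one A) (N := n) (r := p)
    (by simp) (by simp)).trans ?_
  exact A.cast_cast _ _ _

theorem one_comp {k : ℕ} {q : ℤ} (y : HOM A B k q) :
    HOM.comp (fun _ => 1) (fun _ => 0) (by simp) (by simp) (fun _ : Fin k => HOM.one A) y = y := by
  refine ext_ev fun N r xs hxs hN hr => ?_
  have h := lassoc_comp A A B N r
    (xs.map fun x => (([x], ⟨1, 0, HOM.one A⟩) : List A.coll.El × (coll A A).El)) ⟨k, q, y⟩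
    (fun i hi => by
      obtain ⟨x, _, rfl⟩ := List.mem_map.1 hi
      rfl)
  have h₁ : (ev A A).elL (xs.map fun x =>
      (([x], ⟨1, 0, HOM.one A⟩) : List A.coll.El × (coll A A).El)) = xs := by
    rw [OdotMap.elL, List.map_map]
    exact (List.map_congr_left fun x _ => ev_one x).trans (List.map_id xs)
  have h₂ : kos (xs.map fun x =>
      (([x], ⟨1, 0, HOM.one A⟩) : List A.coll.El × (coll A A).El)) = 0 := by
    clear hxs hN hr h h₁
    induction xs with
    | nil => rfl
    | cons x xs ih => simp [kos, ih]
  have h₃ : flatL (xs.map fun x =>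
      (([x], ⟨1, 0, HOM.one A⟩) : List A.coll.El × (coll A A).El)) = xs := by
    simp [flatL, List.flatMap_map]
  have h₄ : sndL (xs.map fun x =>
      (([x], ⟨1, 0, HOM.one A⟩) : List A.coll.El × (coll A A).El)) =
        List.ofFn fun _ : Fin k => ⟨1, 0, HOM.one A⟩ := by
    rw [sndL, List.map_map, List.ofFn_const, hxs]
    simp [Function.comp_def]
  rw [h₁, h₂, h₃, h₄, sgn_zero, one_smul, OdotMap.el_eq (N := k) (r := q) _ (by rw [arSum_ofFn]; simp)
    (by rw [degSum_ofFn]; simp)] at h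
  refine Eq.trans ?_ h.symm
  refine congrArg (fun z => (ev A B).L N r xs ⟨k, q, z⟩) ?_
  exact (compMap A A B).app_eq_L (fun _ => 1) (fun _ => 0) (by simp) (by simp) _ y

theorem comp_one {n : ℕ} {p : ℤ} (x : HOM A B n p) :
    HOM.comp (fun _ : Fin 1 => n) (fun _ => p) (by simp) (by simp) (fun _ => x) (HOM.one B) = x := by
  refine ext_ev fun N r xs hxs hN hr => ?_
  have h := lassoc_comp A B B N r [(xs, ⟨n, p, x⟩)] ⟨1, 0, HOM.one B⟩ (by simpa [Matched] using hxs)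
  rw [OdotMap.elL_cons, OdotMap.elL_nil, OdotMap.el_eq _ hN hr,
    OdotMap.L_eq_of_el (ev_one _)] at h
  have h₁ : (compMap A B B).el (sndL [(xs, (⟨n, p, x⟩ : (coll A B).El))]) ⟨1, 0, HOM.one B⟩ =
      ⟨n, p, HOM.comp (fun _ : Fin 1 => n) (fun _ => p) (by simp) (by simp) (fun _ => x)
        (HOM.one B)⟩ :=
    (compMap A B B).el_ofFn (fun _ : Fin 1 => n) (fun _ => p) (by simp) (by simp) (fun _ => x)
      (HOM.one B)
  rw [h₁] at h
  simpa [kos] using h.symm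

end HOM

variable {O : DGOperad R}

/-- The structure map of an algebra. -/
def OpAlg.hom (A : OpAlg O) : O.toDGColl.Hom (HOM.coll A.toCplx A.toCplx) where
  f := A.act
  map_d h x := A.act_d h x

/-- The bimodule of multilinear maps between two algebras. -/
abbrev OpAlg.homBimod (A B : OpAlg O) : DGBimod O O where
  toDGColl := HOM.coll A.toCplx B.toCplx
  lact := (HOM.compMap A.toCplx A.toCplx B.toCplx).pre A.hom (.id _)
  ract := (HOM.compMap A.toCplx B.toCplx B.toCplx).pre (.id _) B.hom
  one_lact y := by
    refine Eq.trans ?_ (HOM.one_comp y)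
    exact congrArg (fun w => HOM.comp (fun _ => 1) (fun _ => 0) (by simp) (by simp) w y)
      (funext fun _ => A.act_one)
  ract_one {n p} x := by
    refine Eq.trans ?_ (HOM.comp_one x)
    exact congrArg (fun w => HOM.comp (fun _ : Fin 1 => n) (fun _ => p) (by simp) (by simp)
      (fun _ => x) w) B.act_one
  lact_assoc n p m s hN hr x y z := by
    refine Eq.trans ?_ ((HOM.assoc_comp A.toCplx A.toCplx A.toCplx B.toCplx).assoc n p m s hN hr
      (fun i j => A.act (x i j)) (fun i => A.act (y i)) z)
    exact congrArg (fun w => HOM.comp _ _ hN hr w z) (funext fun i => A.act_mul _ _ rfl rfl _ _)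
  ract_assoc n p m s hN hr x y z := by
    refine ((HOM.assoc_comp A.toCplx B.toCplx B.toCplx B.toCplx).assoc n p m s hN hr
      x (fun i => B.act (y i)) (B.act z)).trans (congrArg _ ?_)
    exact congrArg (fun w => (HOM.compMap A.toCplx B.toCplx B.toCplx).app (flat m) (flat s)
      (by rw [sum_flat, hN]) (by rw [sum_flat, ← hr, Finset.sum_add_distrib, add_assoc])
      (flat x) w)
      (B.act_mul n p rfl rfl y z).symm
  comm n p m s hN hr x y z :=
    (HOM.assoc_comp A.toCplx A.toCplx B.toCplx B.toCplx).assoc n p m s hN hr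
      (fun i j => A.act (x i j)) y (B.act z)

/-- An algebra map as a bimodule morphism. -/
def AlgMap.hom {F : DGBimod O O} {A B : OpAlg O} (g : AlgMap F A B) : F.Hom (A.homBimod B) where
  f := g.g
  map_d h x := g.map_d h x
  map_lact n p hN hr a y := g.map_lact n p hN hr a y
  map_ract n p hN hr x b := g.map_ract n p hN hr x b

/-- A bimodule morphism as an algebra map. -/
def AlgMap.ofHom {F : DGBimod O O} {A B : OpAlg O} (g : F.Hom (A.homBimod B)) : AlgMap F A B where
  g := g.f
  map_d h x := g.map_d h x
  map_lact n p hN hr a y := g.map_lact n p hN hr a y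
  map_ract n p hN hr x b := g.map_ract n p hN hr x b

theorem AlgMap.ext_g {F : DGBimod O O} {A B : OpAlg O} {g h : AlgMap F A B}
    (H : ∀ n p (x : F.X n p), g.g x = h.g x) : g = h := by
  obtain ⟨g, _, _, _⟩ := g
  obtain ⟨h, _, _, _⟩ := h
  obtain rfl : @g = @h := by
    funext n p
    exact LinearMap.ext (H n p)
  rfl

section MapPair

variable {P Q S P' Q' S' : DGColl R} (f : P.Hom P') (g : Q.Hom Q')

/-- The list of the `(f(X), g(y))`. -/
def mapPair (L : List (List P.El × Q.El)) : List (List P'.El × Q'.El) :=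
  L.map fun i => (i.1.map f.el, g.el i.2)

theorem flatL_mapPair (L : List (List P.El × Q.El)) :
    flatL (mapPair f g L) = (flatL L).map f.el := by
  simp [mapPair, flatL, List.flatMap_map, List.map_flatMap]

theorem sndL_mapPair (L : List (List P.El × Q.El)) :
    sndL (mapPair f g L) = (sndL L).map g.el := by simp [mapPair, Function.comp_def]

theorem kos_mapPair (L : List (List P.El × Q.El)) : kos (mapPair f g L) = kos L := by
  induction L with
  | nil => rfl
  | cons i L ih =>
    change _ * degSum (flatL (mapPair f g L)) + kos (mapPair f g L) = _
    rw [ih, flatL_mapPair]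
    simp [kos]

theorem Matched.mapPair {L : List (List P.El × Q.El)} (hL : Matched L) :
    Matched (mapPair f g L) := fun i hi => by
  obtain ⟨j, hj, rfl⟩ := List.mem_map.1 hi
  simpa using hL j hj

variable {f g} {t : OdotMap P Q S} {t' : OdotMap P' Q' S'} {h : S.Hom S'}

theorem DGColl.Hom.el_map_el (H : t.Compat t' f g h) (xs : List P.El) (y : Q.El) :
    h.el (t.el xs y) = t'.el (xs.map f.el) (g.el y) := by
  refine Eq.trans ?_ (OdotMap.el_eq (N := arSum xs) (r := degSum xs + y.deg) _ (by simp)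
    (by simp)).symm
  exact congrArg (DGColl.El.mk _ _) (DGColl.Hom.map_L H _ _ xs y)

theorem DGColl.Hom.map_elL (H : t.Compat t' f g h) (L : List (List P.El × Q.El)) :
    (t.elL L).map h.el = t'.elL (HUnital.mapPair f g L) := by
  simp only [OdotMap.elL, HUnital.mapPair, List.map_map]
  exact List.map_congr_left fun i _ => DGColl.Hom.el_map_el H i.1 i.2

end MapPair

/-- The composite `P ⊙ Q → HOM(A, B) ⊙ HOM(B, C) → HOM(A, C)`. -/
noncomputable def convHom {P Q : DGBimod O O} {A B C : OpAlg O} (g : P.Hom (A.homBimod B))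
    (h : Q.Hom (B.homBimod C)) : (relTensor P Q).Hom (A.homBimod C) :=
  relTensor.lift ((HOM.compMap A.toCplx B.toCplx C.toCplx).pre g.toHom h.toHom)
    { balanced := fun n p m s hN hr x y z => by
        refine Eq.trans ?_ (((HOM.assoc_comp A.toCplx B.toCplx B.toCplx C.toCplx).assoc n p m s
          hN hr (fun i j => g.f (x i j)) (fun i => B.act (y i)) (h.f z)).trans (congrArg _ ?_))
        · exact congrArg (fun w => HOM.comp _ _ hN hr w (h.f z))
            (funext fun i => g.map_ract _ _ rfl rfl _ _)
        · exact congrArg (fun w => (HOM.compMap A.toCplx B.toCplx C.toCplx).app (flat m) (flat s)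
            (by rw [sum_flat, hN]) (by rw [sum_flat, ← hr, Finset.sum_add_distrib, add_assoc])
            (fun a => g.f (flat x a)) w)
            (h.map_lact n p rfl rfl y z).symm
      left := fun n p m s hN hr x y z => by
        refine Eq.trans ?_ ((HOM.assoc_comp A.toCplx A.toCplx B.toCplx C.toCplx).assoc n p m s
          hN hr (fun i j => A.act (x i j)) (fun i => g.f (y i)) (h.f z))
        exact congrArg (fun w => HOM.comp _ _ hN hr w (h.f z))
            (funext fun i => g.map_lact _ _ rfl rfl _ _)
      right := fun n p m s hN hr x y z => by
        refine ((HOM.assoc_comp A.toCplx B.toCplx C.toCplx C.toCplx).assoc n p m s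
          hN hr (fun i j => g.f (x i j)) (fun i => h.f (y i)) (C.act z)).trans (congrArg _ ?_)
        exact congrArg (fun w => (HOM.compMap A.toCplx B.toCplx C.toCplx).app (flat m) (flat s)
            (by rw [sum_flat, hN]) (by rw [sum_flat, ← hr, Finset.sum_add_distrib, add_assoc])
            (fun a => g.f (flat x a)) w)
            (h.map_ract n p rfl rfl y z).symm }

theorem convHom_L {P Q : DGBimod O O} {A B C : OpAlg O} (g : P.Hom (A.homBimod B))
    (h : Q.Hom (B.homBimod C)) (N : ℕ) (r : ℤ) (xs : List P.El) (y : Q.El) :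
    (convHom g h).f ((relTensor.mk P Q).L N r xs y) =
      (HOM.compMap A.toCplx B.toCplx C.toCplx).L N r (xs.map g.el) (h.el y) :=
  (relTensor.lift_L _ _ N r xs y).trans
    (DGColl.Hom.map_L (t := (HOM.compMap A.toCplx B.toCplx C.toCplx).pre g.toHom h.toHom)
      (t' := HOM.compMap A.toCplx B.toCplx C.toCplx) (f := g.toHom) (g := h.toHom)
      (h := .id _) (fun _ _ _ _ _ _ => rfl) N r xs y)

theorem convHom_map {P Q P' Q' : DGBimod O O} {A B C : OpAlg O} (u : P'.Hom P) (w : Q'.Hom Q)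
    (g : P.Hom (A.homBimod B)) (h : Q.Hom (B.homBimod C)) :
    convHom (u.comp g) (w.comp h) = (relTensor.map u w).comp (convHom g h) := by
  refine relTensor.hom_ext fun N r xs y _ => ?_
  refine (convHom_L _ _ N r xs y).trans ?_
  refine Eq.trans ?_ (congrArg (convHom g h).f (relTensor.map_L u w N r xs y)).symm
  rw [convHom_L]
  refine congrArg (fun l => (HOM.compMap A.toCplx B.toCplx C.toCplx).L N r l _) ?_
  exact (List.map_map (f := u.el) (g := g.el) (l := xs)).symm

/-- The composite `P ⊙ Q → S → S'`. -/
def OdotMap.post {P Q S S' : DGColl R} (t : OdotMap P Q S) (f : S.Hom S') : OdotMap P Q S' where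
  app n p hN hr := (LinearMap.compRight R f.f).compMultilinearMap (t.app n p hN hr)
  leibniz n p hN hr hr' x y := by
    refine (f.map_d hr' _).symm.trans ?_
    rw [t.leibniz n p hN hr hr' x y, map_add, map_sum]
    simp only [map_zsmul]
    rfl

theorem OdotMap.post_L {P Q S S' : DGColl R} (t : OdotMap P Q S) (f : S.Hom S') (N : ℕ) (r : ℤ)
    (xs : List P.El) (y : Q.El) : (t.post f).L N r xs y = f.f (t.L N r xs y) := by
  have := DGColl.Hom.map_L (t := t) (t' := t.post f) (f := .id _) (g := .id _) (h := f)
    (fun _ _ _ _ _ _ => rfl) N r xs y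
  simpa using this.symm

theorem relTensor.IsAssociator.map_L {O₀ O₁ O₂ O₃ : DGOperad R} {P : DGBimod O₀ O₁}
    {Q : DGBimod O₁ O₂} {S : DGBimod O₂ O₃}
    {a : (relTensor (relTensor P Q) S).Hom (relTensor P (relTensor Q S))} (ha : IsAssociator a)
    (N : ℕ) (r : ℤ) {L : List (List P.El × Q.El)} (z : S.El) (hL : Matched L) :
    a.f ((mk (relTensor P Q) S).L N r ((mk P Q).elL L) z) =
      sgn (kos L) • (mk P (relTensor Q S)).L N r (flatL L) ((mk Q S).el (sndL L) z) := by
  have h : OdotMap.Assoc (mk P Q) ((mk (relTensor P Q) S).post a.toHom) (mk Q S)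
      (mk P (relTensor Q S)) := ha
  rw [← h.lassoc N r L z hL, OdotMap.post_L]

theorem relTensor.hom_ext₂ {O₀ O₁ O₂ O₃ : DGOperad R} {P : DGBimod O₀ O₁}
    {Q : DGBimod O₁ O₂} {S : DGBimod O₂ O₃} {T : DGBimod O₀ O₃}
    {f g : (relTensor (relTensor P Q) S).Hom T}
    (h : ∀ N r L z, Matched L → z.ar = L.length → f.f ((mk (relTensor P Q) S).L N r ((mk P Q).elL L) z) =
      g.f ((mk (relTensor P Q) S).L N r ((mk P Q).elL L) z)) : f = g := by
  refine hom_ext fun N r xs z hz => ?_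
  refine SlotLinear.ext_of_inSpan
    (((mk (relTensor P Q) S).slotLinear N r z).map f.f)
    (((mk (relTensor P Q) S).slotLinear N r z).map g.f)
    (fun x _ => (isTensor P Q).span x) fun l hl hG => ?_
  obtain ⟨L, hL, rfl⟩ := exists_elL_of_isGen hG
  refine h N r L z hL ?_
  rw [← (mk P Q).length_elL, hl.length]
  exact hz.1

theorem convHom_assoc {P Q S : DGBimod O O} {A B C D : OpAlg O}
    {a : (relTensor (relTensor P Q) S).Hom (relTensor P (relTensor Q S))}
    (ha : relTensor.IsAssociator a) (g : P.Hom (A.homBimod B)) (h : Q.Hom (B.homBimod C))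
    (l : S.Hom (C.homBimod D)) :
    convHom (convHom g h) l = a.comp (convHom g (convHom h l)) := by
  refine relTensor.hom_ext₂ fun N r L z hL _ => ?_
  refine (convHom_L _ _ N r _ z).trans ?_
  refine Eq.trans ?_ (congrArg (convHom g (convHom h l)).f (ha.map_L N r z hL)).symm
  rw [map_zsmul, convHom_L]
  have H : ∀ {P Q : DGBimod O O} {A B C : OpAlg O} (g : P.Hom (A.homBimod B))
      (h : Q.Hom (B.homBimod C)), (relTensor.mk P Q).Compat
        (HOM.compMap A.toCplx B.toCplx C.toCplx) g.toHom h.toHom (convHom g h).toHom :=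
    fun g h _ _ _ _ _ _ _ _ _ _ => rfl
  have e₁ := DGColl.Hom.map_elL (H g h) L
  have e₂ := DGColl.Hom.el_map_el (H h l) (sndL L) z
  rw [e₁, e₂, ← flatL_mapPair g.toHom h.toHom, ← sndL_mapPair g.toHom h.toHom,
    ← kos_mapPair g.toHom h.toHom]
  exact HOM.assoc_comp A.toCplx B.toCplx C.toCplx D.toCplx N r _ (l.toHom.el z) (hL.mapPair _ _)

theorem isConvolution_iff {F : DGBimod O O} {Δ : F.Hom (relTensor F F)} {A B C : OpAlg O}
    {g : AlgMap F A B} {h : AlgMap F B C} {c : AlgMap F A C} :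
    IsConvolution Δ g h c ↔ c.hom = Δ.comp (convHom g.hom h.hom) := by
  constructor
  · rintro ⟨φ, h₁, h₂⟩
    refine DGBimod.Hom.ext_f fun n p x => (h₂ n p x).trans ?_
    have e : φ n p = (convHom g.hom h.hom).f := by
      refine relTensor.linear_ext fun xs y hf => ?_
      obtain ⟨k, q, y⟩ := y
      obtain ⟨hk, hN, hr⟩ := hf
      dsimp only at hk hr
      subst hk hN hr
      obtain ⟨e, he⟩ : ∃ e : Fin xs.length → F.El, xs = List.ofFn e := ⟨xs.get, by simp⟩
      generalize xs.length = k at e y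
      subst he
      have := h₁ (N := arSum (List.ofFn e)) (r := degSum (List.ofFn e) + q)
        (fun i => (e i).ar) (fun i => (e i).deg) (arSum_ofFn e).symm
        (by rw [degSum_ofFn]) (fun i => (e i).val) y
      rw [OdotMap.app_eq_L] at this
      refine this.trans ?_
      refine Eq.trans ?_ (convHom_L _ _ _ _ _ _).symm
      rw [List.map_ofFn]
      exact (HOM.compMap A.toCplx B.toCplx C.toCplx).app_eq_L _ _ (arSum_ofFn e).symm
        (by rw [degSum_ofFn]) _ _
    rw [e]
    rfl
  · intro H
    refine ⟨fun _ _ => (convHom g.hom h.hom).f, fun _ _ _ _ _ _ => rfl, fun N r x => ?_⟩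
    exact congrArg (fun w : F.Hom (A.homBimod C) => w.f x) H

/-- The composite of a morphism to the operad with the structure map of an algebra. -/
def OpAlg.identity {F : DGBimod O O} (B : OpAlg O) (ε : F.Hom O.regular) :
    F.Hom (B.homBimod B) where
  f := B.act.comp ε.f
  map_d h x := by
    change B.act (ε.f _) = HOM.d h (B.act (ε.f x))
    rw [ε.map_d]
    exact B.act_d h _
  map_lact n p hN hr a y := by
    change B.act (ε.f _) = HOM.comp n p hN hr (fun i => B.act (a i)) (B.act (ε.f y))
    rw [ε.map_lact]
    exact B.act_mul n p hN hr a _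
  map_ract n p hN hr x b := by
    change B.act (ε.f _) = HOM.comp n p hN hr (fun i => B.act (ε.f (x i))) (B.act b)
    rw [ε.map_ract]
    exact B.act_mul n p hN hr _ b

theorem convHom_identity_right {F G : DGBimod O O} (ε : G.Hom O.regular) {A B : OpAlg O}
    (g : F.Hom (A.homBimod B)) : convHom g (B.identity ε) =
      ((relTensor.map (.id F) ε).comp (relTensor.rightUnitor F)).comp g := by
  refine relTensor.hom_ext fun N r xs y _ => ?_
  refine (convHom_L _ _ N r xs y).trans ?_
  refine Eq.trans ?_ (congrArg (fun w => g.f ((relTensor.rightUnitor F).f w))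
    (relTensor.map_L (.id F) ε N r xs y)).symm
  rw [relTensor.rightUnitor_L]
  refine Eq.trans ?_ (g.map_ract_L N r _ _).symm
  refine Eq.trans ?_ (DGColl.Hom.map_L (t := (A.homBimod B).ract)
    (t' := HOM.compMap A.toCplx B.toCplx B.toCplx) (f := .id _) (g := B.hom) (h := .id _)
    (fun _ _ _ _ _ _ => rfl) N r _ (ε.el y)).symm
  refine congrArg (fun l => (HOM.compMap A.toCplx B.toCplx B.toCplx).L N r l _) ?_
  exact (congrArg (List.map g.el) (List.map_id xs)).symm.trans (List.map_id _).symm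

theorem convHom_identity_left {F G : DGBimod O O} (ε : G.Hom O.regular) {A B : OpAlg O}
    (g : F.Hom (A.homBimod B)) : convHom (A.identity ε) g =
      ((relTensor.map ε (.id F)).comp (relTensor.leftUnitor F)).comp g := by
  refine relTensor.hom_ext fun N r xs y _ => ?_
  refine (convHom_L _ _ N r xs y).trans ?_
  refine Eq.trans ?_ (congrArg (fun w => g.f ((relTensor.leftUnitor F).f w))
    (relTensor.map_L ε (.id F) N r xs y)).symm
  rw [relTensor.leftUnitor_L]
  refine Eq.trans ?_ (g.map_lact_L N r _ _).symm
  refine Eq.trans ?_ (DGColl.Hom.map_L (t := (A.homBimod B).lact)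
    (t' := HOM.compMap A.toCplx A.toCplx B.toCplx) (f := A.hom) (g := .id _) (h := .id _)
    (fun _ _ _ _ _ _ => rfl) N r _ (g.el y)).symm
  refine congrArg (fun l => (HOM.compMap A.toCplx A.toCplx B.toCplx).L N r l _) ?_
  exact (List.map_map (f := ε.el) (g := A.hom.el) (l := xs)).symm

theorem IsCoalgebra.composeAssociatively {F : DGBimod O O} {Δ : F.Hom (relTensor F F)}
    {ε : F.Hom O.regular} (H : IsCoalgebra F Δ ε) : ComposeAssociatively F Δ ε where
  exists_unique_comp A B C g h := by
    refine ⟨AlgMap.ofHom (Δ.comp (convHom g.hom h.hom)), isConvolution_iff.2 rfl, fun c hc => ?_⟩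
    refine AlgMap.ext_g fun n p x => ?_
    exact congrArg (fun w : F.Hom (A.homBimod C) => w.f x) (isConvolution_iff.1 hc)
  assoc A B C D g h l gh hl h₁ h₂ c := by
    obtain ⟨a, ha, H⟩ := H.coassoc
    rw [isConvolution_iff] at h₁ h₂
    rw [isConvolution_iff, isConvolution_iff]
    have e : Δ.comp (convHom gh.hom l.hom) = Δ.comp (convHom g.hom hl.hom) := by
      rw [h₁, h₂]
      have e₁ := convHom_map Δ (.id F) (convHom g.hom h.hom) l.hom
      have e₂ := convHom_map (.id F) Δ g.hom (convHom h.hom l.hom)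
      rw [convHom_assoc ha] at e₁
      change Δ.comp (convHom (Δ.comp (convHom g.hom h.hom)) ((DGBimod.Hom.id F).comp l.hom)) =
        Δ.comp (convHom ((DGBimod.Hom.id F).comp g.hom) (Δ.comp (convHom h.hom l.hom)))
      rw [e₁, e₂]
      exact congrArg (fun w : F.Hom _ => w.comp (convHom g.hom (convHom h.hom l.hom))) H
    rw [e]
  identity B := by
    refine ⟨AlgMap.ofHom (B.identity ε), fun _ _ _ => rfl, fun A g => ?_, fun C h => ?_⟩
    · rw [isConvolution_iff]
      change g.hom = Δ.comp (convHom g.hom (B.identity ε))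
      rw [convHom_identity_right]
      exact congrArg (fun w : F.Hom F => w.comp g.hom) H.counit_right.symm
    · rw [isConvolution_iff]
      change h.hom = Δ.comp (convHom (B.identity ε) h.hom)
      rw [convHom_identity_left]
      exact congrArg (fun w : F.Hom F => w.comp h.hom) H.counit_left.symm

end HUnital

namespace HUnital

variable {R : Type u} [CommRing R]

/-! The defining relations in terms of lists. -/

theorem presentedOperad.induction {G : ℕ → ℤ → Type}
    {M : ∀ O : DGOperad R, (∀ n p, G n p → O.X n p) → Prop}
    (C : ∀ n p, Submodule R ((presentedOperad M).X n p))
    (hgen : ∀ n p (g : G n p), presentedOperad.gen M n p g ∈ C n p)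
    (hone : (presentedOperad M).one ∈ C 1 0)
    (hd : ∀ n p q (h : p + 1 = q) x, x ∈ C n p → (presentedOperad M).d h x ∈ C n q)
    (hmul : ∀ (N : ℕ) (r : ℤ) (x : List (presentedOperad M).El) (y : (presentedOperad M).El),
      (∀ z ∈ x, z.val ∈ C z.ar z.deg) → y.val ∈ C y.ar y.deg →
        (presentedOperad M).mul.L N r x y ∈ C N r)
    (x : (presentedOperad M).El) : x.val ∈ C x.ar x.deg := by
  obtain ⟨n, p, x⟩ := x
  induction x using Quotient.inductionOn with | _ t => ?_
  have cg : ∀ {n p} {x y : (presentedOperad M).X n p}, x = y → y ∈ C n p → x ∈ C n p := by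
    rintro n p x _ rfl h
    exact h
  change OpQuot.mk t ∈ C n p
  induction t with
  | gen g => exact hgen _ _ g
  | one => exact hone
  | @mul k N q r n p hN hr x y ihx ihy =>
    refine cg (OpQuot.ext_ev fun m =>
      (OpQuot.mul_compat m n p hN hr (fun i => OpQuot.mk (x i)) (OpQuot.mk y)).symm) ?_
    have h := hmul N r (List.ofFn fun i => ⟨n i, p i, OpQuot.mk (x i)⟩) ⟨k, q, OpQuot.mk y⟩
      (fun y hy => by
        obtain ⟨i, rfl⟩ := List.mem_ofFn.1 hy
        exact ihx i) ihy
    exact cg ((presentedOperad M).mul.app_eq_L n p hN hr (fun i => OpQuot.mk (x i))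
      (OpQuot.mk y)) h
  | @d n p q h x ih =>
    exact cg (OpQuot.ext_ev fun m => (OpQuot.ev_d m h (OpQuot.mk x)).symm) (hd _ _ _ h _ ih)
  | zero => exact Submodule.zero_mem _
  | @add n p x y ihx ihy =>
    exact cg (OpQuot.ext_ev fun m => (map_add (OpQuot.ev m) (OpQuot.mk x) (OpQuot.mk y)).symm)
      (Submodule.add_mem _ ihx ihy)
  | @smul n p c x ih =>
    exact cg (OpQuot.ext_ev fun m => (map_smul (OpQuot.ev m) c (OpQuot.mk x)).symm)
      (Submodule.smul_mem _ c ih)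

/-- The list `1, …, 1`. -/
abbrev DGOperad.ones (O : DGOperad R) (n : ℕ) : List O.El := List.replicate n O.oneEl

@[simp] theorem DGOperad.arSum_ones (O : DGOperad R) (n : ℕ) : arSum (O.ones n) = n := by
  simp [DGOperad.ones, arSum, DGOperad.oneEl]

@[simp] theorem DGOperad.degSum_ones (O : DGOperad R) (n : ℕ) : degSum (O.ones n) = 0 := by
  simp [DGOperad.ones, degSum, DGOperad.oneEl]

theorem insertOp_eq_L {O : DGOperad R} {Q S : DGColl R} (t : OdotMap O.toDGColl Q S) {l n N : ℕ}
    {p q r : ℤ} (a : Fin l) (x : O.X n p) (y : Q.X l q) (hN : n + l = N + 1) (hr : p + q = r)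
    (b c : ℕ) (hb : (a : ℕ) = b) (hc : l = b + 1 + c) :
    insertOp t a x y hN hr = t.L N r (O.ones b ++ ⟨n, p, x⟩ :: O.ones c) ⟨l, q, y⟩ := by
  rw [insertOp, OdotMap.app_eq_L]
  congr 1
  have h : ∀ i : Fin l, (⟨if i = a then n else 1, if i = a then p else 0,
      if h : i = a then O.cast (if_pos h).symm (if_pos h).symm x
        else O.cast (if_neg h).symm (if_neg h).symm O.one⟩ : O.El) =
      if i = a then ⟨n, p, x⟩ else O.oneEl := fun i => by
    have e : ∀ {n n' : ℕ} {p p' : ℤ} (hn : n = n') (hp : p = p') (x : O.X n p) (v : O.X n' p'),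
        v = O.cast hn hp x → (⟨n', p', v⟩ : O.El) = ⟨n, p, x⟩ := by
      rintro n _ p _ rfl rfl x _ rfl
      rfl
    by_cases h : i = a
    · exact (e _ _ x _ (dif_pos h)).trans (if_pos h).symm
    · exact (e _ _ O.one _ (dif_neg h)).trans (if_neg h).symm
  simp only [h]
  refine List.ext_getElem (by simp [hc]; omega) fun i h₁ h₂ => ?_
  simp only [List.getElem_ofFn, List.getElem_append, List.getElem_cons, List.getElem_replicate,
    List.length_replicate, Fin.ext_iff, hb]
  split_ifs <;> first | rfl | omega

theorem insertOp_map {O O' : DGOperad R} {Q S Q' S' : DGColl R} {t : OdotMap O.toDGColl Q S}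
    {t' : OdotMap O'.toDGColl Q' S'} {f : O.toDGColl.Hom O'.toDGColl} {g : Q.Hom Q'}
    {h : S.Hom S'} (H : t.Compat t' f g h) (hf : f.f O.one = O'.one) {l n N : ℕ} {p q r : ℤ}
    (a : Fin l) (x : O.X n p) (y : Q.X l q) (hN : n + l = N + 1) (hr : p + q = r) :
    h.f (insertOp t a x y hN hr) = insertOp t' a (f.f x) (g.f y) hN hr := by
  rw [insertOp_eq_L t a x y hN hr a (l - 1 - a) rfl (by omega),
    insertOp_eq_L t' a _ _ hN hr a (l - 1 - a) rfl (by omega), DGColl.Hom.map_L H,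
    List.map_append, List.map_cons, List.map_replicate, List.map_replicate]
  have : f.el O.oneEl = O'.oneEl := congrArg (DGColl.El.mk 1 0) hf
  rw [this]
  rfl

namespace Asu

theorem rel : ARel (Asu R) (presentedOperad.gen ARel) := by
  have H : ∀ (m : OpModel (R := R) ARel) {l n N : ℕ} {p q r : ℤ} (a : Fin l) (x : (Asu R).X n p)
      (y : (Asu R).X l q) (hN : n + l = N + 1) (hr : p + q = r),
      OpQuot.ev m (insertOp (Asu R).mul a x y hN hr) =
        insertOp m.O.mul a (OpQuot.ev m x) (OpQuot.ev m y) hN hr :=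
    fun m _ _ _ _ _ _ a x y hN hr => insertOp_map (O := Asu R) (O' := m.O)
      (t := (Asu R).mul) (t' := m.O.mul) (f := OpQuot.evHom m) (g := OpQuot.evHom m)
      (h := OpQuot.evHom m) (OpQuot.mul_compat m) rfl a x y hN hr
  have D : ∀ (m : OpModel (R := R) ARel) {n : ℕ} {p q : ℤ} (h : p + 1 = q) (x : (Asu R).X n p),
      OpQuot.ev m ((Asu R).d h x) = m.O.d h (OpQuot.ev m x) := fun m => OpQuot.ev_d m
  constructor
  · intro n hn
    refine OpQuot.ext_ev fun m => ?_
    refine (D m _ _).trans ((m.rel.m_d n hn).trans ?_)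
    refine Eq.trans ?_ (map_neg (OpQuot.ev m) _).symm
    refine congrArg _ ?_
    refine Eq.trans ?_ (map_sum (OpQuot.ev m) _ _).symm
    refine Finset.sum_congr rfl fun t _ => ?_
    refine Eq.trans ?_ (map_zsmul (OpQuot.ev m) _ _).symm
    refine congrArg _ (Eq.trans ?_ (H m (N := n) (r := 2 - n + 1)
      (⟨t.1.a, by omega⟩ : Fin (t.1.a + 1 + t.1.c)) (Asu.m t.1.b t.1.2.2)
      (Asu.m (t.1.a + 1 + t.1.c) (by have := t.1.sum; have := t.2; omega))
      (by have := t.1.sum; omega) (by have := t.1.sum; omega)).symm)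
    rfl
  · exact OpQuot.ext_ev fun m => (D m _ _).trans (m.rel.unit_d.trans (map_zero _).symm)
  · exact OpQuot.ext_ev fun m => (H m _ _ _ _ _).trans m.rel.unit_left
  · exact OpQuot.ext_ev fun m => (H m _ _ _ _ _).trans m.rel.unit_right
  · exact fun l hl a => OpQuot.ext_ev fun m => (H m _ _ _ _ _).trans
      ((m.rel.unit_m l hl a).trans (map_zero _).symm)
  · exact OpQuot.ext_ev fun m => (D m _ _).trans (m.rel.i_d.trans (map_zero _).symm)
  · refine OpQuot.ext_ev fun m => (D m _ _).trans (m.rel.j_d.trans ?_)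
    exact (map_sub (OpQuot.ev (M := ARel) m) (unit : (Asu R).X 0 0) i).symm

variable (R) in
/-- The operation `m_n`, and `0` for `n < 2`. -/
noncomputable def mEl (n : ℕ) : (Asu R).El := ⟨n, 2 - n, if h : 2 ≤ n then m n h else 0⟩

variable (R) in
/-- The element `1^su`. -/
noncomputable def unitEl : (Asu R).El := ⟨0, 0, unit⟩

variable (R) in
/-- The element `j`. -/
noncomputable def jEl : (Asu R).El := ⟨0, -1, j⟩

@[simp] theorem mEl_ar (n : ℕ) : (mEl R n).ar = n := rfl
@[simp] theorem mEl_deg (n : ℕ) : (mEl R n).deg = 2 - n := rfl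
@[simp] theorem unitEl_ar : (unitEl R).ar = 0 := rfl
@[simp] theorem unitEl_deg : (unitEl R).deg = 0 := rfl
@[simp] theorem jEl_ar : (jEl R).ar = 0 := rfl
@[simp] theorem jEl_deg : (jEl R).deg = -1 := rfl

theorem mEl_of_le {n : ℕ} (h : 2 ≤ n) : mEl R n = ⟨n, 2 - n, m n h⟩ := by rw [mEl, dif_pos h]

theorem unit_mul_m (N : ℕ) (r : ℤ) {b c : ℕ} (h : 3 ≤ b + 1 + c) :
    (Asu R).mul.L N r ((Asu R).ones b ++ unitEl R :: (Asu R).ones c) (mEl R (b + 1 + c)) = 0 := by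
  by_cases hf : b + c = N ∧ 2 - ((b + 1 + c : ℕ) : ℤ) = r
  · obtain ⟨rfl, rfl⟩ := hf
    have := rel.unit_m (R := R) (b + 1 + c) h ⟨b, by omega⟩
    have := (insertOp_eq_L (Asu R).mul ⟨b, by omega⟩ unit (m (b + 1 + c) (by omega)) _ _ b c rfl
      rfl).symm.trans this
    rw [mEl_of_le (by omega)]
    have e : b + 1 + c - 1 = b + c := by omega
    rw [e] at this
    exact this
  · refine OdotMap.L_of_not _ fun ⟨_, h₁, h₂⟩ => hf ⟨?_, ?_⟩
    · rw [← h₁]; simp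
    · rw [← h₂]; simp

theorem unit_mul_m₂ {b c : ℕ} (h : b + c = 1) :
    (Asu R).mul.el ((Asu R).ones b ++ unitEl R :: (Asu R).ones c) (mEl R 2) = (Asu R).oneEl := by
  have hm : mEl R 2 = ⟨2, 0, presentedOperad.gen ARel _ _ (.m 2 0 le_rfl (by simp))⟩ := by
    rw [mEl_of_le le_rfl]; rfl
  rw [OdotMap.el_eq (N := 1) (r := 0) _ (by simp [h]) (by simp), hm]
  refine congrArg (DGColl.El.mk 1 0) ?_
  obtain ⟨rfl, rfl⟩ | ⟨rfl, rfl⟩ : b = 0 ∧ c = 1 ∨ b = 1 ∧ c = 0 := by omega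
  · exact (insertOp_eq_L _ (0 : Fin 2) _ _ rfl rfl 0 1 rfl rfl).symm.trans rel.unit_left
  · exact (insertOp_eq_L _ (1 : Fin 2) _ _ rfl rfl 1 0 rfl rfl).symm.trans rel.unit_right

theorem unit_d : (Asu R).d (zero_add 1) unit = 0 := rel.unit_d

theorem j_d : (Asu R).d (by simp) j = unit - i := rel.j_d

end Asu

section FRelations

variable {P : DGBimod (Asu R) (Asu R)}

/-- The family of elements in the relations of `F_1^su⟨i,j⟩`. -/
def fFam (u : ∀ n : ℕ, P.X n (1 - n)) : ∀ n p, FGen n p → P.X n p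
  | _, _, .f n _ _ hp => P.cast rfl hp.symm (u n)

/-- The list of the `u_{i₁}, …, u_{i_l}`. -/
abbrev uEl (u : ∀ n : ℕ, P.X n (1 - n)) (n : ℕ) : P.El := ⟨n, 1 - n, u n⟩

/-- The relations of `F_1^su⟨i,j⟩` in terms of lists. -/
structure FRelL (u : ∀ n : ℕ, P.X n (1 - n)) : Prop where
  d : ∀ n, 1 ≤ n → P.d rfl (u n) =
    ∑ t : Cut n, sgn (t.c + t.a * t.b) •
      P.lact.L n (1 - n + 1) ((Asu R).ones t.a ++ Asu.mEl R t.b :: (Asu R).ones t.c)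
        (uEl u (t.a + 1 + t.c)) -
    ∑ c : {c : Composition n // 1 < c.length}, sgn (sigma c.1) •
      P.ract.L n (1 - n + 1) (c.1.blocks.map (uEl u)) (Asu.mEl R c.1.length)
  unit_rho : P.ract.L 0 0 [] (Asu.unitEl R) = P.lact.L 0 0 [Asu.unitEl R] (uEl u 1)
  unit_f : ∀ b c, 1 ≤ b + c → ∀ N r,
    P.lact.L N r ((Asu R).ones b ++ Asu.unitEl R :: (Asu R).ones c) (uEl u (b + 1 + c)) = 0

theorem uEl_one (u : ∀ n : ℕ, P.X n (1 - n)) :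
    uEl u 1 = ⟨1, 0, P.cast rfl (by simp) (u 1)⟩ := (DGColl.El.mk_cast _ _ _).symm

theorem blocks_map_eq_ofFn {n : ℕ} (c : Composition n) {α : Type*} (f : ℕ → α) :
    c.blocks.map f = List.ofFn fun a => f (c.blocksFun a) := by
  conv_lhs => rw [← c.ofFn_blocksFun]
  rw [List.map_ofFn]
  rfl

theorem fRel_iff {u : ∀ n : ℕ, P.X n (1 - n)} : FRel P (fFam u) ↔ FRelL u := by
  have h₁ : ∀ (n : ℕ) (t : Cut n) (h h₁ h₂ h₃),
      insertOp P.lact (⟨t.a, by omega⟩ : Fin (t.a + 1 + t.c)) (Asu.m t.b t.2.2)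
        (fFam u (t.a + 1 + t.c) (1 - (t.a + 1 + t.c : ℕ)) (.f _ _ h h₁)) h₂ h₃ =
      P.lact.L n (1 - n + 1) ((Asu R).ones t.a ++ Asu.mEl R t.b :: (Asu R).ones t.c)
        (uEl u (t.a + 1 + t.c)) := fun n t h h₁ h₂ h₃ => by
    rw [insertOp_eq_L _ _ _ _ h₂ h₃ t.a t.c rfl rfl, Asu.mEl_of_le t.2.2]
    rfl
  have h₂ : ∀ (n : ℕ) (c : {c : Composition n // 1 < c.length}) (h : _ = 1 - (n : ℤ) + 1),
      P.ract.app c.1.blocksFun (fun a => 1 - (c.1.blocksFun a : ℤ)) c.1.sum_blocksFun h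
        (fun a => fFam u _ _ (.f _ _ (c.1.one_le_blocksFun a) rfl)) (Asu.m c.1.length c.2) =
      P.ract.L n (1 - n + 1) (c.1.blocks.map (uEl u)) (Asu.mEl R c.1.length) := fun n c h => by
    rw [OdotMap.app_eq_L, blocks_map_eq_ofFn, Asu.mEl_of_le c.2]
    rfl
  have h₃ : P.ract.app (k := 0) Fin.elim0 Fin.elim0 rfl rfl (fun a => a.elim0) Asu.unit =
      P.ract.L 0 0 [] (Asu.unitEl R) := by
    rw [OdotMap.app_eq_L, List.ofFn_zero]
    rfl
  have h₄ : insertOp P.lact (0 : Fin 1) Asu.unit (fFam u 1 0 (.f 1 0 le_rfl (by simp))) rfl rfl =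
      P.lact.L 0 0 [Asu.unitEl R] (uEl u 1) := by
    rw [insertOp_eq_L _ _ _ _ rfl rfl 0 0 rfl rfl, uEl_one]
    rfl
  have h₅ : ∀ (l : ℕ) (a : Fin l) (h h₁ h₂ h₃),
      insertOp P.lact (N := l - 1) (r := 1 - l) a Asu.unit (fFam u l (1 - l) (.f l _ h h₁)) h₂ h₃ =
      P.lact.L (l - 1) (1 - l) ((Asu R).ones a ++ Asu.unitEl R :: (Asu R).ones (l - 1 - a))
        (uEl u l) := fun l a h h₁ h₂ h₃ => by
    rw [insertOp_eq_L _ _ _ _ _ _ a (l - 1 - a) rfl (by omega)]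
    rfl
  constructor
  · intro H
    refine ⟨fun n hn => ?_, ?_, fun b c h N r => ?_⟩
    · refine (H.f_d n hn).trans (congrArg₂ _ ?_ ?_)
      · exact Finset.sum_congr rfl fun t _ => congrArg _ (h₁ n t _ _ _ _)
      · exact Finset.sum_congr rfl fun c _ => congrArg _ (h₂ n c _)
    · rw [← h₃, ← h₄]
      exact H.unit_rho
    · by_cases hf : b + c = N ∧ 1 - ((b + 1 + c : ℕ) : ℤ) = r
      · obtain ⟨rfl, rfl⟩ := hf
        have := H.unit_f (b + 1 + c) (by omega) ⟨b, by omega⟩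
        rw [h₅] at this
        have e : b + 1 + c - 1 = b + c := by omega
        have e' : b + 1 + c - 1 - b = c := by omega
        dsimp only at this
        rw [e', e] at this
        exact this
      · refine OdotMap.L_of_not _ fun ⟨_, h₁, h₂⟩ => hf ⟨?_, ?_⟩
        · rw [← h₁]; simp
        · rw [← h₂]; simp
  · intro H
    refine ⟨fun n hn => ?_, ?_, fun l hl a => ?_⟩
    · refine (H.d n hn).trans (congrArg₂ _ ?_ ?_)
      · exact Finset.sum_congr rfl fun t _ => congrArg _ (h₁ n t _ _ _ _).symm
      · exact Finset.sum_congr rfl fun c _ => congrArg _ (h₂ n c _).symm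
    · rw [h₃, h₄]
      exact H.unit_rho
    · rw [h₅]
      have := H.unit_f a (l - 1 - a) (by omega) (l - 1) (1 - l)
      have e : (a : ℕ) + 1 + (l - 1 - a) = l := by omega
      rwa [e] at this

end FRelations

namespace Fsu

theorem rel : FRel (Fsu R) (presentedBimod.gen FRel) := by
  have H : ∀ (m : BiModel (R := R) FRel) {l n N : ℕ} {p q r : ℤ} (a : Fin l) (x : (Asu R).X n p)
      (y : (Fsu R).X l q) (hN : n + l = N + 1) (hr : p + q = r),
      BiQuot.ev m (insertOp (Fsu R).lact a x y hN hr) =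
        insertOp m.P.lact a x (BiQuot.ev m y) hN hr := fun m _ _ _ _ _ _ a x y hN hr =>
    insertOp_map (f := .id _) (g := BiQuot.evHom m) (h := BiQuot.evHom m)
      (BiQuot.lact_compat m) rfl a x y hN hr
  constructor
  · intro n hn
    refine BiQuot.ext_ev fun m => ?_
    refine (BiQuot.ev_d m _ _).trans ((m.rel.f_d n hn).trans ?_)
    refine Eq.trans ?_ (map_sub (BiQuot.ev m) _ _).symm
    refine congrArg₂ _ ?_ ?_
    · refine Eq.trans ?_ (map_sum (BiQuot.ev m) _ _).symm
      refine Finset.sum_congr rfl fun t _ => ?_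
      refine Eq.trans ?_ (map_zsmul (BiQuot.ev m) _ _).symm
      refine congrArg _ (Eq.trans ?_ (H m (N := n) (r := 1 - n + 1)
        (⟨t.a, by omega⟩ : Fin (t.a + 1 + t.c)) (Asu.m t.b t.2.2)
        (f (t.a + 1 + t.c) (by omega))
        (by have := t.sum; omega) (by have := t.sum; omega)).symm)
      rfl
    · refine Eq.trans ?_ (map_sum (BiQuot.ev m) _ _).symm
      refine Finset.sum_congr rfl fun t _ => ?_
      refine Eq.trans ?_ (map_zsmul (BiQuot.ev m) _ _).symm
      exact congrArg _ (BiQuot.ract_compat m t.1.blocksFun _ _ _ (fun a => f _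
        (t.1.one_le_blocksFun a)) (Asu.m t.1.length t.2)).symm
  · refine BiQuot.ext_ev fun m => (BiQuot.ract_compat m _ _ _ _ _ _).trans
      (Eq.trans ?_ ((m.rel.unit_rho.trans ?_).trans (H m (0 : Fin 1) Asu.unit
        (presentedBimod.gen FRel 1 0 (.f 1 0 le_rfl (by simp))) rfl rfl).symm))
    on_goal 2 => rfl
    exact congrArg (fun x => m.P.ract.app Fin.elim0 Fin.elim0 rfl rfl x Asu.unit)
      (funext fun a => a.elim0)
  · exact fun l hl a => BiQuot.ext_ev fun m => (H m _ _ _ _ _).trans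
      ((m.rel.unit_f l hl a).trans (map_zero _).symm)

variable (R) in
/-- The element `f_n`, and `0` for `n = 0`. -/
noncomputable def fu (n : ℕ) : (Fsu R).X n (1 - n) := if h : 1 ≤ n then f n h else 0

variable (R) in
/-- The element `f_n`. -/
noncomputable abbrev fEl (n : ℕ) : (Fsu R).El := uEl (fu R) n

theorem fu_of_le {n : ℕ} (h : 1 ≤ n) : fu R n = f n h := dif_pos h

theorem gen_eq : presentedBimod.gen (R := R) FRel = fFam (P := Fsu R) (fu R) := by
  funext n p g
  obtain ⟨hn, rfl⟩ := g
  exact (fu_of_le hn).symm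

theorem relL : FRelL (fu R) := fRel_iff.1 (gen_eq (R := R) ▸ rel)

/-- The morphism from `F_1^su⟨i,j⟩` determined by a family that satisfies the relations. -/
theorem exists_hom {T : DGBimod (Asu R) (Asu R)} {u : ∀ n : ℕ, T.X n (1 - n)} (h : FRelL u) :
    ∃ g : (Fsu R).Hom T, ∀ (n : ℕ) (hn : 1 ≤ n), g.f (f n hn) = u n :=
  ⟨presentedBimod.ev ⟨T, fFam u, fRel_iff.2 h⟩, fun _ _ => rfl⟩

theorem hom_ext {T : DGBimod (Asu R) (Asu R)} {g h : (Fsu R).Hom T}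
    (H : ∀ (n : ℕ) (hn : 1 ≤ n), g.f (f n hn) = h.f (f n hn)) : g = h :=
  presentedBimod.hom_ext fun n p s => by
    obtain ⟨hn, rfl⟩ := s
    exact H n hn

end Fsu

end HUnital

namespace HUnital

variable {R : Type u} [CommRing R]

/-! The operad `A_∞^su⟨i,j⟩` and the bimodule `F_1^su⟨i,j⟩` are spanned by the homotopy unital
parts and by elements of arity `0`. -/

section General

variable {P Q S : DGColl R} {M : Type*} [AddCommGroup M] [Module R M]

/-- The submodule spanned by the elements with a given property. -/
def spanOf (G : P.El → Prop) (n : ℕ) (p : ℤ) : Submodule R (P.X n p) :=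
  Submodule.span R {y | G ⟨n, p, y⟩}

theorem mem_spanOf {G : P.El → Prop} {x : P.El} (h : G x) : x.val ∈ spanOf G x.ar x.deg :=
  Submodule.subset_span h

theorem dsum_mem_of_slot {φ : List P.El → M} {N : Submodule R M} {xs : List P.El}
    (h : ∀ l₁ x l₂, xs = l₁ ++ x :: l₂ → φ (l₁ ++ x.d :: l₂) ∈ N) : dsum φ xs ∈ N := by
  induction xs generalizing φ with
  | nil => exact N.zero_mem
  | cons x xs ih =>
    refine N.add_mem (N.smul_of_tower_mem _ (h [] x xs rfl)) (ih fun l₁ y l₂ e => ?_)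
    exact h (x :: l₁) y l₂ (by rw [e]; rfl)

theorem OdotMap.L_zero (t : OdotMap P Q S) (N : ℕ) (r : ℤ) (xs : List P.El) (n : ℕ) (p : ℤ) :
    t.L N r xs ⟨n, p, 0⟩ = 0 := (t.elLinear N r xs n p).map_zero

theorem OdotMap.el_zero (t : OdotMap P Q S) (xs : List P.El) (n : ℕ) (p : ℤ) :
    t.el xs ⟨n, p, 0⟩ = ⟨arSum xs, degSum xs + p, 0⟩ :=
  congrArg (DGColl.El.mk _ _) (t.L_zero _ _ xs n p)

theorem OdotMap.L_mem (t : OdotMap P Q S) {C : P.El → Prop} {D : Q.El → Prop}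
    {E : ∀ N r, Submodule R (S.X N r)}
    (h : ∀ {k N : ℕ} {q r : ℤ} (n : Fin k → ℕ) (p : Fin k → ℤ) (hN : ∑ i, n i = N)
      (hr : ∑ i, p i + q = r) (x : ∀ i, P.X (n i) (p i)) (y : Q.X k q),
      (∀ i, C ⟨n i, p i, x i⟩) → D ⟨k, q, y⟩ → t.app n p hN hr x y ∈ E N r)
    (N : ℕ) (r : ℤ) {xs : List P.El} {y : Q.El} (hx : ∀ x ∈ xs, C x) (hy : D y) :
    t.L N r xs y ∈ E N r := by
  by_cases hf : Fits N r xs y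
  · obtain ⟨k, q, y⟩ := y
    obtain ⟨hk, hN, hr⟩ := hf
    dsimp only at hk hr
    subst hk hN hr
    obtain ⟨e, he⟩ : ∃ e : Fin xs.length → P.El, xs = List.ofFn e := ⟨xs.get, by simp⟩
    generalize xs.length = k at e y hy
    subst he
    have := h (N := arSum (List.ofFn e)) (r := degSum (List.ofFn e) + q)
      (fun i => (e i).ar) (fun i => (e i).deg) (arSum_ofFn e).symm
      (by rw [degSum_ofFn]) (fun i => (e i).val) y (fun i => hx _ (by simp)) hy
    rwa [OdotMap.app_eq_L] at this
  · rw [t.L_of_not hf]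
    exact Submodule.zero_mem _

theorem DGOperad.Sub.mul_L_mem {O : DGOperad R} (S : O.Sub) (N : ℕ) (r : ℤ) {xs : List O.El}
    {y : O.El} (hx : ∀ x ∈ xs, x.val ∈ S.carrier x.ar x.deg) (hy : y.val ∈ S.carrier y.ar y.deg) :
    O.mul.L N r xs y ∈ S.carrier N r :=
  O.mul.L_mem (C := fun x => x.val ∈ S.carrier x.ar x.deg)
    (D := fun y => y.val ∈ S.carrier y.ar y.deg) (E := S.carrier)
    (fun n p hN hr x y => S.mul_mem n p hN hr x y) N r hx hy

theorem DGBimod.Sub.lact_L_mem {A B : DGOperad R} {P : DGBimod A B} {A' : A.Sub} {B' : B.Sub}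
    (S : P.Sub A' B') (N : ℕ) (r : ℤ) {xs : List A.El} {y : P.El}
    (hx : ∀ x ∈ xs, x.val ∈ A'.carrier x.ar x.deg) (hy : y.val ∈ S.carrier y.ar y.deg) :
    P.lact.L N r xs y ∈ S.carrier N r :=
  P.lact.L_mem (C := fun x => x.val ∈ A'.carrier x.ar x.deg)
    (D := fun y => y.val ∈ S.carrier y.ar y.deg) (E := S.carrier)
    (fun n p hN hr x y => S.lact_mem n p hN hr x y) N r hx hy

theorem DGBimod.Sub.ract_L_mem {A B : DGOperad R} {P : DGBimod A B} {A' : A.Sub} {B' : B.Sub}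
    (S : P.Sub A' B') (N : ℕ) (r : ℤ) {xs : List P.El} {y : B.El}
    (hx : ∀ x ∈ xs, x.val ∈ S.carrier x.ar x.deg) (hy : y.val ∈ B'.carrier y.ar y.deg) :
    P.ract.L N r xs y ∈ S.carrier N r :=
  P.ract.L_mem (C := fun x => x.val ∈ S.carrier x.ar x.deg)
    (D := fun y => y.val ∈ B'.carrier y.ar y.deg) (E := S.carrier)
    (fun n p hN hr x y => S.ract_mem n p hN hr x y) N r hx hy

theorem exists_elL {a : OdotMap P Q S} {I : P.El → Prop} {J : Q.El → Prop} {xs : List S.El}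
    (h : ∀ x ∈ xs, ∃ X y, y.ar = X.length ∧ a.el X y = x ∧ (∀ z ∈ X, I z) ∧ J y) :
    ∃ L, Matched L ∧ a.elL L = xs ∧ (∀ x ∈ flatL L, I x) ∧ ∀ y ∈ sndL L, J y := by
  induction xs with
  | nil => exact ⟨[], matched_nil, rfl, by simp, by simp⟩
  | cons x xs ih =>
    obtain ⟨L, h₁, h₂, h₃, h₄⟩ := ih fun y hy => h y (by simp [hy])
    obtain ⟨X, y, h₅, h₆, h₇, h₈⟩ := h x (by simp)
    refine ⟨(X, y) :: L, Matched.cons.2 ⟨h₅, h₁⟩, ?_, fun z hz => ?_, fun z hz => ?_⟩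
    · rw [OdotMap.elL_cons, h₂, ← h₆]
    · rw [flatL, List.flatMap_cons] at hz
      exact (List.mem_append.1 hz).elim (h₇ z) (h₃ z)
    · rw [sndL, List.map_cons] at hz
      exact (List.mem_cons.1 hz).elim (fun e => e ▸ h₈) (h₄ z)

variable {A B : DGOperad R} (P : DGBimod A B)

theorem DGBimod.lact_L_ones (y : P.El) : P.lact.L y.ar y.deg (A.ones y.ar) y = y.val :=
  OdotMap.L_eq_of_el (P.one_lact_el y)

theorem DGBimod.lact_el_nil {y : P.El} (h : y.ar = 0) : P.lact.el [] y = y := by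
  have := P.one_lact_el y
  rwa [h] at this

theorem DGBimod.lact_L_nullary (N : ℕ) (r : ℤ) (xs : List A.El) {y : P.El} (h : y.ar = 0)
    (C : ∀ n p, Submodule R (P.X n p)) (hy : y.val ∈ C y.ar y.deg) :
    P.lact.L N r xs y ∈ C N r := by
  by_cases hf : Fits N r xs y
  · obtain ⟨h₁, h₂, h₃⟩ := hf
    obtain rfl : xs = [] := List.length_eq_zero_iff.1 (by rw [← h₁, h])
    obtain ⟨_, r', y⟩ := y
    subst h h₂
    obtain rfl : r' = r := by simpa using h₃
    have : P.lact.L 0 r' [] ⟨0, r', y⟩ = y := OdotMap.L_eq_of_el (P.lact_el_nil rfl)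
    simp only [arSum_nil]
    rw [this]
    exact hy
  · rw [OdotMap.L_of_not _ hf]
    exact Submodule.zero_mem _

theorem DGBimod.lact_extract {l₁ l₂ : List A.El} {x : A.El} {y : P.El} (hx : x.ar = 0)
    (hx' : x.deg = 0) (hy : y.ar = l₁.length + 1 + l₂.length) :
    P.lact.el (l₁ ++ x :: l₂) y =
      P.lact.el (l₁ ++ l₂) (P.lact.el (A.ones l₁.length ++ x :: A.ones l₂.length) y) := by
  let U : List A.El → List (List A.El × A.El) := fun l => l.map fun x => ([x], A.oneEl)
  have hU : ∀ l, Matched (U l) := fun l i hi => by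
    obtain ⟨x, _, rfl⟩ := List.mem_map.1 hi
    rfl
  have hf : ∀ l, flatL (U l) = l := fun l => by simp [U, flatL, List.flatMap_map]
  have hs : ∀ l, sndL (U l) = A.ones l.length := fun l => by
    simp [U, Function.comp_def]
  have he : ∀ l, A.mul.elL (U l) = l := fun l => by
    simp only [U, OdotMap.elL, List.map_map]
    exact (List.map_congr_left fun x _ => A.regular.ract_one_el x).trans (List.map_id l)
  have hk : ∀ l, kos (U l) = 0 := fun l => by
    induction l with
    | nil => rfl
    | cons x l ih =>
      change A.oneEl.deg * _ + kos (U l) = 0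
      rw [ih, add_zero]
      exact zero_mul _
  have h := OdotMap.Assoc.lassoc P.lact_assoc (arSum (l₁ ++ l₂)) (degSum (l₁ ++ l₂) + y.deg)
    (U l₁ ++ ([], x) :: U l₂) y (Matched.append.2 ⟨hU _, Matched.cons.2 ⟨hx, hU _⟩⟩)
  have e₁ : A.mul.el [] x = x := A.regular.lact_el_nil hx
  have e₂ : kos (U l₁ ++ ([], x) :: U l₂) = 0 := by
    rw [kos_append, hk, hs]
    change 0 + (x.deg * _ + kos (U l₂)) + degSum (A.ones l₁.length) * _ = 0
    rw [hk, hx', DGOperad.degSum_ones]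
    ring
  have e₃ : flatL (U l₁ ++ ([], x) :: U l₂) = l₁ ++ l₂ := by
    rw [flatL, List.flatMap_append, List.flatMap_cons]
    exact congrArg₂ (· ++ ·) (hf l₁) (hf l₂)
  have e₄ : sndL (U l₁ ++ ([], x) :: U l₂) = A.ones l₁.length ++ x :: A.ones l₂.length := by
    rw [sndL, List.map_append, List.map_cons]
    rw [← sndL, ← sndL, hs, hs]
  rw [e₂, e₃, e₄, sgn_zero, one_smul, OdotMap.elL_append, OdotMap.elL_cons, he, he, e₁] at h
  rw [OdotMap.el_eq (N := arSum (l₁ ++ l₂)) (r := degSum (l₁ ++ l₂) + y.deg) _ (by simp [hx])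
    (by simp [hx']), h]
  refine (OdotMap.el_eq _ rfl ?_).symm
  simp only [OdotMap.el_deg, degSum_append, degSum_cons, DGOperad.degSum_ones, hx']
  ring

theorem LAssoc.right_mem {P Q S U V W : DGColl R} {a : OdotMap P Q S} {b : OdotMap S U V}
    {c : OdotMap Q U W} {e : OdotMap P W V} (h : LAssoc a b c e) {N : ℕ} {r : ℤ}
    {E : Submodule R (V.X N r)} {zs : List P.El} {xs : List Q.El} {y : U.El} {n : ℕ} {p : ℤ}
    (H : ∀ L, Matched L → flatL L = zs → sndL L = xs → b.L N r (a.elL L) y ∈ E) :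
    e.L N r zs ⟨n, p, c.L n p xs y⟩ ∈ E := by
  by_cases hf : Fits N r zs (⟨n, p, c.L n p xs y⟩ : W.El)
  · by_cases hg : Fits n p xs y
    · have hl : zs.length = arSum xs := by rw [hg.2.1]; exact hf.1.symm
      have h := h N r (blocks zs xs) y (matched_blocks hl)
      have e₁ : flatL (blocks zs xs) = zs := flatL_blocks hl
      have e₂ : sndL (blocks zs xs) = xs := sndL_blocks ..
      rw [e₁, e₂, c.el_eq hg.2.1 hg.2.2] at h
      have h' := congrArg (sgn (kos (blocks zs xs)) • ·) h
      rw [sgn_smul_self] at h'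
      rw [← h']
      exact Submodule.smul_of_tower_mem _ _ (H _ (matched_blocks hl) e₁ e₂)
    · rw [c.L_of_not hg, OdotMap.L_zero]
      exact Submodule.zero_mem _
  · rw [e.L_of_not hf]
    exact Submodule.zero_mem _

/-- The elements `y` such that all `(x₁ ⊗ ⋯ ⊗ xₖ) y`, where the `xᵢ` satisfy `I`, lie in `E`. -/
def DGBimod.leftSat (I : A.El → Prop) (E : ∀ N r, Submodule R (P.X N r)) (n : ℕ) (p : ℤ) :
    Submodule R (P.X n p) where
  carrier := {y | ∀ N r (xs : List A.El), (∀ x ∈ xs, I x) → P.lact.L N r xs ⟨n, p, y⟩ ∈ E N r}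
  zero_mem' N r xs _ := (P.lact.L_zero N r xs n p).symm ▸ Submodule.zero_mem _
  add_mem' {y z} hy hz N r xs h := by
    have : P.lact.L N r xs ⟨n, p, y + z⟩ = _ := (P.lact.elLinear N r xs n p).map_add y z
    exact this.symm ▸ Submodule.add_mem _ (hy N r xs h) (hz N r xs h)
  smul_mem' c y hy N r xs h := by
    have : P.lact.L N r xs ⟨n, p, c • y⟩ = _ := (P.lact.elLinear N r xs n p).map_smul c y
    exact this.symm ▸ Submodule.smul_mem _ _ (hy N r xs h)

theorem DGBimod.leftSat_d {P : DGBimod A B} {I : A.El → Prop} {E : ∀ N r, Submodule R (P.X N r)}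
    (hI : ∀ x, I x → I x.d)
    (hE : ∀ {n : ℕ} {p q : ℤ} (h : p + 1 = q) (x : P.X n p), x ∈ E n p → P.d h x ∈ E n q)
    {n : ℕ} {p q : ℤ} (h : p + 1 = q) {y : P.X n p} (hy : y ∈ P.leftSat I E n p) :
    P.d h y ∈ P.leftSat I E n q := by
  intro N r xs hxs
  subst h
  by_cases hf : Fits N r xs (⟨n, p + 1, P.d rfl y⟩ : P.El)
  · obtain ⟨h₁, h₂, h₃⟩ := hf
    have := P.lact.leibniz_L (N := N) (r := degSum xs + p) (r' := r) (xs := xs)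
      (y := ⟨n, p, y⟩) (by rw [← h₃, add_assoc]) h₁ h₂ rfl
    have e := eq_sub_of_add_eq this.symm
    refine (show P.lact.L N r xs ⟨n, p + 1, P.d rfl y⟩ = _ from e) ▸
      Submodule.sub_mem _ (hE _ _ (hy _ _ _ hxs)) ?_
    refine Submodule.smul_of_tower_mem _ _ (dsum_mem_of_slot fun l₁ x l₂ e => ?_)
    refine hy _ _ _ fun z hz => ?_
    subst e
    rcases List.mem_append.1 hz with hz | hz
    · exact hxs z (by simp [hz])
    · rcases List.mem_cons.1 hz with rfl | hz
      · exact hI x (hxs x (by simp))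
      · exact hxs z (by simp [hz])
  · exact (OdotMap.L_of_not _ hf : P.lact.L N r xs ⟨n, p + 1, P.d rfl y⟩ = 0) ▸
      Submodule.zero_mem _

end General

namespace Asu

/-- The element lies in `A_∞^hu`. -/
def IsHu (x : (Asu R).El) : Prop := x.val ∈ (AhuSub R).carrier x.ar x.deg

/-- The element lies in `A_∞^hu` or is `1^su` or `j`. -/
def IsBasic (x : (Asu R).El) : Prop := IsHu x ∨ x = unitEl R ∨ x = jEl R

theorem isHu_one : IsHu (Asu R).oneEl := (AhuSub R).one_mem

theorem exists_letters {xs : List (Asu R).El} (h : ∀ x ∈ xs, IsBasic x) :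
    ∃ L : List (List (Asu R).El × (Asu R).El), Matched L ∧ (Asu R).mul.elL L = xs ∧
      (∀ x ∈ flatL L, IsHu x) ∧
      ∀ w ∈ sndL L, w = (Asu R).oneEl ∨ w = jEl R ∨ w = unitEl R := by
  refine exists_elL fun x hx => ?_
  have hn : ∀ y : (Asu R).El, y.ar = 0 → (Asu R).mul.el [] y = y := fun y hy =>
    (Asu R).regular.lact_el_nil hy
  rcases h x hx with hx | rfl | rfl
  · exact ⟨[x], (Asu R).oneEl, rfl, (Asu R).regular.ract_one_el x, by simpa using hx, .inl rfl⟩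
  · exact ⟨[], unitEl R, rfl, hn _ rfl, by simp, .inr (.inr rfl)⟩
  · exact ⟨[], jEl R, rfl, hn _ rfl, by simp, .inr (.inl rfl)⟩

theorem exists_word {ws : List (Asu R).El} (h : ∀ w ∈ ws, w = (Asu R).oneEl ∨ w = jEl R) :
    ∃ w : Fin ws.length → Bool, ws = List.ofFn fun a =>
      (⟨letterArity (w a), letterDeg (w a), letter (w a)⟩ : (Asu R).El) := by
  classical
  refine ⟨fun a => decide (ws.get a = jEl R), ?_⟩
  refine List.ext_getElem (by simp) fun i h₁ h₂ => ?_
  rw [List.getElem_ofFn]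
  by_cases e : ws.get ⟨i, h₁⟩ = jEl R
  · have : decide (ws.get ⟨i, h₁⟩ = jEl R) = true := decide_eq_true e
    change ws[i] = ⟨letterArity (decide (ws.get ⟨i, h₁⟩ = jEl R)), letterDeg _, letter _⟩
    rw [this]
    exact e
  · have : decide (ws.get ⟨i, h₁⟩ = jEl R) = false := decide_eq_false e
    change ws[i] = ⟨letterArity (decide (ws.get ⟨i, h₁⟩ = jEl R)), letterDeg _, letter _⟩
    rw [this]
    exact (h _ (ws.get_mem _)).resolve_right e

theorem isHu_word {ws : List (Asu R).El} (h : ∀ w ∈ ws, w = (Asu R).oneEl ∨ w = jEl R)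
    (hl : 2 ≤ ws.length) : IsHu ((Asu R).mul.el ws (mEl R ws.length)) := by
  obtain ⟨w, e⟩ := exists_word h
  rw [mEl_of_le hl]
  have := (Asu R).mul.el_ofFn (fun a => letterArity (w a)) (fun a => letterDeg (w a)) rfl rfl
    (fun a => letter (w a)) (m ws.length hl)
  rw [← e] at this
  rw [this]
  exact DGOperad.mem_adjoin (.m ws.length hl w)

theorem spanOf_d {n : ℕ} {p q : ℤ} (h : p + 1 = q) (x : (Asu R).X n p)
    (hx : x ∈ spanOf IsBasic n p) : (Asu R).d h x ∈ spanOf IsBasic n q := by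
  subst h
  induction hx using Submodule.span_induction with
  | mem x hx =>
    rcases hx with hx | hx | hx
    · exact Submodule.subset_span (.inl ((AhuSub R).d_mem rfl x hx))
    · cases hx
      have : (Asu R).d (zero_add 1) unit = 0 := unit_d
      exact (this : (Asu R).d rfl unit = 0) ▸ Submodule.zero_mem _
    · cases hx
      have : (Asu R).d (by simp) j = unit - i := j_d
      refine (this : (Asu R).d rfl j = (unit - i : (Asu R).X 0 0)) ▸ Submodule.sub_mem _ ?_ ?_
      · exact Submodule.subset_span (.inr (.inl rfl))
      · exact Submodule.subset_span (.inl (DGOperad.mem_adjoin .i))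
  | zero => rw [map_zero]; exact Submodule.zero_mem _
  | add x y _ _ hx hy => rw [map_add]; exact Submodule.add_mem _ hx hy
  | smul c x _ hx => rw [map_smul]; exact Submodule.smul_mem _ _ hx

theorem mul_m_mem (N : ℕ) (r : ℤ) (n : ℕ) (hn : 2 ≤ n) {xs : List (Asu R).El}
    (hxs : ∀ x ∈ xs, InSpan IsBasic x) :
    (Asu R).mul.L N r xs (mEl R n) ∈ spanOf IsBasic N r := by
  by_cases hlen : n = xs.length
  swap
  · rw [OdotMap.L_of_not _ fun h => hlen h.1]
    exact Submodule.zero_mem _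
  refine ((Asu R).mul.slotLinear N r (mEl R n)).mem_of_inSpan hxs fun l hl hG => ?_
  obtain ⟨L, hL, rfl, h₁, h₂⟩ := exists_letters hG
  rw [OdotMap.Assoc.lassoc (Asu R).assoc N r L _ hL]
  refine Submodule.smul_of_tower_mem _ _ ?_
  have hlen : n = (sndL L).length := by
    rw [hlen, ← hl.length, OdotMap.length_elL, List.length_map]
  by_cases hu : unitEl R ∈ sndL L
  · obtain ⟨l₁, l₂, e⟩ := List.append_of_mem hu
    have hn' : n = l₁.length + 1 + l₂.length := by
      rw [hlen, e]; simp; omega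
    have he : (Asu R).mul.el (sndL L) (mEl R n) = (Asu R).mul.el (l₁ ++ l₂)
        ((Asu R).mul.el ((Asu R).ones l₁.length ++ unitEl R :: (Asu R).ones l₂.length)
          (mEl R n)) := by
      rw [e]
      exact (Asu R).regular.lact_extract rfl rfl hn'
    rw [he]
    by_cases h3 : 3 ≤ n
    · have : (Asu R).mul.el ((Asu R).ones l₁.length ++ unitEl R :: (Asu R).ones l₂.length)
          (mEl R n) = ⟨_, _, 0⟩ := congrArg (DGColl.El.mk _ _) (by
        have e : mEl R n = mEl R (l₁.length + 1 + l₂.length) := congrArg _ hn'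
        generalize mEl R n = y at e ⊢
        subst e
        exact unit_mul_m _ _ (by omega))
      rw [this, OdotMap.el_zero, OdotMap.L_zero]
      exact Submodule.zero_mem _
    · obtain rfl : n = 2 := by omega
      rw [unit_mul_m₂ (by omega)]
      obtain ⟨w, hw⟩ : ∃ w, l₁ ++ l₂ = [w] := List.length_eq_one_iff.1 (by simp; omega)
      have : (Asu R).mul.el [w] (Asu R).oneEl = w := (Asu R).regular.ract_one_el w
      rw [hw, this]
      have hw' : w ∈ sndL L := by
        have : w ∈ l₁ ++ l₂ := by simp [hw]
        rw [e]
        simp only [List.mem_append, List.mem_cons] at this ⊢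
        tauto
      rcases h₂ w hw' with rfl | rfl | rfl
      · exact Submodule.subset_span (.inl ((AhuSub R).mul_L_mem N r h₁ (AhuSub R).one_mem))
      · exact (Asu R).regular.lact_L_nullary N r _ rfl (spanOf IsBasic)
          (mem_spanOf (.inr (.inr rfl)))
      · exact (Asu R).regular.lact_L_nullary N r _ rfl (spanOf IsBasic)
          (mem_spanOf (.inr (.inl rfl)))
  · refine Submodule.subset_span (.inl ((AhuSub R).mul_L_mem N r h₁ ?_))
    subst hlen
    refine isHu_word (fun w hw => ?_) hn
    rcases h₂ w hw with rfl | rfl | rfl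
    · exact .inl rfl
    · exact .inr rfl
    · exact absurd hw hu

/-- The operad `A_∞^su⟨i,j⟩` is spanned by `A_∞^hu`, `1^su` and `j`. -/
theorem inSpan (x : (Asu R).El) : InSpan IsBasic x := by
  let C := (Asu R).regular.leftSat (InSpan IsBasic) (spanOf IsBasic)
  have nul : ∀ y : (Asu R).El, y.ar = 0 → IsBasic y → y.val ∈ C y.ar y.deg :=
    fun y h hy N r xs _ => (Asu R).regular.lact_L_nullary N r _ h (spanOf IsBasic) (mem_spanOf hy)
  have key : x.val ∈ C x.ar x.deg := by
    refine presentedOperad.induction (M := ARel) C (fun n p g => ?_) ?_ (fun n p q h y hy => ?_)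
      (fun N r xs y hx hy => ?_) x
    · cases g with
      | m _ _ hn hp =>
        subst hp
        intro N r xs h
        have := mul_m_mem N r n hn h
        rwa [mEl_of_le hn] at this
      | unit => exact nul (unitEl R) rfl (.inr (.inl rfl))
      | i => exact nul ⟨0, 0, i⟩ rfl (.inl (DGOperad.mem_adjoin .i))
      | j => exact nul (jEl R) rfl (.inr (.inr rfl))
    · intro N r xs h
      by_cases hf : Fits N r xs (Asu R).oneEl
      · obtain ⟨h₁, h₂, h₃⟩ := hf
        obtain ⟨w, rfl⟩ := List.length_eq_one_iff.1 h₁.symm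
        obtain ⟨n, p, w⟩ := w
        obtain rfl : n = N := by simpa using h₂
        obtain rfl : p = r := by simpa [DGOperad.oneEl] using h₃
        have : (Asu R).mul.L n p [⟨n, p, w⟩] (Asu R).oneEl = w :=
          OdotMap.L_eq_of_el ((Asu R).regular.ract_one_el ⟨n, p, w⟩)
        exact (this : (Asu R).mul.L n p [⟨n, p, w⟩] ⟨1, 0, (Asu R).one⟩ = w).symm ▸
          h ⟨n, p, w⟩ (by simp)
      · exact (OdotMap.L_of_not _ hf : (Asu R).mul.L N r xs ⟨1, 0, (Asu R).one⟩ = 0) ▸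
          Submodule.zero_mem _
    · exact (Asu R).regular.leftSat_d (fun x hx => spanOf_d rfl _ hx) spanOf_d h hy
    · intro N' r' zs hzs
      refine LAssoc.right_mem (OdotMap.Assoc.lassoc (Asu R).assoc) fun L hL h₁ h₂ => ?_
      refine hy N' r' _ fun z hz => ?_
      obtain ⟨b, hb, rfl⟩ := List.mem_map.1 hz
      refine hx b.2 ?_ _ _ _ fun w hw => hzs w ?_
      · rw [← h₂]
        exact List.mem_map_of_mem hb
      · rw [← h₁]
        exact List.mem_flatMap.2 ⟨b, hb, hw⟩
  have := key x.ar x.deg ((Asu R).ones x.ar) fun w hw => by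
    rw [List.eq_of_mem_replicate hw]
    exact InSpan.of (.inl isHu_one)
  rwa [show (Asu R).regular.lact.L x.ar x.deg ((Asu R).ones x.ar) ⟨x.ar, x.deg, x.val⟩ = x.val from
    (Asu R).regular.lact_L_ones x] at this

end Asu

end HUnital

namespace HUnital

variable {R : Type u} [CommRing R]

namespace Fsu

open HUnital.Asu (unitEl jEl mEl IsHu IsBasic)

/-- The element `b ρ_∅`. -/
noncomputable def rhoEl (b : (Asu R).El) : (Fsu R).El := (Fsu R).ract.el [] b

@[simp] theorem rhoEl_ar (b : (Asu R).El) : (rhoEl b).ar = 0 := rfl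

@[simp] theorem rhoEl_deg (b : (Asu R).El) : (rhoEl b).deg = b.deg := by simp [rhoEl]

/-- The element lies in `F_1^hu`. -/
def IsHu (x : (Fsu R).El) : Prop := x.val ∈ (FhuSub R).carrier x.ar x.deg

/-- The element lies in `F_1^hu` or is `1^su ρ_∅` or `j ρ_∅`. -/
def IsBasic (x : (Fsu R).El) : Prop := IsHu x ∨ x = rhoEl (unitEl R) ∨ x = rhoEl (jEl R)

theorem isHu_rhoEl {b : (Asu R).El} (h : Asu.IsHu b) : IsHu (rhoEl b) :=
  (FhuSub R).ract_L_mem _ _ (by simp) h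

theorem d_rhoEl {b : (Asu R).El} (h : b.ar = 0) : (rhoEl b).d = rhoEl b.d := by
  have := (Fsu R).ract.leibniz_L (N := 0) (r := degSum ([] : List (Fsu R).El) + b.deg)
    rfl (xs := []) (y := b) h rfl rfl
  simp only [dsum, smul_zero, add_zero] at this
  refine (congrArg (DGColl.El.mk 0 _) this).trans ?_
  exact ((Fsu R).ract.el_eq (xs := []) (y := b.d) rfl (by rw [DGColl.El.d_deg, add_assoc])).symm

theorem rhoEl_mem {n : ℕ} {p : ℤ} {b : (Asu R).X n p}
    (hb : b ∈ spanOf Asu.IsBasic n p) : InSpan IsBasic (rhoEl ⟨n, p, b⟩) := by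
  refine ElLinear.mem_of_inSpan (P := (Asu R).toDGColl) (G := Asu.IsBasic)
    ((Fsu R).ract.elLinear 0 (rhoEl ⟨n, p, b⟩).deg [])
    (x := ⟨n, p, b⟩) hb fun y _ hp hG => ?_
  have hd : (rhoEl ⟨n, p, b⟩).deg = (rhoEl y).deg := by simp [hp]
  rw [hd]
  refine mem_spanOf (x := rhoEl y) ?_
  rcases hG with hG | rfl | rfl
  · exact .inl (isHu_rhoEl hG)
  · exact .inr (.inl rfl)
  · exact .inr (.inr rfl)

theorem spanOf_d {n : ℕ} {p q : ℤ} (h : p + 1 = q) (x : (Fsu R).X n p)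
    (hx : x ∈ spanOf IsBasic n p) : (Fsu R).d h x ∈ spanOf IsBasic n q := by
  subst h
  have key : ∀ b : (Asu R).El, b.ar = 0 → Asu.IsBasic b →
      InSpan IsBasic (rhoEl b).d := fun b h hb => by
    rw [d_rhoEl h]
    exact rhoEl_mem (Asu.spanOf_d rfl _ (mem_spanOf hb))
  induction hx using Submodule.span_induction with
  | mem x hx =>
    rcases hx with hx | hx | hx
    · exact Submodule.subset_span (.inl ((FhuSub R).d_mem rfl x hx))
    · cases hx
      exact key _ rfl (.inr (.inl rfl))
    · cases hx
      exact key _ rfl (.inr (.inr rfl))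
  | zero => rw [map_zero]; exact Submodule.zero_mem _
  | add x y _ _ hx hy => rw [map_add]; exact Submodule.add_mem _ hx hy
  | smul c x _ hx => rw [map_smul]; exact Submodule.smul_mem _ _ hx

theorem exists_ract {xs : List (Fsu R).El} (h : ∀ x ∈ xs, IsBasic x) :
    ∃ L, Matched L ∧ (Fsu R).ract.elL L = xs ∧ (∀ x ∈ flatL L, IsHu x) ∧
      ∀ w ∈ sndL L, w = (Asu R).oneEl ∨ w = jEl R ∨ w = unitEl R := by
  refine exists_elL fun x hx => ?_
  rcases h x hx with hx | rfl | rfl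
  · exact ⟨[x], (Asu R).oneEl, rfl, (Fsu R).ract_one_el x, by simpa using hx, .inl rfl⟩
  · exact ⟨[], unitEl R, rfl, rfl, by simp, .inr (.inr rfl)⟩
  · exact ⟨[], jEl R, rfl, rfl, by simp, .inr (.inl rfl)⟩

theorem ract_nullary (N : ℕ) (r : ℤ) (xs : List (Fsu R).El) {b : (Asu R).El} (h : b.ar = 0)
    (hb : Asu.IsBasic b) : (Fsu R).ract.L N r xs b ∈ spanOf IsBasic N r := by
  by_cases hf : Fits N r xs b
  · obtain ⟨h₁, h₂, h₃⟩ := hf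
    obtain rfl : xs = [] := List.length_eq_zero_iff.1 (by rw [← h₁, h])
    subst h₂ h₃
    exact rhoEl_mem (mem_spanOf hb)
  · rw [OdotMap.L_of_not _ hf]
    exact Submodule.zero_mem _

theorem ract_mem (N : ℕ) (r : ℤ) {xs : List (Fsu R).El} (hxs : ∀ x ∈ xs, InSpan IsBasic x)
    (b : (Asu R).El) : (Fsu R).ract.L N r xs b ∈ spanOf IsBasic N r := by
  refine ((Fsu R).ract.slotLinear N r b).mem_of_inSpan hxs fun l _ hG => ?_
  obtain ⟨L, hL, rfl, h₁, -⟩ := exists_ract hG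
  rw [OdotMap.Assoc.lassoc (Fsu R).ract_assoc N r L _ hL]
  refine Submodule.smul_of_tower_mem _ _ ?_
  refine ElLinear.mem_of_inSpan ((Fsu R).ract.elLinear N r (flatL L)) (Asu.inSpan _)
    fun y _ _ hG => ?_
  rcases hG with hG | rfl | rfl
  · exact Submodule.subset_span (.inl ((FhuSub R).ract_L_mem N r h₁ hG))
  · exact ract_nullary N r _ rfl (.inr (.inl rfl))
  · exact ract_nullary N r _ rfl (.inr (.inr rfl))

theorem fEl_of_le {n : ℕ} (h : 1 ≤ n) : fEl R n = ⟨n, 1 - n, f n h⟩ := by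
  rw [fEl, uEl, fu_of_le h]

theorem isHu_word {ws : List (Asu R).El} (h : ∀ w ∈ ws, w = (Asu R).oneEl ∨ w = jEl R)
    (hl : 1 ≤ ws.length) (hj : ws ≠ [jEl R]) :
    IsHu ((Fsu R).lact.el ws (fEl R ws.length)) := by
  obtain ⟨w, e⟩ := Asu.exists_word h
  rw [fEl_of_le hl]
  have := (Fsu R).lact.el_ofFn (fun a => letterArity (w a)) (fun a => letterDeg (w a)) rfl rfl
    (fun a => letter (w a)) (f ws.length hl)
  rw [← e] at this
  rw [this]
  refine DGBimod.mem_adjoin (.f ws.length hl w fun ⟨h₁, h₂⟩ => hj ?_)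
  rw [e]
  refine List.ext_getElem (by simp [h₁]) fun i h₃ h₄ => ?_
  obtain rfl : i = 0 := by simpa using h₄
  rw [List.getElem_ofFn]
  change (⟨letterArity (w _), letterDeg (w _), letter (w _)⟩ : (Asu R).El) = jEl R
  rw [h₂]
  rfl

theorem lact_unit_f₁ : (Fsu R).lact.el [unitEl R] (fEl R 1) = rhoEl (unitEl R) := by
  have := (relL (R := R)).unit_rho
  rw [(Fsu R).lact.el_eq (N := 0) (r := 0) (by simp) (by simp)]
  exact (congrArg (DGColl.El.mk 0 0) this.symm).trans
    ((Fsu R).ract.el_eq (xs := []) (y := unitEl R) rfl (by simp)).symm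

theorem lact_j_f₁ : InSpan IsBasic ((Fsu R).lact.el [jEl R] (fEl R 1)) := by
  have hv : (Fsu R).lact.L 0 (-1) [jEl R] (fEl R 1) = v + (Fsu R).ract.L 0 (-1) [] (jEl R) := by
    rw [v, insertOp_eq_L _ _ _ _ _ _ 0 0 rfl rfl, rho, OdotMap.app_eq_L, fEl_of_le le_rfl]
    exact (sub_add_cancel _ _).symm
  rw [(Fsu R).lact.el_eq (N := 0) (r := -1) (by simp) (by simp)]
  rw [hv]
  refine Submodule.add_mem _ (Submodule.subset_span (.inl (DGBimod.mem_adjoin .v)))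
    (Submodule.subset_span (.inr (.inr ?_)))
  exact ((Fsu R).ract.el_eq (xs := []) (y := jEl R) rfl (by simp)).symm

theorem lact_f_mem (N : ℕ) (r : ℤ) (n : ℕ) (hn : 1 ≤ n) (xs : List (Asu R).El) :
    (Fsu R).lact.L N r xs (fEl R n) ∈ spanOf IsBasic N r := by
  by_cases hlen : n = xs.length
  swap
  · rw [OdotMap.L_of_not _ fun h => hlen h.1]
    exact Submodule.zero_mem _
  refine ((Fsu R).lact.slotLinear N r (fEl R n)).mem_of_inSpan (fun x _ => Asu.inSpan x)
    fun l hl hG => ?_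
  obtain ⟨L, hL, rfl, h₁, h₂⟩ := Asu.exists_letters hG
  rw [OdotMap.Assoc.lassoc (Fsu R).lact_assoc N r L _ hL]
  refine Submodule.smul_of_tower_mem _ _ ?_
  have hlen : n = (sndL L).length := by
    rw [hlen, ← hl.length, OdotMap.length_elL, List.length_map]
  by_cases hu : unitEl R ∈ sndL L
  · obtain ⟨l₁, l₂, e⟩ := List.append_of_mem hu
    have hn' : n = l₁.length + 1 + l₂.length := by
      rw [hlen, e]; simp; omega
    by_cases h3 : 2 ≤ n
    · have he : (Fsu R).lact.el (sndL L) (fEl R n) = (Fsu R).lact.el (l₁ ++ l₂)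
          ((Fsu R).lact.el ((Asu R).ones l₁.length ++ unitEl R :: (Asu R).ones l₂.length)
            (fEl R n)) := by
        rw [e]
        exact (Fsu R).lact_extract rfl rfl hn'
      rw [he]
      have : (Fsu R).lact.el ((Asu R).ones l₁.length ++ unitEl R :: (Asu R).ones l₂.length)
          (fEl R n) = ⟨_, _, 0⟩ := congrArg (DGColl.El.mk _ _) (by
        have e : fEl R n = fEl R (l₁.length + 1 + l₂.length) := congrArg _ hn'
        generalize fEl R n = y at e ⊢
        subst e
        exact relL.unit_f _ _ (by omega) _ _)
      rw [this, OdotMap.el_zero, OdotMap.L_zero]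
      exact Submodule.zero_mem _
    · obtain rfl : n = 1 := by omega
      obtain rfl : l₁ = [] := List.length_eq_zero_iff.1 (by omega)
      obtain rfl : l₂ = [] := List.length_eq_zero_iff.1 (by omega)
      rw [e, List.nil_append, lact_unit_f₁]
      exact (Fsu R).lact_L_nullary N r _ rfl (spanOf IsBasic) (mem_spanOf (.inr (.inl rfl)))
  · have h₃ : ∀ w ∈ sndL L, w = (Asu R).oneEl ∨ w = jEl R := fun w hw => by
      rcases h₂ w hw with rfl | rfl | rfl
      · exact .inl rfl
      · exact .inr rfl
      · exact absurd hw hu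
    by_cases hj : sndL L = [jEl R]
    · obtain rfl : n = 1 := by rw [hlen, hj]; rfl
      rw [hj]
      exact (Fsu R).lact_L_nullary N r _ rfl (spanOf IsBasic) lact_j_f₁
    · refine Submodule.subset_span (.inl ((FhuSub R).lact_L_mem N r h₁ ?_))
      subst hlen
      exact isHu_word h₃ hn hj

/-- The bimodule `F_1^su⟨i,j⟩` is spanned by `F_1^hu`, `1^su ρ_∅` and `j ρ_∅`. -/
theorem inSpan (x : (Fsu R).El) : InSpan IsBasic x := by
  let C := (Fsu R).leftSat (fun _ => True) (spanOf IsBasic)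
  have key : x.val ∈ C x.ar x.deg := by
    refine presentedBimod.induction (M := FRel) C (fun n p g => ?_) (fun n p q h y hy => ?_)
      (fun N r xs y hy => ?_) (fun N r xs y hx => ?_) x
    · obtain ⟨hn, rfl⟩ := g
      intro N r xs _
      have := lact_f_mem N r n hn xs
      rwa [fEl_of_le hn] at this
    · exact DGBimod.leftSat_d (P := Fsu R) (fun _ _ => trivial) spanOf_d h hy
    · intro N' r' zs _
      exact LAssoc.right_mem (OdotMap.Assoc.lassoc (Fsu R).lact_assoc) fun L _ _ _ =>
        hy N' r' _ fun _ _ => trivial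
    · intro N' r' zs _
      refine LAssoc.right_mem (OdotMap.Assoc.lassoc (Fsu R).comm) fun L hL h₁ h₂ => ?_
      refine ract_mem N' r' (fun z hz => ?_) y
      obtain ⟨b, hb, rfl⟩ := List.mem_map.1 hz
      refine hx b.2 ?_ _ _ _ fun _ _ => trivial
      rw [← h₂]
      exact List.mem_map_of_mem hb
  have := key x.ar x.deg ((Asu R).ones x.ar) fun w _ => trivial
  rwa [show (Fsu R).lact.L x.ar x.deg ((Asu R).ones x.ar) ⟨x.ar, x.deg, x.val⟩ = x.val from
    (Fsu R).lact_L_ones x] at this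

end Fsu

end HUnital

namespace HUnital

variable {R : Type u} [CommRing R]

/-! The counit of `F_1^su⟨i,j⟩`. -/

theorem OdotMap.L_eq_zero_of_mem {P Q S : DGColl R} (t : OdotMap P Q S) (N : ℕ) (r : ℤ)
    {xs : List P.El} {n : ℕ} {p : ℤ} (h : (⟨n, p, 0⟩ : P.El) ∈ xs) (y : Q.El) :
    t.L N r xs y = 0 := by
  obtain ⟨l₁, l₂, rfl⟩ := List.append_of_mem h
  exact (t.slotLinear N r y l₁ l₂ n p).map_zero

namespace Fsu

open HUnital.Asu (unitEl jEl mEl)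

variable (R) in
/-- The images of the `f_n` under the counit. -/
noncomputable def counitFam (n : ℕ) : (Asu R).regular.X n (1 - n) :=
  if h : n = 1 then (Asu R).cast h.symm (by simp [h]) (Asu R).one else 0

theorem counitFam_one : counitFam R 1 = (Asu R).one := dif_pos rfl

theorem counitFam_of_ne {n : ℕ} (h : n ≠ 1) : counitFam R n = 0 := dif_neg h

theorem uEl_counitFam_one : uEl (P := (Asu R).regular) (counitFam R) 1 = (Asu R).oneEl :=
  congrArg (DGColl.El.mk 1 0) counitFam_one

theorem uEl_counitFam_of_ne {n : ℕ} (h : n ≠ 1) :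
    uEl (P := (Asu R).regular) (counitFam R) n = ⟨n, 1 - n, 0⟩ :=
  congrArg (DGColl.El.mk _ _) (counitFam_of_ne h)

theorem counitRel : FRelL (P := (Asu R).regular) (counitFam R) where
  d n hn := by
    have h₀ : (Asu R).regular.d rfl (counitFam R n) = 0 := by
      by_cases h : n = 1
      · subst h
        rw [counitFam_one]
        exact (Asu R).d_one
      · rw [counitFam_of_ne h]
        exact map_zero _
    rw [h₀, eq_comm, sub_eq_zero]
    by_cases h1 : n = 1
    · subst h1
      rw [Finset.sum_eq_zero fun t _ => ?_, Finset.sum_eq_zero fun c _ => ?_]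
      · exact absurd c.2 (by have := c.1.length_le; omega)
      · exact absurd t.2.2 (by have := t.sum; omega)
    · have hn2 : 2 ≤ n := by omega
      have e₁ : ∑ t : Cut n, sgn (t.c + t.a * t.b) •
          (Asu R).regular.lact.L n (1 - n + 1) ((Asu R).ones t.a ++ mEl R t.b :: (Asu R).ones t.c)
            (uEl (P := (Asu R).regular) (counitFam R) (t.a + 1 + t.c)) =
          (Asu R).mul.L n (1 - n + 1) [mEl R n] (Asu R).oneEl := by
        let t₀ : Cut n := ⟨(⟨0, by omega⟩, ⟨n, by omega⟩, ⟨0, by omega⟩), by simp; omega⟩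
        refine (Finset.sum_eq_single t₀ (fun t _ ht => ?_) (by simp)).trans ?_
        · rw [uEl_counitFam_of_ne, OdotMap.L_zero, smul_zero]
          intro h
          have h' := t.sum
          refine ht (Subtype.ext (Prod.ext (Fin.ext ?_) (Prod.ext (Fin.ext ?_) (Fin.ext ?_))))
          · change t.a = 0
            omega
          · change t.b = n
            omega
          · change t.c = 0
            omega
        · change sgn ((0 : ℕ) + (0 : ℕ) * (n : ℕ)) • (Asu R).mul.L n (1 - n + 1) [mEl R n]
            (uEl (P := (Asu R).regular) (counitFam R) 1) = _
          rw [uEl_counitFam_one]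
          simp
      have e₂ : ∑ c : {c : Composition n // 1 < c.length}, sgn (sigma c.1) •
          (Asu R).regular.ract.L n (1 - n + 1)
            (c.1.blocks.map (uEl (P := (Asu R).regular) (counitFam R))) (mEl R c.1.length) =
          (Asu R).mul.L n (1 - n + 1) ((Asu R).ones n) (mEl R n) := by
        refine (Finset.sum_eq_single ⟨Composition.ones n, by simp; omega⟩ (fun c _ hc => ?_)
          (by simp)).trans ?_
        · obtain ⟨i, hi, hi'⟩ := Composition.ne_ones_iff.1 fun h => hc (Subtype.ext h)
          rw [OdotMap.L_eq_zero_of_mem (n := i) (p := 1 - i), smul_zero]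
          rw [← uEl_counitFam_of_ne (by omega)]
          exact List.mem_map_of_mem hi
        · have : sigma (Composition.ones n) = 0 := Finset.sum_eq_zero fun a _ => by simp
          dsimp only
          rw [this, sgn_zero, one_smul, Composition.ones_blocks, List.map_replicate,
            uEl_counitFam_one, Composition.ones_length]
          rfl
      rw [e₁, e₂]
      have h₁ := (Asu R).regular.ract_one_el (mEl R n)
      have h₂ := (Asu R).regular.one_lact_el (mEl R n)
      have d : 1 - (n : ℤ) + 1 = (mEl R n).deg := by rw [Asu.mEl_deg]; ring
      rw [d]
      exact (OdotMap.L_eq_of_el h₁).trans (OdotMap.L_eq_of_el h₂).symm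
  unit_rho := by
    rw [uEl_counitFam_one]
    exact (OdotMap.L_eq_of_el ((Asu R).regular.lact_el_nil (y := unitEl R) rfl)).trans
      (OdotMap.L_eq_of_el ((Asu R).regular.ract_one_el (unitEl R))).symm
  unit_f b c h N r := by
    rw [uEl_counitFam_of_ne (by omega)]
    exact OdotMap.L_zero _ _ _ _ _ _

theorem exists_unique_counit : ∃! ε : (Fsu R).Hom (Asu R).regular, IsCounit ε := by
  obtain ⟨g, hg⟩ := exists_hom (counitRel (R := R))
  refine ⟨g, ⟨(hg 1 le_rfl).trans ?_, fun n hn => (hg n hn.le).trans ?_⟩, fun ε h => ?_⟩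
  · exact counitFam_one
  · exact counitFam_of_ne hn.ne'
  · refine hom_ext fun n hn => ?_
    rw [hg n hn]
    by_cases h1 : n = 1
    · subst h1
      exact h.1.trans counitFam_one.symm
    · exact (h.2 n (by omega)).trans (counitFam_of_ne h1).symm

theorem el_fEl {ε : (Fsu R).Hom (Asu R).regular} (h : IsCounit ε) {n : ℕ} (hn : 1 ≤ n) :
    ε.toHom.el (fEl R n) = uEl (P := (Asu R).regular) (counitFam R) n := by
  rw [fEl_of_le hn]
  by_cases h1 : n = 1
  · subst h1
    rw [uEl_counitFam_one]
    exact congrArg (DGColl.El.mk 1 0) h.1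
  · rw [uEl_counitFam_of_ne h1]
    exact congrArg (DGColl.El.mk _ _) (h.2 n (by omega))

end Fsu

theorem DGOperad.adjoin_le {O : DGOperad R} {G : ∀ n p, O.X n p → Prop} (S : O.Sub)
    (h : ∀ n p x, G n p x → x ∈ S.carrier n p) {n : ℕ} {p : ℤ} {x : O.X n p}
    (hx : x ∈ (O.adjoin G).carrier n p) : x ∈ S.carrier n p := by
  simp only [DGOperad.adjoin, Submodule.mem_iInf] at hx
  exact hx S h

theorem DGBimod.adjoin_le {A B : DGOperad R} {P : DGBimod A B} {A' : A.Sub} {B' : B.Sub}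
    {G : ∀ n p, P.X n p → Prop} (S : P.Sub A' B') (h : ∀ n p x, G n p x → x ∈ S.carrier n p)
    {n : ℕ} {p : ℤ} {x : P.X n p} (hx : x ∈ (P.adjoin A' B' G).carrier n p) :
    x ∈ S.carrier n p := by
  simp only [DGBimod.adjoin, Submodule.mem_iInf] at hx
  exact hx S h

/-- The preimage of a subbimodule. -/
def DGBimod.Sub.comap {A B : DGOperad R} {P Q : DGBimod A B} {A' : A.Sub} {B' : B.Sub}
    (S : Q.Sub A' B') (f : P.Hom Q) : P.Sub A' B' where
  carrier n p := (S.carrier n p).comap f.f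
  d_mem h x hx := by
    rw [Submodule.mem_comap, f.map_d]
    exact S.d_mem h _ hx
  lact_mem n p hN hr a y ha hy := by
    rw [Submodule.mem_comap, f.map_lact]
    exact S.lact_mem n p hN hr a _ ha hy
  ract_mem n p hN hr x b hx hb := by
    rw [Submodule.mem_comap, f.map_ract]
    exact S.ract_mem n p hN hr _ b hx hb

/-- A dg-suboperad as a subbimodule over itself. -/
def DGOperad.Sub.regular {O : DGOperad R} (S : O.Sub) : O.regular.Sub S S where
  toSub := S.toSub
  lact_mem n p hN hr a y ha hy := S.mul_mem n p hN hr a y ha hy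
  ract_mem n p hN hr a y ha hy := S.mul_mem n p hN hr a y ha hy

namespace Fsu

open HUnital.Asu (unitEl jEl mEl)

variable {ε : (Fsu R).Hom (Asu R).regular}

theorem counit_lact (hε : IsCounit ε) (N : ℕ) (r : ℤ) (ws : List (Asu R).El) :
    ε.f ((Fsu R).lact.L N r ws (fEl R 1)) = (Asu R).mul.L N r ws (Asu R).oneEl := by
  rw [ε.map_lact_L, el_fEl hε le_rfl, uEl_counitFam_one]
  rfl

theorem counit_rhoEl (b : (Asu R).El) (h : b.ar = 0) : ε.toHom.el (rhoEl b) = b := by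
  refine Eq.trans ?_ ((Asu R).regular.lact_el_nil h)
  exact congrArg (DGColl.El.mk _ _) (ε.map_ract_L _ _ _ _)

theorem rho_eq_L {p : ℤ} (x : (Asu R).X 0 p) : rho x = (Fsu R).ract.L 0 p [] ⟨0, p, x⟩ := by
  rw [rho, OdotMap.app_eq_L, List.ofFn_zero]
  rfl

theorem counit_mem (hε : IsCounit ε) {n : ℕ} {p : ℤ} {x : (Fsu R).X n p}
    (hx : x ∈ (FhuSub R).carrier n p) : ε.f x ∈ (AhuSub R).carrier n p := by
  refine DGBimod.adjoin_le ((AhuSub R).regular.comap ε) (fun n p x hx => ?_) hx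
  change ε.f x ∈ (AhuSub R).carrier n p
  cases hx with
  | v =>
    have h₁ : ε.f (insertOp (Fsu R).lact (0 : Fin 1) Asu.j (f 1 le_rfl) rfl (by simp)) =
        (Asu.j : (Asu R).X 0 (-1)) := by
      rw [insertOp_eq_L _ _ _ _ _ _ 0 0 rfl rfl]
      have := counit_lact hε 0 (-1) [jEl R]
      rw [fEl_of_le le_rfl] at this
      exact this.trans (OdotMap.L_eq_of_el ((Asu R).regular.ract_one_el (jEl R)))
    have h₂ : ε.f (rho (Asu.j : (Asu R).X 0 (-1))) = Asu.j := by
      rw [rho_eq_L, ε.map_ract_L]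
      exact OdotMap.L_eq_of_el ((Asu R).regular.lact_el_nil (y := jEl R) rfl)
    rw [v, map_sub, h₁, h₂]
    exact (sub_self (Asu.j : (Asu R).X 0 (-1))).symm ▸ Submodule.zero_mem _
  | f l hl w hw =>
    rw [wordAct, OdotMap.app_eq_L, ← fEl_of_le hl, ε.map_lact_L, el_fEl hε hl]
    by_cases h1 : l = 1
    · subst h1
      rw [uEl_counitFam_one]
      refine (AhuSub R).mul_L_mem _ _ (fun z hz => ?_) (AhuSub R).one_mem
      obtain ⟨a, rfl⟩ := List.mem_ofFn.1 hz
      have ha : w a = false := by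
        by_contra h
        refine hw ⟨rfl, fun b => ?_⟩
        rw [Subsingleton.elim b a]
        simpa using h
      change letter (w a) ∈ (AhuSub R).carrier (letterArity (w a)) (letterDeg (w a))
      rw [ha]
      exact (AhuSub R).one_mem
    · rw [uEl_counitFam_of_ne h1, OdotMap.L_zero]
      exact Submodule.zero_mem _

end Fsu

end HUnital

namespace HUnital

variable {R : Type u} [CommRing R]

/-! An operad that detects `1^su` and `j`. -/

namespace Dual

open DualNumber
open TrivSqZeroExt (inl)

variable (R) in
/-- The dual numbers of degree `p`, where `ε` has degree `-1`. -/
def X (p : ℤ) : Submodule R (DualNumber R) where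
  carrier := {x | (p ≠ 0 → x.fst = 0) ∧ (p ≠ -1 → x.snd = 0)}
  zero_mem' := by simp
  add_mem' {x y} hx hy := ⟨fun h => by simp [hx.1 h, hy.1 h], fun h => by simp [hx.2 h, hy.2 h]⟩
  smul_mem' c x hx := ⟨fun h => by simp [hx.1 h], fun h => by simp [hx.2 h]⟩

theorem one_mem : (1 : DualNumber R) ∈ X R 0 := ⟨fun h => absurd rfl h, fun _ => rfl⟩

theorem mul_mem {p q : ℤ} {x y : DualNumber R} (hx : x ∈ X R p) (hy : y ∈ X R q) :
    x * y ∈ X R (p + q) := by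
  refine ⟨fun h => ?_, fun h => ?_⟩
  · rw [TrivSqZeroExt.fst_mul]
    by_cases hp : p = 0
    · rw [hy.1 (by omega), mul_zero]
    · rw [hx.1 hp, zero_mul]
  · rw [DualNumber.snd_mul]
    by_cases hp : p = 0
    · rw [hy.2 (by omega), hx.2 (by omega)]
      simp
    · rw [hx.1 hp, zero_mul, zero_add]
      by_cases hp' : p = -1
      · rw [hy.1 (by omega), mul_zero]
      · rw [hx.2 hp', zero_mul]

/-- The derivation with `ε ↦ 1`. -/
def D : DualNumber R →ₗ[R] DualNumber R where
  toFun x := inl x.snd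
  map_add' x y := by simp
  map_smul' c x := by ext <;> simp

theorem D_mem {p : ℤ} {x : DualNumber R} (hx : x ∈ X R p) : D x ∈ X R (p + 1) :=
  ⟨fun h => by
    change x.snd = 0
    exact hx.2 (by omega), fun _ => rfl⟩

theorem D_mul {q : ℤ} (x : DualNumber R) {y : DualNumber R} (hy : y ∈ X R q) :
    D (x * y) = x * D y + sgn q • (D x * y) := by
  have h₁ : ((sgn q : ℤ) : R) * y.fst = y.fst := by
    by_cases h : q = 0
    · simp [h]
    · simp [hy.1 h]
  have h₂ : ((sgn q : ℤ) : R) * y.snd = -y.snd := by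
    by_cases h : q = -1
    · simp [h, sgn]
    · simp [hy.2 h]
  rw [← Int.cast_smul_eq_zsmul R]
  ext
  · simp [D]
    linear_combination -x.snd * h₁
  · simp [D]
    linear_combination -x.snd * h₂

theorem mul_comm_sgn {p q : ℤ} {x y : DualNumber R} (hx : x ∈ X R p) (hy : y ∈ X R q) :
    sgn (q * p) • (x * y) = y * x := by
  by_cases h : p = 0 ∨ q = 0
  · rcases h with rfl | rfl <;> simp [mul_comm]
  · push Not at h
    have : x * y = 0 := by ext <;> simp [hx.1 h.1, hy.1 h.2]
    rw [mul_comm y, this, smul_zero]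

variable (R) in
/-- The collection with all components the complex `R ε → R`. -/
def coll : DGColl R where
  X _ p := X R p
  d {_ p q} h := D.restrict fun x hx => h ▸ D_mem hx
  d_d h h' x := Subtype.ext (by rfl)

theorem prod_mem {k : ℕ} {p : Fin k → ℤ} {x : Fin k → DualNumber R} (h : ∀ i, x i ∈ X R (p i)) :
    ∏ i, x i ∈ X R (∑ i, p i) := by
  induction k with
  | zero => exact one_mem
  | succ k ih =>
    rw [Fin.prod_univ_succ, Fin.sum_univ_succ]
    exact mul_mem (h 0) (ih fun i => h i.succ)

variable (R) in
/-- The multiplication as a family of multilinear maps. -/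
def fam : OdotFam (coll R) (coll R) (coll R) where
  app {k N q r} n p hN hr :=
    { toFun := fun x => (LinearMap.mulLeft R (∏ i, (x i).1)).restrict fun y hy =>
        hr ▸ mul_mem (prod_mem fun i => (x i).2) hy
      map_update_add' := fun x i u v => LinearMap.ext fun y => Subtype.ext <| by
        have e : ∀ w : X R (p i), (fun j => (Function.update x i w j).1) =
            Function.update (fun j => (x j).1) i w.1 := fun w =>
          funext fun j => Function.apply_update (fun j (z : X R (p j)) => z.1) x i w j
        have h := (MultilinearMap.mkPiAlgebra R (Fin k) (DualNumber R)).map_update_add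
          (fun j => (x j).1) i u.1 v.1
        simp only [MultilinearMap.mkPiAlgebra_apply] at h
        change (∏ j, (Function.update x i (u + v) j).1) * y.1 =
          (∏ j, (Function.update x i u j).1) * y.1 + (∏ j, (Function.update x i v j).1) * y.1
        rw [show (∏ j, (Function.update x i (u + v) j).1) = _ from
          congrArg (fun f : Fin k → DualNumber R => ∏ j, f j) (e (u + v)),
          show (∏ j, (Function.update x i u j).1) = _ from
          congrArg (fun f : Fin k → DualNumber R => ∏ j, f j) (e u),
          show (∏ j, (Function.update x i v j).1) = _ from
          congrArg (fun f : Fin k → DualNumber R => ∏ j, f j) (e v), ← add_mul, ← h]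
        rfl
      map_update_smul' := fun x i c v => LinearMap.ext fun y => Subtype.ext <| by
        have e : ∀ w : X R (p i), (fun j => (Function.update x i w j).1) =
            Function.update (fun j => (x j).1) i w.1 := fun w =>
          funext fun j => Function.apply_update (fun j (z : X R (p j)) => z.1) x i w j
        have h := (MultilinearMap.mkPiAlgebra R (Fin k) (DualNumber R)).map_update_smul
          (fun j => (x j).1) i c v.1
        simp only [MultilinearMap.mkPiAlgebra_apply] at h
        change (∏ j, (Function.update x i (c • v) j).1) * y.1 =
          c • ((∏ j, (Function.update x i v j).1) * y.1)
        rw [show (∏ j, (Function.update x i (c • v) j).1) = _ from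
          congrArg (fun f : Fin k → DualNumber R => ∏ j, f j) (e (c • v)),
          show (∏ j, (Function.update x i v j).1) = _ from
          congrArg (fun f : Fin k → DualNumber R => ∏ j, f j) (e v), ← smul_mul_assoc, ← h]
        rfl }

/-- The underlying dual number. -/
def val (x : (coll R).El) : DualNumber R := x.val.1

/-- The product of the underlying dual numbers. -/
def prod (xs : List (coll R).El) : DualNumber R := (xs.map val).prod

theorem prod_mem_degSum (xs : List (coll R).El) : prod xs ∈ X R (degSum xs) := by
  induction xs with
  | nil => exact one_mem
  | cons x xs ih =>
    rw [degSum_cons, prod, List.map_cons, List.prod_cons]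
    exact mul_mem x.val.2 ih

theorem fam_L {N : ℕ} {r : ℤ} {xs : List (coll R).El} {y : (coll R).El} (h : Fits N r xs y) :
    ((fam R).L N r xs y).1 = prod xs * val y := by
  obtain ⟨k, q, y⟩ := y
  obtain ⟨hk, hN, hr⟩ := h
  dsimp only at hk hr
  subst hk hN hr
  obtain ⟨e, he⟩ : ∃ e : Fin xs.length → (coll R).El, xs = List.ofFn e := ⟨xs.get, by simp⟩
  generalize xs.length = k at e y
  subst he
  have := (fam R).app_eq_L (N := arSum (List.ofFn e)) (r := degSum (List.ofFn e) + q)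
      (fun i => (e i).ar) (fun i => (e i).deg) (arSum_ofFn e).symm
      (by rw [degSum_ofFn]) (fun i => (e i).val) y
  rw [← this]
  change (∏ i, (e i).val.1) * y.1 = _
  rw [prod, List.map_ofFn, List.prod_ofFn]
  rfl

theorem val_d (x : (coll R).El) : val x.d = D (val x) := rfl

theorem dsum_fam {N : ℕ} {r : ℤ} {y : (coll R).El} (xs pre : List (coll R).El)
    (hy : y.ar = pre.length + xs.length) (hN : arSum pre + arSum xs = N)
    (hr : degSum pre + degSum xs + y.deg + 1 = r) :
    (dsum (fun l => (fam R).L N r (pre ++ l) y) xs : X R r).1 =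
      prod pre * D (prod xs) * val y := by
  induction xs generalizing pre with
  | nil =>
    have : D (prod ([] : List (coll R).El)) = 0 := rfl
    rw [this, mul_zero, zero_mul]
    rfl
  | cons x xs ih =>
    have h := ih (pre ++ [x]) (by simp at hy ⊢; omega) (by simp at hN ⊢; omega)
      (by simp at hr ⊢; omega)
    simp only [List.append_assoc, List.singleton_append] at h
    refine (congrArg₂ (· + ·) (congrArg (sgn (degSum xs) • ·) (fam_L (xs := pre ++ x.d :: xs) ?_))
      h).trans ?_
    · refine ⟨by simpa using hy, by simpa using hN, ?_⟩
      simp at hr ⊢; omega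
    · have e₁ : prod (pre ++ x.d :: xs) = prod pre * (D (val x) * prod xs) := by
        simp [prod, val_d]
      have e₂ : prod (pre ++ [x]) = prod pre * val x := by simp [prod]
      have e₃ : prod (x :: xs) = val x * prod xs := by simp [prod]
      rw [e₁, e₂, e₃, D_mul _ (prod_mem_degSum xs)]
      simp only [zsmul_eq_mul]
      ring

variable (R) in
/-- The composition `(x₁ ⊗ ⋯ ⊗ xₖ) y = x₁ ⋯ xₖ y`. -/
def mul : OdotMap (coll R) (coll R) (coll R) :=
  (fam R).toOdotMap fun {N r r'} h {xs y} h₁ h₂ h₃ => Subtype.ext (by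
    subst h
    refine (congrArg D (fam_L ⟨h₁, h₂, h₃⟩)).trans ?_
    refine Eq.trans ?_ (congrArg₂ (· + ·) (fam_L (y := y.d) ⟨h₁, h₂, ?_⟩)
      (congrArg (sgn y.deg • ·) (dsum_fam xs [] (by simpa using h₁) (by simpa using h₂) ?_))).symm
    · rw [D_mul _ (show val y ∈ X R y.deg from y.val.2), val_d]
      simp [prod]
    · rw [DGColl.El.d_deg, ← h₃, add_assoc]
    · simp [h₃])

theorem mul_L {N : ℕ} {r : ℤ} {xs : List (coll R).El} {y : (coll R).El} (h : Fits N r xs y) :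
    ((mul R).L N r xs y).1 = prod xs * val y := fam_L h

theorem val_mul_el {xs : List (coll R).El} {y : (coll R).El} (h : y.ar = xs.length) :
    val ((mul R).el xs y) = prod xs * val y := mul_L ⟨h, rfl, rfl⟩

theorem prod_elL {L : List (List (coll R).El × (coll R).El)} (hL : Matched L) :
    prod ((mul R).elL L) = sgn (kos L) • (prod (flatL L) * prod (sndL L)) := by
  induction L with
  | nil => simp [prod, kos]
  | cons i L ih =>
    obtain ⟨h₁, h₂⟩ := Matched.cons.1 hL
    have e₁ : prod ((mul R).elL (i :: L)) = val ((mul R).el i.1 i.2) * prod ((mul R).elL L) := by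
      simp [prod, OdotMap.elL]
    have e₂ : prod (flatL (i :: L)) = prod i.1 * prod (flatL L) := by simp [prod]
    have e₃ : prod (sndL (i :: L)) = val i.2 * prod (sndL L) := by simp [prod]
    rw [e₁, e₂, e₃, val_mul_el h₁, ih h₂, kos, ← sgn_smul_smul, smul_comm, mul_smul_comm]
    refine congrArg _ ?_
    have := mul_comm_sgn (prod_mem_degSum (flatL L)) (show val i.2 ∈ X R i.2.deg from i.2.val.2)
    rw [← mul_assoc, mul_assoc (prod i.1), ← this]
    simp only [zsmul_eq_mul]
    ring

theorem lassoc : LAssoc (mul R) (mul R) (mul R) (mul R) := by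
  refine LAssoc.of_matched fun L z hL hz N r hN hr => Subtype.ext ?_
  rw [mul_L ⟨by simpa using hz, by simpa using hN, by simpa [add_assoc] using hr⟩, prod_elL hL]
  refine Eq.trans ?_ (congrArg (sgn (kos L) • ·) (mul_L
    ⟨by simpa using hL.length_flatL.symm, hN, by simpa using hr⟩)).symm
  rw [val_mul_el (by simpa using hz), smul_mul_assoc, mul_assoc]

variable (R) in
/-- The operad of dual numbers. -/
def operad : DGOperad R where
  toDGColl := coll R
  one := ⟨1, one_mem⟩
  mul := mul R
  d_one := rfl
  one_mul y := Subtype.ext (by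
    change (∏ _, (1 : DualNumber R)) * y.1 = y.1
    simp)
  mul_one x := Subtype.ext (by
    change (∏ _ : Fin 1, x.1) * 1 = x.1
    simp)
  assoc := lassoc.assoc

/-- The images of the generators of `A_∞^su⟨i,j⟩`. -/
def gen : ∀ n p, AGen n p → (operad R).X n p
  | _, _, .m _ p _ _ => if h : p = 0 then ⟨1, h ▸ one_mem⟩ else 0
  | _, _, .unit => ⟨1, one_mem⟩
  | _, _, .i => 0
  | _, _, .j => ⟨DualNumber.eps, by simp [X]⟩

theorem cast_val {n m : ℕ} {p q : ℤ} (hn : n = m) (hp : p = q) (x : (operad R).X n p) :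
    ((operad R).cast hn hp x).1 = x.1 := by
  subst hn hp
  rfl

theorem insertOp_val {l n N : ℕ} {p q r : ℤ} (a : Fin l) (x : (operad R).X n p)
    (y : (operad R).X l q) (hN : n + l = N + 1) (hr : p + q = r) :
    (insertOp (operad R).mul a x y hN hr).1 = x.1 * y.1 := by
  refine congrArg (· * y.1) ((Finset.prod_eq_single a (fun b _ hb => ?_) (by simp)).trans ?_)
  · exact (congrArg Subtype.val (dif_neg hb)).trans (cast_val _ _ _)
  · exact (congrArg Subtype.val (dif_pos rfl)).trans (cast_val _ _ _)

theorem gen_m_val (n : ℕ) (p : ℤ) (hn : 2 ≤ n) (hp : p = 2 - n) :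
    (gen (R := R) n p (.m n p hn hp)).1 = if n = 2 then 1 else 0 := by
  by_cases h : n = 2
  · rw [if_pos h]
    exact congrArg Subtype.val (dif_pos (by omega))
  · rw [if_neg h]
    exact congrArg Subtype.val (dif_neg (by omega))

theorem rel : ARel (operad R) gen where
  m_d n hn := by
    have h₀ : (operad R).d rfl (gen n (2 - n) (.m n _ hn rfl)) = 0 := Subtype.ext (by
      change D (gen (R := R) n (2 - n) (.m n _ hn rfl)).1 = 0
      rw [gen_m_val]
      split_ifs
      · rfl
      · exact map_zero _)
    rw [h₀, eq_comm, neg_eq_zero]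
    by_cases h3 : n = 3
    · subst h3
      let t₁ : {t : Cut 3 // t.b < 3} := ⟨⟨(1, 2, 0), by decide⟩, by decide⟩
      let t₂ : {t : Cut 3 // t.b < 3} := ⟨⟨(0, 2, 1), by decide⟩, by decide⟩
      have h : ∀ t : {t : Cut 3 // t.b < 3}, t = t₁ ∨ t = t₂ := by decide
      refine (Fintype.sum_eq_add t₁ t₂ (by decide) fun t ht =>
        absurd (h t) (not_or.2 ht)).trans ?_
      have e₁ : sgn ((t₁.1.a : ℤ) * t₁.1.b + t₁.1.c) = 1 := by
        change sgn (((1 : ℕ) : ℤ) * ((2 : ℕ) : ℤ) + ((0 : ℕ) : ℤ)) = 1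
        decide
      have e₂ : sgn ((t₂.1.a : ℤ) * t₂.1.b + t₂.1.c) = -1 := by
        change sgn (((0 : ℕ) : ℤ) * ((2 : ℕ) : ℤ) + ((1 : ℕ) : ℤ)) = -1
        decide
      rw [e₁, e₂, one_smul, neg_one_smul, add_neg_eq_zero]
      refine Subtype.ext ?_
      rw [insertOp_val, insertOp_val, gen_m_val, gen_m_val, gen_m_val]
      rfl
    · refine Finset.sum_eq_zero fun t _ => ?_
      have h₁ := t.1.sum
      refine (congrArg _ (Subtype.ext ?_)).trans (smul_zero _)
      rw [insertOp_val, gen_m_val, gen_m_val]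
      by_cases h₂ : t.1.b = 2
      · rw [if_neg (show ¬t.1.a + 1 + t.1.c = 2 by omega), mul_zero]
        rfl
      · rw [if_neg h₂, zero_mul]
        rfl
  unit_d := rfl
  unit_left := Subtype.ext (by
    rw [insertOp_val, gen_m_val]
    exact one_mul _)
  unit_right := Subtype.ext (by
    rw [insertOp_val, gen_m_val]
    exact one_mul _)
  unit_m l hl a := Subtype.ext (by
    rw [insertOp_val, gen_m_val, if_neg (by omega), mul_zero]
    rfl)
  i_d := map_zero _
  j_d := Subtype.ext (by
    change inl (DualNumber.eps : DualNumber R).snd = 1 - 0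
    simp)

end Dual

end HUnital

namespace HUnital

variable {R : Type u} [CommRing R]

/-! The components of `1^su` and `j`. -/

namespace Asu

variable (R) in
/-- The morphism from `A_∞^su⟨i,j⟩` to the dual numbers. -/
noncomputable def tau : (Asu R).toDGColl.Hom (Dual.operad R).toDGColl :=
  OpQuot.evHom (M := ARel) ⟨Dual.operad R, Dual.gen, Dual.rel⟩

theorem tau_mul : (Asu R).mul.Compat (Dual.operad R).mul (tau R) (tau R) (tau R) :=
  OpQuot.mul_compat (M := ARel) ⟨Dual.operad R, Dual.gen, Dual.rel⟩

theorem tau_letter : ∀ b : Bool, letterArity b = 0 → ((tau R).f (letter b)).1 = DualNumber.eps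
  | true, _ => rfl

variable (R) in
/-- The suboperad of the elements that have arity `≥ 1` or go to zero in the dual numbers. -/
noncomputable def tauSub : (Asu R).Sub where
  carrier n p :=
    { carrier := {x | n = 0 → (tau R).f x = 0}
      zero_mem' := fun _ => map_zero _
      add_mem' := fun {x y} hx hy h => by rw [map_add, hx h, hy h, add_zero]
      smul_mem' := fun c x hx h => by rw [map_smul, hx h, smul_zero] }
  d_mem h x hx h' := by rw [(tau R).map_d, hx h', map_zero]
  one_mem h := absurd h one_ne_zero
  mul_mem {k N q r} n p hN hr x y hx hy h := by
    subst hN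
    rw [tau_mul]
    cases k with
    | zero => rw [hy rfl, map_zero]
    | succ k =>
      have h0 : n 0 = 0 := Finset.sum_eq_zero_iff.1 h 0 (Finset.mem_univ 0)
      rw [MultilinearMap.map_coord_zero _ (0 : Fin (k + 1)) (hx 0 h0)]
      rfl

theorem tau_of_hu {n : ℕ} {p : ℤ} {x : (Asu R).X n p} (hx : x ∈ (AhuSub R).carrier n p)
    (hn : n = 0) : (tau R).f x = 0 := by
  refine DGOperad.adjoin_le (tauSub R) (fun n p x hx => ?_) hx hn
  cases hx with
  | i => exact fun _ => rfl
  | m l hl w =>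
    intro h
    rw [wordAct, tau_mul]
    obtain ⟨l, rfl⟩ := Nat.exists_eq_add_of_le' hl
    have e : ∀ a, ((tau R).f (letter (w a))).1 = DualNumber.eps := fun a =>
      tau_letter _ (Finset.sum_eq_zero_iff.1 h a (Finset.mem_univ a))
    refine Subtype.ext ?_
    change (∏ a, ((tau R).f (letter (w a))).1) * _ = 0
    rw [Fin.prod_univ_succ, Fin.prod_univ_succ, e, e, ← mul_assoc, DualNumber.eps_mul_eps,
      zero_mul, zero_mul]

variable (R) in
/-- The element `1^su` in arity and degree zero, and `0` in other arities and degrees. -/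
noncomputable def unitAt (n : ℕ) (p : ℤ) : (Asu R).X n p :=
  if h : 0 = n ∧ 0 = p then (Asu R).cast h.1 h.2 unit else 0

variable (R) in
/-- The element `j` in arity `0` and degree `-1`, and `0` in other arities and degrees. -/
noncomputable def jAt (n : ℕ) (p : ℤ) : (Asu R).X n p :=
  if h : 0 = n ∧ -1 = p then (Asu R).cast h.1 h.2 j else 0

/-- The component in the span of `1^su` and `j`. -/
noncomputable def strict {n : ℕ} {p : ℤ} : (Asu R).X n p →ₗ[R] (Asu R).X n p where
  toFun x := ((tau R).f x).1.fst • unitAt R n p + ((tau R).f x).1.snd • jAt R n p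
  map_add' x y := by
    rw [map_add]
    change (((tau R).f x).1 + ((tau R).f y).1).fst • unitAt R n p +
      (((tau R).f x).1 + ((tau R).f y).1).snd • jAt R n p = _
    rw [TrivSqZeroExt.fst_add, TrivSqZeroExt.snd_add, add_smul, add_smul]
    abel
  map_smul' c x := by
    rw [map_smul]
    change (c • ((tau R).f x).1).fst • unitAt R n p + (c • ((tau R).f x).1).snd • jAt R n p = _
    rw [TrivSqZeroExt.fst_smul, TrivSqZeroExt.snd_smul, RingHom.id_apply, smul_add, smul_smul,
      smul_smul]
    rfl

theorem strict_apply {n : ℕ} {p : ℤ} (x : (Asu R).X n p) :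
    strict x = ((tau R).f x).1.fst • unitAt R n p + ((tau R).f x).1.snd • jAt R n p := rfl

theorem strict_of_hu {n : ℕ} {p : ℤ} {x : (Asu R).X n p} (hx : x ∈ (AhuSub R).carrier n p) :
    strict x = 0 := by
  rw [strict_apply]
  by_cases hn : n = 0
  · rw [tau_of_hu hx hn]
    exact (congrArg₂ (· + ·) (zero_smul R _) (zero_smul R _)).trans (add_zero _)
  · rw [unitAt, jAt, dif_neg fun h => hn h.1.symm, dif_neg fun h => hn h.1.symm, smul_zero,
      smul_zero, add_zero]

theorem strict_unit : strict (unit : (Asu R).X 0 0) = unit := by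
  rw [strict_apply]
  change (1 : R) • unitAt R 0 0 + (0 : R) • jAt R 0 0 = unit
  rw [unitAt, dif_pos ⟨rfl, rfl⟩, one_smul, zero_smul, add_zero]
  rfl

theorem strict_j : strict (j : (Asu R).X 0 (-1)) = j := by
  rw [strict_apply]
  change (0 : R) • unitAt R 0 (-1) + (1 : R) • jAt R 0 (-1) = j
  rw [jAt, dif_pos ⟨rfl, rfl⟩, one_smul, zero_smul, zero_add]
  rfl

theorem strict_of_ne {n : ℕ} {p : ℤ} (x : (Asu R).X n p) (hn : n ≠ 0) : strict x = 0 := by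
  rw [strict_apply, unitAt, jAt, dif_neg fun h => hn h.1.symm, dif_neg fun h => hn h.1.symm,
    smul_zero, smul_zero, add_zero]

end Asu

theorem map_mem_of_inSpan {P : DGColl R} {M : Type*} [AddCommGroup M] [Module R M]
    {G : P.El → Prop} (hG : ∀ x, InSpan G x) {n : ℕ} {p : ℤ} (f : P.X n p →ₗ[R] M)
    (N : Submodule R M) (h : ∀ y, G ⟨n, p, y⟩ → f y ∈ N) (x : P.X n p) : f x ∈ N :=
  (Submodule.span_le.2 h : Submodule.span R {y : P.X n p | G ⟨n, p, y⟩} ≤ N.comap f)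
    (hG ⟨n, p, x⟩)

namespace Fsu

open HUnital.Asu (unitEl jEl mEl strict)

variable {ε : (Fsu R).Hom (Asu R).regular}

/-- The component in the span of `1^su ρ_∅` and `j ρ_∅`, as an element of the operad. -/
noncomputable def strictPart (ε : (Fsu R).Hom (Asu R).regular) {n : ℕ} {p : ℤ} :
    (Fsu R).X n p →ₗ[R] (Asu R).X n p := strict.comp ε.f

theorem strictPart_of_hu (hε : IsCounit ε) {n : ℕ} {p : ℤ} {x : (Fsu R).X n p}
    (hx : x ∈ (FhuSub R).carrier n p) : strictPart ε x = 0 :=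
  Asu.strict_of_hu (counit_mem hε hx)

theorem strictPart_rhoEl {b : (Asu R).El} (h : b.ar = 0) (hs : strict b.val = b.val) :
    (⟨0, (rhoEl b).deg, strictPart ε (rhoEl b).val⟩ : (Asu R).El) = b := by
  have h' := counit_rhoEl (ε := ε) b h
  have key : ∀ c : (Asu R).El, c = b → (⟨c.ar, c.deg, strict c.val⟩ : (Asu R).El) = b := by
    rintro _ rfl
    rw [hs]
  exact key _ h'

/-- The element of the span of `1^su ρ_∅` and `j ρ_∅`. -/
noncomputable def ofStrict {n : ℕ} {p : ℤ} : (Asu R).X n p →ₗ[R] (Fsu R).X n p :=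
  IsLinearMap.mk' _ ((Fsu R).ract.elLinear n p [] n p)

theorem ofStrict_apply {n : ℕ} {p : ℤ} (b : (Asu R).X n p) :
    ofStrict b = (Fsu R).ract.L n p [] ⟨n, p, b⟩ := rfl

theorem ofStrict_strictPart_rhoEl {b : (Asu R).El} (h : b.ar = 0) (hs : strict b.val = b.val) :
    ofStrict (strictPart ε (rhoEl b).val) = (rhoEl b).val := by
  have h' := strictPart_rhoEl (ε := ε) h hs
  have : (rhoEl b).val = (Fsu R).ract.L 0 (rhoEl b).deg [] b := rfl
  rw [ofStrict_apply]
  exact (congrArg ((Fsu R).ract.L 0 (rhoEl b).deg []) h').trans this.symm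

/-- The complement of the part in the span of `1^su ρ_∅` and `j ρ_∅`. -/
noncomputable def huPart (ε : (Fsu R).Hom (Asu R).regular) {n : ℕ} {p : ℤ} :
    (Fsu R).X n p →ₗ[R] (Fsu R).X n p := LinearMap.id - ofStrict.comp (strictPart ε)

theorem huPart_apply {n : ℕ} {p : ℤ} (x : (Fsu R).X n p) :
    huPart ε x = x - ofStrict (strictPart ε x) := rfl

theorem huPart_of_hu (hε : IsCounit ε) {n : ℕ} {p : ℤ} {x : (Fsu R).X n p}
    (hx : x ∈ (FhuSub R).carrier n p) : huPart ε x = x := by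
  rw [huPart_apply, strictPart_of_hu hε hx, map_zero, sub_zero]

theorem huPart_rhoEl {b : (Asu R).El} (h : b.ar = 0) (hs : strict b.val = b.val) :
    huPart ε (rhoEl b).val = 0 := by
  rw [huPart_apply, ofStrict_strictPart_rhoEl h hs, sub_self]

theorem huPart_mem (hε : IsCounit ε) {n : ℕ} {p : ℤ} (x : (Fsu R).X n p) :
    huPart ε x ∈ (FhuSub R).carrier n p := by
  refine map_mem_of_inSpan inSpan (huPart ε) _ (fun y hy => ?_) x
  rcases hy with hy | hy | hy
  · rw [huPart_of_hu hε hy]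
    exact hy
  · cases hy
    have := huPart_rhoEl (ε := ε) (b := unitEl R) rfl Asu.strict_unit
    exact this.symm ▸ Submodule.zero_mem _
  · cases hy
    have := huPart_rhoEl (ε := ε) (b := jEl R) rfl Asu.strict_j
    exact this.symm ▸ Submodule.zero_mem _

theorem strictPart_of_ne {n : ℕ} {p : ℤ} (x : (Fsu R).X n p) (hn : n ≠ 0) :
    strictPart ε x = 0 := Asu.strict_of_ne _ hn

theorem mem_hu_of_ne {n : ℕ} {p : ℤ} (x : (Fsu R).X n p) (hn : n ≠ 0) :
    x ∈ (FhuSub R).carrier n p := by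
  obtain ⟨ε, hε, -⟩ := exists_unique_counit (R := R)
  have := huPart_mem hε x
  rwa [huPart_apply, strictPart_of_ne x hn, map_zero, sub_zero] at this

end Fsu

end HUnital

namespace HUnital

variable {R : Type u} [CommRing R]

theorem OdotMap.pre_L {P Q S P' Q' : DGColl R} (t : OdotMap P Q S) (f : P'.Hom P) (g : Q'.Hom Q)
    (N : ℕ) (r : ℤ) (xs : List P'.El) (y : Q'.El) :
    (t.pre f g).L N r xs y = t.L N r (xs.map f.el) (g.el y) :=
  DGColl.Hom.map_L (t := t.pre f g) (t' := t) (f := f) (g := g) (h := .id S)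
    (fun _ _ _ _ _ _ => rfl) N r xs y

theorem OdotMap.pre_el {P Q S P' Q' : DGColl R} (t : OdotMap P Q S) (f : P'.Hom P) (g : Q'.Hom Q)
    (xs : List P'.El) (y : Q'.El) : (t.pre f g).el xs y = t.el (xs.map f.el) (g.el y) :=
  DGColl.Hom.el_map_el (t := t.pre f g) (t' := t) (f := f) (g := g) (h := .id S)
    (fun _ _ _ _ _ _ => rfl) xs y

/-- The inclusion of a subbimodule as a morphism of bimodules over suboperads. -/
def DGBimod.Sub.inclHom {A B : DGOperad R} {P : DGBimod A B} {A' : A.Sub} {B' : B.Sub}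
    (S : P.Sub A' B') : S.bimod.Hom (P.restrict A' B') where
  toHom := S.incl
  map_lact _ _ _ _ _ _ := rfl
  map_ract _ _ _ _ _ _ := rfl

theorem InSpan.mono {P : DGColl R} {G G' : P.El → Prop} (h : ∀ x, G x → G' x) {x : P.El}
    (hx : InSpan G x) : InSpan G' x :=
  Submodule.span_mono (fun _ => h _) hx

theorem flatL_map_singleton {α β : Type*} (xs : List α) (o : β) :
    flatL (xs.map fun x => ([x], o)) = xs := by
  simp [flatL, List.flatMap_map]

theorem kos_map_singleton {P Q : DGColl R} (xs : List P.El) {o : Q.El} (h : o.deg = 0) :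
    kos (xs.map fun x => ([x], o)) = 0 := by
  induction xs with
  | nil => rfl
  | cons x xs ih => rw [List.map_cons, kos, ih, h, zero_mul, zero_add]

namespace Fsu

open HUnital.Asu (unitEl jEl)

/-- The inclusion of `F_1^hu`. -/
noncomputable def huIncl : (FhuSub R).bimod.toDGColl.Hom (Fsu R).toDGColl := (FhuSub R).incl

theorem incl_ract_L (N : ℕ) (r : ℤ) (xs : List (FhuSub R).bimod.El) (w : (AhuSub R).operad.El) :
    huIncl.f ((FhuSub R).bimod.ract.L N r xs w) =
      (Fsu R).ract.L N r (xs.map huIncl.el) ((AhuSub R).incl.el w) :=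
  DGColl.Hom.map_L (t := (FhuSub R).bimod.ract) (t' := (Fsu R).ract) (f := huIncl)
    (g := (AhuSub R).incl) (h := huIncl) (fun _ _ _ _ _ _ => rfl) N r xs w

variable (R) in
/-- The right action of `A_∞^su⟨i,j⟩` on elements of `F_1^hu`. -/
noncomputable def huAct : OdotMap (FhuSub R).bimod.toDGColl
    ((Asu R).regular.restrict (AhuSub R) (AhuSub R)).toDGColl (Fsu R).toDGColl :=
  (Fsu R).ract.pre huIncl (DGColl.Hom.id _)

theorem huAct_el (xs : List (FhuSub R).bimod.El) (y : (Asu R).El) :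
    (huAct R).el xs y = (Fsu R).ract.el (xs.map huIncl.el) y :=
  ((Fsu R).ract.pre_el huIncl (DGColl.Hom.id _) xs y).trans (by simp)

theorem huAct_L (N : ℕ) (r : ℤ) (xs : List (FhuSub R).bimod.El) (y : (Asu R).El) :
    (huAct R).L N r xs y = (Fsu R).ract.L N r (xs.map huIncl.el) y :=
  ((Fsu R).ract.pre_L huIncl (DGColl.Hom.id _) N r xs y).trans (by simp)

theorem huAct_isGen (x : (Fsu R).El) : InSpan (IsGen (huAct R)) x := by
  refine (inSpan x).mono fun x hx => ?_
  rcases hx with hx | rfl | rfl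
  · refine ⟨[⟨x.ar, x.deg, ⟨x.val, hx⟩⟩], (Asu R).oneEl, rfl, ?_⟩
    rw [huAct_el]
    exact ((Fsu R).ract_one_el x).symm
  · exact ⟨[], unitEl R, rfl, (huAct_el [] _).symm⟩
  · exact ⟨[], jEl R, rfl, (huAct_el [] _).symm⟩

/-- The component in `F_1^hu`. -/
noncomputable def toHu {ε : (Fsu R).Hom (Asu R).regular} (hε : IsCounit ε) {n : ℕ} {p : ℤ} :
    (Fsu R).X n p →ₗ[R] (FhuSub R).bimod.X n p :=
  (huPart ε).codRestrict ((FhuSub R).carrier n p) (huPart_mem hε)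

variable {ε : (Fsu R).Hom (Asu R).regular} (hε : IsCounit ε)

theorem toHu_incl {n : ℕ} {p : ℤ} (x : (FhuSub R).bimod.X n p) :
    toHu hε (huIncl.f x) = x :=
  Subtype.ext (huPart_of_hu hε x.2)

theorem incl_toHu {n : ℕ} {p : ℤ} (x : (Fsu R).X n p) (hn : n ≠ 0) :
    huIncl.f (toHu hε x) = x :=
  huPart_of_hu hε (mem_hu_of_ne x hn)

theorem huAct_isTensor : IsTensor (FhuSub R).bimod
    ((Asu R).regular.restrict (AhuSub R) (AhuSub R)) (huAct R) where
  balanced := OdotMap.Assoc.lassoc fun n p m s hN hr x y z =>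
    (Fsu R).ract_assoc n p m s hN hr (fun i j => (x i j).1) (fun i => (y i).1) z
  span := huAct_isGen
  lin {M _ _} t ht N r := by
    obtain ⟨ε, hε, -⟩ := exists_unique_counit (R := R)
    let one : ((Asu R).regular.restrict (AhuSub R) (AhuSub R)).El := (Asu R).oneEl
    let f₁ := IsLinearMap.mk' _ (ht.slot one [] [] N r)
    let f₂ := IsLinearMap.mk' _ (ht.lin [] N r)
    let f : (Fsu R).X N r →ₗ[R] M := f₁.comp (toHu hε) + f₂.comp (strictPart ε)
    have hf : ∀ x, f x = t [⟨N, r, toHu hε x⟩] one + t [] ⟨N, r, strictPart ε x⟩ :=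
      fun x => rfl
    refine ⟨f, fun xs y hxy => ?_⟩
    refine ElLinear.ext_of_inSpan (((huAct R).elLinear N r xs).map f) (ht.lin xs)
      (Asu.inSpan y) fun y' ha hd hy => ?_
    obtain ⟨h₁, h₂, h₃⟩ : Fits N r xs y' := by
      unfold Fits
      rw [ha, hd]
      exact hxy
    clear hxy ha hd y
    refine (hf _).trans ?_
    rcases hy with hy | hy
    · let w : (AhuSub R).operad.El := ⟨y'.ar, y'.deg, ⟨y'.val, hy⟩⟩
      have e : (huAct R).L N r xs y' = huIncl.f ((FhuSub R).bimod.ract.L N r xs w) :=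
        (huAct_L N r xs y').trans (incl_ract_L N r xs w).symm
      have e₁ : toHu hε ((huAct R).L N r xs y') = (FhuSub R).bimod.ract.L N r xs w :=
        (congrArg (toHu hε) e).trans (toHu_incl hε _)
      have e₂ : strictPart ε ((huAct R).L N r xs y') = 0 :=
        (congrArg (strictPart ε) e).trans (strictPart_of_hu hε (Subtype.property _))
      have h₄ := ht.balanced [(xs, w)] one (by simpa [Matched] using h₁) rfl
      have e₃ : ((Asu R).regular.restrict (AhuSub R) (AhuSub R)).lact.el [w] one = y' :=
        ((Asu R).mul.pre_el (AhuSub R).incl (DGColl.Hom.id _) [w] (Asu R).oneEl).trans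
          ((Asu R).regular.ract_one_el y')
      rw [OdotMap.elL_cons, OdotMap.elL_nil, (FhuSub R).bimod.ract.el_eq h₂ h₃] at h₄
      refine (congrArg₂ (· + ·) (congrArg (fun a => t [⟨N, r, a⟩] one) e₁)
        (congrArg (fun a => t [] ⟨N, r, a⟩) e₂)).trans ?_
      refine (congrArg₂ (· + ·) (h₄.trans ?_) (ht.lin [] N r).map_zero).trans (add_zero _)
      have hk : kos [(xs, w)] = 0 := by simp [kos]
      rw [hk, sgn_zero, one_smul]
      exact congrArg₂ t (List.append_nil xs) e₃
    · have key : ∀ b : (Asu R).El, b.ar = 0 → Asu.strict b.val = b.val → y' = b →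
          t [⟨N, r, toHu hε ((huAct R).L N r xs y')⟩] one +
            t [] ⟨N, r, strictPart ε ((huAct R).L N r xs y')⟩ = t xs y' := by
        rintro b hb hs rfl
        obtain rfl : xs = [] := List.eq_nil_of_length_eq_zero (h₁.symm.trans hb)
        obtain rfl : 0 = N := h₂
        obtain rfl := h₃
        have e : (huAct R).L 0 (rhoEl y').deg [] y' = (rhoEl y').val := huAct_L _ _ [] y'
        have e₁ : toHu hε ((huAct R).L 0 (rhoEl y').deg [] y') = 0 :=
          Subtype.ext ((congrArg (huPart ε) e).trans (huPart_rhoEl hb hs))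
        have e₂ : (⟨0, (rhoEl y').deg, strictPart ε ((huAct R).L 0 (rhoEl y').deg [] y')⟩ :
            (Asu R).El) = y' :=
          (congrArg (fun a => (⟨0, (rhoEl y').deg, strictPart ε a⟩ : (Asu R).El)) e).trans
            (strictPart_rhoEl hb hs)
        refine (congrArg₂ (· + ·) (congrArg (fun a => t [⟨0, (rhoEl y').deg, a⟩] one) e₁)
          (congrArg (t []) e₂)).trans ?_
        exact (congrArg (· + t [] y') (ht.slot one [] [] 0 (rhoEl y').deg).map_zero).trans
          (zero_add _)
      rcases hy with hy | hy
      · exact key _ rfl Asu.strict_unit hy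
      · exact key _ rfl Asu.strict_j hy

/-- The morphism `F ⊙ G → F^hu ⊙ G` inverse to the one induced by the inclusion. -/
theorem exists_toHuTensor {B : DGOperad R} (G : DGBimod (Asu R) B) (B' : B.Sub) :
    ∃ b : OdotMap (Fsu R).toDGColl G.toDGColl
        (relTensor (FhuSub R).bimod (G.restrict (AhuSub R) B')).toDGColl,
      LAssoc (Fsu R).ract b G.lact b ∧
        ∀ N r xs z, b.L N r (xs.map huIncl.el) z =
          (relTensor.mk (FhuSub R).bimod (G.restrict (AhuSub R) B')).L N r xs z := by
  let mk' : OdotMap (FhuSub R).bimod.toDGColl G.toDGColl _ :=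
    relTensor.mk (FhuSub R).bimod (G.restrict (AhuSub R) B')
  have h₁ : LAssoc (FhuSub R).bimod.ract mk' (G.restrict (AhuSub R) B').lact mk' :=
    (relTensor.isTensor (FhuSub R).bimod (G.restrict (AhuSub R) B')).balanced
  have h₂ : LAssoc ((Asu R).regular.restrict (AhuSub R) (AhuSub R)).lact G.lact G.lact
      (G.restrict (AhuSub R) B').lact :=
    OdotMap.Assoc.lassoc fun n p m s hN hr x y z =>
      G.lact_assoc n p m s hN hr (fun i j => (x i j).1) y z
  obtain ⟨b, hb⟩ := huAct_isTensor.exists_ext h₁ h₂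
  have h₃ : LAssoc (huAct R) (Fsu R).ract (Asu R).mul (huAct R) :=
    OdotMap.Assoc.lassoc fun n p m s hN hr x y z =>
      (Fsu R).ract_assoc n p m s hN hr (fun i j => (x i j).1) y z
  refine ⟨b, LAssoc.of_span₁ huAct_isGen fun N r L z hL hG => ?_, fun N r xs z => ?_⟩
  · obtain ⟨LL, hLL, rfl⟩ := exists_pairC_of_isGen hL hG
    exact pentagon₃ h₃ (OdotMap.Assoc.lassoc G.lact_assoc) hb hb hLL N r z
  · by_cases hz : z.ar = xs.length
    · let o : ((Asu R).regular.restrict (AhuSub R) (AhuSub R)).El := (Asu R).oneEl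
      have h := hb N r (xs.map fun x => ([x], o)) z
        fun i hi => by obtain ⟨x, -, rfl⟩ := List.mem_map.1 hi; rfl
      have e : (huAct R).elL (xs.map fun x => ([x], o)) = xs.map huIncl.el := by
        rw [OdotMap.elL, List.map_map]
        refine List.map_congr_left fun x _ => ?_
        exact (huAct_el [x] _).trans ((Fsu R).ract_one_el _)
      have e₃ : G.lact.el (sndL (xs.map fun x => ([x], o))) z = z := by
        have : sndL (xs.map fun x => ([x], o)) = List.replicate z.ar o := by
          rw [hz]
          simp [sndL, Function.comp_def]
        exact (congrArg (fun l => G.lact.el l z) this).trans (G.one_lact_el z)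
      rw [e, kos_map_singleton xs rfl, sgn_zero, one_smul] at h
      exact h.trans (congrArg₂ (mk'.L N r) (flatL_map_singleton xs o) e₃)
    · rw [b.L_of_not fun h => hz (by simpa using h.1)]
      exact (OdotMap.L_of_not (relTensor.mk (FhuSub R).bimod (G.restrict (AhuSub R) B'))
        fun h => hz h.1).symm

/-- The morphism `F^hu ⊙ G' → F ⊙ G` induced by a split inclusion `G' → G` that is bijective in
positive arities is injective. -/
theorem injective_of_retraction {B : DGOperad R} {G : DGBimod (Asu R) B} {B' : B.Sub}
    {G' : DGBimod (AhuSub R).operad B'.operad} (ι : G'.Hom (G.restrict (AhuSub R) B'))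
    (π : ∀ {n : ℕ} {p : ℤ}, G.X n p →ₗ[R] G'.X n p)
    (hπ : ∀ {n : ℕ} {p : ℤ} (x : G'.X n p), π (ι.f x) = x)
    (hι : ∀ {n : ℕ} {p : ℤ} (x : G.X n p), n ≠ 0 → ι.f (π x) = x) {N : ℕ} {r : ℤ}
    (ψ : (relTensor (FhuSub R).bimod G').X N r →ₗ[R] (relTensor (Fsu R) G).X N r)
    (hψ : ∀ xs y, Fits N r xs y → ψ ((relTensor.mk (FhuSub R).bimod G').L N r xs y) =
      (relTensor.mk (Fsu R) G).L N r (xs.map huIncl.el) (ι.toHom.el y)) :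
    Function.Injective ψ := by
  obtain ⟨b, hb, hb'⟩ := exists_toHuTensor G B'
  obtain ⟨f, hf⟩ := (relTensor.isTensor (Fsu R) G).lin (fun xs y => b.L N r xs y)
    ⟨fun y => b.slotLinear N r y, fun xs => b.elLinear N r xs, fun L z hL _ => hb N r L z hL⟩ N r
  let πe : (G.restrict (AhuSub R) B').El → G'.El := fun y => ⟨y.ar, y.deg, π y.val⟩
  have hπe : ∀ y, πe (ι.toHom.el y) = y := fun y =>
    congrArg (fun v => (⟨y.ar, y.deg, v⟩ : G'.El)) (hπ y.val)
  obtain ⟨g, hg⟩ := (relTensor.isTensor (FhuSub R).bimod (G.restrict (AhuSub R) B')).lin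
    (fun xs y => (relTensor.mk (FhuSub R).bimod G').L N r xs (πe y))
    { slot := fun y => (relTensor.mk (FhuSub R).bimod G').slotLinear N r _
      lin := fun xs n p =>
        { map_add := fun x y => (congrArg (fun v => (relTensor.mk (FhuSub R).bimod G').L N r xs
            ⟨n, p, v⟩) (map_add π x y)).trans
              (((relTensor.mk (FhuSub R).bimod G').elLinear N r xs n p).map_add _ _)
          map_smul := fun c x => (congrArg (fun v => (relTensor.mk (FhuSub R).bimod G').L N r xs
            ⟨n, p, v⟩) (map_smul π c x)).trans
              (((relTensor.mk (FhuSub R).bimod G').elLinear N r xs n p).map_smul _ _) }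
      balanced := fun L z hL hz => by
        by_cases h0 : z.ar = 0
        · obtain rfl : L = [] := List.eq_nil_of_length_eq_zero (hz.symm.trans h0)
          have e : (G.restrict (AhuSub R) B').lact.el [] z = z :=
            (G.restrict (AhuSub R) B').lact_el_nil h0
          change _ = sgn (kos []) • (relTensor.mk (FhuSub R).bimod G').L N r []
            (πe ((G.restrict (AhuSub R) B').lact.el [] z))
          rw [e, kos, sgn_zero, one_smul]
          rfl
        · have e : ι.toHom.el (πe z) = z :=
            congrArg (fun v => (⟨z.ar, z.deg, v⟩ : (G.restrict (AhuSub R) B').El)) (hι z.val h0)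
          have e₁ : (G.restrict (AhuSub R) B').lact.el (sndL L) z =
              ι.toHom.el (G'.lact.el (sndL L) (πe z)) := by
            rw [DGColl.Hom.el_map_el ι.compat_lact, e]
            simp
          rw [e₁, hπe]
          exact (relTensor.isTensor (FhuSub R).bimod G').balanced N r L (πe z) hL } N r
  have key : (g.comp f).comp ψ = LinearMap.id := relTensor.linear_ext fun xs y hxy => by
    have h' : Fits N r (xs.map huIncl.el) (ι.toHom.el y) := by
      refine ⟨by simpa using hxy.1, by simpa using hxy.2.1, by simpa using hxy.2.2⟩
    refine (congrArg (g.comp f) (hψ xs y hxy)).trans ?_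
    refine (congrArg g (hf _ _ h')).trans ?_
    refine (congrArg g (hb' N r xs _)).trans ?_
    refine (hg xs _ hxy).trans ?_
    exact congrArg _ (hπe y)
  exact fun x y h => by
    have := congrArg (g.comp f) h
    exact (LinearMap.congr_fun key x).symm.trans (this.trans (LinearMap.congr_fun key y))

end Fsu

theorem alpha_L (N : ℕ) (r : ℤ) (xs : List (Fhu R).El) (y : (Fhu R).El) :
    (alpha R).f ((relTensor.mk (Fhu R) (Fhu R)).L N r xs y) =
      (relTensor.mk (Fsu R) (Fsu R)).L N r (xs.map Fsu.huIncl.el) (Fsu.huIncl.el y) :=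
  DGColl.Hom.map_L (t := relTensor.mk (Fhu R) (Fhu R)) (t' := relTensor.mk (Fsu R) (Fsu R))
    (f := Fsu.huIncl) (g := Fsu.huIncl) (h := (alpha R).toHom) (fun _ _ _ _ _ _ => rfl) N r xs y

theorem alpha_injective (n : ℕ) (p : ℤ) : Function.Injective ((alpha R).f (n := n) (p := p)) := by
  obtain ⟨ε, hε, -⟩ := Fsu.exists_unique_counit (R := R)
  exact Fsu.injective_of_retraction (FhuSub R).inclHom (Fsu.toHu hε) (Fsu.toHu_incl hε)
    (Fsu.incl_toHu hε) ((alpha R).f (n := n) (p := p)) fun xs y _ => alpha_L n p xs y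

end HUnital

namespace HUnital

variable {R : Type u} [CommRing R]

/-! Morphisms from bimodules over suboperads. -/

section Restrict

variable {A O B : DGOperad R} {A' : A.Sub} {O' : O.Sub} {B' : B.Sub}

/-- A morphism between bimodules as a morphism between their restrictions. -/
def DGBimod.Hom.restrict {P Q : DGBimod A B} (f : P.Hom Q) (A' : A.Sub) (B' : B.Sub) :
    (P.restrict A' B').Hom (Q.restrict A' B') where
  toHom := f.toHom
  map_lact n p hN hr a y := f.map_lact n p hN hr (fun i => (a i).1) y
  map_ract n p hN hr x b := f.map_ract n p hN hr x b.1

/-- The underlying chain map to the bimodule before restriction. -/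
def DGBimod.Hom.toBase {P' : DGBimod A'.operad B'.operad} {P : DGBimod A B}
    (f : P'.Hom (P.restrict A' B')) : P'.toDGColl.Hom P.toDGColl := f.toHom

/-- A morphism whose values come from an injective morphism factors through it. -/
theorem DGBimod.Hom.exists_factor {P Q S : DGBimod A B} (α : Q.Hom S)
    (hα : ∀ n p, Function.Injective (α.f (n := n) (p := p))) (g : P.Hom S)
    (hg : ∀ n p (x : P.X n p), ∃ y, α.f y = g.f x) :
    ∃ g' : P.Hom Q, ∀ n p (x : P.X n p), α.f (g'.f x) = g.f x := by
  let e : ∀ n p, P.X n p →ₗ[R] Q.X n p := fun n p =>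
    (LinearEquiv.ofInjective (α.f (n := n) (p := p)) (hα n p)).symm.toLinearMap.comp
      ((g.f (n := n) (p := p)).codRestrict (LinearMap.range (α.f (n := n) (p := p))) (hg n p))
  have he : ∀ n p (x : P.X n p), α.f (e n p x) = g.f x := fun n p x =>
    congrArg Subtype.val ((LinearEquiv.ofInjective (α.f (n := n) (p := p)) (hα n p)).apply_symm_apply
      ⟨g.f x, hg n p x⟩)
  refine ⟨{ f := e _ _, map_d := fun h x => hα _ _ ?_, map_lact := fun n p hN hr a y => hα _ _ ?_,
            map_ract := fun n p hN hr x b => hα _ _ ?_ }, he⟩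
  · rw [he, g.map_d, α.map_d, he]
  · rw [he, g.map_lact, α.map_lact, he]
  · rw [he, g.map_ract, α.map_ract]
    simp only [he]

namespace relTensor

variable {P : DGBimod A O} {Q : DGBimod O B} {P' : DGBimod A'.operad O'.operad}
  {Q' : DGBimod O'.operad B'.operad}

/-- The morphism `P' ⊙_{O'} Q' → P ⊙_O Q` induced by morphisms over suboperads. -/
noncomputable def subMap₂ (f : P'.Hom (P.restrict A' O')) (g : Q'.Hom (Q.restrict O' B')) :
    (relTensor P' Q').Hom ((relTensor P Q).restrict A' B') :=
  lift (T := (relTensor P Q).restrict A' B') ((mk P Q).pre f.toBase g.toBase)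
    { balanced := fun n p m s hN hr x y z => by
        refine Eq.trans ?_ (((isBalanced P Q).balanced n p m s hN hr (fun i j => f.f (x i j))
          (fun i => (y i).1) (g.f z)).trans (congrArg _ ?_))
        · exact congrArg (fun w => (mk P Q).app _ _ hN hr w (g.f z))
            (funext fun i => f.map_ract _ _ rfl rfl _ _)
        · exact congrArg (fun w => (mk P Q).app (flat m) (flat s) (by rw [sum_flat, hN])
            (by rw [sum_flat, ← hr, Finset.sum_add_distrib, add_assoc])
            (fun a => f.f (flat x a)) w) (g.map_lact n p rfl rfl y z).symm
      left := fun n p m s hN hr x y z => by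
        refine Eq.trans ?_ ((isBalanced P Q).left n p m s hN hr (fun i j => (x i j).1)
          (fun i => f.f (y i)) (g.f z))
        exact congrArg (fun w => (mk P Q).app _ _ hN hr w (g.f z))
          (funext fun i => f.map_lact _ _ rfl rfl _ _)
      right := fun n p m s hN hr x y z => by
        refine ((isBalanced P Q).right n p m s hN hr (fun i j => f.f (x i j))
          (fun i => g.f (y i)) z.1).trans (congrArg _ ?_)
        exact congrArg (fun w => (mk P Q).app (flat m) (flat s) (by rw [sum_flat, hN])
          (by rw [sum_flat, ← hr, Finset.sum_add_distrib, add_assoc])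
          (fun a => f.f (flat x a)) w) (g.map_ract n p rfl rfl y z).symm }

theorem subMap₂_compat (f : P'.Hom (P.restrict A' O')) (g : Q'.Hom (Q.restrict O' B')) :
    (mk P' Q').Compat (mk P Q) f.toBase g.toBase (subMap₂ f g).toBase :=
  fun _ _ _ _ _ _ => rfl

theorem subMap₂_L (f : P'.Hom (P.restrict A' O')) (g : Q'.Hom (Q.restrict O' B')) (N : ℕ) (r : ℤ)
    (xs : List P'.El) (y : Q'.El) : (subMap₂ f g).toBase.f ((mk P' Q').L N r xs y) =
      (mk P Q).L N r (xs.map f.toBase.el) (g.toBase.el y) :=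
  DGColl.Hom.map_L (subMap₂_compat f g) N r xs y

/-- Morphisms induced on tensor products commute with base change along suboperads. -/
theorem subMap₂_map {P₁ : DGBimod A O} {Q₁ : DGBimod O B} {P₁' : DGBimod A'.operad O'.operad}
    {Q₁' : DGBimod O'.operad B'.operad} {f : P'.Hom (P.restrict A' O')}
    {g : Q'.Hom (Q.restrict O' B')} {f₁ : P₁'.Hom (P₁.restrict A' O')}
    {g₁ : Q₁'.Hom (Q₁.restrict O' B')} {u : P.Hom P₁} {w : Q.Hom Q₁} {u' : P'.Hom P₁'}
    {w' : Q'.Hom Q₁'} (hu : u'.comp f₁ = f.comp (u.restrict A' O'))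
    (hw : w'.comp g₁ = g.comp (w.restrict O' B')) :
    (map u' w').comp (subMap₂ f₁ g₁) = (subMap₂ f g).comp ((map u w).restrict A' B') := by
  refine hom_ext fun N r xs y _ => ?_
  have e₁ : ∀ x, f₁.toBase.el (u'.toHom.el x) = u.toHom.el (f.toBase.el x) := fun x =>
    congrArg (fun h : P'.Hom (P₁.restrict A' O') => h.toBase.el x) hu
  have e₂ : ∀ x, g₁.toBase.el (w'.toHom.el x) = w.toHom.el (g.toBase.el x) := fun x =>
    congrArg (fun h : Q'.Hom (Q₁.restrict O' B') => h.toBase.el x) hw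
  refine (congrArg (subMap₂ f₁ g₁).f (map_L u' w' N r xs y)).trans ?_
  refine (subMap₂_L f₁ g₁ N r _ _).trans ?_
  refine Eq.trans ?_ (congrArg (map u w).f (subMap₂_L f g N r xs y)).symm
  refine Eq.trans ?_ (map_L u w N r _ _).symm
  rw [List.map_map, List.map_map, e₂]
  exact congrArg (fun l => (mk P₁ Q₁).L N r l _) (List.map_congr_left fun x _ => e₁ x)

end relTensor

theorem relTensor.IsAssociator.subMap₂ {O₀ O₁ O₂ O₃ : DGOperad R} {P : DGBimod O₀ O₁}
    {Q : DGBimod O₁ O₂} {S : DGBimod O₂ O₃} {B₀ : O₀.Sub} {B₁ : O₁.Sub} {B₂ : O₂.Sub}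
    {B₃ : O₃.Sub} {P' : DGBimod B₀.operad B₁.operad} {Q' : DGBimod B₁.operad B₂.operad}
    {S' : DGBimod B₂.operad B₃.operad}
    {a : (relTensor (relTensor P Q) S).Hom (relTensor P (relTensor Q S))} (ha : IsAssociator a)
    {a' : (relTensor (relTensor P' Q') S').Hom (relTensor P' (relTensor Q' S'))}
    (ha' : IsAssociator a') (f : P'.Hom (P.restrict B₀ B₁)) (g : Q'.Hom (Q.restrict B₁ B₂))
    (h : S'.Hom (S.restrict B₂ B₃)) :
    a'.comp (relTensor.subMap₂ f (relTensor.subMap₂ g h)) =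
      (relTensor.subMap₂ (relTensor.subMap₂ f g) h).comp (a.restrict B₀ B₃) := by
  refine hom_ext₂ fun N r L z hL _ => ?_
  refine (congrArg (relTensor.subMap₂ f (relTensor.subMap₂ g h)).f (ha'.map_L N r z hL)).trans ?_
  refine Eq.trans (map_zsmul _ _ _) ?_
  refine (congrArg (sgn (kos L) • ·) (subMap₂_L f (relTensor.subMap₂ g h) N r _ _)).trans ?_
  refine Eq.trans ?_ (congrArg a.f (subMap₂_L (relTensor.subMap₂ f g) h N r _ _)).symm
  rw [DGColl.Hom.map_elL (subMap₂_compat f g), DGColl.Hom.el_map_el (subMap₂_compat g h)]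
  refine Eq.trans ?_ (ha.map_L N r (h.toBase.el z) (hL.mapPair (f := f.toBase) (g := g.toBase))).symm
  rw [kos_mapPair, flatL_mapPair, sndL_mapPair]
  rfl

end Restrict

end HUnital

namespace HUnital

variable {R : Type u} [CommRing R]

theorem exists_unique_counit_hu {ε : (Fsu R).Hom (Asu R).regular} (hε : IsCounit ε) :
    ∃! ε' : (Fhu R).Hom (Ahu R).regular, ∀ (n : ℕ) (p : ℤ) (x : (Fhu R).X n p),
      (AhuSub R).incl.f (ε'.f x) = ε.f ((FhuSub R).incl.f x) := by
  obtain ⟨ε', h⟩ := DGBimod.Hom.exists_factor (P := (FhuSub R).bimod)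
    (Q := (AhuSub R).operad.regular) (AhuSub R).regular.inclHom
    (fun n p => Subtype.val_injective) ((FhuSub R).inclHom.comp (ε.restrict (AhuSub R) (AhuSub R)))
    fun n p x => ⟨⟨_, Fsu.counit_mem hε x.2⟩, rfl⟩
  exact ⟨ε', h, fun ε₁ h₁ => DGBimod.Hom.ext_f fun n p x =>
    Subtype.val_injective ((h₁ n p x).trans (h n p x).symm)⟩

namespace Fsu

open HUnital.Asu (unitEl jEl strict)

/-- The morphism `ε ⊙ 1 : F ⊙ F → F`. -/
noncomputable def counitL {O : DGOperad R} {F : DGBimod O O} (ε : F.Hom O.regular) :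
    (relTensor F F).Hom F :=
  (relTensor.map ε (.id F)).comp (relTensor.leftUnitor F)

theorem counitL_L {O : DGOperad R} {F : DGBimod O O} (ε : F.Hom O.regular) (N : ℕ) (r : ℤ)
    (xs : List F.El) (y : F.El) :
    (counitL ε).f ((relTensor.mk F F).L N r xs y) = F.lact.L N r (xs.map ε.toHom.el) y :=
  (congrArg (relTensor.leftUnitor F).f (relTensor.map_L ε (.id F) N r xs y)).trans
    (relTensor.leftUnitor_L F N r _ _)

/-- The morphism `1 ⊙ ε : F ⊙ F → F`. -/
noncomputable def counitR {O : DGOperad R} {F : DGBimod O O} (ε : F.Hom O.regular) :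
    (relTensor F F).Hom F :=
  (relTensor.map (.id F) ε).comp (relTensor.rightUnitor F)

theorem counitR_L {O : DGOperad R} {F : DGBimod O O} (ε : F.Hom O.regular) (N : ℕ) (r : ℤ)
    (xs : List F.El) (y : F.El) :
    (counitR ε).f ((relTensor.mk F F).L N r xs y) = F.ract.L N r xs (ε.toHom.el y) := by
  refine (congrArg (relTensor.rightUnitor F).f (relTensor.map_L (.id F) ε N r xs y)).trans
    ((relTensor.rightUnitor_L F N r _ _).trans ?_)
  have : xs.map (DGBimod.Hom.id F).toHom.el = xs := List.map_id xs
  rw [this]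

variable {ε : (Fsu R).Hom (Asu R).regular}

/-- The component of an element of `F ⊙ F` in the span of the images of `1^su ρ_∅` and `j ρ_∅`. -/
noncomputable def strictTensor (ε : (Fsu R).Hom (Asu R).regular) {n : ℕ} {p : ℤ} :
    (relTensor (Fsu R) (Fsu R)).X n p →ₗ[R] (relTensor (Fsu R) (Fsu R)).X n p :=
  (IsLinearMap.mk' _ ((relTensor.mk (Fsu R) (Fsu R)).elLinear n p [] n p)).comp
    (ofStrict.comp ((strictPart ε).comp (counitL ε).f))

theorem strictTensor_apply {n : ℕ} {p : ℤ} (t : (relTensor (Fsu R) (Fsu R)).X n p) :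
    strictTensor ε t = (relTensor.mk (Fsu R) (Fsu R)).L n p []
      ⟨n, p, ofStrict (strictPart ε ((counitL ε).f t))⟩ := rfl

theorem strictTensor_eq_zero {n : ℕ} {p : ℤ} {t : (relTensor (Fsu R) (Fsu R)).X n p}
    (h : strictPart ε ((counitL ε).f t) = 0) : strictTensor ε t = 0 := by
  rw [strictTensor_apply, h, map_zero]
  exact OdotMap.L_zero _ n p [] n p

/-- The complement of the part in the span of the images of `1^su ρ_∅` and `j ρ_∅`. -/
noncomputable def huTensorPart (ε : (Fsu R).Hom (Asu R).regular) {n : ℕ} {p : ℤ} :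
    (relTensor (Fsu R) (Fsu R)).X n p →ₗ[R] (relTensor (Fsu R) (Fsu R)).X n p :=
  LinearMap.id - strictTensor ε

theorem huTensorPart_apply {n : ℕ} {p : ℤ} (t : (relTensor (Fsu R) (Fsu R)).X n p) :
    huTensorPart ε t = t - strictTensor ε t := rfl

theorem huTensorPart_of_eq_zero {n : ℕ} {p : ℤ} {t : (relTensor (Fsu R) (Fsu R)).X n p}
    (h : strictPart ε ((counitL ε).f t) = 0) : huTensorPart ε t = t := by
  rw [huTensorPart_apply, strictTensor_eq_zero h, sub_zero]

/-- The image of `F^hu ⊙ F^hu`. -/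
noncomputable abbrev huRange (R : Type u) [CommRing R] (n : ℕ) (p : ℤ) :
    Submodule R ((relTensor (Fsu R) (Fsu R)).X n p) :=
  LinearMap.range (alpha R).toBase.f

theorem exists_lift {xs : List (Fsu R).El} (h : ∀ x ∈ xs, IsHu x) :
    ∃ ys : List (FhuSub R).bimod.El, ys.map huIncl.el = xs := by
  induction xs with
  | nil => exact ⟨[], rfl⟩
  | cons x xs ih =>
    obtain ⟨ys, rfl⟩ := ih fun y hy => h y (List.mem_cons_of_mem _ hy)
    exact ⟨⟨x.ar, x.deg, ⟨x.val, h x List.mem_cons_self⟩⟩ :: ys, rfl⟩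

theorem huTensorPart_mem_of_hu (hε : IsCounit ε) {N : ℕ} {r : ℤ} {xs : List (Fsu R).El}
    (hxs : ∀ x ∈ xs, IsHu x) (w : (Fsu R).El) :
    huTensorPart ε ((relTensor.mk (Fsu R) (Fsu R)).L N r xs w) ∈ huRange R N r := by
  refine ElLinear.mem_of_inSpan (((relTensor.mk (Fsu R) (Fsu R)).elLinear N r xs).map
    (huTensorPart ε)) (inSpan w) fun w' _ _ hw => ?_
  rcases hw with hw | hw
  · rw [huTensorPart_of_eq_zero]
    · obtain ⟨ys, rfl⟩ := exists_lift hxs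
      exact ⟨_, alpha_L N r ys ⟨w'.ar, w'.deg, ⟨w'.val, hw⟩⟩⟩
    · refine strictPart_of_hu hε ?_
      rw [counitL_L]
      refine (FhuSub R).lact_L_mem N r (fun x hx => ?_) hw
      obtain ⟨y, hy, rfl⟩ := List.mem_map.1 hx
      exact counit_mem hε (hxs y hy)
  · have key : ∀ b : (Asu R).El, b.ar = 0 → strict b.val = b.val → w' = rhoEl b →
        huTensorPart ε ((relTensor.mk (Fsu R) (Fsu R)).L N r xs w') ∈ huRange R N r := by
      rintro b hb hs rfl
      by_cases hf : (rhoEl b).ar = xs.length ∧ arSum xs = N ∧ degSum xs + (rhoEl b).deg = r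
      · obtain ⟨h₁, h₂, h₃⟩ := hf
        obtain rfl : xs = [] := List.eq_nil_of_length_eq_zero h₁.symm
        obtain rfl : 0 = N := h₂
        obtain rfl : (rhoEl b).deg = r := (zero_add _).symm.trans h₃
        have e : (counitL ε).f ((relTensor.mk (Fsu R) (Fsu R)).L 0 (rhoEl b).deg [] (rhoEl b)) =
            (rhoEl b).val := by
          rw [counitL_L]
          exact OdotMap.L_eq_of_el ((Fsu R).lact_el_nil (y := rhoEl b) rfl)
        have e₁ : strictTensor ε
            ((relTensor.mk (Fsu R) (Fsu R)).L 0 (rhoEl b).deg [] (rhoEl b)) =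
            (relTensor.mk (Fsu R) (Fsu R)).L 0 (rhoEl b).deg [] (rhoEl b) :=
          congrArg (fun v => (relTensor.mk (Fsu R) (Fsu R)).L 0 (rhoEl b).deg []
            ⟨0, (rhoEl b).deg, v⟩) ((congrArg (fun v => ofStrict (strictPart ε v)) e).trans
              (ofStrict_strictPart_rhoEl hb hs))
        rw [huTensorPart_apply, e₁, sub_self]
        exact Submodule.zero_mem _
      · rw [OdotMap.L_of_not _ hf, map_zero]
        exact Submodule.zero_mem _
    rcases hw with hw | hw
    · exact key _ rfl Asu.strict_unit hw
    · exact key _ rfl Asu.strict_j hw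

theorem huTensorPart_mem (hε : IsCounit ε) {N : ℕ} {r : ℤ}
    (t : (relTensor (Fsu R) (Fsu R)).X N r) : huTensorPart ε t ∈ huRange R N r := by
  refine map_mem_of_inSpan (relTensor.isTensor (Fsu R) (Fsu R)).span
    (huTensorPart ε) _ (fun y hy => ?_) t
  obtain ⟨xs, w, -, rfl⟩ := relTensor.mk_mem hy
  refine SlotLinear.mem_of_inSpan (((relTensor.mk (Fsu R) (Fsu R)).slotLinear N r w).map
    (huTensorPart ε)) (fun x _ => inSpan x) fun xs' _ hxs => ?_
  obtain ⟨L, hL, rfl, hF, -⟩ := exists_ract hxs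
  rw [(relTensor.isTensor (Fsu R) (Fsu R)).balanced N r L w hL, map_zsmul]
  exact zsmul_mem (huTensorPart_mem_of_hu hε hF _) _

theorem mem_huRange (hε : IsCounit ε) {N : ℕ} {r : ℤ} {t : (relTensor (Fsu R) (Fsu R)).X N r}
    (h : strictPart ε ((counitL ε).f t) = 0) : t ∈ huRange R N r := by
  have := huTensorPart_mem hε t
  rwa [huTensorPart_of_eq_zero h] at this

/-- The retraction of `F ⊙ F` to `F^hu ⊙ F^hu`. -/
noncomputable def toHuTensor (hε : IsCounit ε) {n : ℕ} {p : ℤ} :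
    (relTensor (Fsu R) (Fsu R)).X n p →ₗ[R] (relTensor (Fhu R) (Fhu R)).X n p :=
  (LinearEquiv.ofInjective ((alpha R).toBase.f (n := n) (p := p))
    (alpha_injective n p)).symm.toLinearMap.comp
      ((huTensorPart ε).codRestrict (huRange R n p) (huTensorPart_mem hε))

theorem alpha_toHuTensor (hε : IsCounit ε) {n : ℕ} {p : ℤ}
    (t : (relTensor (Fsu R) (Fsu R)).X n p) :
    (alpha R).toBase.f (toHuTensor hε t) = huTensorPart ε t :=
  congrArg Subtype.val ((LinearEquiv.ofInjective ((alpha R).toBase.f (n := n) (p := p))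
    (alpha_injective n p)).apply_symm_apply ⟨huTensorPart ε t, huTensorPart_mem hε t⟩)

end Fsu

open Fsu

section Coalgebra

variable {ε : (Fsu R).Hom (Asu R).regular} {Δ : (Fsu R).Hom (relTensor (Fsu R) (Fsu R))}
  {Δ' : (Fhu R).Hom (relTensor (Fhu R) (Fhu R))} {ε' : (Fhu R).Hom (Ahu R).regular}

theorem exists_unique_comult_hu (H : IsCoalgebra (Fsu R) Δ ε) (hε : IsCounit ε) :
    ∃! Δ' : (Fhu R).Hom (relTensor (Fhu R) (Fhu R)), ∀ (n : ℕ) (p : ℤ) (x : (Fhu R).X n p),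
      (alpha R).f (Δ'.f x) = Δ.f ((FhuSub R).incl.f x) := by
  obtain ⟨Δ', h⟩ := DGBimod.Hom.exists_factor (P := (FhuSub R).bimod) (alpha R)
    alpha_injective ((FhuSub R).inclHom.comp (Δ.restrict (AhuSub R) (AhuSub R))) fun n p x => by
      refine mem_huRange hε ?_
      have : (counitL ε).f (Δ.f (huIncl.f x)) = huIncl.f x :=
        congrArg (fun f : (Fsu R).Hom (Fsu R) => f.f (huIncl.f x)) H.counit_left
      exact (congrArg (strictPart ε) this).trans (strictPart_of_hu hε x.2)
  exact ⟨Δ', h, fun Δ₁ h₁ => DGBimod.Hom.ext_f fun n p x =>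
    alpha_injective n p ((h₁ n p x).trans (h n p x).symm)⟩

theorem incl_counitL (hε' : ∀ (n : ℕ) (p : ℤ) (x : (Fhu R).X n p),
      (AhuSub R).incl.f (ε'.f x) = ε.f ((FhuSub R).incl.f x)) :
    (counitL ε').comp (FhuSub R).inclHom =
      (alpha R).comp ((counitL ε).restrict (AhuSub R) (AhuSub R)) := by
  refine relTensor.hom_ext fun N r xs y _ => ?_
  refine (congrArg huIncl.f (counitL_L ε' N r xs y)).trans ?_
  refine Eq.trans ?_ (congrArg (counitL ε).f (alpha_L N r xs y)).symm
  refine Eq.trans ?_ (counitL_L ε N r _ _).symm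
  refine (DGColl.Hom.map_L (t := (FhuSub R).bimod.lact) (t' := (Fsu R).lact)
    (f := (AhuSub R).incl) (g := huIncl) (h := huIncl) (fun _ _ _ _ _ _ => rfl) N r _ y).trans ?_
  have e : (xs.map ε'.toHom.el).map (AhuSub R).incl.el = (xs.map huIncl.el).map ε.toHom.el :=
    (List.map_map (l := xs) (f := ε'.toHom.el) (g := (AhuSub R).incl.el)).trans
      ((List.map_congr_left fun x _ =>
        congrArg (fun v => (⟨x.ar, x.deg, v⟩ : (Asu R).El)) (hε' _ _ x.val)).trans
        (List.map_map (l := xs) (f := huIncl.el) (g := ε.toHom.el)).symm)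
  exact congrArg (fun l => (Fsu R).lact.L N r l (huIncl.el y)) e

theorem incl_counitR (hε' : ∀ (n : ℕ) (p : ℤ) (x : (Fhu R).X n p),
      (AhuSub R).incl.f (ε'.f x) = ε.f ((FhuSub R).incl.f x)) :
    (counitR ε').comp (FhuSub R).inclHom =
      (alpha R).comp ((counitR ε).restrict (AhuSub R) (AhuSub R)) := by
  refine relTensor.hom_ext fun N r xs y _ => ?_
  refine (congrArg huIncl.f (counitR_L ε' N r xs y)).trans ?_
  refine Eq.trans ?_ (congrArg (counitR ε).f (alpha_L N r xs y)).symm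
  refine Eq.trans ?_ (counitR_L ε N r _ _).symm
  refine (incl_ract_L N r xs _).trans ?_
  exact congrArg (fun v => (Fsu R).ract.L N r (xs.map huIncl.el) ⟨y.ar, y.deg, v⟩) (hε' _ _ y.val)

theorem toHuTensor_alpha (hε : IsCounit ε) {n : ℕ} {p : ℤ} (t : (relTensor (Fhu R) (Fhu R)).X n p) :
    toHuTensor hε ((alpha R).toBase.f t) = t := by
  obtain ⟨ε', hε', -⟩ := exists_unique_counit_hu hε
  refine alpha_injective n p ((alpha_toHuTensor hε _).trans (huTensorPart_of_eq_zero ?_))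
  have : (counitL ε).f ((alpha R).toBase.f t) = huIncl.f ((counitL ε').f t) :=
    (congrArg (fun f : (relTensor (Fhu R) (Fhu R)).Hom ((Fsu R).restrict (AhuSub R) (AhuSub R)) =>
      f.f t) (incl_counitL hε')).symm
  rw [this]
  exact strictPart_of_hu hε (Subtype.property _)

theorem subMap₂_alpha_injective (n : ℕ) (p : ℤ) : Function.Injective
    ((relTensor.subMap₂ (FhuSub R).inclHom (alpha R)).f (n := n) (p := p)) := by
  obtain ⟨ε, hε, -⟩ := Fsu.exists_unique_counit (R := R)
  refine Fsu.injective_of_retraction (alpha R) (toHuTensor hε) (toHuTensor_alpha hε)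
    (fun x hn => ?_) ((relTensor.subMap₂ (FhuSub R).inclHom (alpha R)).f (n := n) (p := p))
    fun xs y _ => relTensor.subMap₂_L (FhuSub R).inclHom (alpha R) n p xs y
  exact (alpha_toHuTensor hε x).trans (huTensorPart_of_eq_zero (strictPart_of_ne _ hn))

theorem isCoalgebra_hu (H : IsCoalgebra (Fsu R) Δ ε)
    (hΔ : ∀ (n : ℕ) (p : ℤ) (x : (Fhu R).X n p),
      (alpha R).f (Δ'.f x) = Δ.f ((FhuSub R).incl.f x))
    (hε' : ∀ (n : ℕ) (p : ℤ) (x : (Fhu R).X n p),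
      (AhuSub R).incl.f (ε'.f x) = ε.f ((FhuSub R).incl.f x)) : IsCoalgebra (Fhu R) Δ' ε' where
  coassoc := by
    obtain ⟨a, ha, h⟩ := H.coassoc
    obtain ⟨a', ha'⟩ := relTensor.exists_associator (Fhu R) (Fhu R) (Fhu R)
    have ha₁ : relTensor.IsAssociator a' := relTensor.isAssociator_of_L ha'
    refine ⟨a', ha₁, DGBimod.Hom.ext_f fun n p x => subMap₂_alpha_injective n p ?_⟩
    have hΔ₁ : Δ'.comp (alpha R) =
        (FhuSub R).inclHom.comp (Δ.restrict (AhuSub R) (AhuSub R)) := DGBimod.Hom.ext_f hΔ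
    have hid : (DGBimod.Hom.id (Fhu R)).comp (FhuSub R).inclHom =
        (FhuSub R).inclHom.comp ((DGBimod.Hom.id (Fsu R)).restrict (AhuSub R) (AhuSub R)) := rfl
    have e₁ := ha.subMap₂ ha₁ (FhuSub R).inclHom (FhuSub R).inclHom (FhuSub R).inclHom
    have e₂ := relTensor.subMap₂_map hΔ₁ hid
    have e₃ := relTensor.subMap₂_map hid hΔ₁
    have f₁ := congrArg (fun g => g.f ((relTensor.map Δ' (.id (Fhu R))).f (Δ'.f x))) e₁
    have f₂ := congrArg (fun g => a.f (g.f (Δ'.f x))) e₂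
    have f₃ := congrArg (fun g => g.f (Δ'.f x)) e₃
    have f₄ := congrArg (fun g => g.f ((FhuSub R).incl.f x)) h
    refine f₁.trans (f₂.trans (Eq.trans ?_ f₃.symm))
    refine (congrArg (fun v => a.f ((relTensor.map Δ (.id (Fsu R))).f v)) (hΔ n p x)).trans ?_
    exact f₄.trans (congrArg (relTensor.map (.id (Fsu R)) Δ).f (hΔ n p x)).symm
  counit_left := DGBimod.Hom.ext_f fun n p x => Subtype.val_injective <| by
    have f₁ := congrArg (fun g => g.f (Δ'.f x)) (incl_counitL hε')
    refine f₁.trans ((congrArg (counitL ε).f (hΔ n p x)).trans ?_)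
    exact congrArg (fun g => g.f ((FhuSub R).incl.f x)) H.counit_left
  counit_right := DGBimod.Hom.ext_f fun n p x => Subtype.val_injective <| by
    have f₁ := congrArg (fun g => g.f (Δ'.f x)) (incl_counitR hε')
    refine f₁.trans ((congrArg (counitR ε).f (hΔ n p x)).trans ?_)
    exact congrArg (fun g => g.f ((FhuSub R).incl.f x)) H.counit_right

end Coalgebra

end HUnital

namespace HUnital

variable {R : Type u} [CommRing R]

open Fsu

open HUnital.Asu (jEl)

theorem comult_lact_f₁ {Δ : (Fsu R).Hom (relTensor (Fsu R) (Fsu R))}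
    (hΔ : Δ.toHom.el (fEl R 1) = (relTensor.mk (Fsu R) (Fsu R)).el [fEl R 1] (fEl R 1))
    (b : (Asu R).El) : Δ.f ((Fsu R).lact.L 0 b.deg [b] (fEl R 1)) =
      (relTensor.mk (Fsu R) (Fsu R)).L 0 b.deg [(Fsu R).lact.el [b] (fEl R 1)] (fEl R 1) := by
  rw [Δ.map_lact_L, hΔ]
  have := OdotMap.Assoc.lassoc (relTensor.isBalanced (Fsu R) (Fsu R)).left 0 b.deg [([b], fEl R 1)] (fEl R 1)
    (by simp [Matched])
  rw [show kos [([b], fEl R 1)] = 0 by simp [kos], sgn_zero, one_smul] at this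
  exact this.symm

theorem comult_rho {Δ : (Fsu R).Hom (relTensor (Fsu R) (Fsu R))} (b : (Asu R).El)  :
    Δ.f ((Fsu R).ract.L 0 b.deg [] b) =
      (relTensor.mk (Fsu R) (Fsu R)).L 0 b.deg [] (rhoEl b) := by
  rw [Δ.map_ract_L]
  have := OdotMap.Assoc.lassoc (relTensor.isBalanced (Fsu R) (Fsu R)).right 0 b.deg [] b matched_nil
  rw [kos, sgn_zero, one_smul] at this
  exact this

theorem mk_rho_f₁ (b : (Asu R).El) (hb : b.ar = 0) :
    (relTensor.mk (Fsu R) (Fsu R)).L 0 b.deg [rhoEl b] (fEl R 1) =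
      (relTensor.mk (Fsu R) (Fsu R)).L 0 b.deg [] ((Fsu R).lact.el [b] (fEl R 1)) := by
  have := (relTensor.isTensor (Fsu R) (Fsu R)).balanced 0 b.deg [([], b)] (fEl R 1)
    (by simpa [Matched] using hb)
  rw [show kos [(([] : List (Fsu R).El), b)] = 0 by simp [kos], sgn_zero, one_smul] at this
  exact this

theorem f₁_eq : (⟨1, 0, f 1 le_rfl⟩ : (Fsu R).El) = fEl R 1 := by
  rw [fEl_of_le le_rfl]
  rfl

theorem v_eq : (Fsu.v : (Fsu R).X 0 (-1)) =
    (Fsu R).lact.L 0 (-1) [jEl R] (fEl R 1) - (Fsu R).ract.L 0 (-1) [] (jEl R) := by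
  rw [v, rho_eq_L, insertOp_eq_L _ _ _ _ _ _ 0 0 rfl rfl, ← f₁_eq]
  rfl

theorem comult_v {Δ : (Fsu R).Hom (relTensor (Fsu R) (Fsu R))}
    (hΔ : Δ.toHom.el (fEl R 1) = (relTensor.mk (Fsu R) (Fsu R)).el [fEl R 1] (fEl R 1))
    {Δ' : (Fhu R).Hom (relTensor (Fhu R) (Fhu R))}
    (h : ∀ (n : ℕ) (p : ℤ) (x : (Fhu R).X n p),
      (alpha R).f (Δ'.f x) = Δ.f ((FhuSub R).incl.f x)) :
    Δ'.f Fhu.v =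
      (relTensor.mk (Fhu R) (Fhu R)).app (fun _ : Fin 1 => 0) (fun _ => -1) (by simp)
        (by simp) (fun _ => Fhu.v) Fhu.f₁ +
      (relTensor.mk (Fhu R) (Fhu R)).app (k := 0) (N := 0) (r := -1) Fin.elim0 Fin.elim0 rfl (by simp)
        (fun a => a.elim0) Fhu.v := by
  refine alpha_injective 0 (-1) ((h 0 (-1) Fhu.v).trans ?_)
  let T := relTensor.mk (Fsu R) (Fsu R)
  have e₁ : (alpha R).f ((relTensor.mk (Fhu R) (Fhu R)).app (fun _ : Fin 1 => 0) (fun _ => -1)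
      (by simp) (by simp) (fun _ => Fhu.v) Fhu.f₁) = T.L 0 (-1) [⟨0, -1, v⟩] (fEl R 1) := by
    refine (T.app_eq_L (fun _ : Fin 1 => 0) (fun _ => -1) (by simp) (by simp) (fun _ => v)
      (f 1 le_rfl : (Fsu R).X 1 0)).trans ?_
    exact congrArg (T.L 0 (-1) [⟨0, -1, v⟩]) f₁_eq
  have e₂ : (alpha R).f ((relTensor.mk (Fhu R) (Fhu R)).app (k := 0) (N := 0) (r := -1)
      Fin.elim0 Fin.elim0 rfl (by simp) (fun a => a.elim0) Fhu.v) = T.L 0 (-1) [] ⟨0, -1, v⟩ :=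
    (congrArg (alpha R).f (((relTensor.mk (Fhu R) (Fhu R)).app_eq_L (k := 0) (N := 0) (r := -1)
      Fin.elim0 Fin.elim0 rfl (by simp) (fun a => a.elim0) Fhu.v).trans
        (by rw [List.ofFn_zero]))).trans (alpha_L 0 (-1) [] ⟨0, -1, Fhu.v⟩)
  refine Eq.trans ?_ ((congrArg₂ (· + ·) e₁ e₂).symm.trans (map_add (alpha R).f _ _).symm)
  have e₃ : T.L 0 (-1) [⟨0, -1, v⟩] (fEl R 1) =
      T.L 0 (-1) [(Fsu R).lact.el [jEl R] (fEl R 1)] (fEl R 1) -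
        T.L 0 (-1) [rhoEl (jEl R)] (fEl R 1) := by
    rw [v_eq]
    exact (T.slotLinear 0 (-1) (fEl R 1) [] [] 0 (-1)).map_sub _ _
  have e₄ : T.L 0 (-1) [] ⟨0, -1, v⟩ =
      T.L 0 (-1) [] ((Fsu R).lact.el [jEl R] (fEl R 1)) - T.L 0 (-1) [] (rhoEl (jEl R)) := by
    rw [v_eq]
    exact (T.elLinear 0 (-1) [] 0 (-1)).map_sub _ _
  have e₅ : Δ.f v = T.L 0 (-1) [(Fsu R).lact.el [jEl R] (fEl R 1)] (fEl R 1) -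
      T.L 0 (-1) [] (rhoEl (jEl R)) := by
    rw [v_eq, map_sub]
    exact congrArg₂ (· - ·) (comult_lact_f₁ hΔ (jEl R)) (comult_rho (jEl R))
  have e₆ : T.L 0 (-1) [rhoEl (jEl R)] (fEl R 1) =
      T.L 0 (-1) [] ((Fsu R).lact.el [jEl R] (fEl R 1)) := mk_rho_f₁ (jEl R) rfl
  refine e₅.trans ?_
  rw [e₃, e₄, e₆]
  abel

end HUnital

namespace HUnital

/-! Sums over compositions. -/

/-- The exponent `σ` of a list of numbers. -/
def lsig : List ℕ → ℤ
  | [] => 0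
  | _ :: l => lsig l + (l.sum - l.length)

theorem lsig_append (l l' : List ℕ) :
    lsig (l ++ l') = lsig l + lsig l' + l.length * (l'.sum - l'.length) := by
  induction l with
  | nil => simp [lsig]
  | cons x l ih =>
    rw [List.cons_append, lsig, lsig, ih]
    push_cast [List.sum_append, List.length_append, List.length_cons]
    ring

theorem sum_get_sub_one (l : List ℕ) :
    ∑ a : Fin l.length, ((l.get a : ℤ) - 1) = l.sum - l.length := by
  induction l with
  | nil => rfl
  | cons x l ih =>
    refine (Fin.sum_univ_succ _).trans ?_
    simp only [List.get_cons_zero, List.get_cons_succ', List.sum_cons, List.length_cons] at ih ⊢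
    rw [ih]
    push_cast
    ring

theorem lsig_eq_sum (l : List ℕ) :
    lsig l = ∑ a : Fin l.length, ((a : ℕ) : ℤ) * ((l.get a : ℤ) - 1) := by
  induction l with
  | nil => rfl
  | cons x l ih =>
    rw [lsig, ih, ← sum_get_sub_one, ← Finset.sum_add_distrib]
    refine Eq.symm ((Fin.sum_univ_succ _).trans ?_)
    rw [Fin.val_zero, Nat.cast_zero, zero_mul, zero_add]
    refine Finset.sum_congr rfl fun a _ => ?_
    simp only [Fin.val_succ, List.get_cons_succ']
    push_cast
    ring

theorem sigma_eq_lsig {n : ℕ} (c : Composition n) : sigma c = lsig c.blocks :=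
  (lsig_eq_sum c.blocks).symm

open Finset.HasAntidiagonal (antidiagonal mem_antidiagonal)

section CompositionSum

variable {M : Type*} [AddCommGroup M]

/-- The sum of the values of `g` on the compositions of `n`. -/
def csum (n : ℕ) (g : List ℕ → M) : M := ∑ c : Composition n, g c.blocks

/-- The lists of blocks of the compositions of `n`. -/
def comps (n : ℕ) : Finset (List ℕ) :=
  (Finset.univ : Finset (Composition n)).map
    ⟨Composition.blocks, fun _ _ h => Composition.ext h⟩

theorem mem_comps {n : ℕ} {l : List ℕ} : l ∈ comps n ↔ (∀ x ∈ l, 0 < x) ∧ l.sum = n := by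
  refine ⟨fun h => ?_, fun h => Finset.mem_map.2 ⟨⟨l, fun hx => h.1 _ hx, h.2⟩, Finset.mem_univ _, rfl⟩⟩
  obtain ⟨c, -, rfl⟩ := Finset.mem_map.1 h
  exact ⟨fun x hx => c.blocks_pos hx, c.blocks_sum⟩

theorem csum_eq_sum_comps (n : ℕ) (g : List ℕ → M) : csum n g = ∑ l ∈ comps n, g l :=
  (Finset.sum_map (Finset.univ : Finset (Composition n))
    ⟨Composition.blocks, fun _ _ h => Composition.ext h⟩ g).symm

theorem csum_congr {n : ℕ} {g g' : List ℕ → M}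
    (h : ∀ l, (∀ x ∈ l, 0 < x) → l.sum = n → g l = g' l) : csum n g = csum n g' :=
  Finset.sum_congr rfl fun c _ => h _ (fun _ hx => c.blocks_pos hx) c.blocks_sum

theorem csum_add (n : ℕ) (g g' : List ℕ → M) :
    csum n (fun l => g l + g' l) = csum n g + csum n g' := Finset.sum_add_distrib

theorem csum_sub (n : ℕ) (g g' : List ℕ → M) :
    csum n (fun l => g l - g' l) = csum n g - csum n g' := Finset.sum_sub_distrib _ _

theorem csum_zsmul (n : ℕ) (e : ℤ) (g : List ℕ → M) :
    csum n (fun l => e • g l) = e • csum n g := Finset.smul_sum.symm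

theorem csum_fun_zero (n : ℕ) : csum n (fun _ => (0 : M)) = 0 := Finset.sum_const_zero

theorem map_csum {M' F : Type*} [AddCommGroup M'] [FunLike F M M'] [AddMonoidHomClass F M M']
    (f : F) (n : ℕ) (g : List ℕ → M) : f (csum n g) = csum n fun l => f (g l) := map_sum f _ _

theorem csum_sum {α : Type*} (s : Finset α) (n : ℕ) (g : α → List ℕ → M) :
    csum n (fun l => ∑ a ∈ s, g a l) = ∑ a ∈ s, csum n (g a) := Finset.sum_comm

theorem csum_comm (n m : ℕ) (g : List ℕ → List ℕ → M) :
    csum n (fun l => csum m (g l)) = csum m fun l' => csum n fun l => g l l' := Finset.sum_comm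

theorem csum_zero (g : List ℕ → M) : csum 0 g = g [] := by
  have : comps 0 = {[]} := by
    ext l
    rw [mem_comps, Finset.mem_singleton]
    refine ⟨fun h => List.eq_nil_iff_forall_not_mem.2 fun x hx => ?_, by rintro rfl; simp⟩
    exact (h.1 x hx).ne' (List.sum_eq_zero_iff.1 h.2 x hx)
  rw [csum_eq_sum_comps, this, Finset.sum_singleton]

theorem csum_succ (n : ℕ) (g : List ℕ → M) :
    csum (n + 1) g =
      ∑ p ∈ antidiagonal n, csum p.2 fun l => g ((p.1 + 1) :: l) := by
  simp only [csum_eq_sum_comps]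
  rw [Finset.sum_sigma']
  refine Finset.sum_bij' (fun l _ => ⟨(l.headI - 1, l.tail.sum), l.tail⟩)
    (fun s _ => (s.1.1 + 1) :: s.2) ?_ ?_ ?_ ?_ ?_
  · intro l hl
    rw [mem_comps] at hl
    cases l with
    | nil => simp at hl
    | cons x l =>
      have := hl.1 x List.mem_cons_self
      simp only [Finset.mem_sigma, mem_antidiagonal, mem_comps, List.headI, List.tail]
      refine ⟨?_, fun y hy => hl.1 y (List.mem_cons_of_mem _ hy), trivial⟩
      have h := hl.2
      rw [List.sum_cons] at h
      omega
  · rintro ⟨⟨i, j⟩, l⟩ hs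
    simp only [Finset.mem_sigma, mem_antidiagonal, mem_comps] at hs
    rw [mem_comps]
    refine ⟨fun x hx => ?_, ?_⟩
    · rcases List.mem_cons.1 hx with rfl | hx
      · exact Nat.succ_pos _
      · exact hs.2.1 x hx
    · rw [List.sum_cons, hs.2.2]
      have := hs.1
      simp only
      omega
  · intro l hl
    rw [mem_comps] at hl
    cases l with
    | nil => simp at hl
    | cons x l =>
      have := hl.1 x List.mem_cons_self
      simp only [List.headI, List.tail]
      rw [Nat.sub_add_cancel this]
  · rintro ⟨⟨i, j⟩, l⟩ hs
    simp only [Finset.mem_sigma, mem_antidiagonal, mem_comps] at hs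
    obtain ⟨-, -, rfl⟩ := hs
    rfl
  · intro l hl
    rw [mem_comps] at hl
    cases l with
    | nil => simp at hl
    | cons x l =>
      have := hl.1 x List.mem_cons_self
      simp only [List.headI, List.tail]
      rw [Nat.sub_add_cancel this]

theorem sum_antidiagonal_assoc (n : ℕ) (f : ℕ → ℕ → ℕ → M) :
    ∑ p ∈ antidiagonal n, ∑ q ∈ antidiagonal p.1, f q.1 q.2 p.2 =
      ∑ p ∈ antidiagonal n, ∑ q ∈ antidiagonal p.2, f p.1 q.1 q.2 := by
  rw [Finset.sum_sigma', Finset.sum_sigma']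
  refine Finset.sum_bij' (fun s _ => ⟨(s.2.1, s.2.2 + s.1.2), (s.2.2, s.1.2)⟩)
    (fun s _ => ⟨(s.1.1 + s.2.1, s.2.2), (s.1.1, s.2.1)⟩) ?_ ?_ ?_ ?_ ?_
  · rintro ⟨⟨a, b⟩, ⟨c, d⟩⟩ h
    simp only [Finset.mem_sigma, mem_antidiagonal, and_true] at h ⊢
    omega
  · rintro ⟨⟨a, b⟩, ⟨c, d⟩⟩ h
    simp only [Finset.mem_sigma, mem_antidiagonal, and_true] at h ⊢
    omega
  · rintro ⟨⟨a, b⟩, ⟨c, d⟩⟩ h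
    simp only [Finset.mem_sigma, mem_antidiagonal] at h
    obtain ⟨-, rfl⟩ := h
    rfl
  · rintro ⟨⟨a, b⟩, ⟨c, d⟩⟩ h
    simp only [Finset.mem_sigma, mem_antidiagonal] at h
    obtain ⟨-, rfl⟩ := h
    rfl
  · intros; rfl

/-- A composition with a cut between blocks is a pair of compositions. -/
theorem csum_splits (n : ℕ) (g : List ℕ → List ℕ → M) :
    csum n (fun l => ∑ p ∈ antidiagonal l.length, g (l.take p.1) (l.drop p.1)) =
      ∑ p ∈ antidiagonal n, csum p.1 fun l => csum p.2 fun l' => g l l' := by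
  simp only [csum_eq_sum_comps]
  rw [Finset.sum_sigma']
  have : ∀ p : ℕ × ℕ, ∑ l ∈ comps p.1, ∑ l' ∈ comps p.2, g l l' =
      ∑ s ∈ comps p.1 ×ˢ comps p.2, g s.1 s.2 := fun p => Finset.sum_product' _ _ _ |>.symm
  simp only [this]
  rw [Finset.sum_sigma']
  refine Finset.sum_bij' (fun s _ => ⟨((s.1.take s.2.1).sum, (s.1.drop s.2.1).sum),
    (s.1.take s.2.1, s.1.drop s.2.1)⟩)
    (fun s _ => ⟨s.2.1 ++ s.2.2, (s.2.1.length, s.2.2.length)⟩) ?_ ?_ ?_ ?_ ?_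
  · rintro ⟨l, a, b⟩ h
    simp only [Finset.mem_sigma, mem_antidiagonal, mem_comps, Finset.mem_product] at h ⊢
    refine ⟨?_, ⟨fun x hx => h.1.1 x (List.mem_of_mem_take hx), trivial⟩,
      fun x hx => h.1.1 x (List.mem_of_mem_drop hx), trivial⟩
    rw [← List.sum_append, List.take_append_drop, h.1.2]
  · rintro ⟨⟨a, b⟩, ⟨l, l'⟩⟩ h
    simp only [Finset.mem_sigma, mem_antidiagonal, mem_comps, Finset.mem_product] at h ⊢
    obtain ⟨rfl, ⟨h₁, rfl⟩, h₂, rfl⟩ := h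
    refine ⟨⟨fun x hx => ?_, List.sum_append⟩, List.length_append.symm⟩
    rcases List.mem_append.1 hx with hx | hx
    · exact h₁ x hx
    · exact h₂ x hx
  · rintro ⟨l, a, b⟩ h
    simp only [Finset.mem_sigma, mem_antidiagonal] at h
    simp only [List.take_append_drop, List.length_take, List.length_drop]
    congr 2 <;> omega
  · rintro ⟨⟨a, b⟩, ⟨l, l'⟩⟩ h
    simp only [Finset.mem_sigma, mem_antidiagonal, mem_comps, Finset.mem_product] at h
    obtain ⟨rfl, ⟨h₁, rfl⟩, h₂, rfl⟩ := h
    simp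
  · intros; rfl

/-- A composition of `a + 1 + c` consists of a block that contains the point number `a` and two
compositions. -/
theorem csum_pointed (a c : ℕ) (g : List ℕ → M) :
    csum (a + 1 + c) g = ∑ p ∈ antidiagonal a, ∑ q ∈ antidiagonal c,
      csum p.1 fun l => csum q.2 fun l' => g (l ++ (p.2 + 1 + q.1) :: l') := by
  induction a using Nat.strong_induction_on generalizing g with
  | _ a ih =>
  have e : csum (a + 1 + c) g = ∑ i ∈ Finset.range a, csum (a + c - i) (fun l => g ((i + 1) :: l)) +
      ∑ q ∈ antidiagonal c, csum q.2 fun l => g ((a + 1 + q.1) :: l) := by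
    rw [show a + 1 + c = a + c + 1 by omega, csum_succ,
      Finset.Nat.sum_antidiagonal_eq_sum_range_succ
        (fun i j => csum j fun l => g ((i + 1) :: l)),
      Finset.Nat.sum_antidiagonal_eq_sum_range_succ
        (fun i j => csum j fun l => g ((a + 1 + i) :: l)), Nat.succ_eq_add_one,
      Nat.succ_eq_add_one, add_assoc, Finset.sum_range_add]
    congr 1
    refine Finset.sum_congr rfl fun i _ => ?_
    rw [show a + c - (a + i) = c - i by omega]
    refine congrArg _ (funext fun l => ?_)
    rw [show a + i + 1 = a + 1 + i by omega]
  rw [e]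
  cases a with
  | zero =>
    simp only [Finset.range_zero, Finset.sum_empty, zero_add, Finset.Nat.antidiagonal_zero,
      Finset.sum_singleton, csum_zero, List.nil_append]
  | succ a =>
    rw [Finset.Nat.sum_antidiagonal_succ, add_comm]
    congr 1
    · simp only [csum_zero, List.nil_append]
    · simp only [csum_succ]
      have h₁ : ∀ i ∈ Finset.range (a + 1), csum (a + 1 + c - i) (fun l => g ((i + 1) :: l)) =
          ∑ p ∈ antidiagonal (a - i), ∑ q ∈ antidiagonal c,
            csum p.1 fun l => csum q.2 fun l' =>
              g ((i + 1) :: (l ++ (p.2 + 1 + q.1) :: l')) := fun i hi => by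
        rw [Finset.mem_range] at hi
        rw [show a + 1 + c - i = (a - i) + 1 + c by omega, ih (a - i) (by omega)]
      rw [Finset.sum_congr rfl h₁, ← Finset.Nat.sum_antidiagonal_eq_sum_range_succ
        (fun i j => ∑ p ∈ antidiagonal j, ∑ q ∈ antidiagonal c,
            csum p.1 fun l => csum q.2 fun l' =>
              g ((i + 1) :: (l ++ (p.2 + 1 + q.1) :: l')))]
      rw [← sum_antidiagonal_assoc a (fun i j k => ∑ q ∈ antidiagonal c,
            csum j fun l => csum q.2 fun l' => g ((i + 1) :: (l ++ (k + 1 + q.1) :: l')))]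
      refine Finset.sum_congr rfl fun p _ => ?_
      rw [Finset.sum_comm]
      rfl

end CompositionSum

end HUnital

namespace HUnital

variable {R : Type u} [CommRing R]

open Finset.HasAntidiagonal (antidiagonal mem_antidiagonal)

/-! Substitution of sums over compositions. -/

section CompositionSum

variable {M : Type*} [AddCommGroup M]

/-- The sum over families of compositions of the numbers in a list. -/
def csums : List ℕ → (List (List ℕ) → M) → M
  | [], g => g []
  | n :: l, g => csum n fun J => csums l fun Js => g (J :: Js)

theorem csums_congr {I : List ℕ} {g g' : List (List ℕ) → M}
    (h : ∀ Js : List (List ℕ), Js.map List.sum = I → g Js = g' Js) : csums I g = csums I g' := by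
  induction I generalizing g g' with
  | nil => exact h [] rfl
  | cons n I ih =>
    refine csum_congr fun J _ hJ => ih fun Js hJs => h _ ?_
    rw [List.map_cons, hJ, hJs]

theorem csums_zsmul (e : ℤ) (I : List ℕ) (g : List (List ℕ) → M) :
    csums I (fun Js => e • g Js) = e • csums I g := by
  induction I generalizing g with
  | nil => rfl
  | cons n I ih =>
    simp only [csums, ih, csum_zsmul]

theorem csum_nonempty_splits (n : ℕ) (g : List ℕ → List ℕ → M) :
    csum (n + 1) (fun l => ∑ p ∈ antidiagonal (l.length - 1),
      g (l.take (p.1 + 1)) (l.drop (p.1 + 1))) =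
      ∑ p ∈ antidiagonal n, csum (p.1 + 1) fun l => csum p.2 fun l' => g l l' := by
  have h := csum_splits (n + 1) fun l l' => if l = [] then 0 else g l l'
  rw [Finset.Nat.sum_antidiagonal_succ, csum_zero] at h
  simp only [if_pos, csum_fun_zero, zero_add] at h
  refine Eq.trans (csum_congr fun l _ hl => ?_) (h.trans ?_)
  · cases l with
    | nil => simp at hl
    | cons x l => simp [Finset.Nat.sum_antidiagonal_succ]
  · refine Finset.sum_congr rfl fun p _ => csum_congr fun l _ hl => ?_
    cases l with
    | nil => simp at hl
    | cons x l => simp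

/-- A composition with compositions of all its blocks is a composition with a composition of its
length. -/
theorem csum_csums (n : ℕ) (g : List (List ℕ) → M) :
    csum n (fun I => csums I g) =
      csum n fun K => csum K.length fun p => g (List.splitLengths p K) := by
  induction n using Nat.strong_induction_on generalizing g with
  | _ n ih =>
  cases n with
  | zero =>
    simp only [csum_zero, List.length_nil]
    rfl
  | succ n =>
    have h : csum (n + 1) (fun K => csum K.length fun p => g (List.splitLengths p K)) =
        csum (n + 1) fun K => ∑ q ∈ antidiagonal (K.length - 1),
          (fun l l' => csum l'.length fun p => g (l :: List.splitLengths p l'))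
            (K.take (q.1 + 1)) (K.drop (q.1 + 1)) := by
      refine csum_congr fun K _ hK => ?_
      cases K with
      | nil => simp at hK
      | cons x K =>
        rw [List.length_cons, csum_succ, Nat.add_sub_cancel]
        refine Finset.sum_congr rfl fun q hq => ?_
        have : (List.drop (q.1 + 1) (x :: K)).length = q.2 := by
          have := mem_antidiagonal.1 hq
          simp
          omega
        simp only [this, List.splitLengths, List.splitAt_eq]
    refine Eq.trans ?_ (h.trans (csum_nonempty_splits n fun l l' => csum l'.length fun p =>
      g (l :: List.splitLengths p l'))).symm
    rw [csum_succ]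
    refine Finset.sum_congr rfl fun p hp => ?_
    have hp := mem_antidiagonal.1 hp
    simp only [csums]
    rw [csum_comm]
    exact csum_congr fun J _ _ => ih p.2 (by omega) fun Js => g (J :: Js)

end CompositionSum

variable {P Q S U V W : DGColl R}

theorem OdotMap.L_csum (w : OdotMap P Q S) (N : ℕ) (r : ℤ) (u : Q.El)
    (h : ∀ n : ℕ, List ℕ → P.X n (1 - n)) (G : List ℕ → P.El)
    (hG : ∀ J : List ℕ, G J = ⟨J.sum, 1 - J.sum, h J.sum J⟩) (pre : List P.El) (I : List ℕ) :
    w.L N r (pre ++ I.map fun n => (⟨n, 1 - n, csum n (h n)⟩ : P.El)) u =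
      csums I fun Js => w.L N r (pre ++ Js.map G) u := by
  induction I generalizing pre with
  | nil => rfl
  | cons n I ih =>
    refine (map_csum (IsLinearMap.mk' _ (w.slotLinear N r u pre (I.map _) n (1 - n))) n _).trans ?_
    refine csum_congr fun J _ hJ => ?_
    have e := ih (pre ++ [G J])
    subst hJ
    simp only [List.append_assoc, List.singleton_append] at e
    rw [IsLinearMap.mk'_apply, ← hG]
    exact e

theorem arSum_map_comp {x : ℕ → P.El} (hx : ∀ n, (x n).ar = n) (l : List ℕ) :
    arSum (l.map x) = l.sum := by
  rw [arSum, List.map_map, show DGColl.El.ar ∘ x = id from funext hx, List.map_id]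

theorem degSum_map_comp {x : ℕ → P.El} (hx : ∀ n, (x n).deg = 1 - n) (l : List ℕ) :
    degSum (l.map x) = l.length - l.sum := by
  induction l with
  | nil => rfl
  | cons n l ih =>
    rw [List.map_cons, degSum_cons, ih, hx, List.length_cons, List.sum_cons]
    push_cast
    ring

theorem lsig_flatten {x : ℕ → P.El} {y : ℕ → Q.El} (hx : ∀ n, (x n).deg = 1 - n)
    (hy : ∀ n, (y n).deg = 1 - n) (LL : List (List ℕ)) :
    lsig (LL.map List.sum) + (LL.map lsig).sum + kos (LL.map fun J => (J.map x, y J.length)) =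
      lsig LL.flatten + lsig (LL.map List.length) := by
  induction LL with
  | nil => rfl
  | cons J LL ih =>
    have e : flatL (LL.map fun J => (J.map x, y J.length)) = LL.flatten.map x := by
      rw [flatL, List.flatMap_map, List.map_flatten, List.flatMap]
    simp only [List.map_cons, List.flatten_cons, lsig, lsig_append, kos, List.sum_cons, e,
      degSum_map_comp hx, hy, List.length_flatten, List.sum_flatten, List.length_map] at ih ⊢
    linear_combination ih

/-- Substitution of `uᵢ = ∑ ± (x_{j₁} ⊗ ⋯ ⊗ x_{jₖ}) yₖ` into `∑ ± (u_{i₁} ⊗ ⋯ ⊗ u_{i_l}) z_l`. -/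
theorem LAssoc.csum_subst {a : OdotMap P Q S} {b : OdotMap S U V} {c : OdotMap Q U W}
    {e : OdotMap P W V} (H : LAssoc a b c e) {x : ℕ → P.El} {y : ℕ → Q.El}
    (hx : ∀ n, (x n).ar = n ∧ (x n).deg = 1 - n) (hy : ∀ n, (y n).ar = n ∧ (y n).deg = 1 - n)
    (z : ℕ → U.El) (n N : ℕ) (r : ℤ) :
    csum n (fun I => sgn (lsig I) • b.L N r (I.map fun i => (⟨i, 1 - i, csum i fun J =>
      sgn (lsig J) • a.L i (1 - i) (J.map x) (y J.length)⟩ : S.El)) (z I.length)) =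
    csum n fun K => sgn (lsig K) • csum K.length fun p => sgn (lsig p) •
      e.L N r (K.map x) (c.el (p.map y) (z p.length)) := by
  let E : List ℕ → S.El := fun J => a.el (J.map x) (y J.length)
  have hE : ∀ J : List ℕ, E J = ⟨J.sum, 1 - J.sum, a.L J.sum (1 - J.sum) (J.map x) (y J.length)⟩ :=
    fun J => a.el_eq (arSum_map_comp (fun n => (hx n).1) J)
      (by rw [degSum_map_comp fun n => (hx n).2, (hy _).2]; ring)
  have h₁ : ∀ I : List ℕ, sgn (lsig I) • b.L N r (I.map fun i => (⟨i, 1 - i, csum i fun J =>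
      sgn (lsig J) • a.L i (1 - i) (J.map x) (y J.length)⟩ : S.El)) (z I.length) =
      csums I fun Js => sgn (lsig Js.flatten + lsig (Js.map List.length)) •
        e.L N r (Js.flatten.map x) (c.el ((Js.map List.length).map y) (z Js.length)) := fun I => by
    have := b.L_csum N r (z I.length) (fun i J => sgn (lsig J) • a.L i (1 - i) (J.map x) (y J.length))
      _ (fun J => rfl) [] I
    rw [List.nil_append] at this
    rw [this, ← csums_zsmul]
    refine csums_congr fun Js hJs => ?_
    rw [b.L_map_smul lsig _ E N r _ Js fun J _ => ⟨_, _, _, rfl, hE J⟩, List.nil_append]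
    have hL := H N r (Js.map fun J => (J.map x, y J.length)) (z I.length) fun i hi => by
      obtain ⟨J, -, rfl⟩ := List.mem_map.1 hi
      rw [List.length_map, (hy _).1]
    have e₁ : flatL (Js.map fun J => (J.map x, y J.length)) = Js.flatten.map x := by
      rw [flatL, List.flatMap_map, List.map_flatten, List.flatMap]
    have e₂ : a.elL (Js.map fun J => (J.map x, y J.length)) = Js.map E := by
      rw [OdotMap.elL, List.map_map]
      rfl
    have e₃ : sndL (Js.map fun J => (J.map x, y J.length)) = (Js.map List.length).map y := by
      rw [sndL, List.map_map, List.map_map]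
      rfl
    rw [e₁, e₂, e₃] at hL
    rw [hL, sgn_smul_smul, sgn_smul_smul, ← lsig_flatten (fun n => (hx n).2) (fun n => (hy n).2),
      ← hJs, List.length_map, add_assoc]
  rw [csum_congr fun I _ _ => h₁ I, csum_csums]
  refine csum_congr fun K _ _ => ?_
  rw [← csum_zsmul]
  refine csum_congr fun p _ hp => ?_
  have h₂ : (List.splitLengths p K).flatten = K := List.flatten_splitLengths _ _ hp.ge
  have h₃ : (List.splitLengths p K).map List.length = p := List.map_splitLengths_length _ _ hp.le
  have h₄ : (List.splitLengths p K).length = p.length := List.length_splitLengths ..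
  rw [h₂, h₃, h₄, sgn_smul_smul]

end HUnital

namespace HUnital

variable {R : Type u} [CommRing R]

open Finset.HasAntidiagonal (antidiagonal mem_antidiagonal)

section CompositionSum

variable {M : Type*} [AddCommGroup M]

/-- The sum over the triples of numbers with sum `n`. -/
def tsum₃ (n : ℕ) (f : ℕ → ℕ → ℕ → M) : M :=
  ∑ p ∈ antidiagonal n, ∑ q ∈ antidiagonal p.2, f p.1 q.1 q.2

theorem tsum₃_congr {n : ℕ} {f g : ℕ → ℕ → ℕ → M}
    (h : ∀ a b c, a + b + c = n → f a b c = g a b c) : tsum₃ n f = tsum₃ n g := by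
  refine Finset.sum_congr rfl fun p hp => Finset.sum_congr rfl fun q hq => h _ _ _ ?_
  rw [mem_antidiagonal] at hp hq
  omega

theorem tsum₃_sub (n : ℕ) (f g : ℕ → ℕ → ℕ → M) :
    tsum₃ n (fun a b c => f a b c - g a b c) = tsum₃ n f - tsum₃ n g := by
  simp only [tsum₃, Finset.sum_sub_distrib]

theorem tsum₃_zsmul (n : ℕ) (e : ℤ) (f : ℕ → ℕ → ℕ → M) :
    tsum₃ n (fun a b c => e • f a b c) = e • tsum₃ n f := by
  simp only [tsum₃, Finset.smul_sum]

theorem map_tsum₃ {M' F : Type*} [AddCommGroup M'] [FunLike F M M'] [AddMonoidHomClass F M M']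
    (f : F) (n : ℕ) (g : ℕ → ℕ → ℕ → M) : f (tsum₃ n g) = tsum₃ n fun a b c => f (g a b c) := by
  simp only [tsum₃, map_sum]

theorem sum_cut (n : ℕ) (f : ℕ → ℕ → ℕ → M) (h : ∀ a b c, b < 2 → f a b c = 0) :
    ∑ t : Cut n, f t.a t.b t.c = tsum₃ n f := by
  rw [tsum₃, Finset.sum_sigma', ← Finset.sum_filter_of_ne
    (p := fun s : (_ : ℕ × ℕ) × ℕ × ℕ => 1 < s.2.1) fun s _ hs => by
      by_contra hb
      exact hs (h _ _ _ (by omega))]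
  refine Finset.sum_bij' (fun t _ => ⟨(t.a, t.b + t.c), (t.b, t.c)⟩)
    (fun s hs => ⟨(⟨s.1.1, ?_⟩, ⟨s.2.1, ?_⟩, ⟨s.2.2, ?_⟩), ?_⟩) ?_ ?_ ?_ ?_ ?_
  iterate 3
    · simp only [Finset.mem_filter, Finset.mem_sigma, mem_antidiagonal] at hs
      omega
  · simp only [Finset.mem_filter, Finset.mem_sigma, mem_antidiagonal] at hs
    simp only
    omega
  · intro t _
    have := t.sum
    simp only [Finset.mem_filter, Finset.mem_sigma, mem_antidiagonal, and_true]
    exact ⟨by omega, t.2.2⟩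
  · exact fun _ _ => Finset.mem_univ _
  · exact fun _ _ => rfl
  · rintro ⟨⟨a, b⟩, ⟨c, d⟩⟩ hs
    simp only [Finset.mem_filter, Finset.mem_sigma, mem_antidiagonal] at hs
    obtain ⟨⟨-, rfl⟩, -⟩ := hs
    rfl
  · exact fun _ _ => rfl

theorem sum_length_gt_one (n : ℕ) (g : List ℕ → M) (h : ∀ l, l.length < 2 → g l = 0) :
    ∑ c : {c : Composition n // 1 < c.length}, g c.1.blocks = csum n g := by
  refine (Finset.sum_subtype (Finset.univ.filter fun c : Composition n => 1 < c.length) (by simp)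
    fun c => g c.blocks).symm.trans (Finset.sum_filter_of_ne fun c _ hc => ?_)
  by_contra hl
  exact hc (h _ (by rw [c.blocks_length]; omega))

/-- The value of a function of the first entry of a list and of the rest of the list. -/
def headTail (g : ℕ → List ℕ → M) : List ℕ → M
  | [] => 0
  | n :: l => g n l

theorem csum_headTail (n : ℕ) {g : ℕ → List ℕ → M} (h : ∀ l, g 0 l = 0) :
    csum n (headTail g) = ∑ q ∈ antidiagonal n, csum q.2 (g q.1) := by
  cases n with
  | zero =>
    rw [csum_zero, Finset.Nat.antidiagonal_zero, Finset.sum_singleton, csum_zero, h]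
    rfl
  | succ n =>
    rw [csum_succ, Finset.Nat.sum_antidiagonal_succ, csum_congr fun l _ _ => h l, csum_fun_zero,
      zero_add]
    rfl

theorem csum_tsum₃ (n : ℕ) (f : List ℕ → ℕ → ℕ → ℕ → M) :
    csum n (fun K => tsum₃ K.length (f K)) = tsum₃ n fun i j k => csum i fun l₁ => csum j fun m =>
      csum k fun l₂ => f (l₁ ++ (m ++ l₂)) l₁.length m.length l₂.length := by
  have h : ∀ K : List ℕ, tsum₃ K.length (f K) = ∑ p ∈ antidiagonal K.length,
      (fun l l' => ∑ q ∈ antidiagonal l'.length, (fun m l₂ =>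
        f (l ++ (m ++ l₂)) l.length m.length l₂.length) (l'.take q.1) (l'.drop q.1))
      (K.take p.1) (K.drop p.1) := fun K => by
    refine Finset.sum_congr rfl fun p hp => ?_
    have hp := mem_antidiagonal.1 hp
    have h₁ : (K.drop p.1).length = p.2 := by rw [List.length_drop]; omega
    have h₂ : (K.take p.1).length = p.1 := by rw [List.length_take]; omega
    simp only [h₁, h₂]
    refine Finset.sum_congr rfl fun q hq => ?_
    have hq := mem_antidiagonal.1 hq
    have h₃ : ((K.drop p.1).take q.1).length = q.1 := by rw [List.length_take]; omega
    have h₄ : ((K.drop p.1).drop q.1).length = q.2 := by rw [List.length_drop]; omega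
    rw [h₃, h₄, List.take_append_drop, List.take_append_drop]
  rw [csum_congr fun K _ _ => h K]
  refine (csum_splits n fun l l' => ∑ q ∈ antidiagonal l'.length, (fun m l₂ =>
        f (l ++ (m ++ l₂)) l.length m.length l₂.length) (l'.take q.1) (l'.drop q.1)).trans ?_
  refine Finset.sum_congr rfl fun p _ => ?_
  rw [← csum_sum]
  exact csum_congr fun l _ _ => csum_splits p.2 fun m l₂ =>
    f (l ++ (m ++ l₂)) l.length m.length l₂.length

theorem tsum₃_csum_pointed (n : ℕ) (G : ℕ → ℕ → ℕ → List ℕ → M) :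
    tsum₃ n (fun a b c => csum (a + 1 + c) (G a b c)) =
      tsum₃ n fun i l k => csum i fun l₁ => csum k fun l₂ => tsum₃ l fun a b c =>
        G (i + a) b (c + k) (l₁ ++ (a + 1 + c) :: l₂) := by
  let h : ℕ → ℕ → ℕ → ℕ → ℕ → M := fun i a b c k => csum i fun l₁ => csum k fun l₂ =>
    G (i + a) b (c + k) (l₁ ++ (a + 1 + c) :: l₂)
  have e₁ : tsum₃ n (fun a b c => csum (a + 1 + c) (G a b c)) =
      ∑ p ∈ antidiagonal n, ∑ x ∈ antidiagonal p.1, ∑ q ∈ antidiagonal p.2,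
        ∑ y ∈ antidiagonal q.2, h x.1 x.2 q.1 y.1 y.2 := by
    refine Finset.sum_congr rfl fun p _ => ?_
    rw [Finset.sum_comm]
    refine Finset.sum_congr rfl fun q _ => ?_
    refine (csum_pointed p.1 q.2 _).trans ?_
    refine Finset.sum_congr rfl fun x hx => Finset.sum_congr rfl fun y hy => ?_
    rw [← mem_antidiagonal.1 hx, ← mem_antidiagonal.1 hy]
  have e₂ : tsum₃ n (fun i l k => csum i fun l₁ => csum k fun l₂ => tsum₃ l fun a b c =>
        G (i + a) b (c + k) (l₁ ++ (a + 1 + c) :: l₂)) =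
      ∑ p ∈ antidiagonal n, ∑ q ∈ antidiagonal p.2, ∑ t ∈ antidiagonal q.1,
        ∑ v ∈ antidiagonal t.2, h p.1 t.1 v.1 v.2 q.2 := by
    refine Finset.sum_congr rfl fun p _ => Finset.sum_congr rfl fun q _ => ?_
    simp only [tsum₃, csum_sum, h]
  rw [e₁, e₂, sum_antidiagonal_assoc n fun i a m => ∑ q ∈ antidiagonal m,
    ∑ y ∈ antidiagonal q.2, h i a q.1 y.1 y.2]
  refine Finset.sum_congr rfl fun p _ => ?_
  rw [sum_antidiagonal_assoc p.2 fun a m k => ∑ v ∈ antidiagonal m, h p.1 a v.1 v.2 k]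
  refine Finset.sum_congr rfl fun x _ => ?_
  exact (sum_antidiagonal_assoc x.2 fun b c k => h p.1 x.1 b c k).symm

variable {P : DGColl R}

theorem dsum_map_eq_sum (ψ : List P.El → M) (x : ℕ → P.El) (K : List ℕ) :
    dsum ψ (K.map x) = ∑ p ∈ antidiagonal K.length, headTail (fun n l =>
      sgn (degSum (l.map x)) • ψ ((K.take p.1).map x ++ (x n).d :: l.map x)) (K.drop p.1) := by
  induction K generalizing ψ with
  | nil => simp [dsum, headTail]
  | cons n K ih =>
    rw [List.map_cons, dsum, ih, List.length_cons, Finset.Nat.sum_antidiagonal_succ]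
    rfl

theorem csum_dsum (n : ℕ) (x : ℕ → P.El) (ψ : List ℕ → List P.El → M)
    (h : ∀ K l₁ l₂, ψ K (l₁ ++ (x 0).d :: l₂) = 0) :
    csum n (fun K => dsum (ψ K) (K.map x)) = tsum₃ n fun i b k => csum i fun l₁ => csum k fun l₂ =>
      sgn (degSum (l₂.map x)) • ψ (l₁ ++ b :: l₂) (l₁.map x ++ (x b).d :: l₂.map x) := by
  have e : ∀ K : List ℕ, dsum (ψ K) (K.map x) = ∑ p ∈ antidiagonal K.length,
      (fun l₁ => headTail fun b l₂ => sgn (degSum (l₂.map x)) •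
        ψ (l₁ ++ b :: l₂) (l₁.map x ++ (x b).d :: l₂.map x)) (K.take p.1) (K.drop p.1) := fun K => by
    rw [dsum_map_eq_sum]
    refine Finset.sum_congr rfl fun p _ => ?_
    have := List.take_append_drop p.1 K
    beta_reduce
    revert this
    generalize K.drop p.1 = l'
    cases l' with
    | nil => exact fun _ => rfl
    | cons b l₂ =>
      intro this
      simp only [headTail, this]
  rw [csum_congr fun K _ _ => e K]
  refine (csum_splits n fun l₁ => headTail fun b l₂ => sgn (degSum (l₂.map x)) •
    ψ (l₁ ++ b :: l₂) (l₁.map x ++ (x b).d :: l₂.map x)).trans ?_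
  refine Finset.sum_congr rfl fun p _ => ?_
  rw [← csum_sum]
  refine csum_congr fun l₁ _ _ => csum_headTail _ fun l₂ => ?_
  rw [h, smul_zero]

end CompositionSum

section Relations

open HUnital.Asu (mEl)

variable {P : DGBimod (Asu R) (Asu R)}

theorem Asu.mEl_of_lt {n : ℕ} (h : n < 2) : mEl R n = ⟨n, 2 - n, 0⟩ := by
  rw [mEl, dif_neg (by omega)]

/-- The right hand side of the relation for `f_n ∂`. -/
theorem frel_eq (u : ∀ n : ℕ, P.X n (1 - n)) (n : ℕ) :
    ∑ t : Cut n, sgn (t.c + t.a * t.b) •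
      P.lact.L n (1 - n + 1) ((Asu R).ones t.a ++ mEl R t.b :: (Asu R).ones t.c)
        (uEl u (t.a + 1 + t.c)) -
    ∑ c : {c : Composition n // 1 < c.length}, sgn (sigma c.1) •
      P.ract.L n (1 - n + 1) (c.1.blocks.map (uEl u)) (mEl R c.1.length) =
    tsum₃ n (fun a b c => sgn (c + a * b) •
      P.lact.L n (1 - n + 1) ((Asu R).ones a ++ mEl R b :: (Asu R).ones c) (uEl u (a + 1 + c))) -
    csum n fun l => sgn (lsig l) •
      P.ract.L n (1 - n + 1) (l.map (uEl u)) (mEl R l.length) := by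
  rw [← sum_cut n _ fun a b c hb => ?_, ← sum_length_gt_one n _ fun l hl => ?_]
  · simp only [sigma_eq_lsig]
  · rw [Asu.mEl_of_lt hl, OdotMap.L_zero, smul_zero]
  · rw [OdotMap.L_eq_zero_of_mem (n := b) (p := 2 - b), smul_zero]
    rw [Asu.mEl_of_lt hb]
    simp

namespace Fsu

variable (R) in
/-- The element `(1^⊗a ⊗ m_b ⊗ 1^⊗c) f_{a+1+c}`. -/
noncomputable def lactEl (a b c : ℕ) : (Fsu R).El :=
  (Fsu R).lact.el ((Asu R).ones a ++ mEl R b :: (Asu R).ones c) (fEl R (a + 1 + c))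

variable (R) in
/-- The element `(f_{i₁} ⊗ ⋯ ⊗ f_{i_l}) m_l`. -/
noncomputable def ractEl (l : List ℕ) : (Fsu R).El :=
  (Fsu R).ract.el (l.map (fEl R)) (mEl R l.length)

variable {M : Type*} [AddCommGroup M] [Module R M]

theorem map_fEl_d {ψ : (Fsu R).El → M} (h : ElLinear ψ) (n : ℕ) :
    ψ (fEl R n).d = tsum₃ n (fun a b c => sgn (c + a * b) • ψ (lactEl R a b c)) -
      csum n fun l => sgn (lsig l) • ψ (ractEl R l) := by
  have e : (Fsu R).d rfl (fu R n) =
      tsum₃ n (fun a b c => sgn (c + a * b) • (Fsu R).lact.L n (1 - n + 1)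
        ((Asu R).ones a ++ mEl R b :: (Asu R).ones c) (uEl (fu R) (a + 1 + c))) -
      csum n fun l => sgn (lsig l) •
        (Fsu R).ract.L n (1 - n + 1) (l.map (uEl (fu R))) (mEl R l.length) := by
    rw [← frel_eq]
    by_cases hn : 1 ≤ n
    · exact relL.d n hn
    · obtain rfl : n = 0 := by omega
      rw [fu, dif_neg hn, map_zero, frel_eq, csum_zero, Asu.mEl_of_lt (by simp), OdotMap.L_zero,
        smul_zero, sub_zero]
      simp only [tsum₃, Finset.Nat.antidiagonal_zero, Finset.sum_singleton]
      rw [OdotMap.L_eq_zero_of_mem (n := 0) (p := 2 - (0 : ℕ)), smul_zero]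
      rw [Asu.mEl_of_lt (by omega)]
      simp
  let g := IsLinearMap.mk' _ (h n (1 - n + 1))
  change g ((Fsu R).d rfl (fu R n)) = _
  rw [e, map_sub, map_tsum₃, map_csum]
  congr 1
  · refine tsum₃_congr fun a b c habc => ?_
    rw [map_zsmul, lactEl, OdotMap.el_eq (N := n) (r := 1 - n + 1)]
    · rfl
    · simp [← habc]
      omega
    · simp [← habc]
      ring
  · refine csum_congr fun l _ hl => ?_
    rw [map_zsmul, ractEl, OdotMap.el_eq (N := n) (r := 1 - n + 1)]
    · rfl
    · rw [← hl]
      exact arSum_map_comp (fun _ => rfl) l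
    · rw [← hl, degSum_map_comp fun _ => rfl]
      simp only [Asu.mEl]
      ring

end Fsu

end Relations

end HUnital

namespace HUnital

variable {R : Type u} [CommRing R]

/-! The comultiplication of `F_1^su⟨i,j⟩`. -/

open Finset.HasAntidiagonal (antidiagonal mem_antidiagonal)

section Balanced

variable {A O B : DGOperad R} {P : DGBimod A O} {Q : DGBimod O B}

/-- An operation between units acts on a factor from the left. -/
theorem relTensor.mk_lact_L (l₁ l₂ : List P.El) {w : A.El} {y : P.El} {a c : ℕ}
    (hy : y.ar = a + 1 + c) (z : Q.El) (N : ℕ) (r : ℤ) :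
    (mk P Q).L N r (l₁ ++ P.lact.el (A.ones a ++ w :: A.ones c) y :: l₂) z =
      sgn (w.deg * degSum l₁) • (relTensor P Q).lact.L N r
        (A.ones (arSum l₁ + a) ++ w :: A.ones (c + arSum l₂)) ((mk P Q).el (l₁ ++ y :: l₂) z) := by
  let U : List P.El → List (List A.El × P.El) := fun l => l.map fun x => (A.ones x.ar, x)
  have hU : ∀ l, Matched (U l) := fun l i hi => by
    obtain ⟨x, _, rfl⟩ := List.mem_map.1 hi
    exact (List.length_replicate ..).symm
  have hs : ∀ l, sndL (U l) = l := fun l => by simp [U, Function.comp_def]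
  have h := OdotMap.Assoc.lassoc (relTensor.isBalanced P Q).left N r
    (U l₁ ++ (A.ones a ++ w :: A.ones c, y) :: U l₂) z
    (Matched.append.2 ⟨hU _, Matched.cons.2 ⟨by simp [hy]; omega, hU _⟩⟩)
  have e₁ : flatL (U l₁ ++ (A.ones a ++ w :: A.ones c, y) :: U l₂) =
      A.ones (arSum l₁ + a) ++ w :: A.ones (c + arSum l₂) := by
    rw [flatL, List.flatMap_append, List.flatMap_cons, ← flatL, ← flatL, flatL_map_units,
      flatL_map_units]
    simp only [DGOperad.ones, List.replicate_add, List.append_assoc, List.cons_append]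
  have e₂ : kos (U l₁ ++ (A.ones a ++ w :: A.ones c, y) :: U l₂) = w.deg * degSum l₁ := by
    rw [kos_append, kos, kos_map_units, kos_map_units, hs, flatL_map_units, flatL,
      List.flatMap_cons, ← flatL, flatL_map_units]
    have h₀ : ∀ n, degSum (List.replicate n A.oneEl) = 0 := A.degSum_ones
    simp only [degSum_append, degSum_cons, h₀]
    ring
  have e₃ : sndL (U l₁ ++ (A.ones a ++ w :: A.ones c, y) :: U l₂) = l₁ ++ y :: l₂ := by
    rw [sndL, List.map_append, List.map_cons, ← sndL, ← sndL, hs, hs]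
  rw [OdotMap.elL_append, OdotMap.elL_cons, elL_map_units, elL_map_units, e₁, e₂, e₃] at h
  exact h

/-- An operation between units moves from a factor to the last factor. -/
theorem relTensor.mk_ract_L (l₁ m l₂ : List P.El) {w : O.El} (hw : w.ar = m.length) (z : Q.El)
    (N : ℕ) (r : ℤ) :
    (mk P Q).L N r (l₁ ++ P.ract.el m w :: l₂) z = sgn (w.deg * degSum l₂) •
      (mk P Q).L N r (l₁ ++ (m ++ l₂)) (Q.lact.el (O.ones l₁.length ++ w :: O.ones l₂.length) z) := by
  let U : List P.El → List (List P.El × O.El) := fun l => l.map fun x => ([x], O.oneEl)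
  have hU : ∀ l, Matched (U l) := fun l i hi => by
    obtain ⟨x, _, rfl⟩ := List.mem_map.1 hi
    rfl
  have h := OdotMap.Assoc.lassoc (relTensor.isBalanced P Q).balanced N r
    (U l₁ ++ (m, w) :: U l₂) z (Matched.append.2 ⟨hU _, Matched.cons.2 ⟨hw, hU _⟩⟩)
  have e₁ : flatL (U l₁ ++ (m, w) :: U l₂) = l₁ ++ (m ++ l₂) := by
    rw [flatL, List.flatMap_append, List.flatMap_cons, ← flatL, ← flatL, flatL_unitSplit,
      flatL_unitSplit]
  have e₂ : kos (U l₁ ++ (m, w) :: U l₂) = w.deg * degSum l₂ := by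
    rw [kos_append, kos, kos_unitSplit, kos_unitSplit, sndL_unitSplit, flatL_unitSplit,
      ← DGOperad.ones, DGOperad.degSum_ones]
    ring
  have e₃ : sndL (U l₁ ++ (m, w) :: U l₂) = O.ones l₁.length ++ w :: O.ones l₂.length := by
    rw [sndL, List.map_append, List.map_cons, ← sndL, ← sndL, sndL_unitSplit, sndL_unitSplit]
  rw [OdotMap.elL_append, OdotMap.elL_cons, elL_unitSplit, elL_unitSplit, e₁, e₂, e₃] at h
  exact h

end Balanced

namespace Fsu

open HUnital.Asu (unitEl mEl)

variable (R) in
/-- The tensor product of `F_1^su⟨i,j⟩` with itself. -/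
noncomputable abbrev F₂ : DGBimod (Asu R) (Asu R) := relTensor (Fsu R) (Fsu R)

variable (R) in
/-- The universal map to the tensor product of `F_1^su⟨i,j⟩` with itself. -/
noncomputable abbrev mk₂ : OdotMap (Fsu R).toDGColl (Fsu R).toDGColl (F₂ R).toDGColl :=
  relTensor.mk (Fsu R) (Fsu R)

variable (R) in
/-- The images of the `f_n` under the comultiplication. -/
noncomputable def comultFam (n : ℕ) : (F₂ R).X n (1 - n) :=
  csum n fun K => sgn (lsig K) • (mk₂ R).L n (1 - n) (K.map (fEl R)) (fEl R K.length)

theorem arSum_fEl (l : List ℕ) : arSum (l.map (fEl R)) = l.sum := arSum_map_comp (fun _ => rfl) l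

theorem degSum_fEl (l : List ℕ) : degSum (l.map (fEl R)) = l.length - l.sum :=
  degSum_map_comp (fun _ => rfl) l

theorem comultFam_d (n : ℕ) {r : ℤ} (hr : 1 - (n : ℤ) + 1 = r) :
    (F₂ R).d hr (comultFam R n) =
      tsum₃ n (fun a b c => sgn (c + a * b) • (F₂ R).lact.L n r
        ((Asu R).ones a ++ mEl R b :: (Asu R).ones c) (uEl (comultFam R) (a + 1 + c))) -
      csum n fun l => sgn (lsig l) • (F₂ R).ract.L n r (l.map (uEl (comultFam R))) (mEl R l.length) := by
  -- the terms of the differential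
  let X : List ℕ → ℕ → ℕ → ℕ → (F₂ R).X n r := fun K a b c => (mk₂ R).L n r (K.map (fEl R)) (lactEl R a b c)
  let Y : List ℕ → ℕ → ℕ → ℕ → List ℕ → (F₂ R).X n r := fun l₁ a b c l₂ =>
    (mk₂ R).L n r (l₁.map (fEl R) ++ lactEl R a b c :: l₂.map (fEl R)) (fEl R (l₁.length + 1 + l₂.length))
  let Z : List ℕ → List ℕ → List ℕ → (F₂ R).X n r := fun l₁ J l₂ =>
    (mk₂ R).L n r (l₁.map (fEl R) ++ ractEl R J :: l₂.map (fEl R)) (fEl R (l₁.length + 1 + l₂.length))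
  have h₁ : (F₂ R).d hr (comultFam R n) =
      (csum n fun K => tsum₃ K.length fun a b c => sgn (lsig K + (c + a * b)) • X K a b c) -
      (csum n fun K => sgn (lsig K) • csum K.length fun p => sgn (lsig p) •
        (mk₂ R).L n r (K.map (fEl R)) (ractEl R p)) +
      csum n fun K => dsum (fun l => sgn (lsig K + (1 - K.length)) • (mk₂ R).L n r l (fEl R K.length))
        (K.map (fEl R)) := by
    rw [comultFam, map_csum, ← csum_sub, ← csum_add]
    refine csum_congr fun K _ hK => ?_
    have := map_fEl_d ((mk₂ R).elLinear n r (K.map (fEl R))) K.length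
    rw [map_zsmul, OdotMap.leibniz_L _ hr (List.length_map _).symm ((arSum_fEl K).trans hK)
      (by rw [degSum_fEl, hK]; simp only; ring), smul_add, this, smul_sub, ← tsum₃_zsmul, dsum_smul]
    simp only [sgn_smul_smul]
    rfl
  have h₂ : csum n (fun K => dsum (fun l => sgn (lsig K + (1 - K.length)) •
        (mk₂ R).L n r l (fEl R K.length)) (K.map (fEl R))) =
      tsum₃ n (fun i l k => csum i fun l₁ => csum k fun l₂ => tsum₃ l fun a b c =>
        sgn (l₂.length - l₂.sum + (lsig (l₁ ++ l :: l₂) + (1 - (l₁.length + 1 + l₂.length : ℕ))) +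
          (c + a * b)) • Y l₁ a b c l₂) -
      tsum₃ n fun i l k => csum i fun l₁ => csum k fun l₂ => csum l fun J =>
        sgn (l₂.length - l₂.sum + (lsig (l₁ ++ l :: l₂) + (1 - (l₁.length + 1 + l₂.length : ℕ))) +
          lsig J) • Z l₁ J l₂ := by
    rw [csum_dsum n (fEl R) (fun K l => sgn (lsig K + (1 - K.length)) • (mk₂ R).L n r l (fEl R K.length)),
      ← tsum₃_sub]
    · refine tsum₃_congr fun i l k _ => ?_
      simp only [← csum_sub]
      refine csum_congr fun l₁ _ _ => csum_congr fun l₂ _ _ => ?_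
      have hlen : (l₁ ++ l :: l₂).length = l₁.length + 1 + l₂.length := by simp; omega
      have := map_fEl_d (ψ := fun x => (mk₂ R).L n r (l₁.map (fEl R) ++ x :: l₂.map (fEl R))
        (fEl R (l₁.length + 1 + l₂.length)))
        (fun m p => (mk₂ R).slotLinear n r (fEl R (l₁.length + 1 + l₂.length))
          (l₁.map (fEl R)) (l₂.map (fEl R)) m p) l
      rw [hlen, degSum_fEl, this, sgn_smul_smul, smul_sub, ← tsum₃_zsmul, ← csum_zsmul]
      simp only [sgn_smul_smul]
      rfl
    · intro K l₁ l₂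
      have e : (fEl R 0).d = ⟨0, 1 - (0 : ℕ) + 1, 0⟩ := by
        simp [fEl, DGColl.El.d, fu]
      rw [e, OdotMap.L_eq_zero_of_mem (n := 0) (p := 1 - (0 : ℕ) + 1), smul_zero]
      simp
  have h₃ : (csum n fun K => tsum₃ K.length fun a b c => sgn (lsig K + (c + a * b)) • X K a b c) =
      tsum₃ n fun i l k => csum i fun l₁ => csum k fun l₂ => csum l fun J =>
        sgn (l₂.length - l₂.sum + (lsig (l₁ ++ l :: l₂) + (1 - (l₁.length + 1 + l₂.length : ℕ))) +
          lsig J) • Z l₁ J l₂ := by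
    rw [csum_tsum₃]
    refine tsum₃_congr fun i l k _ => csum_congr fun l₁ _ _ => ?_
    rw [csum_comm]
    refine csum_congr fun l₂ _ _ => csum_congr fun J _ hJ => ?_
    have e : Z l₁ J l₂ = sgn ((2 - J.length) * (l₂.length - l₂.sum)) •
        X (l₁ ++ (J ++ l₂)) l₁.length J.length l₂.length := by
      have := relTensor.mk_ract_L (P := Fsu R) (Q := Fsu R) (l₁.map (fEl R)) (J.map (fEl R))
        (l₂.map (fEl R)) (w := mEl R J.length) (List.length_map _).symm
        (fEl R (l₁.length + 1 + l₂.length)) n r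
      rw [degSum_fEl, List.length_map, List.length_map, ← List.map_append, ← List.map_append] at this
      exact this
    rw [e, sgn_smul_smul]
    refine congrArg (· • _) (sgn_eq_of_even ⟨(l₁.length + l₂.sum : ℤ), ?_⟩)
    simp only [lsig_append, lsig, ← hJ, List.sum_append, List.length_append, List.sum_cons,
      List.length_cons]
    push_cast
    ring
  have h₄ : (tsum₃ n fun i l k => csum i fun l₁ => csum k fun l₂ => tsum₃ l fun a b c =>
        sgn (l₂.length - l₂.sum + (lsig (l₁ ++ l :: l₂) + (1 - (l₁.length + 1 + l₂.length : ℕ))) +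
          (c + a * b)) • Y l₁ a b c l₂) =
      tsum₃ n fun a b c => sgn (c + a * b) • (F₂ R).lact.L n r
        ((Asu R).ones a ++ mEl R b :: (Asu R).ones c) (uEl (comultFam R) (a + 1 + c)) := by
    have e : ∀ a b c : ℕ, sgn (c + a * b) • (F₂ R).lact.L n r
        ((Asu R).ones a ++ mEl R b :: (Asu R).ones c) (uEl (comultFam R) (a + 1 + c)) =
        csum (a + 1 + c) fun K => sgn (c + a * b + lsig K) • (F₂ R).lact.L n r
          ((Asu R).ones a ++ mEl R b :: (Asu R).ones c)
            ((mk₂ R).el (K.map (fEl R)) (fEl R K.length)) := fun a b c => by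
      let g := IsLinearMap.mk' _ ((F₂ R).lact.elLinear n r
        ((Asu R).ones a ++ mEl R b :: (Asu R).ones c) (a + 1 + c) (1 - (a + 1 + c : ℕ)))
      change _ • g (csum _ _) = _
      rw [map_csum, ← csum_zsmul]
      refine csum_congr fun K _ hK => ?_
      rw [map_zsmul, sgn_smul_smul, OdotMap.el_eq (r := 1 - (a + 1 + c : ℕ)) _
        ((arSum_fEl K).trans hK) (by rw [degSum_fEl, hK]; ring)]
      rfl
    simp only [e]
    rw [tsum₃_csum_pointed]
    refine tsum₃_congr fun i l k _ => csum_congr fun l₁ _ h₁ => csum_congr fun l₂ _ h₂ =>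
      tsum₃_congr fun a b c habc => ?_
    have e : Y l₁ a b c l₂ = sgn ((2 - b) * (l₁.length - i)) • (F₂ R).lact.L n r
        ((Asu R).ones (i + a) ++ mEl R b :: (Asu R).ones (c + k))
          ((mk₂ R).el ((l₁ ++ (a + 1 + c) :: l₂).map (fEl R)) (fEl R (l₁ ++ (a + 1 + c) :: l₂).length)) := by
      have := relTensor.mk_lact_L (P := Fsu R) (Q := Fsu R) (l₁.map (fEl R)) (l₂.map (fEl R))
        (w := mEl R b) (y := fEl R (a + 1 + c)) (a := a) (c := c) rfl
        (fEl R (l₁.length + 1 + l₂.length)) n r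
      rw [degSum_fEl, arSum_fEl, arSum_fEl, h₁, h₂] at this
      rw [List.map_append, List.map_cons, show (l₁ ++ (a + 1 + c) :: l₂).length =
        l₁.length + 1 + l₂.length by simp; omega]
      exact this
    rw [e, sgn_smul_smul]
    refine congrArg (· • _) (sgn_eq_of_even ⟨-(l₁.sum + l₂.sum : ℤ), ?_⟩)
    simp only [lsig_append, lsig, ← habc, ← h₁, ← h₂, List.sum_cons, List.length_cons]
    push_cast
    ring
  have h₅ := LAssoc.csum_subst (OdotMap.Assoc.lassoc (relTensor.isBalanced (Fsu R) (Fsu R)).right)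
    (x := fEl R) (y := fEl R) (fun _ => ⟨rfl, rfl⟩) (fun _ => ⟨rfl, rfl⟩) (mEl R) n n r
  rw [h₁, h₂, h₃, h₄]
  refine Eq.trans ?_ (congrArg (_ - ·) h₅.symm)
  simp only [ractEl]
  abel

end Fsu

end HUnital

namespace HUnital

variable {R : Type u} [CommRing R]

open Finset.HasAntidiagonal (antidiagonal mem_antidiagonal)

theorem csum_eq_single {M : Type*} [AddCommGroup M] {n : ℕ} {g : List ℕ → M} {l₀ : List ℕ}
    (h₁ : ∀ x ∈ l₀, 0 < x) (h₂ : l₀.sum = n)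
    (h : ∀ l, (∀ x ∈ l, 0 < x) → l.sum = n → l ≠ l₀ → g l = 0) : csum n g = g l₀ := by
  rw [csum_eq_sum_comps]
  exact Finset.sum_eq_single l₀ (fun l hl hne => h l (mem_comps.1 hl).1 (mem_comps.1 hl).2 hne)
    fun hl => absurd (mem_comps.2 ⟨h₁, h₂⟩) hl

theorem csum_one {M : Type*} [AddCommGroup M] (g : List ℕ → M) : csum 1 g = g [1] := by
  rw [csum_succ, Finset.Nat.antidiagonal_zero, Finset.sum_singleton, csum_zero]

theorem lsig_replicate_one (n : ℕ) : lsig (List.replicate n 1) = 0 := by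
  induction n with
  | zero => rfl
  | succ n ih => simp [List.replicate_succ, lsig, ih]

namespace Fsu

open HUnital.Asu (unitEl mEl)

theorem map_comultFam {M : Type*} [AddCommGroup M] [Module R M] {ψ : (F₂ R).El → M}
    (h : ElLinear ψ) (n : ℕ) : ψ (uEl (comultFam R) n) =
      csum n fun K => sgn (lsig K) • ψ ((mk₂ R).el (K.map (fEl R)) (fEl R K.length)) := by
  refine (map_csum (IsLinearMap.mk' _ (h n (1 - n))) n _).trans (csum_congr fun K _ hK => ?_)
  rw [map_zsmul, OdotMap.el_eq (N := n) (r := 1 - n) _ ((arSum_fEl K).trans hK)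
    (by rw [degSum_fEl, hK]; ring)]
  rfl

theorem lact_unit_fEl {a c : ℕ} (h : 1 ≤ a + c) : ∃ (n : ℕ) (p : ℤ), (Fsu R).lact.el
    ((Asu R).ones a ++ unitEl R :: (Asu R).ones c) (fEl R (a + 1 + c)) = ⟨n, p, 0⟩ :=
  ⟨_, _, congrArg (DGColl.El.mk _ _) (relL.unit_f a c h _ _)⟩

theorem comultFam_unit_rho : (F₂ R).ract.L 0 0 [] (unitEl R) =
    (F₂ R).lact.L 0 0 [unitEl R] (uEl (comultFam R) 1) := by
  rw [map_comultFam ((F₂ R).lact.elLinear 0 0 [unitEl R]), csum_one]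
  have h₁ := relTensor.mk_lact_L (P := Fsu R) (Q := Fsu R) [] [] (w := unitEl R) (y := fEl R 1)
    (a := 0) (c := 0) rfl (fEl R 1) 0 0
  have h₂ := relTensor.mk_ract_L (P := Fsu R) (Q := Fsu R) [] [] [] (w := unitEl R) rfl
    (fEl R 1) 0 0
  have h₃ := OdotMap.Assoc.lassoc (relTensor.isBalanced (Fsu R) (Fsu R)).right 0 0 []
    (unitEl R) matched_nil
  have e : sgn (lsig [1]) = 1 := by simp [lsig]
  rw [e, one_smul]
  rw [degSum_nil, mul_zero, sgn_zero, one_smul] at h₁ h₂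
  rw [kos, sgn_zero, one_smul] at h₃
  refine h₃.trans (Eq.trans ?_ h₁)
  refine (congrArg ((mk₂ R).L 0 0 []) lact_unit_f₁.symm).trans (h₂.symm.trans ?_)
  exact congrArg (fun x => (mk₂ R).L 0 0 [x] (fEl R 1)) lact_unit_f₁.symm

theorem comultFam_unit_f (b c : ℕ) (h : 1 ≤ b + c) (N : ℕ) (r : ℤ) :
    (F₂ R).lact.L N r ((Asu R).ones b ++ unitEl R :: (Asu R).ones c)
      (uEl (comultFam R) (b + 1 + c)) = 0 := by
  rw [map_comultFam ((F₂ R).lact.elLinear N r _), csum_pointed]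
  refine Finset.sum_eq_zero fun p hp => Finset.sum_eq_zero fun q hq => ?_
  refine (csum_congr fun l₁ _ h₁ => (csum_congr fun l₂ _ h₂ => ?_).trans
    (csum_fun_zero _)).trans (csum_fun_zero _)
  have h₃ := relTensor.mk_lact_L (P := Fsu R) (Q := Fsu R) (l₁.map (fEl R)) (l₂.map (fEl R))
    (w := unitEl R) (y := fEl R (p.2 + 1 + q.1)) (a := p.2) (c := q.1) rfl
    (fEl R (l₁.length + 1 + l₂.length)) N r
  have e : (unitEl R).deg * degSum (l₁.map (fEl R)) = 0 := zero_mul _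
  rw [arSum_fEl, arSum_fEl, h₁, h₂, mem_antidiagonal.1 hp, mem_antidiagonal.1 hq, e, sgn_zero,
    one_smul] at h₃
  rw [List.map_append, List.map_cons, show (l₁ ++ (p.2 + 1 + q.1) :: l₂).length =
    l₁.length + 1 + l₂.length by simp; omega]
  refine Eq.trans (congrArg (_ • ·) (h₃.symm.trans ?_)) (smul_zero _)
  by_cases hpq : 1 ≤ p.2 + q.1
  · obtain ⟨n, s, e⟩ := lact_unit_fEl (R := R) hpq
    rw [e]
    exact OdotMap.L_eq_zero_of_mem (n := n) (p := s) _ _ _ (by simp) _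
  · have hp₂ : p.2 = 0 := by omega
    have hq₁ : q.1 = 0 := by omega
    have hp := mem_antidiagonal.1 hp
    have hq := mem_antidiagonal.1 hq
    have hl : 1 ≤ l₁.length + l₂.length := by
      by_contra hl
      have e₁ : l₁ = [] := List.eq_nil_of_length_eq_zero (by omega)
      have e₂ : l₂ = [] := List.eq_nil_of_length_eq_zero (by omega)
      subst e₁ e₂
      simp only [List.sum_nil] at h₁ h₂
      omega
    obtain ⟨n, s, e⟩ := lact_unit_fEl (R := R) hl
    rw [hp₂, hq₁]
    refine (congrArg (fun x => (mk₂ R).L N r (l₁.map (fEl R) ++ x :: l₂.map (fEl R))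
      (fEl R (l₁.length + 1 + l₂.length))) lact_unit_f₁).trans ?_
    refine (relTensor.mk_ract_L (P := Fsu R) (Q := Fsu R) _ [] _ (w := unitEl R) rfl _ N r).trans ?_
    rw [List.length_map, List.length_map, e, OdotMap.L_zero, smul_zero]

theorem comultRel : FRelL (comultFam R) where
  d n _ := (comultFam_d n rfl).trans (frel_eq (comultFam R) n).symm
  unit_rho := comultFam_unit_rho
  unit_f := comultFam_unit_f

theorem isComult_iff {Δ : (Fsu R).Hom (relTensor (Fsu R) (Fsu R))} :
    IsComult Δ ↔ ∀ (n : ℕ) (hn : 1 ≤ n), Δ.f (f n hn) = comultFam R n := by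
  have e : ∀ (n : ℕ) (hn : 1 ≤ n) (c : Composition n) (h),
      (relTensor.mk (Fsu R) (Fsu R)).app c.blocksFun (fun a => 1 - (c.blocksFun a : ℤ))
        c.sum_blocksFun h (fun a => f _ (c.one_le_blocksFun a))
        (f c.length (c.length_pos_of_pos hn)) =
      (mk₂ R).L n (1 - n) (c.blocks.map (fEl R)) (fEl R c.blocks.length) := fun n hn c h => by
    rw [OdotMap.app_eq_L, blocks_map_eq_ofFn, c.blocks_length, fEl_of_le (c.length_pos_of_pos hn)]
    simp only [fEl_of_le (c.one_le_blocksFun _)]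
  refine forall_congr' fun n => forall_congr' fun hn => ?_
  rw [comultFam, csum]
  simp only [e n hn, sigma_eq_lsig]

variable (R) in
theorem exists_unique_comult :
    ∃! Δ : (Fsu R).Hom (relTensor (Fsu R) (Fsu R)), IsComult Δ := by
  obtain ⟨Δ, h⟩ := exists_hom (comultRel (R := R))
  exact ⟨Δ, isComult_iff.2 h, fun Δ' h' => hom_ext fun n hn =>
    (isComult_iff.1 h' n hn).trans (h n hn).symm⟩

theorem comult_fEl {Δ : (Fsu R).Hom (relTensor (Fsu R) (Fsu R))} (h : IsComult Δ) (n : ℕ) :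
    Δ.toHom.el (fEl R n) = uEl (comultFam R) n := by
  refine congrArg (DGColl.El.mk _ _) ?_
  by_cases hn : 1 ≤ n
  · exact (congrArg Δ.f (fu_of_le hn)).trans (isComult_iff.1 h n hn)
  · obtain rfl : n = 0 := by omega
    rw [comultFam, csum_zero]
    refine (congrArg Δ.f (dif_neg hn : fu R 0 = 0)).trans ((map_zero Δ.f).trans (Eq.symm ?_))
    have e : fEl R 0 = ⟨0, 1 - (0 : ℕ), 0⟩ := congrArg (DGColl.El.mk _ _) (dif_neg hn)
    rw [List.length_nil, e, OdotMap.L_zero, smul_zero]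

theorem comult_f₁ {Δ : (Fsu R).Hom (relTensor (Fsu R) (Fsu R))} (h : IsComult Δ) :
    Δ.toHom.el (fEl R 1) = (mk₂ R).el [fEl R 1] (fEl R 1) := by
  rw [comult_fEl h, OdotMap.el_eq (N := 1) (r := 1 - (1 : ℕ)) _ rfl (by simp)]
  refine congrArg (DGColl.El.mk _ _) ?_
  rw [comultFam, csum_one, show lsig [1] = 0 by simp [lsig], sgn_zero, one_smul]
  rfl

theorem coassoc {Δ : (Fsu R).Hom (relTensor (Fsu R) (Fsu R))} (h : IsComult Δ)
    {a : (relTensor (F₂ R) (Fsu R)).Hom (relTensor (Fsu R) (F₂ R))}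
    (ha : ∀ N r (L : List (List (Fsu R).El × (Fsu R).El)) (z : (Fsu R).El), Matched L →
      a.f ((relTensor.mk (F₂ R) (Fsu R)).L N r ((mk₂ R).elL L) z) =
        sgn (kos L) • (relTensor.mk (Fsu R) (F₂ R)).L N r (flatL L) ((mk₂ R).el (sndL L) z)) :
    (Δ.comp (relTensor.map Δ (.id (Fsu R)))).comp a = Δ.comp (relTensor.map (.id (Fsu R)) Δ) := by
  refine hom_ext fun n hn => ?_
  change a.f ((relTensor.map Δ (.id (Fsu R))).f (Δ.f (f n hn))) =
    (relTensor.map (.id (Fsu R)) Δ).f (Δ.f (f n hn))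
  rw [isComult_iff.1 h n hn, comultFam, map_csum, map_csum, map_csum]
  have H : LAssoc (mk₂ R) ((relTensor.mk (F₂ R) (Fsu R)).post a.toHom) (mk₂ R)
      (relTensor.mk (Fsu R) (F₂ R)) := fun N r L z hL => by
    rw [OdotMap.post_L]
    exact ha N r L z hL
  have h₁ := H.csum_subst (x := fEl R) (y := fEl R) (fun _ => ⟨rfl, rfl⟩) (fun _ => ⟨rfl, rfl⟩)
    (fEl R) n n (1 - n)
  refine Eq.trans (csum_congr fun K _ _ => ?_) (h₁.trans (csum_congr fun K _ _ => ?_))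
  · rw [map_zsmul, map_zsmul, relTensor.map_L, OdotMap.post_L, List.map_map]
    refine congrArg (fun l => sgn (lsig K) • a.f ((relTensor.mk (F₂ R) (Fsu R)).L n (1 - n) l
      (fEl R K.length))) (List.map_congr_left fun i _ => ?_)
    exact comult_fEl h i
  · rw [map_zsmul, relTensor.map_L, comult_fEl h,
      map_comultFam ((relTensor.mk (Fsu R) (F₂ R)).elLinear n (1 - n) _)]
    have : (K.map (fEl R)).map (DGBimod.Hom.id (Fsu R)).toHom.el = K.map (fEl R) := List.map_id _
    rw [this]

theorem counit_fEl {ε : (Fsu R).Hom (Asu R).regular} (h : IsCounit ε) {n : ℕ} (hn : n ≠ 1) :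
    ε.toHom.el (fEl R n) = ⟨n, 1 - n, 0⟩ := by
  by_cases h1 : 1 ≤ n
  · rw [el_fEl h h1, uEl_counitFam_of_ne hn]
  · refine congrArg (DGColl.El.mk _ _) ?_
    exact (congrArg ε.f (dif_neg h1)).trans (map_zero ε.f)

theorem map_counit_fEl (ε : (Fsu R).Hom (Asu R).regular) (K : List ℕ) :
    (K.map (fEl R)).map ε.toHom.el = K.map fun n => ε.toHom.el (fEl R n) := List.map_map

theorem counitL_comultFam {ε : (Fsu R).Hom (Asu R).regular} (h : IsCounit ε) {n : ℕ} (hn : 1 ≤ n) :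
    (counitL ε).f (comultFam R n) = f n hn := by
  rw [comultFam, map_csum, csum_eq_single (l₀ := List.replicate n 1)
    (fun x hx => (List.eq_of_mem_replicate hx) ▸ Nat.one_pos) (by simp)]
  · rw [map_zsmul, lsig_replicate_one, sgn_zero, one_smul, List.length_replicate]
    refine (counitL_L ε _ _ _ _).trans (Eq.trans ?_ (((Fsu R).lact_L_ones (fEl R n)).trans
      (fu_of_le hn)))
    refine congrArg (fun l => (Fsu R).lact.L n (1 - n) l (fEl R n)) ?_
    refine (map_counit_fEl ε _).trans ((List.map_replicate ..).trans ?_)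
    exact congrArg (List.replicate n) ((el_fEl h le_rfl).trans uEl_counitFam_one)
  · intro K _ hK hne
    obtain ⟨m, hm, hm1⟩ : ∃ m ∈ K, m ≠ 1 := by
      by_contra! hc
      have := List.eq_replicate_of_mem hc
      rw [this, List.sum_replicate, smul_eq_mul, mul_one] at hK
      exact hne (hK ▸ this)
    rw [map_zsmul]
    refine (congrArg (_ • ·) ((counitL_L ε _ _ _ _).trans ?_)).trans (smul_zero _)
    refine OdotMap.L_eq_zero_of_mem (n := m) (p := 1 - m) _ _ _ ?_ _
    exact (counit_fEl h hm1) ▸ List.mem_map_of_mem (List.mem_map_of_mem hm)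

theorem counitR_comultFam {ε : (Fsu R).Hom (Asu R).regular} (h : IsCounit ε) {n : ℕ} (hn : 1 ≤ n) :
    (counitR ε).f (comultFam R n) = f n hn := by
  rw [comultFam, map_csum, csum_eq_single (l₀ := [n]) (by simpa using Nat.pos_of_ne_zero (by omega)) (by simp)]
  · have e : sgn (lsig [n]) = 1 := by simp [lsig]
    rw [map_zsmul, e, one_smul, counitR_L]
    have e : ε.toHom.el (fEl R [n].length) = (Asu R).oneEl :=
      (el_fEl h le_rfl).trans uEl_counitFam_one
    rw [e]
    refine (OdotMap.L_eq_of_el ((Fsu R).ract_one_el (fEl R n))).trans ?_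
    exact fu_of_le hn
  · intro K _ hK hne
    have hl : K.length ≠ 1 := fun hl => by
      obtain ⟨m, rfl⟩ := List.length_eq_one_iff.1 hl
      exact hne (by simpa using hK)
    rw [map_zsmul, counitR_L, counit_fEl h hl]
    refine (congrArg (_ • ·) ?_).trans (smul_zero _)
    exact OdotMap.L_zero _ _ _ _ _ _

theorem isCoalgebra {Δ : (Fsu R).Hom (relTensor (Fsu R) (Fsu R))}
    {ε : (Fsu R).Hom (Asu R).regular} (hΔ : IsComult Δ) (hε : IsCounit ε) :
    IsCoalgebra (Fsu R) Δ ε where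
  coassoc := by
    obtain ⟨a, ha⟩ := relTensor.exists_associator (P := Fsu R) (Q := Fsu R) (S := Fsu R)
    exact ⟨a, relTensor.isAssociator_of_L ha, coassoc hΔ ha⟩
  counit_left := hom_ext fun n hn =>
    (congrArg (counitL ε).f (isComult_iff.1 hΔ n hn)).trans (counitL_comultFam hε hn)
  counit_right := hom_ext fun n hn =>
    (congrArg (counitR ε).f (isComult_iff.1 hΔ n hn)).trans (counitR_comultFam hε hn)

end Fsu

end HUnital

theorem mainTheorem6 (R : Type u) [CommRing R] :
    (∃! Δ : (Fsu R).Hom (relTensor (Fsu R) (Fsu R)), IsComult Δ) ∧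
    (∃! ε : (Fsu R).Hom (Asu R).regular, IsCounit ε) ∧
    ∀ (Δ : (Fsu R).Hom (relTensor (Fsu R) (Fsu R))) (ε : (Fsu R).Hom (Asu R).regular),
      IsComult Δ → IsCounit ε →
      IsCoalgebra (Fsu R) Δ ε ∧
      (∀ (n : ℕ) (p : ℤ), Function.Injective ((alpha R).f (n := n) (p := p))) ∧
      (∃! Δ' : (Fhu R).Hom (relTensor (Fhu R) (Fhu R)),
        ∀ (n : ℕ) (p : ℤ) (x : (Fhu R).X n p),
          (alpha R).f (Δ'.f x) = Δ.f ((FhuSub R).incl.f x)) ∧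
      (∃! ε' : (Fhu R).Hom (Ahu R).regular,
        ∀ (n : ℕ) (p : ℤ) (x : (Fhu R).X n p),
          (AhuSub R).incl.f (ε'.f x) = ε.f ((FhuSub R).incl.f x)) ∧
      ∀ (Δ' : (Fhu R).Hom (relTensor (Fhu R) (Fhu R))) (ε' : (Fhu R).Hom (Ahu R).regular),
        (∀ (n : ℕ) (p : ℤ) (x : (Fhu R).X n p),
          (alpha R).f (Δ'.f x) = Δ.f ((FhuSub R).incl.f x)) →
        (∀ (n : ℕ) (p : ℤ) (x : (Fhu R).X n p),
          (AhuSub R).incl.f (ε'.f x) = ε.f ((FhuSub R).incl.f x)) →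
        IsCoalgebra (Fhu R) Δ' ε' ∧
        Δ'.f Fhu.v =
          (relTensor.mk (Fhu R) (Fhu R)).app (fun _ : Fin 1 => 0) (fun _ => -1) (by simp)
            (by simp) (fun _ => Fhu.v) Fhu.f₁ +
          (relTensor.mk (Fhu R) (Fhu R)).app (k := 0) Fin.elim0 Fin.elim0 rfl (by simp)
            (fun a => a.elim0) Fhu.v ∧
        ComposeAssociatively (Fhu R) Δ' ε' := by
  refine ⟨Fsu.exists_unique_comult R, Fsu.exists_unique_counit, fun Δ ε hΔ hε => ?_⟩
  have H := Fsu.isCoalgebra hΔ hε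
  refine ⟨H, alpha_injective, exists_unique_comult_hu H hε, exists_unique_counit_hu hε,
    fun Δ' ε' h h' => ?_⟩
  have H' := isCoalgebra_hu H h h'
  exact ⟨H', comult_v (Fsu.comult_f₁ hΔ) h, H'.composeAssociatively⟩
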